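/- Let $p,q,n$ be integers with $p>1$, $1\le q\le p$ and $n\ge p+q+2$. For $0\le i\le p-q$ and $0\le j\le q$ let $A^{(i,j)}_{\mu_1\dots\mu_{p-i}|\nu_1\dots\nu_{q-j}}$ be tensor fields on $\mathbb R^n$ with the symmetry of the Young diagram with two columns of lengths $p-i$ and $q-j$: antisymmetric in the $\mu$'s and in the $\nu$'s, with $A^{(i,j)}_{[\mu_1\dots\mu_{p-i}|\nu_1]\nu_2\dots}=0$ (brackets are strength-one antisymmetrizations). Here $\phi=A^{(0,0)}$ is the $[p,q]$ gauge field and the other $A^{(i,j)}$ are the ghosts; $A^{(i,j)}$ has Grassmann parity $i+j$ mod 2. The antifields $A^{*(i,j)}$ have the same Young symmetry and parity $i+j+1$. Put $A^{(p-q+1,j)}=A^{(i,q+1)}=0$. A local function is a function of finitely many of the variables $\partial_{\rho_1\dots\rho_k}A^{(i,j)}$, $\partial_{\rho_1\dots\rho_k}A^{*(i,j)}$ ($k\ge0$): smooth in the even (commuting) variables, and a polynomial in the odd (anticommuting) ones. There is exactly one odd derivation $\gamma$ of the algebra of local functions with $\gamma(\partial_{\rho_1\dots\rho_k}A^{*(i,j)})=0$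 and $\gamma(\partial_{\rho_1\dots\rho_k}A^{(i,j)})=\partial_{\rho_1\dots\rho_k}(\gamma A^{(i,j)})$, where $$\gamma A^{(i,j)}_{\mu_1\dots\mu_{p-i}|\nu_1\dots\nu_{q-j}}=\partial_{[\mu_1}A^{(i+1,j)}_{\mu_2\dots\mu_{p-i}]|\nu_1\dots\nu_{q-j}}+b_{i,j}\Big(A^{(i,j+1)}_{\mu_1\dots\mu_{p-i}|[\nu_1\dots\nu_{q-j-1},\nu_{q-j}]}+a_{i,j}A^{(i,j+1)}_{\nu_1\dots\nu_{q-j}[\mu_{q-j+1}\dots\mu_{p-i}|\mu_1\dots\mu_{q-j-1},\mu_{q-j}]}\Big),$$ $$a_{i,j}=\frac{(p-i)!}{(p-i-q+j+1)!\,(q-j)!},\qquad b_{i,j}=(-1)^i\,\frac{p-q+j+2}{p-i-q+j+2},$$ a comma denotes a derivative, and the bracket in the last term antisymmetrizes over all the $\mu$'s. This derivation satisfies $\gamma^2=0$. Let $K_{\mu_1\dots\mu_{p+1}|\nu_1\dots\nu_{q+1}}=\partial_{[\mu_1}\phi_{\mu_2\dots\mu_{p+1}]|[\nu_1\dots\nu_q,\nu_{q+1}]}$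 be the curvature and $D^0_{\mu_1\dots\mu_{p+1}}=(-1)^q\partial_{[\mu_1}A^{(0,q)}_{\mu_2\dots\mu_{p+1}]}$. Then every local function that depends only on - the antifields $A^{*(i,j)}$ and their derivatives, - the curvature $K$ and its derivatives, - the (undifferentiated) last ghost $A^{(p-q,q)}$, and - the (undifferentiated) curl $D^0$ of the ghost $A^{(0,q)}$ is $\gamma$-closed, and sending such a function to its cohomology class is an isomorphism of algebras $$\big\{f\big([A^{*(i,j)}],[K],A^{(p-q,q)},D^0\big)\big\}\;\cong\;H(\gamma)=\ker\gamma/\operatorname{im}\gamma .$$ -/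

import Mathlib

open scoped ContDiff

noncomputable section

namespace MixedGauge

/-! ### Variables of the jet space -/

/-- The formal symbol of a component of a derivative of a field or of an antifield:
`⟨false, i, j, ρ, μ, ν⟩` stands for `∂_ρ A^{(i,j)}_{μ|ν}` and `⟨true, i, j, ρ, μ, ν⟩` for
`∂_ρ A^{*(i,j) μ|ν}`.  The multi-index `ρ` of the (commuting) partial derivatives is a multiset;
`μ` and `ν` are the indices of the first and of the second column. -/
structure Comp (n : ℕ) where
  anti : Bool
  i : ℕ
  j : ℕ
  der : Multiset (Fin n)
  mu : List (Fin n)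
  nu : List (Fin n)

/-- The Grassmann parity: `i + j` for `A^{(i,j)}` and `i + j + 1` for `A^{*(i,j)}`. -/
def Comp.parity {n : ℕ} (s : Comp n) : ZMod 2 :=
  if s.anti then (s.i + s.j + 1 : ℕ) else (s.i + s.j : ℕ)

/-- The symbols that occur in the theory of the `[p,q]` field: `0 ≤ i ≤ p - q`, `0 ≤ j ≤ q`,
and the two columns have lengths `p - i` and `q - j`. -/
def Comp.Occurs {n : ℕ} (p q : ℕ) (s : Comp n) : Prop :=
  s.i ≤ p - q ∧ s.j ≤ q ∧ s.mu.length = p - s.i ∧ s.nu.length = q - s.j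

/-- Strength-one complete antisymmetrization of an expression in a list of indices. -/
def alt {n : ℕ} {V : Type*} [AddCommGroup V] [Module ℝ V]
    (T : List (Fin n) → V) (l : List (Fin n)) : V :=
  (l.length.factorial : ℝ)⁻¹ • ∑ σ : Equiv.Perm (Fin l.length),
    ((Equiv.Perm.sign σ : ℤ) : ℝ) • T (List.ofFn fun k => l.get (σ k))

theorem alt_add {n : ℕ} (T U : List (Fin n) → ℝ) (l : List (Fin n)) :
    alt (fun m => T m + U m) l = alt T l + alt U l := by
  simp only [alt, smul_add, Finset.sum_add_distrib]

theorem alt_smul {n : ℕ} (c : ℝ) (T : List (Fin n) → ℝ) (l : List (Fin n)) :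
    alt (fun m => c * T m) l = c * alt T l := by
  simp only [alt, smul_eq_mul, Finset.mul_sum]
  refine Finset.sum_congr rfl fun σ _ => ?_
  ring

theorem alt_zero {n : ℕ} (l : List (Fin n)) :
    alt (fun _ : List (Fin n) => (0 : ℝ)) l = 0 := by
  simp [alt]

/-- The space of jets (Taylor coefficients at a point, of all orders) of the fields and antifields
of Grassmann parity `ε`.  A jet assigns a number to each symbol; it vanishes on the symbols that
do not occur or have the other parity, and it has the symmetries of the Young diagram
`[p - i, q - j]` with two columns: antisymmetry in each column, and vanishing of the
antisymmetrization over the first column and one index of the second. -/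
def jets (n p q : ℕ) (ε : ZMod 2) : Submodule ℝ (Comp n → ℝ) where
  carrier := {φ |
    (∀ s, ¬ (s.Occurs p q ∧ s.parity = ε) → φ s = 0) ∧
    (∀ a i j ρ μ ν, φ ⟨a, i, j, ρ, μ, ν⟩ = alt (fun m => φ ⟨a, i, j, ρ, m, ν⟩) μ) ∧
    (∀ a i j ρ μ ν, φ ⟨a, i, j, ρ, μ, ν⟩ = alt (fun m => φ ⟨a, i, j, ρ, μ, m⟩) ν) ∧
    (∀ a i j ρ μ ν, μ.length = p - i + 1 →
      alt (fun m => φ ⟨a, i, j, ρ, m.take (p - i), m.drop (p - i) ++ ν⟩) μ = 0)}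
  add_mem' := by
    rintro φ ψ ⟨h1, h2, h3, h4⟩ ⟨k1, k2, k3, k4⟩
    refine ⟨fun s hs => ?_, fun a i j ρ μ ν => ?_, fun a i j ρ μ ν => ?_,
      fun a i j ρ μ ν h => ?_⟩
    · simp [h1 s hs, k1 s hs]
    · simp only [Pi.add_apply, alt_add]
      rw [← h2, ← k2]
    · simp only [Pi.add_apply, alt_add]
      rw [← h3, ← k3]
    · simp only [Pi.add_apply, alt_add]
      rw [h4 _ _ _ _ _ _ h, k4 _ _ _ _ _ _ h, add_zero]
  zero_mem' := by
    refine ⟨fun _ _ => rfl, fun a i j ρ μ ν => ?_, fun a i j ρ μ ν => ?_,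
      fun a i j ρ μ ν _ => ?_⟩ <;> simp only [Pi.zero_apply, alt_zero]
  smul_mem' := by
    rintro c φ ⟨h1, h2, h3, h4⟩
    refine ⟨fun s hs => ?_, fun a i j ρ μ ν => ?_, fun a i j ρ μ ν => ?_,
      fun a i j ρ μ ν h => ?_⟩
    · simp [h1 s hs]
    · simp only [Pi.smul_apply, smul_eq_mul, alt_smul]
      rw [← h2]
    · simp only [Pi.smul_apply, smul_eq_mul, alt_smul]
      rw [← h3]
    · simp only [Pi.smul_apply, smul_eq_mul, alt_smul]
      rw [h4 _ _ _ _ _ _ h, mul_zero]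

/-! ### Local functions -/

/-- Formal linear combinations of symbols. -/
abbrev Lin (n : ℕ) := Comp n →₀ ℝ

/-- A symbol, as a linear combination. -/
def sym {n : ℕ} (s : Comp n) : Lin n := Finsupp.single s 1

/-- The linear function on jets given by a linear combination of symbols. -/
def coord {n : ℕ} (t : Lin n) : (Comp n → ℝ) →ₗ[ℝ] ℝ := t.sum fun s c => c • LinearMap.proj s

/-- Superfunctions: functions of the even (commuting) variables with values in the exterior
algebra generated by the odd (anticommuting) variables.  An odd variable is a linear function on
the space of odd jets. -/
abbrev SuperFun (n p q : ℕ) :=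
  jets n p q 0 → ExteriorAlgebra ℝ (Module.Dual ℝ (jets n p q 1))

/-- The function `g(t₁, …, tₘ)` of the even parts of the linear combinations `t₁, …, tₘ`. -/
def evenFun (n p q : ℕ) {m : ℕ} (g : (Fin m → ℝ) → ℝ) (t : Fin m → Lin n) : SuperFun n p q :=
  fun φ => algebraMap ℝ _ (g fun k => coord (t k) φ)

/-- The odd part of a linear combination, as a superfunction. -/
def oddVar (n p q : ℕ) (t : Lin n) : SuperFun n p q :=
  fun _ => ExteriorAlgebra.ι ℝ ((coord t).domRestrict (jets n p q 1))

/-- A linear combination of variables, as a superfunction (the sum of its even and odd parts). -/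
def linVar (n p q : ℕ) (t : Lin n) : SuperFun n p q :=
  evenFun n p q (fun x : Fin 1 → ℝ => x 0) (fun _ => t) + oddVar n p q t

/-- The algebra of functions that depend only on the variables in `S`: each is a sum of products of
finitely many odd variables with a smooth function of finitely many even variables. -/
def functionsOf (n p q : ℕ) (S : Set (Lin n)) : Subalgebra ℝ (SuperFun n p q) :=
  Algebra.adjoin ℝ
    ({f | ∃ (m : ℕ) (g : (Fin m → ℝ) → ℝ) (t : Fin m → Lin n),
        ContDiff ℝ ∞ g ∧ (∀ k, t k ∈ S) ∧ f = evenFun n p q g t} ∪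
      {f | ∃ t ∈ S, f = oddVar n p q t})

/-- The algebra of local functions of the fields, ghosts and antifields: functions of all the
variables and their derivatives (of finitely many of them at a time). -/
def localFunctions (n p q : ℕ) : Subalgebra ℝ (SuperFun n p q) := functionsOf n p q Set.univ

theorem functionsOf_le (n p q : ℕ) (S : Set (Lin n)) :
    functionsOf n p q S ≤ localFunctions n p q := by
  refine Algebra.adjoin_mono ?_
  rintro f (⟨m, g, t, hg, -, rfl⟩ | ⟨t, -, rfl⟩)
  · exact Or.inl ⟨m, g, t, hg, fun _ => Set.mem_univ _, rfl⟩
  · exact Or.inr ⟨t, Set.mem_univ _, rfl⟩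

theorem linVar_mem (n p q : ℕ) (t : Lin n) : linVar n p q t ∈ localFunctions n p q :=
  Subalgebra.add_mem _
    (Algebra.subset_adjoin (Or.inl ⟨1, _, _, contDiff_apply ℝ ℝ 0, fun _ => Set.mem_univ _, rfl⟩))
    (Algebra.subset_adjoin (Or.inr ⟨t, Set.mem_univ _, rfl⟩))

/-- A linear combination of variables, as a local function. -/
def var (n p q : ℕ) (t : Lin n) : localFunctions n p q := ⟨linVar n p q t, linVar_mem n p q t⟩

/-- The parity involution `f ↦ (-1)^{|f|} f` on superfunctions. -/
def superInv (n p q : ℕ) : SuperFun n p q →ₐ[ℝ] SuperFun n p q :=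
  AlgHom.pi fun φ => CliffordAlgebra.involute.comp (Pi.evalAlgHom ℝ _ φ)

theorem superInv_mem (n p q : ℕ) (f : localFunctions n p q) :
    superInv n p q f ∈ localFunctions n p q := by
  have h : localFunctions n p q ≤ (localFunctions n p q).comap (superInv n p q) := by
    refine Algebra.adjoin_le ?_
    rintro f (⟨m, g, t, hg, -, rfl⟩ | ⟨t, -, rfl⟩)
    · have e : superInv n p q (evenFun n p q g t) = evenFun n p q g t := by
        funext φ
        exact AlgHom.commutes CliffordAlgebra.involute _
      change superInv n p q (evenFun n p q g t) ∈ localFunctions n p q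
      rw [e]
      exact Algebra.subset_adjoin (Or.inl ⟨m, g, t, hg, fun _ => Set.mem_univ _, rfl⟩)
    · have e : superInv n p q (oddVar n p q t) = - oddVar n p q t := by
        funext φ
        exact CliffordAlgebra.involute_ι _
      change superInv n p q (oddVar n p q t) ∈ localFunctions n p q
      rw [e]
      exact Subalgebra.neg_mem _ (Algebra.subset_adjoin (Or.inr ⟨t, Set.mem_univ _, rfl⟩))
  exact h f.2

/-- The restriction of the parity involution to local functions. -/
def parityHom (n p q : ℕ) : localFunctions n p q →ₐ[ℝ] localFunctions n p q :=
  ((superInv n p q).comp (localFunctions n p q).val).codRestrict _ (superInv_mem n p q)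

theorem parityHom_comp (n p q : ℕ) :
    (parityHom n p q).comp (parityHom n p q) = AlgHom.id ℝ _ := by
  refine AlgHom.ext fun f => Subtype.ext (funext fun φ => ?_)
  exact CliffordAlgebra.involute_involute _

/-- The parity involution `f ↦ (-1)^{|f|} f` on local functions. -/
def parityInv (n p q : ℕ) : localFunctions n p q ≃ₐ[ℝ] localFunctions n p q :=
  AlgEquiv.ofAlgHom (parityHom n p q) (parityHom n p q) (parityHom_comp n p q)
    (parityHom_comp n p q)

/-! ### Cohomology of an odd derivation -/

/-- `γ` is an odd derivation of the superalgebra `A` with parity involution `π f = (-1)^{|f|} f`. -/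
structure IsOddDerivation {A : Type*} [Ring A] [Algebra ℝ A] (π : A ≃ₐ[ℝ] A) (γ : A →ₗ[ℝ] A) :
    Prop where
  odd : ∀ f, γ (π f) = - π (γ f)
  leibniz : ∀ f g, γ (f * g) = γ f * g + π f * γ g

section Cohomology

variable {A : Type*} [Ring A] [Algebra ℝ A] {π : A ≃ₐ[ℝ] A} {γ : A →ₗ[ℝ] A}

/-- The algebra of `γ`-cocycles. -/
def cocycles (hγ : IsOddDerivation π γ) : Subalgebra ℝ A where
  carrier := {f | γ f = 0}
  add_mem' := by
    intro a b ha hb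
    change γ (a + b) = 0
    rw [map_add, show γ a = 0 from ha, show γ b = 0 from hb, add_zero]
  mul_mem' := by
    intro a b ha hb
    change γ (a * b) = 0
    rw [hγ.leibniz, show γ a = 0 from ha, show γ b = 0 from hb, zero_mul, mul_zero, add_zero]
  algebraMap_mem' := by
    intro r
    have h1 : γ 1 = 0 := by simpa using hγ.leibniz 1 1
    change γ (algebraMap ℝ _ r) = 0
    rw [Algebra.algebraMap_eq_smul_one, map_smul, h1, smul_zero]

/-- Two cocycles are cohomologous if their difference is a coboundary `γ b`; this is compatible
with sums and products. -/
def cohomologous (hγ : IsOddDerivation π γ) : RingCon (cocycles hγ) where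
  r x y := ∃ b, γ b = (x : A) - y
  iseqv := by
    refine ⟨fun x => ⟨0, by simp⟩, ?_, ?_⟩
    · rintro x y ⟨b, hb⟩
      exact ⟨-b, by rw [map_neg, hb, neg_sub]⟩
    · rintro x y z ⟨b, hb⟩ ⟨c, hc⟩
      exact ⟨b + c, by rw [map_add, hb, hc, sub_add_sub_cancel]⟩
  add' := by
    rintro x x' y y' ⟨b, hb⟩ ⟨c, hc⟩
    refine ⟨b + c, ?_⟩
    rw [map_add, hb, hc]
    exact sub_add_sub_comm _ _ _ _
  mul' := by
    rintro x x' y y' ⟨b, hb⟩ ⟨c, hc⟩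
    have hy : γ (y : A) = 0 := y.2
    have hx : γ (π.symm (x' : A)) = 0 := by
      have h := hγ.odd (π.symm (x' : A))
      rw [π.apply_symm_apply, show γ (x' : A) = 0 from x'.2, eq_comm, neg_eq_zero] at h
      exact π.injective (h.trans (map_zero π).symm)
    refine ⟨b * y + π.symm x' * c, ?_⟩
    rw [map_add, hγ.leibniz, hγ.leibniz, hx, hy, hb, hc, π.apply_symm_apply]
    push_cast
    noncomm_ring

/-- The cohomology algebra `H(γ)`: cocycles modulo coboundaries. -/
abbrev Cohomology (hγ : IsOddDerivation π γ) := (cohomologous hγ).Quotient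

/-- The cohomology class of a cocycle. -/
def cohomologyClass (hγ : IsOddDerivation π γ) : cocycles hγ →ₐ[ℝ] Cohomology hγ :=
  (cohomologous hγ).mkₐ (α := ℝ)

end Cohomology

/-! ### The gauge differential -/

/-- The coefficient `a_{i,j} = (p-i)! / ((p-i-q+j+1)! (q-j)!)`. -/
def coeffA (p q i j : ℕ) : ℝ :=
  ((p - i).factorial : ℝ) / ((p - i + j + 1 - q).factorial * (q - j).factorial)

/-- The coefficient `b_{i,j} = (-1)^i (p-q+j+2) / (p-i-q+j+2)`. -/
def coeffB (p q i j : ℕ) : ℝ :=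
  (-1) ^ i * (((p : ℝ) - q + j + 2) / ((p : ℝ) - i - q + j + 2))

/-- The derivative `∂_ρ` of
`∂_{[μ₁} A^{(i+1,j)}_{μ₂ … μ_{p-i}] | ν} + b_{i,j} (A^{(i,j+1)}_{μ | [ν₁ … ν_{q-j-1}, ν_{q-j}]}`
`+ a_{i,j} A^{(i,j+1)}_{ν₁ … ν_{q-j} [μ_{q-j+1} … μ_{p-i} | μ₁ … μ_{q-j-1}, μ_{q-j}]})`,
where `A^{(p-q+1,j)} = 0 = A^{(i,q+1)}` since these symbols do not occur. -/
def gammaField {n : ℕ} (p q i j : ℕ) (ρ : Multiset (Fin n)) (μ ν : List (Fin n)) : Lin n :=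
  alt (fun m => sym ⟨false, i + 1, j, ρ + Multiset.ofList (m.take 1), m.drop 1, ν⟩) μ +
    coeffB p q i j •
      (alt (fun l => sym ⟨false, i, j + 1, ρ + Multiset.ofList (l.drop (q - j - 1)), μ, l.take (q - j - 1)⟩) ν +
        coeffA p q i j • alt (fun m => sym ⟨false, i, j + 1, ρ + Multiset.ofList ((m.drop (q - j - 1)).take 1),
          ν ++ m.drop (q - j), m.take (q - j - 1)⟩) μ)

/-- `γ` is the gauge differential of the free `[p,q]` theory: the odd derivation of the algebra of
local functions that commutes with the partial derivatives, is given on the fields and ghosts by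
their gauge transformations, and vanishes on the antifields. -/
structure IsGaugeDifferential (n p q : ℕ) (γ : localFunctions n p q →ₗ[ℝ] localFunctions n p q) :
    Prop extends IsOddDerivation (parityInv n p q) γ where
  field : ∀ i j ρ μ ν, (⟨false, i, j, ρ, μ, ν⟩ : Comp n).Occurs p q →
    γ (var n p q (sym ⟨false, i, j, ρ, μ, ν⟩)) = var n p q (gammaField p q i j ρ μ ν)
  antifield : ∀ i j ρ μ ν, (⟨true, i, j, ρ, μ, ν⟩ : Comp n).Occurs p q →
    γ (var n p q (sym ⟨true, i, j, ρ, μ, ν⟩)) = 0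

/-! ### Invariant variables -/

/-- The derivative `∂_ρ` of the curvature
`K_{μ₁ … μ_{p+1} | ν₁ … ν_{q+1}} = ∂_{[μ₁} φ_{μ₂ … μ_{p+1}] | [ν₁ … ν_q, ν_{q+1}]}`,
where `φ = A^{(0,0)}`. -/
def curvature {n : ℕ} (q : ℕ) (ρ : Multiset (Fin n)) (μ ν : List (Fin n)) : Lin n :=
  alt (fun m => alt (fun l =>
    sym ⟨false, 0, 0, ρ + Multiset.ofList (m.take 1) + Multiset.ofList (l.drop q), m.drop 1, l.take q⟩) ν) μ

/-- The curl `D⁰_{μ₁ … μ_{p+1}} = (-1)^q ∂_{[μ₁} A^{(0,q)}_{μ₂ … μ_{p+1}]}`. -/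
def curl {n : ℕ} (q : ℕ) (μ : List (Fin n)) : Lin n :=
  (-1 : ℝ) ^ q • alt (fun m => sym ⟨false, 0, q, Multiset.ofList (m.take 1), m.drop 1, []⟩) μ

/-- The four kinds of variables: the antifields and their derivatives, the curvature and its
derivatives, the undifferentiated last ghost `A^{(p-q,q)}`, and the curl `D⁰`. -/
def invariantVars (n p q : ℕ) : Set (Lin n) :=
  {t | ∃ i j ρ μ ν, (⟨true, i, j, ρ, μ, ν⟩ : Comp n).Occurs p q ∧
      t = sym ⟨true, i, j, ρ, μ, ν⟩} ∪
  {t | ∃ ρ μ ν, μ.length = p + 1 ∧ ν.length = q + 1 ∧ t = curvature q ρ μ ν} ∪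
  {t | ∃ μ, μ.length = q ∧ t = sym ⟨false, p - q, q, 0, μ, []⟩} ∪
  {t | ∃ μ, μ.length = p + 1 ∧ t = curl q μ}

/-- The algebra of functions `f([A^{*(i,j)}], [K], A^{(p-q,q)}, D⁰)`. -/
def invariantFunctions (n p q : ℕ) : Subalgebra ℝ (SuperFun n p q) :=
  functionsOf n p q (invariantVars n p q)

/-- The inclusion of the functions of the four kinds of variables into the local functions. -/
def toLocal (n p q : ℕ) : invariantFunctions n p q →ₐ[ℝ] localFunctions n p q :=
  Subalgebra.inclusion (functionsOf_le n p q _)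

end MixedGauge

end

open scoped ContDiff

noncomputable section
set_option linter.unusedSectionVars false

namespace MixedGauge

/-! ### Smooth dependence of integrals on parameters -/

section Analysis

open MeasureTheory

variable {E : Type*} [NormedAddCommGroup E] [NormedSpace ℝ E] [FiniteDimensional ℝ E]

/-! The theory is free: γ sends each variable to a linear combination of variables. So the proof
consists of linear algebra, which finds the cohomology of γ on linear functions of the jets, and a
nonlinear Poincaré lemma, which passes to all local functions.

Nonlinear part. Let H be the span of the invariant variables. Once H is known to represent the
linear cohomology, there are a projection P onto H and a homotopy ρ with γρ + ργ = 1 - P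
(`exists_homotopies`), and both can be transposed to maps of jets (`exists_isContraction`).
Interpolating affinely between P at time 0 and the identity at time 1 gives substitutions T_t, and
the derivation B_t along T_t induced by ρ satisfies dT_t/dt = γB_t + B_tγ (`exists_timeDerivative`),
because both sides are derivations along T_t that agree on the variables. For a cocycle f,
integration over t exhibits f - T_0 f as a coboundary, and T_0 f depends only on the invariants.
Since T_0 fixes functions of the invariants and kills coboundaries, no nonzero function of the
invariants is exact. Hadamard's lemma shows that a derivation is determined by its values on the
variables (`twistedDerivation_eq_zero`); uniqueness of γ and γ² = 0 follow as well.

Linear part. The symbols become words in the Fock space Λ ⊗ Λ ⊗ S, and Young symmetry becomes the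
quotient by the image of the `sl₂` operator `lower`. Modulo this image γ is a double complex
(`fam_gammaField_sub_mem`) with differentials `kL` and `kT = kR + c • raise * kL`, where c is the
value for which `kT` respects the image of `lower`. Both `kL` and `kR` have Koszul homotopies; these
work modulo relations because `lower` is injective in positive weight and onto in weight -1. A
closed family is then cleared column by column, from the shortest first column to the longest
(`mem_of_delta_mem`). The obstructions are the last ghost in the shortest column, and the curl and
the curvature in the longest one. Counting derivatives shows that none of them is exact
(`invariantFamily_mem_relFamilies`). -/

theorem hasFDerivAt_integral_of_contDiff {F : ℝ × E → ℝ} (hF : ContDiff ℝ ∞ F) (y : E) :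
    HasFDerivAt (fun y => ∫ t in (0 : ℝ)..1, F (t, y))
      (∫ t in (0 : ℝ)..1, (fderiv ℝ F (t, y)).comp (ContinuousLinearMap.inr ℝ ℝ E)) y := by
  have hc : Continuous fun z : ℝ × E => (fderiv ℝ F z).comp (ContinuousLinearMap.inr ℝ ℝ E) :=
    ((hF.continuous_fderiv (by simp)).clm_comp continuous_const)
  -- The partial derivative is continuous, hence bounded on the compact product of `[0, 1]` with a
  -- closed ball; the bound dominates the integrand.
  obtain ⟨C, hC⟩ := ((isCompact_Icc (a := (0 : ℝ)) (b := 1)).prod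
    (isCompact_closedBall y 1)).exists_bound_of_continuousOn hc.continuousOn
  refine intervalIntegral.hasFDerivAt_integral_of_dominated_of_fderiv_le (𝕜 := ℝ)
    (F := fun y t => F (t, y))
    (F' := fun y t => (fderiv ℝ F (t, y)).comp (ContinuousLinearMap.inr ℝ ℝ E))
    (bound := fun _ => C) (Metric.closedBall_mem_nhds y one_pos) ?_ ?_ ?_ ?_ ?_ ?_
  · refine Filter.Eventually.of_forall fun z => ?_
    exact (hF.continuous.comp (by fun_prop : Continuous fun t : ℝ => (t, z))).aestronglyMeasurable
  · exact (hF.continuous.comp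
      (by fun_prop : Continuous fun t : ℝ => (t, y))).intervalIntegrable _ _
  · exact (hc.comp (by fun_prop : Continuous fun t : ℝ => (t, y))).aestronglyMeasurable
  · refine Filter.Eventually.of_forall fun t ht z hz => hC (t, z) ⟨?_, hz⟩
    rw [Set.uIoc_of_le zero_le_one] at ht
    exact ⟨ht.1.le, ht.2⟩
  · exact intervalIntegrable_const
  · refine Filter.Eventually.of_forall fun t _ z _ => ?_
    exact ((hF.differentiable (by simp)) (t, z)).hasFDerivAt.comp z
      ((hasFDerivAt_const t z).prodMk (hasFDerivAt_id z))

theorem fderiv_integral_apply {F : ℝ × E → ℝ} (hF : ContDiff ℝ ∞ F) (y v : E) :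
    fderiv ℝ (fun y => ∫ t in (0 : ℝ)..1, F (t, y)) y v =
      ∫ t in (0 : ℝ)..1, fderiv ℝ F (t, y) (0, v) := by
  have hc : Continuous fun z : ℝ × E => (fderiv ℝ F z).comp (ContinuousLinearMap.inr ℝ ℝ E) :=
    ((hF.continuous_fderiv (by simp)).clm_comp continuous_const)
  rw [(hasFDerivAt_integral_of_contDiff hF y).fderiv, ContinuousLinearMap.intervalIntegral_apply]
  · simp
  · exact (hc.comp (by fun_prop : Continuous fun t : ℝ => (t, y))).intervalIntegrable _ _

/-- Induction on the order, for all integrands at once: a derivative in a fixed direction is again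
an integral of this kind, with another smooth integrand. -/
theorem contDiff_integral {F : ℝ × E → ℝ} (hF : ContDiff ℝ ∞ F) :
    ContDiff ℝ ∞ fun y => ∫ t in (0 : ℝ)..1, F (t, y) := by
  have key : ∀ k : ℕ, ∀ F : ℝ × E → ℝ, ContDiff ℝ ∞ F →
      ContDiff ℝ k fun y => ∫ t in (0 : ℝ)..1, F (t, y) := by
    intro k
    induction k with
    | zero =>
      intro F hF
      rw [Nat.cast_zero, contDiff_zero, continuous_iff_continuousAt]
      exact fun y => (hasFDerivAt_integral_of_contDiff hF y).continuousAt
    | succ k ih =>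
      intro F hF
      rw [Nat.cast_succ, contDiff_succ_iff_fderiv_apply]
      refine ⟨fun y => (hasFDerivAt_integral_of_contDiff hF y).differentiableAt, by simp,
        fun v => ?_⟩
      simp only [fderiv_integral_apply hF]
      exact ih (fun z => fderiv ℝ F z (0, v))
        ((hF.fderiv_right (m := ∞) (by simp)).clm_apply contDiff_const)
  exact contDiff_infty.2 fun k => key k F hF

/-- Hadamard's lemma. -/
theorem exists_hadamard {m : ℕ} {g : (Fin m → ℝ) → ℝ} (hg : ContDiff ℝ ∞ g) (y₀ : Fin m → ℝ) :
    ∃ h : Fin m → (Fin m → ℝ) → ℝ, (∀ k, ContDiff ℝ ∞ (h k)) ∧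
      ∀ y, g y = g y₀ + ∑ k, (y k - y₀ k) * h k y := by
  have hp : ContDiff ℝ ∞ fun z : ℝ × (Fin m → ℝ) => y₀ + z.1 • (z.2 - y₀) := by fun_prop
  have hd : ∀ v, ContDiff ℝ ∞ fun z : ℝ × (Fin m → ℝ) => fderiv ℝ g (y₀ + z.1 • (z.2 - y₀)) v :=
    fun v => ((hg.fderiv_right (m := ∞) (by simp)).comp hp).clm_apply contDiff_const
  -- The coefficients are the averages of the partial derivatives over the segment from `y₀` to `y`,
  -- by the fundamental theorem of calculus.
  refine ⟨fun k y => ∫ t in (0 : ℝ)..1, fderiv ℝ g (y₀ + t • (y - y₀)) (Pi.single k 1),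
    fun k => contDiff_integral (hd _), fun y => ?_⟩
  have hftc : ∫ t in (0 : ℝ)..1, fderiv ℝ g (y₀ + t • (y - y₀)) (y - y₀) = g y - g y₀ := by
    have h := intervalIntegral.integral_eq_sub_of_hasDerivAt (a := 0) (b := 1)
      (f := fun t : ℝ => g (y₀ + t • (y - y₀)))
      (f' := fun t : ℝ => fderiv ℝ g (y₀ + t • (y - y₀)) (y - y₀)) (fun t _ => ?_) ?_
    · simpa using h
    · have h1 : HasDerivAt (fun t : ℝ => y₀ + t • (y - y₀)) (y - y₀) t := by
        simpa using ((hasDerivAt_id t).smul_const (y - y₀)).const_add y₀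
      exact ((hg.differentiable (by simp)) _).hasFDerivAt.comp_hasDerivAt t h1
    · exact ((hd (y - y₀)).continuous.comp
        (by fun_prop : Continuous fun t : ℝ => (t, y))).intervalIntegrable _ _
  have hsum : ∀ t : ℝ, fderiv ℝ g (y₀ + t • (y - y₀)) (y - y₀) =
      ∑ k, (y k - y₀ k) * fderiv ℝ g (y₀ + t • (y - y₀)) (Pi.single k 1) := fun t => by
    generalize fderiv ℝ g (y₀ + t • (y - y₀)) = A
    conv_lhs => rw [pi_eq_sum_univ' (y - y₀), map_sum]
    exact Finset.sum_congr rfl fun k _ => by rw [map_smul, smul_eq_mul, Pi.sub_apply]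
  simp only [hsum] at hftc
  rw [intervalIntegral.integral_finsetSum] at hftc
  · simp only [intervalIntegral.integral_const_mul] at hftc
    rw [hftc]; ring
  · intro k _
    exact (((hd (Pi.single k 1)).continuous.comp
        (by fun_prop : Continuous fun t : ℝ => (t, y))).const_mul _).intervalIntegrable _ _

end Analysis

/-! ### Exterior algebras -/

section Exterior

variable {N N' : Type*} [AddCommGroup N] [Module ℝ N] [AddCommGroup N'] [Module ℝ N']

-- Contraction is an odd derivation: peeling generators off the left factor reduces this to the rule
-- for one vector. The action of induced derivations on the odd variables rests on it.
open CliffordAlgebra in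
theorem contractLeft_mul (d : Module.Dual ℝ N) (a b : ExteriorAlgebra ℝ N) :
    contractLeft d (a * b) = contractLeft d a * b + involute a * contractLeft d b := by
  induction a using CliffordAlgebra.left_induction with
  | algebraMap r =>
    rw [contractLeft_algebraMap_mul, contractLeft_algebraMap, AlgHom.commutes, zero_mul, zero_add]
  | add x y hx hy => rw [add_mul, map_add, hx, hy, map_add, map_add]; noncomm_ring
  | ι_mul x m hx =>
    rw [mul_assoc, contractLeft_ι_mul, hx, contractLeft_ι_mul, map_mul, involute_ι, sub_mul,
      smul_mul_assoc]
    noncomm_ring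

open CliffordAlgebra in
theorem contractLeft_involute (d : Module.Dual ℝ N) (a : ExteriorAlgebra ℝ N) :
    contractLeft d (involute a) = - involute (contractLeft d a) := by
  induction a using CliffordAlgebra.left_induction with
  | algebraMap r => rw [AlgHom.commutes, contractLeft_algebraMap, map_zero, neg_zero]
  | add x y hx hy => rw [map_add, map_add, hx, hy, map_add, map_add, neg_add]
  | ι_mul x m hx =>
    rw [map_mul, involute_ι, neg_mul, map_neg, contractLeft_ι_mul, hx, contractLeft_ι_mul, map_sub,
      map_smul, map_mul, involute_ι]
    noncomm_ring

-- A vector anticommutes with each generator, so carrying it across `a` costs the parity sign of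
-- `a`. The sign is needed when the gradient of a coefficient passes odd variables.
open CliffordAlgebra in
theorem ι_mul_eq_involute_mul (v : N) (a : ExteriorAlgebra ℝ N) :
    ExteriorAlgebra.ι ℝ v * a = involute a * ExteriorAlgebra.ι ℝ v := by
  induction a using CliffordAlgebra.left_induction with
  | algebraMap r => rw [AlgHom.commutes, Algebra.commutes]
  | add x y hx hy => rw [map_add, mul_add, hx, hy, add_mul]
  | ι_mul x m hx =>
    have h : ExteriorAlgebra.ι ℝ v * CliffordAlgebra.ι 0 m =
        -(CliffordAlgebra.ι 0 m * ExteriorAlgebra.ι ℝ v) :=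
      eq_neg_of_add_eq_zero_left (ExteriorAlgebra.ι_add_mul_swap v m)
    rw [map_mul, involute_ι, mul_assoc, ← hx, ← mul_assoc, h, neg_mul, neg_mul, mul_assoc]

theorem involute_map (f : N →ₗ[ℝ] N') (a : ExteriorAlgebra ℝ N) :
    CliffordAlgebra.involute (ExteriorAlgebra.map f a) =
      ExteriorAlgebra.map f (CliffordAlgebra.involute a) := by
  have h : (CliffordAlgebra.involute.comp (ExteriorAlgebra.map f) :
      ExteriorAlgebra ℝ N →ₐ[ℝ] ExteriorAlgebra ℝ N') =
      (ExteriorAlgebra.map f).comp CliffordAlgebra.involute := by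
    refine ExteriorAlgebra.hom_ext (LinearMap.ext fun v => ?_)
    simp only [LinearMap.comp_apply, AlgHom.toLinearMap_apply, AlgHom.comp_apply,
      ExteriorAlgebra.map_apply_ι]
    erw [CliffordAlgebra.involute_ι, CliffordAlgebra.involute_ι]
    rw [map_neg]
    exact congrArg _ (ExteriorAlgebra.map_apply_ι f v).symm
  exact DFunLike.congr_fun h a

end Exterior

/-! ### Smooth superfunctions of finitely many variables -/

section FunctionAlgebra

variable {J₀ J₁ : Type*} [AddCommGroup J₀] [Module ℝ J₀] [AddCommGroup J₁] [Module ℝ J₁]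

/-- Functions on `J₀` with values in the exterior algebra on the dual of `J₁`. -/
abbrev Superfunction (J₀ J₁ : Type*) [AddCommGroup J₁] [Module ℝ J₁] :=
  J₀ → ExteriorAlgebra ℝ (Module.Dual ℝ J₁)

/-- The smooth functions of finitely many of the linear functions in `S`. -/
def cylinder (S : Set (Module.Dual ℝ J₀)) : Set (J₀ → ℝ) :=
  {G | ∃ (m : ℕ) (g : (Fin m → ℝ) → ℝ) (t : Fin m → Module.Dual ℝ J₀),
    ContDiff ℝ ∞ g ∧ (∀ k, t k ∈ S) ∧ G = fun φ => g fun k => t k φ}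

theorem const_mem_cylinder (S : Set (Module.Dual ℝ J₀)) (c : ℝ) : (fun _ => c) ∈ cylinder S :=
  ⟨0, fun _ => c, fun k => k.elim0, contDiff_const, fun k => k.elim0, rfl⟩

theorem coe_mem_cylinder {S : Set (Module.Dual ℝ J₀)} {v : Module.Dual ℝ J₀} (hv : v ∈ S) :
    (v : J₀ → ℝ) ∈ cylinder S :=
  ⟨1, fun y => y 0, fun _ => v, contDiff_apply ℝ ℝ 0, fun _ => hv, rfl⟩

/-- Each `H k` has its own finite list of variables; the lists are concatenated through
`finSigmaFinEquiv` into a single finite list. -/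
theorem comp_mem_cylinder {S : Set (Module.Dual ℝ J₀)} {m : ℕ} {g : (Fin m → ℝ) → ℝ}
    (hg : ContDiff ℝ ∞ g) {H : Fin m → J₀ → ℝ} (hH : ∀ k, H k ∈ cylinder S) :
    (fun φ => g fun k => H k φ) ∈ cylinder S := by
  choose N h t hh ht e using hH
  refine ⟨∑ k, N k, fun y => g fun k => h k fun j => y (finSigmaFinEquiv ⟨k, j⟩),
    fun i => t (finSigmaFinEquiv.symm i).1 (finSigmaFinEquiv.symm i).2,
    hg.comp (contDiff_pi.2 fun k => (hh k).comp (by fun_prop)), fun i => ht _ _, ?_⟩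
  have key : ∀ k j, t (finSigmaFinEquiv.symm (finSigmaFinEquiv ⟨k, j⟩)).1
      (finSigmaFinEquiv.symm (finSigmaFinEquiv ⟨k, j⟩)).2 = t k j := fun k j =>
    congrArg (fun s : (k : Fin m) × Fin (N k) => t s.1 s.2)
      (finSigmaFinEquiv.symm_apply_apply ⟨k, j⟩)
  funext φ
  simp only [e, key]

theorem op_mem_cylinder {S : Set (Module.Dual ℝ J₀)} {op : ℝ × ℝ → ℝ} (hop : ContDiff ℝ ∞ op)
    {G G' : J₀ → ℝ} (hG : G ∈ cylinder S) (hG' : G' ∈ cylinder S) :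
    (fun φ => op (G φ, G' φ)) ∈ cylinder S := by
  have h := comp_mem_cylinder (g := fun y : Fin 2 → ℝ => op (y 0, y 1)) (S := S)
    (hop.comp (by fun_prop)) (H := ![G, G']) (by simp [Fin.forall_fin_two, hG, hG'])
  simpa using h

/-- The algebra of smooth functions of finitely many of the linear functions in `S`. -/
def cylinderAlgebra (S : Set (Module.Dual ℝ J₀)) : Subalgebra ℝ (J₀ → ℝ) where
  carrier := cylinder S
  mul_mem' h h' := op_mem_cylinder (op := fun z => z.1 * z.2) (by fun_prop) h h'
  add_mem' h h' := op_mem_cylinder (op := fun z => z.1 + z.2) (by fun_prop) h h'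
  algebraMap_mem' c := const_mem_cylinder S c

/-- `d` is the differential of `G` at `φ`, in the weak sense. -/
def HasGrad (G : J₀ → ℝ) (φ : J₀) (d : Module.Dual ℝ J₀) : Prop :=
  ∀ e, HasDerivAt (fun s : ℝ => G (φ + s • e)) (d e) 0

theorem HasGrad.unique {G : J₀ → ℝ} {φ : J₀} {d d' : Module.Dual ℝ J₀} (h : HasGrad G φ d)
    (h' : HasGrad G φ d') : d = d' :=
  LinearMap.ext fun e => (h e).unique (h' e)

theorem HasGrad.add {G G' : J₀ → ℝ} {φ : J₀} {d d' : Module.Dual ℝ J₀} (h : HasGrad G φ d)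
    (h' : HasGrad G' φ d') : HasGrad (G + G') φ (d + d') :=
  fun e => (h e).add (h' e)

theorem HasGrad.mul {G G' : J₀ → ℝ} {φ : J₀} {d d' : Module.Dual ℝ J₀} (h : HasGrad G φ d)
    (h' : HasGrad G' φ d') : HasGrad (G * G') φ (G φ • d' + G' φ • d) := fun e => by
  refine ((h e).mul (h' e)).congr_deriv ?_
  simp only [zero_smul, add_zero, LinearMap.add_apply, LinearMap.smul_apply, smul_eq_mul]
  ring

theorem hasGrad_const (c : ℝ) (φ : J₀) : HasGrad (fun _ => c) φ 0 :=
  fun _ => hasDerivAt_const _ _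

theorem hasGrad_coe (v : Module.Dual ℝ J₀) (φ : J₀) : HasGrad v φ v := fun e => by
  simp only [map_add, map_smul, smul_eq_mul]
  simpa using ((hasDerivAt_id (0 : ℝ)).mul_const (v e)).const_add (v φ)

/-- No topology on `J₀` is needed: along each line the chain rule takes place in `Fin m → ℝ`, and
the outcome is linear in the direction. -/
theorem hasGrad_comp {m : ℕ} {g : (Fin m → ℝ) → ℝ} (hg : ContDiff ℝ ∞ g)
    (t : Fin m → Module.Dual ℝ J₀) (φ : J₀) :
    HasGrad (fun φ => g fun k => t k φ) φ
      (∑ k, fderiv ℝ g (fun k => t k φ) (Pi.single k 1) • t k) := fun e => by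
  have h1 : HasDerivAt (fun s : ℝ => fun k => t k (φ + s • e)) (fun k => t k e) 0 :=
    hasDerivAt_pi.2 fun k => hasGrad_coe (t k) φ e
  have h2 := (((hg.differentiable (by simp)) (fun k => t k (φ + (0 : ℝ) • e))).hasFDerivAt
    ).comp_hasDerivAt (0 : ℝ) h1
  refine h2.congr_deriv ?_
  simp only [zero_smul, add_zero]
  generalize fderiv ℝ g _ = A
  conv_lhs => rw [pi_eq_sum_univ' (fun k => t k e), map_sum]
  simp [LinearMap.sum_apply, mul_comm]

open Classical in
/-- The differential of a function at a point; it is `0` where there is none. -/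
def grad (G : J₀ → ℝ) (φ : J₀) : Module.Dual ℝ J₀ :=
  if h : ∃ d, HasGrad G φ d then h.choose else 0

theorem HasGrad.grad_eq {G : J₀ → ℝ} {φ : J₀} {d : Module.Dual ℝ J₀} (h : HasGrad G φ d) :
    grad G φ = d := by
  have hex : ∃ d, HasGrad G φ d := ⟨d, h⟩
  rw [grad, dif_pos hex]
  exact hex.choose_spec.unique h

theorem hasGrad_grad {S : Set (Module.Dual ℝ J₀)} {G : J₀ → ℝ} (hG : G ∈ cylinder S) (φ : J₀) :
    HasGrad G φ (grad G φ) := by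
  obtain ⟨m, g, t, hg, -, rfl⟩ := hG
  rw [(hasGrad_comp hg t φ).grad_eq]
  exact hasGrad_comp hg t φ

/-- The superfunction `G w`. -/
def pureFn (G : J₀ → ℝ) (w : ExteriorAlgebra ℝ (Module.Dual ℝ J₁)) : Superfunction J₀ J₁ :=
  fun φ => G φ • w

/-- A real function, as a superfunction. -/
def scalFn (J₁ : Type*) [AddCommGroup J₁] [Module ℝ J₁] (G : J₀ → ℝ) : Superfunction J₀ J₁ :=
  fun φ => algebraMap ℝ _ (G φ)

/-- An odd linear variable, as a superfunction. -/
def oddFn (J₀ : Type*) {J₁ : Type*} [AddCommGroup J₁] [Module ℝ J₁] (v : Module.Dual ℝ J₁) :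
    Superfunction J₀ J₁ :=
  fun _ => ExteriorAlgebra.ι ℝ v

/-- The algebra of functions of the even variables in `S₀` and of the odd variables in `S₁`. -/
def fnAlgebra (S₀ : Set (Module.Dual ℝ J₀)) (S₁ : Set (Module.Dual ℝ J₁)) :
    Subalgebra ℝ (Superfunction J₀ J₁) :=
  Algebra.adjoin ℝ (scalFn J₁ '' cylinder S₀ ∪ oddFn J₀ '' S₁)

variable {S₀ : Set (Module.Dual ℝ J₀)} {S₁ : Set (Module.Dual ℝ J₁)}

theorem scalFn_mem {G : J₀ → ℝ} (hG : G ∈ cylinder S₀) : scalFn J₁ G ∈ fnAlgebra S₀ S₁ :=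
  Algebra.subset_adjoin (Or.inl ⟨G, hG, rfl⟩)

theorem oddFn_mem {v : Module.Dual ℝ J₁} (hv : v ∈ S₁) : oddFn J₀ v ∈ fnAlgebra S₀ S₁ :=
  Algebra.subset_adjoin (Or.inr ⟨v, hv, rfl⟩)

theorem scalFn_eq_pureFn (G : J₀ → ℝ) : scalFn J₁ G = pureFn G 1 :=
  funext fun _ => Algebra.algebraMap_eq_smul_one _

theorem oddFn_eq_pureFn (v : Module.Dual ℝ J₁) :
    oddFn J₀ v = pureFn (fun _ => 1) (ExteriorAlgebra.ι ℝ v) :=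
  funext fun _ => (one_smul _ _).symm

theorem pureFn_mul_pureFn (G G' : J₀ → ℝ) (w w' : ExteriorAlgebra ℝ (Module.Dual ℝ J₁)) :
    pureFn G w * pureFn G' w' = pureFn (G * G') (w * w') :=
  funext fun φ => by
    rw [Pi.mul_apply, pureFn, pureFn, pureFn, Pi.mul_apply, smul_mul_smul_comm]

theorem pureFn_mem {G : J₀ → ℝ} (hG : G ∈ cylinder S₀)
    {w : ExteriorAlgebra ℝ (Module.Dual ℝ J₁)}
    (hw : w ∈ Submonoid.closure (ExteriorAlgebra.ι ℝ '' S₁)) : pureFn G w ∈ fnAlgebra S₀ S₁ := by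
  have h : (fun _ => w : Superfunction J₀ J₁) ∈ fnAlgebra S₀ S₁ := by
    induction hw using Submonoid.closure_induction with
    | mem x hx => obtain ⟨v, hv, rfl⟩ := hx; exact oddFn_mem hv
    | one => exact one_mem _
    | mul x y _ _ hx hy => exact mul_mem hx hy
  have e : pureFn G w = scalFn J₁ G * fun _ => w := funext fun φ => Algebra.smul_def _ _
  rw [e]
  exact mul_mem (scalFn_mem hG) h

/-- The algebra of functions is spanned by products of a smooth function with odd variables. -/
theorem fnAlgebra_induction {p : Superfunction J₀ J₁ → Prop}
    (hp : ∀ G ∈ cylinder S₀, ∀ w ∈ Submonoid.closure (ExteriorAlgebra.ι ℝ '' S₁), p (pureFn G w))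
    (hadd : ∀ f ∈ fnAlgebra S₀ S₁, ∀ f' ∈ fnAlgebra S₀ S₁, p f → p f' → p (f + f'))
    {f : Superfunction J₀ J₁} (hf : f ∈ fnAlgebra S₀ S₁) : p f := by
  have h1 : ∀ x ∈ Submonoid.closure (scalFn J₁ '' cylinder S₀ ∪ oddFn J₀ '' S₁),
      ∃ G ∈ cylinder S₀, ∃ w ∈ Submonoid.closure (ExteriorAlgebra.ι ℝ '' S₁), x = pureFn G w := by
    intro x hx
    induction hx using Submonoid.closure_induction with
    | mem x hx =>
      rcases hx with ⟨G, hG, rfl⟩ | ⟨v, hv, rfl⟩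
      · exact ⟨G, hG, 1, one_mem _, scalFn_eq_pureFn G⟩
      · exact ⟨_, const_mem_cylinder S₀ 1, _, Submonoid.subset_closure ⟨v, hv, rfl⟩,
          oddFn_eq_pureFn v⟩
    | one => exact ⟨_, const_mem_cylinder S₀ 1, 1, one_mem _, funext fun _ => (one_smul _ _).symm⟩
    | mul x y _ _ hx hy =>
      obtain ⟨G, hG, w, hw, rfl⟩ := hx
      obtain ⟨G', hG', w', hw', rfl⟩ := hy
      exact ⟨_, mul_mem (S := Subalgebra ℝ (J₀ → ℝ)) (s := cylinderAlgebra S₀) hG hG', _,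
        mul_mem hw hw', pureFn_mul_pureFn _ _ _ _⟩
  have h2 : f ∈ Submodule.span ℝ
      (Submonoid.closure (scalFn J₁ '' cylinder S₀ ∪ oddFn J₀ '' S₁) :
        Set (Superfunction J₀ J₁)) := by
    rw [← Algebra.adjoin_eq_span]; exact hf
  -- The predicate is not assumed stable under scaling, so the induction over the span carries all
  -- multiples; a scalar is absorbed into the coefficient of a pure function.
  have h3 : ∀ c : ℝ, c • f ∈ fnAlgebra S₀ S₁ ∧ p (c • f) := by
    clear hf
    induction h2 using Submodule.span_induction with
    | mem x hx =>
      intro c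
      obtain ⟨G, hG, w, hw, rfl⟩ := h1 x hx
      have e : c • pureFn G w = pureFn (c • G) w := funext fun φ => smul_smul c (G φ) w
      have hG' : c • G ∈ cylinder S₀ := Subalgebra.smul_mem (cylinderAlgebra S₀) hG c
      rw [e]
      exact ⟨pureFn_mem hG' hw, hp _ hG' w hw⟩
    | zero =>
      intro c
      have := hp _ (const_mem_cylinder S₀ 0) 1 (one_mem _)
      rw [show pureFn (fun _ => 0) 1 = (0 : Superfunction J₀ J₁) from
        funext fun _ => zero_smul _ _] at this
      rw [smul_zero]
      exact ⟨zero_mem _, this⟩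
    | add x y _ _ hx hy =>
      intro c
      rw [smul_add]
      exact ⟨add_mem (hx c).1 (hy c).1, hadd _ (hx c).1 _ (hy c).1 (hx c).2 (hy c).2⟩
    | smul c' x _ hx =>
      intro c
      rw [smul_smul]
      exact hx _
  simpa using (h3 1).2

end FunctionAlgebra

/-! ### Odd derivations along a change of variables -/

section Derivations

variable {J₀ J₁ : Type*} [AddCommGroup J₀] [Module ℝ J₀] [AddCommGroup J₁] [Module ℝ J₁]
variable {K₀ K₁ : Type*} [AddCommGroup K₀] [Module ℝ K₀] [AddCommGroup K₁] [Module ℝ K₁]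

/-- A bilinear expression in a smooth function and an element of the exterior algebra extends to a
linear map on superfunctions. -/
theorem exists_linear_of_bilinear (S : Set (Module.Dual ℝ J₀)) {N : Type*} [AddCommGroup N]
    [Module ℝ N]
    (B : cylinderAlgebra S →ₗ[ℝ] ExteriorAlgebra ℝ (Module.Dual ℝ J₁) →ₗ[ℝ] N) :
    ∃ D : Superfunction J₀ J₁ →ₗ[ℝ] N, ∀ (G : cylinderAlgebra S) w,
      D (pureFn G w) = B G w := by
  let E : (cylinderAlgebra S) →ₗ[ℝ]
      ExteriorAlgebra ℝ (Module.Dual ℝ J₁) →ₗ[ℝ] Superfunction J₀ J₁ :=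
    LinearMap.mk₂ ℝ (fun G w => pureFn G w)
      (fun _ _ _ => funext fun _ => add_smul _ _ _) (fun c G w => funext fun φ => mul_smul c (G.1 φ) w)
      (fun _ _ _ => funext fun _ => smul_add _ _ _) (fun _ _ _ => funext fun _ => smul_comm _ _ _)
  -- In a basis of the exterior algebra the coefficients of a tensor can be read off from the values
  -- of its superfunction, so the tensor product embeds into the superfunctions.
  have hE : LinearMap.ker (TensorProduct.lift E) = ⊥ := by
    rw [LinearMap.ker_eq_bot']
    intro z hz
    let b := Module.Free.chooseBasis ℝ (ExteriorAlgebra ℝ (Module.Dual ℝ J₁))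
    let e := TensorProduct.equivFinsuppOfBasisRight (M := cylinderAlgebra S) b
    rw [← e.symm_apply_apply z] at hz ⊢
    generalize e z = y at hz ⊢
    rw [TensorProduct.equivFinsuppOfBasisRight_symm_apply, Finsupp.sum, map_sum] at hz
    have h0 : y = 0 := by
      ext k φ
      have h1 := congrArg (fun F => b.repr (F φ) k) hz
      simp only [TensorProduct.lift.tmul, Finset.sum_apply, map_sum, Pi.zero_apply, map_zero,
        Finsupp.coe_zero, Finsupp.coe_finsetSum] at h1
      have h2 : ∀ j, (b.repr ((E (y j) (b j)) φ)) k = if j = k then (y j).1 φ else 0 := fun j => by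
        change (b.repr ((y j).1 φ • b j)) k = _
        rw [map_smul, b.repr_self, Finsupp.smul_apply, Finsupp.single_apply]
        split_ifs <;> simp
      simp only [h2, Finset.sum_ite_eq'] at h1
      by_cases hk : y k = 0
      · rw [hk]; rfl
      · rw [if_pos (Finsupp.mem_support_iff.2 hk)] at h1
        exact h1
    rw [h0, map_zero]
  -- A linear left inverse extends the prescription to all superfunctions; the values off the image
  -- carry no meaning.
  obtain ⟨L, hL⟩ : ∃ L : Superfunction J₀ J₁ →ₗ[ℝ] TensorProduct ℝ (cylinderAlgebra S)
      (ExteriorAlgebra ℝ (Module.Dual ℝ J₁)), L ∘ₗ TensorProduct.lift E = LinearMap.id :=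
    LinearMap.exists_leftInverse_of_injective (V' := Superfunction J₀ J₁)
      (V := TensorProduct ℝ (cylinderAlgebra S) (ExteriorAlgebra ℝ (Module.Dual ℝ J₁)))
      (TensorProduct.lift E) hE
  refine ⟨TensorProduct.lift B ∘ₗ L, fun G w => ?_⟩
  have h1 := LinearMap.congr_fun hL (G ⊗ₜ w)
  rw [LinearMap.comp_apply, TensorProduct.lift.tmul, LinearMap.id_apply] at h1
  rw [LinearMap.comp_apply]
  change (TensorProduct.lift B) (L (E G w)) = _
  rw [h1, TensorProduct.lift.tmul]

/-- The change of variables `χ₀` in the even variables, together with linear changes `χ₁` of the odd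
variables that may depend on the even ones. -/
def pullback (χ₀ : K₀ → J₀) (χ₁ : K₀ → K₁ →ₗ[ℝ] J₁) :
    Superfunction J₀ J₁ →ₐ[ℝ] Superfunction K₀ K₁ :=
  AlgHom.pi fun φ => (ExteriorAlgebra.map (χ₁ φ).dualMap).comp (Pi.evalAlgHom ℝ _ (χ₀ φ))

theorem pullback_apply (χ₀ : K₀ → J₀) (χ₁ : K₀ → K₁ →ₗ[ℝ] J₁) (f : Superfunction J₀ J₁) (φ : K₀) :
    pullback χ₀ χ₁ f φ = ExteriorAlgebra.map (χ₁ φ).dualMap (f (χ₀ φ)) := rfl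

theorem pullback_scalFn (χ₀ : K₀ → J₀) (χ₁ : K₀ → K₁ →ₗ[ℝ] J₁) (G : J₀ → ℝ) :
    pullback χ₀ χ₁ (scalFn J₁ G) = scalFn K₁ (G ∘ χ₀) :=
  funext fun _ => AlgHom.commutes _ _

theorem pullback_oddFn (χ₀ : K₀ → J₀) (χ₁ : K₀ → K₁ →ₗ[ℝ] J₁) (v : Module.Dual ℝ J₁) :
    pullback χ₀ χ₁ (oddFn J₀ v) = fun φ => ExteriorAlgebra.ι ℝ (v ∘ₗ χ₁ φ) :=
  funext fun _ => ExteriorAlgebra.map_apply_ι _ _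

theorem pullback_id_apply (f : Superfunction J₀ J₁) :
    pullback id (fun _ => LinearMap.id) f = f :=
  funext fun φ => by
    rw [pullback_apply, LinearMap.dualMap_id, ExteriorAlgebra.map_id]
    rfl

/-- The parity involution. -/
def parityMap (J₀ J₁ : Type*) [AddCommGroup J₁] [Module ℝ J₁] :
    Superfunction J₀ J₁ →ₐ[ℝ] Superfunction J₀ J₁ :=
  AlgHom.pi fun φ => CliffordAlgebra.involute.comp (Pi.evalAlgHom ℝ _ φ)

theorem parityMap_apply (f : Superfunction J₀ J₁) (φ : J₀) :
    parityMap J₀ J₁ f φ = CliffordAlgebra.involute (f φ) := rfl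

theorem parityMap_scalFn (G : J₀ → ℝ) : parityMap J₀ J₁ (scalFn J₁ G) = scalFn J₁ G :=
  funext fun _ => AlgHom.commutes _ _

theorem parityMap_oddFn (v : Module.Dual ℝ J₁) :
    parityMap J₀ J₁ (oddFn J₀ v) = - oddFn J₀ v :=
  funext fun _ => CliffordAlgebra.involute_ι _

theorem parityMap_pureFn (G : J₀ → ℝ) (w : ExteriorAlgebra ℝ (Module.Dual ℝ J₁)) :
    parityMap J₀ J₁ (pureFn G w) = pureFn G (CliffordAlgebra.involute w) :=
  funext fun φ => map_smul CliffordAlgebra.involute (G φ) w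

theorem parityMap_parityMap (f : Superfunction J₀ J₁) :
    parityMap J₀ J₁ (parityMap J₀ J₁ f) = f :=
  funext fun _ => CliffordAlgebra.involute_involute _

theorem parityMap_pullback (χ₀ : K₀ → J₀) (χ₁ : K₀ → K₁ →ₗ[ℝ] J₁) (f : Superfunction J₀ J₁) :
    parityMap K₀ K₁ (pullback χ₀ χ₁ f) = pullback χ₀ χ₁ (parityMap J₀ J₁ f) :=
  funext fun _ => involute_map _ _

theorem fnAlgebra_le_of {S₀ : Set (Module.Dual ℝ J₀)} {S₁ : Set (Module.Dual ℝ J₁)}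
    {B : Subalgebra ℝ (Superfunction J₀ J₁)} (h₀ : ∀ G ∈ cylinder S₀, scalFn J₁ G ∈ B)
    (h₁ : ∀ v ∈ S₁, oddFn J₀ v ∈ B) : fnAlgebra S₀ S₁ ≤ B := by
  refine Algebra.adjoin_le ?_
  rintro f (⟨G, hG, rfl⟩ | ⟨v, hv, rfl⟩)
  exacts [h₀ G hG, h₁ v hv]

theorem parityMap_mem {S₀ : Set (Module.Dual ℝ J₀)} {S₁ : Set (Module.Dual ℝ J₁)}
    {f : Superfunction J₀ J₁} (hf : f ∈ fnAlgebra S₀ S₁) :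
    parityMap J₀ J₁ f ∈ fnAlgebra S₀ S₁ := by
  refine fnAlgebra_le_of (B := (fnAlgebra S₀ S₁).comap (parityMap J₀ J₁)) (fun G hG => ?_)
    (fun v hv => ?_) hf
  · rw [Subalgebra.mem_comap, parityMap_scalFn]; exact scalFn_mem hG
  · rw [Subalgebra.mem_comap, parityMap_oddFn]; exact neg_mem (oddFn_mem hv)

/-- `D` is an odd derivation along the change of variables `(χ₀, χ₁)`, on functions of the even
variables in `S`, given on even variables by `v ↦ v ∘ ρ₁` and on odd ones by `v ↦ v ∘ ρ₀`. -/
def IsInducedDerivation (S : Set (Module.Dual ℝ J₀)) (χ₀ : K₀ → J₀) (χ₁ : K₀ → K₁ →ₗ[ℝ] J₁)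
    (ρ₁ : K₁ →ₗ[ℝ] J₀) (ρ₀ : K₀ → J₁) (D : Superfunction J₀ J₁ →ₗ[ℝ] Superfunction K₀ K₁) :
    Prop :=
  ∀ G ∈ cylinder S, ∀ w, D (pureFn G w) = fun φ =>
    ExteriorAlgebra.ι ℝ (grad G (χ₀ φ) ∘ₗ ρ₁) * ExteriorAlgebra.map (χ₁ φ).dualMap w +
      G (χ₀ φ) • ExteriorAlgebra.map (χ₁ φ).dualMap
        (CliffordAlgebra.contractLeft (Module.Dual.eval ℝ J₁ (ρ₀ φ)) w)

/-- The prescribed formula is bilinear, because the gradient is linear on cylinder functions;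
`exists_linear_of_bilinear` then supplies the operator. -/
theorem exists_isInducedDerivation (S : Set (Module.Dual ℝ J₀)) (χ₀ : K₀ → J₀)
    (χ₁ : K₀ → K₁ →ₗ[ℝ] J₁) (ρ₁ : K₁ →ₗ[ℝ] J₀) (ρ₀ : K₀ → J₁) :
    ∃ D, IsInducedDerivation S χ₀ χ₁ ρ₁ ρ₀ D := by
  let B : cylinderAlgebra S →ₗ[ℝ] ExteriorAlgebra ℝ (Module.Dual ℝ J₁) →ₗ[ℝ]
      Superfunction K₀ K₁ :=
    LinearMap.mk₂ ℝ (fun G w φ =>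
      ExteriorAlgebra.ι ℝ (grad G.1 (χ₀ φ) ∘ₗ ρ₁) * ExteriorAlgebra.map (χ₁ φ).dualMap w +
        G.1 (χ₀ φ) • ExteriorAlgebra.map (χ₁ φ).dualMap
          (CliffordAlgebra.contractLeft (Module.Dual.eval ℝ J₁ (ρ₀ φ)) w))
      (fun G G' w => funext fun φ => by
        have e : grad (G + G' : cylinderAlgebra S).1 (χ₀ φ) = grad G.1 (χ₀ φ) + grad G'.1 (χ₀ φ) :=
          ((hasGrad_grad G.2 _).add (hasGrad_grad G'.2 _)).grad_eq
        have e2 : (G + G' : cylinderAlgebra S).1 (χ₀ φ) = G.1 (χ₀ φ) + G'.1 (χ₀ φ) := rfl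
        simp only [e, e2, LinearMap.add_comp, map_add, add_mul, add_smul, Pi.add_apply]
        abel)
      (fun c G w => funext fun φ => by
        have e : grad (c • G : cylinderAlgebra S).1 (χ₀ φ) = c • grad G.1 (χ₀ φ) := by
          have h := ((hasGrad_const c (χ₀ φ)).mul (hasGrad_grad G.2 (χ₀ φ))).grad_eq
          rwa [smul_zero, add_zero] at h
        have e2 : (c • G : cylinderAlgebra S).1 (χ₀ φ) = c * G.1 (χ₀ φ) := rfl
        simp only [e, e2, LinearMap.smul_comp, map_smul, smul_mul_assoc, mul_smul, Pi.smul_apply,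
          smul_add])
      (fun G w w' => funext fun φ => by
        simp only [map_add, mul_add, smul_add, Pi.add_apply]
        abel)
      (fun c G w => funext fun φ => by
        simp only [map_smul, mul_smul_comm, Pi.smul_apply, smul_add]
        rw [smul_comm])
  obtain ⟨D, hD⟩ := exists_linear_of_bilinear S B
  exact ⟨D, fun G hG w => hD ⟨G, hG⟩ w⟩

namespace IsInducedDerivation

variable {S₀ : Set (Module.Dual ℝ J₀)} {S₁ : Set (Module.Dual ℝ J₁)} {χ₀ : K₀ → J₀}
  {χ₁ : K₀ → K₁ →ₗ[ℝ] J₁} {ρ₁ : K₁ →ₗ[ℝ] J₀} {ρ₀ : K₀ → J₁}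
  {D : Superfunction J₀ J₁ →ₗ[ℝ] Superfunction K₀ K₁}

/-- It suffices to multiply two pure functions. The product rules for gradients and contractions
combine, and the sign appears when the gradient of the second coefficient passes the exterior
element of the first. -/
theorem leibniz (hD : IsInducedDerivation S₀ χ₀ χ₁ ρ₁ ρ₀ D) {f f' : Superfunction J₀ J₁}
    (hf : f ∈ fnAlgebra S₀ S₁) (hf' : f' ∈ fnAlgebra S₀ S₁) :
    D (f * f') = D f * pullback χ₀ χ₁ f' + pullback χ₀ χ₁ (parityMap J₀ J₁ f) * D f' := by
  refine fnAlgebra_induction (p := fun f => D (f * f') =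
    D f * pullback χ₀ χ₁ f' + pullback χ₀ χ₁ (parityMap J₀ J₁ f) * D f')
    (fun G hG w _ => ?_) (fun a _ b _ ha hb => ?_) hf
  · refine fnAlgebra_induction (p := fun f' => D (pureFn G w * f') =
      D (pureFn G w) * pullback χ₀ χ₁ f' + pullback χ₀ χ₁ (parityMap J₀ J₁ (pureFn G w)) * D f')
      (fun G' hG' w' _ => ?_) (fun a _ b _ ha hb => ?_) hf'
    · rw [pureFn_mul_pureFn, parityMap_pureFn, hD G hG, hD G' hG', hD (G * G')
        (mul_mem (S := Subalgebra ℝ (J₀ → ℝ)) (s := cylinderAlgebra S₀) hG hG')]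
      funext φ
      simp only [Pi.add_apply, Pi.mul_apply, pullback_apply, pureFn, map_smul]
      rw [((hasGrad_grad hG (χ₀ φ)).mul (hasGrad_grad hG' (χ₀ φ))).grad_eq, contractLeft_mul]
      simp only [map_add, map_mul, LinearMap.add_comp, LinearMap.smul_comp, map_smul, mul_smul,
        add_mul, mul_add, smul_mul_assoc, mul_smul_comm, smul_add]
      rw [← mul_assoc (ExteriorAlgebra.ι ℝ (grad G' (χ₀ φ) ∘ₗ ρ₁)), ι_mul_eq_involute_mul,
        involute_map, smul_comm (G' (χ₀ φ)) (G (χ₀ φ)), mul_assoc, mul_assoc]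
      module
    · simp only [mul_add, map_add, ha, hb]; abel
  · simp only [add_mul, map_add, ha, hb]; abel

theorem odd (hD : IsInducedDerivation S₀ χ₀ χ₁ ρ₁ ρ₀ D) {f : Superfunction J₀ J₁}
    (hf : f ∈ fnAlgebra S₀ S₁) : D (parityMap J₀ J₁ f) = - parityMap K₀ K₁ (D f) := by
  refine fnAlgebra_induction
    (p := fun f => D (parityMap J₀ J₁ f) = - parityMap K₀ K₁ (D f))
    (fun G hG w _ => ?_) (fun a _ b _ ha hb => ?_) hf
  · rw [parityMap_pureFn, hD G hG, hD G hG]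
    funext φ
    simp only [Pi.neg_apply, parityMap_apply, map_add, map_mul, contractLeft_involute, map_neg,
      map_smul, involute_map, smul_neg, neg_add]
    erw [CliffordAlgebra.involute_ι]
    noncomm_ring
  · rw [map_add, map_add, ha, hb, map_add, map_add, neg_add]

theorem apply_scalFn (hD : IsInducedDerivation S₀ χ₀ χ₁ ρ₁ ρ₀ D) {G : J₀ → ℝ}
    (hG : G ∈ cylinder S₀) :
    D (scalFn J₁ G) = fun φ => ExteriorAlgebra.ι ℝ (grad G (χ₀ φ) ∘ₗ ρ₁) := by
  rw [scalFn_eq_pureFn, hD G hG]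
  funext φ
  rw [map_one, mul_one, CliffordAlgebra.contractLeft_one, map_zero, smul_zero, add_zero]

theorem apply_coe (hD : IsInducedDerivation S₀ χ₀ χ₁ ρ₁ ρ₀ D) {v : Module.Dual ℝ J₀}
    (hv : v ∈ S₀) : D (scalFn J₁ v) = oddFn K₀ (v ∘ₗ ρ₁) := by
  rw [hD.apply_scalFn (coe_mem_cylinder hv)]
  funext φ
  rw [(hasGrad_coe v _).grad_eq]
  rfl

theorem apply_oddFn (hD : IsInducedDerivation S₀ χ₀ χ₁ ρ₁ ρ₀ D) (v : Module.Dual ℝ J₁) :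
    D (oddFn J₀ v) = scalFn K₁ (fun φ => v (ρ₀ φ)) := by
  rw [oddFn_eq_pureFn, hD _ (const_mem_cylinder S₀ 1)]
  funext φ
  rw [(hasGrad_const 1 _).grad_eq, LinearMap.zero_comp, map_zero, zero_mul, zero_add, one_smul]
  erw [CliffordAlgebra.contractLeft_ι]
  rw [AlgHom.commutes]
  rfl

end IsInducedDerivation

end Derivations

/-! ### Derivations are determined by their values on the variables -/

section Uniqueness

variable {J₀ J₁ : Type*} [AddCommGroup J₀] [Module ℝ J₀] [AddCommGroup J₁] [Module ℝ J₁]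
variable {K₀ K₁ : Type*} [AddCommGroup K₀] [Module ℝ K₀] [AddCommGroup K₁] [Module ℝ K₁]
variable {S₀ : Set (Module.Dual ℝ J₀)} {S₁ : Set (Module.Dual ℝ J₁)}

theorem fnAlgebra_prod_induction {p : Superfunction J₀ J₁ → Prop}
    (h₀ : ∀ G ∈ cylinder S₀, p (scalFn J₁ G)) (h₁ : ∀ v ∈ S₁, p (oddFn J₀ v))
    (hadd : ∀ f ∈ fnAlgebra S₀ S₁, ∀ f' ∈ fnAlgebra S₀ S₁, p f → p f' → p (f + f'))
    (hmul : ∀ f ∈ fnAlgebra S₀ S₁, ∀ f' ∈ fnAlgebra S₀ S₁, p f → p f' → p (f * f'))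
    {f : Superfunction J₀ J₁} (hf : f ∈ fnAlgebra S₀ S₁) : p f := by
  induction hf using Algebra.adjoin_induction with
  | mem x hx =>
    rcases hx with ⟨G, hG, rfl⟩ | ⟨v, hv, rfl⟩
    exacts [h₀ G hG, h₁ v hv]
  | algebraMap r => exact h₀ _ (const_mem_cylinder S₀ r)
  | add x y hx hy ihx ihy => exact hadd x hx y hy ihx ihy
  | mul x y hx hy ihx ihy => exact hmul x hx y hy ihx ihy

theorem pullback_mem {χ₀ : K₀ → J₀} {χ₁ : K₀ → K₁ →ₗ[ℝ] J₁}
    {S₀' : Set (Module.Dual ℝ K₀)} {S₁' : Set (Module.Dual ℝ K₁)}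
    (h₀ : ∀ G ∈ cylinder S₀, G ∘ χ₀ ∈ cylinder S₀')
    (h₁ : ∀ v ∈ S₁, (fun φ => ExteriorAlgebra.ι ℝ (v ∘ₗ χ₁ φ)) ∈ fnAlgebra S₀' S₁')
    {f : Superfunction J₀ J₁} (hf : f ∈ fnAlgebra S₀ S₁) :
    pullback χ₀ χ₁ f ∈ fnAlgebra S₀' S₁' := by
  refine fnAlgebra_prod_induction (p := fun f => pullback χ₀ χ₁ f ∈ fnAlgebra S₀' S₁')
    (fun G hG => ?_) (fun v hv => ?_) (fun f _ f' _ h h' => ?_) (fun f _ f' _ h h' => ?_) hf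
  · rw [pullback_scalFn]
    exact scalFn_mem (h₀ G hG)
  · rw [pullback_oddFn]
    exact h₁ v hv
  · rw [map_add]
    exact add_mem h h'
  · rw [map_mul]
    exact mul_mem h h'

/-- A derivation along a change of variables that vanishes on the variables is zero. -/
theorem twistedDerivation_eq_zero {D : Superfunction J₀ J₁ →ₗ[ℝ] Superfunction K₀ K₁}
    {χ ψ : Superfunction J₀ J₁ → Superfunction K₀ K₁} (θ : K₀ → J₀)
    (hψ : ∀ G ∈ cylinder S₀, ψ (scalFn J₁ G) = scalFn K₁ (G ∘ θ)) (hχ : χ 1 = 1)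
    (leibniz : ∀ f ∈ fnAlgebra S₀ S₁, ∀ f' ∈ fnAlgebra S₀ S₁, D (f * f') = D f * χ f' + ψ f * D f')
    (h₀ : ∀ v ∈ S₀, D (scalFn J₁ v) = 0) (h₁ : ∀ v ∈ S₁, D (oddFn J₀ v) = 0)
    {f : Superfunction J₀ J₁} (hf : f ∈ fnAlgebra S₀ S₁) : D f = 0 := by
  have e1 : scalFn J₁ (fun _ : J₀ => (1 : ℝ)) = 1 := funext fun _ => map_one _
  have hD1 : D 1 = 0 := by
    have h := leibniz 1 (one_mem _) 1 (one_mem _)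
    have hψ1 : ψ 1 = 1 := by
      rw [← e1, hψ _ (const_mem_cylinder S₀ 1)]
      exact funext fun _ => map_one _
    rw [hχ, hψ1, one_mul, mul_one, one_mul] at h
    simpa using h
  have hDc : ∀ c : ℝ, D (scalFn J₁ fun _ => c) = 0 := fun c => by
    have e : scalFn J₁ (fun _ : J₀ => c) = c • 1 := funext fun _ => Algebra.algebraMap_eq_smul_one c
    rw [e, map_smul, hD1, smul_zero]
  refine fnAlgebra_prod_induction (p := fun f => D f = 0) ?_ h₁ ?_ ?_ hf
  · rintro _ ⟨m, g, t, hg, ht, rfl⟩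
    funext φ
    -- Hadamard expansion at the image of `φ`. In each product `D` kills the first factor and `ψ` of
    -- it vanishes at `φ`, so the value of `D` at `φ` is zero.
    obtain ⟨h, hh, he⟩ := exists_hadamard hg (fun k => t k (θ φ))
    have e : scalFn J₁ (fun φ => g fun k => t k φ) =
        scalFn J₁ (fun _ => g fun k => t k (θ φ)) +
          ∑ k, (scalFn J₁ (t k) - scalFn J₁ fun _ => t k (θ φ)) *
            scalFn J₁ (fun φ => h k fun k => t k φ) := by
      funext φ'
      rw [scalFn, he, map_add, map_sum, Pi.add_apply, Finset.sum_apply]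
      refine congrArg₂ _ rfl (Finset.sum_congr rfl fun k _ => ?_)
      rw [map_mul, map_sub]
      rfl
    rw [e, map_add, hDc, zero_add, map_sum, Finset.sum_apply, Pi.zero_apply]
    refine Finset.sum_eq_zero fun k _ => ?_
    have hs : scalFn J₁ (t k) - scalFn J₁ (fun _ => t k (θ φ)) =
        scalFn J₁ fun φ' => t k φ' - t k (θ φ) := 
      funext fun φ' => (map_sub (algebraMap ℝ _) (t k φ') (t k (θ φ))).symm
    have hc : (fun φ' => t k φ' - t k (θ φ)) ∈ cylinder S₀ :=
      sub_mem (S := Subalgebra ℝ (J₀ → ℝ)) (H := cylinderAlgebra S₀) (coe_mem_cylinder (ht k))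
        (const_mem_cylinder S₀ _)
    rw [leibniz _ (hs ▸ scalFn_mem hc) _ (scalFn_mem ⟨m, h k, t, hh k, ht, rfl⟩), map_sub, hDc,
      h₀ _ (ht k), sub_zero, zero_mul, zero_add, hs, hψ _ hc, Pi.mul_apply]
    simp [scalFn]
  · intro f _ f' _ hf hf'
    rw [map_add, hf, hf', add_zero]
  · intro f hf f' hf' h h'
    rw [leibniz f hf f' hf', h, h', zero_mul, mul_zero, add_zero]

namespace IsInducedDerivation

variable {χ₀ : K₀ → J₀} {χ₁ : K₀ → K₁ →ₗ[ℝ] J₁} {ρ₁ : K₁ →ₗ[ℝ] J₀} {ρ₀ : K₀ → J₁}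
  {D : Superfunction J₀ J₁ →ₗ[ℝ] Superfunction K₀ K₁}
  {S₀' : Set (Module.Dual ℝ K₀)} {S₁' : Set (Module.Dual ℝ K₁)}

/-- By the chain rule the image of a coefficient is a finite sum of partial derivatives times
transformed variables; the Leibniz rule then covers products. -/
theorem apply_mem (hD : IsInducedDerivation S₀ χ₀ χ₁ ρ₁ ρ₀ D)
    (hχ : ∀ f ∈ fnAlgebra S₀ S₁, pullback χ₀ χ₁ f ∈ fnAlgebra S₀' S₁')
    (h₀ : ∀ G ∈ cylinder S₀, G ∘ χ₀ ∈ cylinder S₀')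
    (h₁ : ∀ v ∈ S₀, v ∘ₗ ρ₁ ∈ S₁') (h₂ : ∀ v ∈ S₁, (fun φ => v (ρ₀ φ)) ∈ cylinder S₀')
    {f : Superfunction J₀ J₁} (hf : f ∈ fnAlgebra S₀ S₁) : D f ∈ fnAlgebra S₀' S₁' := by
  refine fnAlgebra_prod_induction (p := fun f => D f ∈ fnAlgebra S₀' S₁') ?_ ?_ ?_ ?_ hf
  · intro G hG
    rw [hD.apply_scalFn hG]
    obtain ⟨m, g, t, hg, ht, rfl⟩ := hG
    have e : (fun φ => ExteriorAlgebra.ι ℝ (grad (fun φ => g fun k => t k φ) (χ₀ φ) ∘ₗ ρ₁) :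
        Superfunction K₀ K₁) =
        ∑ k, scalFn K₁ ((fun φ => fderiv ℝ g (fun k => t k φ) (Pi.single k 1)) ∘ χ₀) *
          oddFn K₀ (t k ∘ₗ ρ₁) := by
      funext φ
      have hs : ∀ c : Fin m → ℝ, (∑ k, c k • t k) ∘ₗ ρ₁ = ∑ k, c k • (t k ∘ₗ ρ₁) := fun c => by
        ext; simp
      rw [(hasGrad_comp hg t (χ₀ φ)).grad_eq, Finset.sum_apply, hs, map_sum]
      refine Finset.sum_congr rfl fun k _ => ?_
      rw [map_smul, Algebra.smul_def]
      rfl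
    rw [e]
    refine sum_mem fun k _ => mul_mem (scalFn_mem (h₀ _ ?_)) (oddFn_mem (h₁ _ (ht k)))
    exact ⟨m, fun y => fderiv ℝ g y (Pi.single k 1), t,
      (hg.fderiv_right (m := ∞) (by simp)).clm_apply contDiff_const, ht, rfl⟩
  · intro v hv
    rw [hD.apply_oddFn]
    exact scalFn_mem (h₂ v hv)
  · intro f _ f' _ h h'
    rw [map_add]
    exact add_mem h h'
  · intro f hf f' hf' h h'
    rw [hD.leibniz hf hf']
    exact add_mem (mul_mem h (hχ _ hf')) (mul_mem (hχ _ (parityMap_mem hf)) h')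

end IsInducedDerivation

/-- The weak derivative of a function at a point in a direction. -/
theorem exists_dirDeriv (S₀ : Set (Module.Dual ℝ J₀)) (S₁ : Set (Module.Dual ℝ J₁)) (φ e : J₀) :
    ∃ D : Superfunction J₀ J₁ →ₗ[ℝ] ExteriorAlgebra ℝ (Module.Dual ℝ J₁),
      (∀ G ∈ cylinder S₀, ∀ w, D (pureFn G w) = grad G φ e • w) ∧
      (∀ f ∈ fnAlgebra S₀ S₁, ∀ f' ∈ fnAlgebra S₀ S₁, D (f * f') = D f * f' φ + f φ * D f') ∧
      ∀ f ∈ fnAlgebra S₀ S₁, ∀ l : Module.Dual ℝ (ExteriorAlgebra ℝ (Module.Dual ℝ J₁)),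
        HasDerivAt (fun s : ℝ => l (f (φ + s • e))) (l (D f)) 0 := by
  -- Only the coefficient depends on the point, so it alone is differentiated. Convergence is tested
  -- against linear functionals, as no topology is chosen on the exterior algebra.
  let B : cylinderAlgebra S₀ →ₗ[ℝ] ExteriorAlgebra ℝ (Module.Dual ℝ J₁) →ₗ[ℝ]
      ExteriorAlgebra ℝ (Module.Dual ℝ J₁) :=
    LinearMap.mk₂ ℝ (fun G w => grad G.1 φ e • w)
      (fun G G' w => by
        have h : grad (G + G' : cylinderAlgebra S₀).1 φ = grad G.1 φ + grad G'.1 φ :=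
          ((hasGrad_grad G.2 _).add (hasGrad_grad G'.2 _)).grad_eq
        rw [h, LinearMap.add_apply, add_smul])
      (fun c G w => by
        have h : grad (c • G : cylinderAlgebra S₀).1 φ = c • grad G.1 φ := by
          have h := ((hasGrad_const c φ).mul (hasGrad_grad G.2 φ)).grad_eq
          rwa [smul_zero, add_zero] at h
        rw [h, LinearMap.smul_apply, smul_assoc])
      (fun _ _ _ => smul_add _ _ _) (fun _ _ _ => smul_comm _ _ _)
  obtain ⟨D, hD⟩ := exists_linear_of_bilinear S₀ B
  have hD' : ∀ G ∈ cylinder S₀, ∀ w, D (pureFn G w) = grad G φ e • w :=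
    fun G hG w => hD ⟨G, hG⟩ w
  refine ⟨D, hD', fun f hf f' hf' => ?_, fun f hf l => ?_⟩
  · refine fnAlgebra_induction (p := fun f => D (f * f') = D f * f' φ + f φ * D f')
      (fun G hG w _ => ?_) (fun a _ b _ ha hb => ?_) hf
    · refine fnAlgebra_induction (p := fun f' => D (pureFn G w * f') =
        D (pureFn G w) * f' φ + pureFn G w φ * D f')
        (fun G' hG' w' _ => ?_) (fun a _ b _ ha hb => ?_) hf'
      · rw [pureFn_mul_pureFn, hD' G hG, hD' G' hG', hD' (G * G')
          (mul_mem (S := Subalgebra ℝ (J₀ → ℝ)) (s := cylinderAlgebra S₀) hG hG'),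
          ((hasGrad_grad hG φ).mul (hasGrad_grad hG' φ)).grad_eq]
        simp only [pureFn, LinearMap.add_apply, LinearMap.smul_apply, smul_eq_mul,
          smul_mul_smul_comm, ← add_smul]
        ring_nf
      · simp only [mul_add, map_add, ha, hb, Pi.add_apply]; abel
    · simp only [add_mul, map_add, ha, hb, Pi.add_apply]; abel
  · refine fnAlgebra_induction
      (p := fun f => HasDerivAt (fun s : ℝ => l (f (φ + s • e))) (l (D f)) 0)
      (fun G hG w _ => ?_) (fun a _ b _ ha hb => ?_) hf
    · rw [hD' G hG, map_smul]
      simp only [pureFn, map_smul]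
      exact (hasGrad_grad hG φ e).smul_const (l w)
    · rw [map_add, map_add]
      simp only [Pi.add_apply, map_add]
      exact ha.add hb

end Uniqueness

/-! ### Superfunctions that depend on time, and their integrals -/

section Homotopy

variable {J₀ J₁ : Type*} [AddCommGroup J₀] [Module ℝ J₀] [AddCommGroup J₁] [Module ℝ J₁]

/-- The variables in `V` and a time variable. -/
def timeVars (V : Submodule ℝ (Module.Dual ℝ J₀)) : Set (Module.Dual ℝ (ℝ × J₀)) :=
  {L | L ∘ₗ LinearMap.inr ℝ ℝ J₀ ∈ V}

variable {V₀ H₀ : Submodule ℝ (Module.Dual ℝ J₀)} {V₁ H₁ : Submodule ℝ (Module.Dual ℝ J₁)}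

theorem fst_mem_timeVars : LinearMap.fst ℝ ℝ J₀ ∈ timeVars V₀ := by
  have e : LinearMap.fst ℝ ℝ J₀ ∘ₗ LinearMap.inr ℝ ℝ J₀ = 0 := LinearMap.ext fun _ => rfl
  change _ ∈ V₀
  rw [e]
  exact zero_mem _

theorem comp_snd_mem_timeVars {v : Module.Dual ℝ J₀} (hv : v ∈ V₀) :
    v ∘ₗ LinearMap.snd ℝ ℝ J₀ ∈ timeVars V₀ := hv

/-- A function of time and of the even variables, at a fixed time. -/
def timeSlice (t : ℝ) : Superfunction (ℝ × J₀) J₁ →ₗ[ℝ] Superfunction J₀ J₁ :=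
  LinearMap.funLeft ℝ _ fun φ => (t, φ)

theorem timeSlice_eq_pullback (t : ℝ) (F : Superfunction (ℝ × J₀) J₁) :
    timeSlice t F = pullback (fun φ => (t, φ)) (fun _ => LinearMap.id) F := funext fun φ => by
  rw [pullback_apply, LinearMap.dualMap_id, ExteriorAlgebra.map_id]
  rfl

theorem timeVars_apply (L : Module.Dual ℝ (ℝ × J₀)) (t : ℝ) (φ : J₀) :
    L (t, φ) = t * L (1, 0) + (L ∘ₗ LinearMap.inr ℝ ℝ J₀) φ := by
  have e : ((t, φ) : ℝ × J₀) = t • (1, 0) + (0, φ) := by simp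
  rw [e, map_add, map_smul]
  rfl

theorem timeSlice_mem (t : ℝ) {S₁ : Set (Module.Dual ℝ J₁)} {F : Superfunction (ℝ × J₀) J₁}
    (hF : F ∈ fnAlgebra (timeVars V₀) S₁) : timeSlice t F ∈ fnAlgebra (V₀ : Set _) S₁ := by
  rw [timeSlice_eq_pullback]
  refine pullback_mem (fun G hG => ?_) (fun v hv => oddFn_mem hv) hF
  obtain ⟨m, g, L, hg, hL, rfl⟩ := hG
  refine comp_mem_cylinder hg (H := fun k φ => L k (t, φ)) fun k => ?_
  rw [funext fun φ => timeVars_apply (L k) t φ]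
  exact add_mem (S := Subalgebra ℝ (J₀ → ℝ)) (s := cylinderAlgebra (V₀ : Set _))
    (const_mem_cylinder _ _) (coe_mem_cylinder (hL k))

/-- The integral over time of a family of functions, and its image under an odd derivation. -/
theorem exists_timeIntegral {δ₁ : J₁ →ₗ[ℝ] J₀} {δ₀ : J₀ → J₁}
    {D : Superfunction J₀ J₁ →ₗ[ℝ] Superfunction J₀ J₁}
    (hD : IsInducedDerivation (V₀ : Set _) id (fun _ => LinearMap.id) δ₁ δ₀ D)
    {S₁ : Set (Module.Dual ℝ J₁)} {F : Superfunction (ℝ × J₀) J₁}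
    (hF : F ∈ fnAlgebra (timeVars V₀) S₁) :
    ∃ b ∈ fnAlgebra (V₀ : Set _) S₁, ∀ φ (l : Module.Dual ℝ (ExteriorAlgebra ℝ (Module.Dual ℝ J₁))),
      Continuous (fun t => l (D (timeSlice t F) φ)) ∧
      l (D b φ) = ∫ t in (0 : ℝ)..1, l (D (timeSlice t F) φ) := by
  revert hF
  generalize hp : (fun F : Superfunction (ℝ × J₀) J₁ => ∃ b ∈ fnAlgebra (V₀ : Set _) S₁,
      ∀ φ (l : Module.Dual ℝ (ExteriorAlgebra ℝ (Module.Dual ℝ J₁))),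
      Continuous (fun t => l (D (timeSlice t F) φ)) ∧
      l (D b φ) = ∫ t in (0 : ℝ)..1, l (D (timeSlice t F) φ)) = p
  suffices h : ∀ F ∈ fnAlgebra (timeVars V₀) S₁, p F by
    intro hF
    have h1 := h F hF
    rw [← hp] at h1
    exact h1
  intro F hF
  refine fnAlgebra_induction (fun G hG w hw => ?_) (fun F _ F' _ h h' => ?_) hF <;>
    subst hp
  · obtain ⟨m, g, L, hg, hL, rfl⟩ := hG
    -- Time enters a linear function through its value on `(1, 0)`. Splitting this off makes the
    -- coefficient a smooth function of time and of finitely many variables in `V₀`.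
    let Ft : ℝ × (Fin m → ℝ) → ℝ := fun z => g fun k => z.1 * L k (1, 0) + z.2 k
    have hFt : ContDiff ℝ ∞ Ft := hg.comp (by fun_prop)
    let v : Fin m → Module.Dual ℝ J₀ := fun k => L k ∘ₗ LinearMap.inr ℝ ℝ J₀
    have hsm : ∀ t, ContDiff ℝ ∞ fun y => Ft (t, y) := fun t => hFt.comp (by fun_prop)
    have hslice : ∀ t, timeSlice t (pureFn (fun z => g fun k => L k z) w) =
        pureFn (fun φ => Ft (t, fun k => v k φ)) w := fun t => by
      funext φ
      change (g fun k => L k (t, φ)) • w = (g _) • w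
      rw [funext fun k => timeVars_apply (L k) t φ]
    have hcyl : ∀ g' : (Fin m → ℝ) → ℝ, ContDiff ℝ ∞ g' →
        (fun φ => g' fun k => v k φ) ∈ cylinder (V₀ : Set _) := fun g' hg' => ⟨m, g', v, hg', hL, rfl⟩
    -- Paired with a functional, the image under `D` involves the coefficient only through its value
    -- and its first partial derivatives, so differentiation under the integral sign finishes the
    -- argument.
    have hDapp : ∀ g' : (Fin m → ℝ) → ℝ, ContDiff ℝ ∞ g' → ∀ φ
        (l : Module.Dual ℝ (ExteriorAlgebra ℝ (Module.Dual ℝ J₁))),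
        l (D (pureFn (fun φ => g' fun k => v k φ) w) φ) =
          ∑ k, fderiv ℝ g' (fun k => v k φ) (Pi.single k 1) *
              l (ExteriorAlgebra.ι ℝ (v k ∘ₗ δ₁) * w) +
            g' (fun k => v k φ) *
              l (CliffordAlgebra.contractLeft (Module.Dual.eval ℝ J₁ (δ₀ φ)) w) := by
      intro g' hg' φ l
      have hs : ∀ c : Fin m → ℝ, (∑ k, c k • v k) ∘ₗ δ₁ = ∑ k, c k • (v k ∘ₗ δ₁) := fun c => by
        ext; simp
      rw [hD _ (hcyl g' hg') w]
      simp only [LinearMap.dualMap_id, ExteriorAlgebra.map_id, id_eq, AlgHom.coe_id]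
      rw [(hasGrad_comp hg' v φ).grad_eq, hs, map_add, map_smul, map_sum, Finset.sum_mul, map_sum,
        smul_eq_mul]
      simp only [map_smul, smul_mul_assoc, smul_eq_mul]
    have hI := contDiff_integral hFt
    have hfd : ∀ t y e, fderiv ℝ (fun y => Ft (t, y)) y e = fderiv ℝ Ft (t, y) (0, e) := by
      intro t y e
      have h := ((hFt.differentiable (by simp)) (t, y)).hasFDerivAt.comp y
        ((hasFDerivAt_const t y).prodMk (hasFDerivAt_id y))
      have h2 : (fun y => Ft (t, y)) = Ft ∘ Prod.mk t := rfl
      rw [h2, h.fderiv]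
      simp
    have hc : ∀ (y : Fin m → ℝ) e, Continuous fun t => fderiv ℝ Ft (t, y) (0, e) := fun y e =>
      ((hFt.continuous_fderiv (by simp)).clm_apply continuous_const).comp
        (by fun_prop : Continuous fun t : ℝ => (t, y))
    have hc' : ∀ y : Fin m → ℝ, Continuous fun t => Ft (t, y) := fun y =>
      hFt.continuous.comp (by fun_prop : Continuous fun t : ℝ => (t, y))
    refine ⟨pureFn (fun φ => ∫ t in (0 : ℝ)..1, Ft (t, fun k => v k φ)) w,
      pureFn_mem (hcyl _ hI) hw, fun φ l => ?_⟩
    simp only [hslice, hDapp _ (hsm _), hDapp _ hI, hfd, fderiv_integral_apply hFt]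
    refine ⟨?_, ?_⟩
    · exact (continuous_finsetSum _ fun k _ => (hc _ _).mul continuous_const).add
        ((hc' _).mul continuous_const)
    · rw [intervalIntegral.integral_add, intervalIntegral.integral_finsetSum]
      · simp only [intervalIntegral.integral_mul_const]
      · exact fun k _ => ((hc _ _).mul continuous_const).intervalIntegrable _ _
      · exact (continuous_finsetSum _ fun k _ =>
          (hc _ _).mul continuous_const).intervalIntegrable _ _
      · exact ((hc' _).mul continuous_const).intervalIntegrable _ _
  · obtain ⟨b, hb, hb'⟩ := h
    obtain ⟨c, hc, hc'⟩ := h'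
    refine ⟨b + c, add_mem hb hc, fun φ l => ?_⟩
    simp only [map_add, Pi.add_apply]
    refine ⟨(hb' φ l).1.add (hc' φ l).1, ?_⟩
    rw [(hb' φ l).2, (hc' φ l).2, intervalIntegral.integral_add]
    · exact (hb' φ l).1.intervalIntegrable _ _
    · exact (hc' φ l).1.intervalIntegrable _ _

/-- `δ` is a linear differential, and `ρ` a homotopy between the identity and the projection `P`
onto the variables in `H`. -/
structure IsContraction (V₀ H₀ : Submodule ℝ (Module.Dual ℝ J₀))
    (V₁ H₁ : Submodule ℝ (Module.Dual ℝ J₁)) (δ₁ ρ₁ : J₁ →ₗ[ℝ] J₀) (δ₀ ρ₀ : J₀ →ₗ[ℝ] J₁)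
    (P₀ : J₀ →ₗ[ℝ] J₀) (P₁ : J₁ →ₗ[ℝ] J₁) : Prop where
  le₀ : H₀ ≤ V₀
  le₁ : H₁ ≤ V₁
  δ₁_mem : ∀ v ∈ V₀, v ∘ₗ δ₁ ∈ V₁
  δ₀_mem : ∀ v ∈ V₁, v ∘ₗ δ₀ ∈ V₀
  ρ₁_mem : ∀ v ∈ V₀, v ∘ₗ ρ₁ ∈ V₁
  ρ₀_mem : ∀ v ∈ V₁, v ∘ₗ ρ₀ ∈ V₀
  P₀_mem : ∀ v ∈ V₀, v ∘ₗ P₀ ∈ H₀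
  P₁_mem : ∀ v ∈ V₁, v ∘ₗ P₁ ∈ H₁
  P₀_id : ∀ v ∈ H₀, v ∘ₗ P₀ = v
  P₁_id : ∀ v ∈ H₁, v ∘ₗ P₁ = v
  P₀_comp : P₀ ∘ₗ δ₁ = 0
  P₁_comp : P₁ ∘ₗ δ₀ = 0
  comp_P₁ : δ₁ ∘ₗ P₁ = 0
  comp_P₀ : δ₀ ∘ₗ P₀ = 0
  homotopy₀ : δ₁ ∘ₗ ρ₀ + ρ₁ ∘ₗ δ₀ = LinearMap.id - P₀
  homotopy₁ : δ₀ ∘ₗ ρ₁ + ρ₀ ∘ₗ δ₁ = LinearMap.id - P₁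

namespace IsInducedDerivation

variable {δ₁ : J₁ →ₗ[ℝ] J₀} {δ₀ : J₀ →ₗ[ℝ] J₁}
  {D : Superfunction J₀ J₁ →ₗ[ℝ] Superfunction J₀ J₁}

theorem leibniz_id {S₀ : Set (Module.Dual ℝ J₀)} {S₁ : Set (Module.Dual ℝ J₁)}
    (hD : IsInducedDerivation S₀ id (fun _ => LinearMap.id) δ₁ δ₀ D) {f f' : Superfunction J₀ J₁}
    (hf : f ∈ fnAlgebra S₀ S₁) (hf' : f' ∈ fnAlgebra S₀ S₁) :
    D (f * f') = D f * f' + parityMap J₀ J₁ f * D f' := by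
  rw [hD.leibniz hf hf', pullback_id_apply, pullback_id_apply]

theorem apply_mem_id (hD : IsInducedDerivation (V₀ : Set _) id (fun _ => LinearMap.id) δ₁ δ₀ D)
    (h₁ : ∀ v ∈ V₀, v ∘ₗ δ₁ ∈ V₁) (h₀ : ∀ v ∈ V₁, v ∘ₗ δ₀ ∈ V₀) {f : Superfunction J₀ J₁}
    (hf : f ∈ fnAlgebra (V₀ : Set _) (V₁ : Set _)) :
    D f ∈ fnAlgebra (V₀ : Set _) (V₁ : Set _) := by
  refine hD.apply_mem (S₁ := (V₁ : Set (Module.Dual ℝ J₁))) (fun f hf => ?_) (fun _ h => h) h₁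
    (fun v hv => ?_) hf
  · rwa [pullback_id_apply]
  · exact coe_mem_cylinder (S := (V₀ : Set (Module.Dual ℝ J₀))) (h₀ v hv)

theorem pullback_linear_mem {χ₀ : J₀ →ₗ[ℝ] J₀} {χ₁ : J₁ →ₗ[ℝ] J₁}
    {S₀ S₀' : Set (Module.Dual ℝ J₀)} {S₁ S₁' : Set (Module.Dual ℝ J₁)}
    (h₀ : ∀ v ∈ S₀, v ∘ₗ χ₀ ∈ S₀') (h₁ : ∀ v ∈ S₁, v ∘ₗ χ₁ ∈ S₁') {f : Superfunction J₀ J₁}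
    (hf : f ∈ fnAlgebra S₀ S₁) : pullback χ₀ (fun _ => χ₁) f ∈ fnAlgebra S₀' S₁' := by
  refine pullback_mem (fun G hG => ?_) (fun v hv => oddFn_mem (h₁ v hv)) hf
  obtain ⟨m, g, t, hg, ht, rfl⟩ := hG
  exact ⟨m, g, fun k => t k ∘ₗ χ₀, hg, fun k => h₀ _ (ht k), rfl⟩

/-- The difference `D ∘ T - T ∘ D` obeys a Leibniz rule along `T`, so it vanishes once it kills the
variables; there it is the commutation of `χ` with `δ`. -/
theorem pullback_comm (hD : IsInducedDerivation (V₀ : Set _) id (fun _ => LinearMap.id) δ₁ δ₀ D)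
    {χ₀ : J₀ →ₗ[ℝ] J₀} {χ₁ : J₁ →ₗ[ℝ] J₁} (hχ₀ : ∀ v ∈ V₀, v ∘ₗ χ₀ ∈ V₀)
    (hχ₁ : ∀ v ∈ V₁, v ∘ₗ χ₁ ∈ V₁) (e₁ : χ₀ ∘ₗ δ₁ = δ₁ ∘ₗ χ₁) (e₀ : χ₁ ∘ₗ δ₀ = δ₀ ∘ₗ χ₀)
    {f : Superfunction J₀ J₁} (hf : f ∈ fnAlgebra (V₀ : Set _) (V₁ : Set _)) :
    D (pullback χ₀ (fun _ => χ₁) f) = pullback χ₀ (fun _ => χ₁) (D f) := by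
  let T := pullback χ₀ fun _ => χ₁
  have hT : ∀ f ∈ fnAlgebra (V₀ : Set _) (V₁ : Set _), T f ∈ fnAlgebra (V₀ : Set _) (V₁ : Set _) :=
    fun f hf => pullback_linear_mem hχ₀ hχ₁ hf
  have h := twistedDerivation_eq_zero (D := D ∘ₗ T.toLinearMap - T.toLinearMap ∘ₗ D) (χ := T)
    (ψ := fun f => T (parityMap J₀ J₁ f)) χ₀ (fun G hG => by
      rw [parityMap_scalFn, pullback_scalFn]) (map_one _) (fun f hf f' hf' => ?_)
    (fun v hv => ?_) (fun v hv => ?_) hf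
  · exact sub_eq_zero.1 h
  · simp only [LinearMap.sub_apply, LinearMap.comp_apply, AlgHom.toLinearMap_apply]
    rw [map_mul, hD.leibniz_id (hT f hf) (hT f' hf'), hD.leibniz_id hf hf', map_add, map_mul,
      map_mul, parityMap_pullback]
    noncomm_ring
  · simp only [LinearMap.sub_apply, LinearMap.comp_apply, AlgHom.toLinearMap_apply, T]
    rw [pullback_scalFn, hD.apply_coe hv, pullback_oddFn, ← LinearMap.coe_comp,
      hD.apply_coe (hχ₀ v hv), LinearMap.comp_assoc, e₁]
    exact sub_self _
  · simp only [LinearMap.sub_apply, LinearMap.comp_apply, AlgHom.toLinearMap_apply, T]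
    rw [pullback_oddFn, hD.apply_oddFn]
    change D (oddFn J₀ (v ∘ₗ χ₁)) - _ = 0
    rw [hD.apply_oddFn, pullback_scalFn, sub_eq_zero]
    exact congrArg (scalFn J₁) (funext fun φ => congrArg v (LinearMap.congr_fun e₀ φ))

/-- `T ∘ D` is a derivation along `T` that kills the variables, since `χ` takes values in the kernel
of `δ`. With the projections as `χ`, restriction to the invariants kills coboundaries. -/
theorem pullback_apply_eq_zero
    (hD : IsInducedDerivation (V₀ : Set _) id (fun _ => LinearMap.id) δ₁ δ₀ D)
    {χ₀ : J₀ →ₗ[ℝ] J₀} {χ₁ : J₁ →ₗ[ℝ] J₁} (e₁ : δ₁ ∘ₗ χ₁ = 0) (e₀ : δ₀ ∘ₗ χ₀ = 0)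
    {f : Superfunction J₀ J₁} (hf : f ∈ fnAlgebra (V₀ : Set _) (V₁ : Set _)) :
    pullback χ₀ (fun _ => χ₁) (D f) = 0 := by
  let T := pullback χ₀ fun _ => χ₁
  refine twistedDerivation_eq_zero (D := T.toLinearMap ∘ₗ D) (χ := T)
    (ψ := fun f => T (parityMap J₀ J₁ f)) χ₀ (fun G hG => by
      rw [parityMap_scalFn, pullback_scalFn]) (map_one _) (fun f hf f' hf' => ?_)
    (fun v hv => ?_) (fun v hv => ?_) hf
  · simp only [LinearMap.comp_apply, AlgHom.toLinearMap_apply]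
    rw [hD.leibniz_id hf hf', map_add, map_mul, map_mul]
  · simp only [LinearMap.comp_apply, AlgHom.toLinearMap_apply, T]
    rw [hD.apply_coe hv, pullback_oddFn, LinearMap.comp_assoc, e₁, LinearMap.comp_zero, map_zero]
    rfl
  · simp only [LinearMap.comp_apply, AlgHom.toLinearMap_apply, T]
    rw [hD.apply_oddFn, pullback_scalFn]
    refine funext fun φ => ?_
    have h : δ₀ (χ₀ φ) = 0 := LinearMap.congr_fun e₀ φ
    simp [scalFn, h]

end IsInducedDerivation

end Homotopy

/-! ### The nonlinear Poincaré lemma of a linear contraction -/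

section Contraction

variable {J₀ J₁ : Type*} [AddCommGroup J₀] [Module ℝ J₀] [AddCommGroup J₁] [Module ℝ J₁]
variable {V₀ H₀ : Submodule ℝ (Module.Dual ℝ J₀)} {V₁ H₁ : Submodule ℝ (Module.Dual ℝ J₁)}
  {δ₁ ρ₁ : J₁ →ₗ[ℝ] J₀} {δ₀ ρ₀ : J₀ →ₗ[ℝ] J₁} {P₀ : J₀ →ₗ[ℝ] J₀} {P₁ : J₁ →ₗ[ℝ] J₁}
  {D : Superfunction J₀ J₁ →ₗ[ℝ] Superfunction J₀ J₁}

/-- The interpolation between a projection at time `0` and the identity at time `1`. -/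
def interpolate {J : Type*} [AddCommGroup J] [Module ℝ J] (P : J →ₗ[ℝ] J) (t : ℝ) : J →ₗ[ℝ] J :=
  P + t • (LinearMap.id - P)

theorem interpolate_zero {J : Type*} [AddCommGroup J] [Module ℝ J] (P : J →ₗ[ℝ] J) :
    interpolate P 0 = P := by
  rw [interpolate, zero_smul, add_zero]

theorem interpolate_one {J : Type*} [AddCommGroup J] [Module ℝ J] (P : J →ₗ[ℝ] J) :
    interpolate P 1 = LinearMap.id := by
  rw [interpolate, one_smul, add_sub_cancel]

theorem comp_interpolate {J : Type*} [AddCommGroup J] [Module ℝ J] (P : J →ₗ[ℝ] J) (t : ℝ)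
    (v : Module.Dual ℝ J) : v ∘ₗ interpolate P t = v ∘ₗ P + t • (v - v ∘ₗ P) := by
  rw [interpolate, LinearMap.comp_add, LinearMap.comp_smul, LinearMap.comp_sub, LinearMap.comp_id]

theorem comp_interpolate_mem {J : Type*} [AddCommGroup J] [Module ℝ J] {P : J →ₗ[ℝ] J}
    {V : Submodule ℝ (Module.Dual ℝ J)} (hP : ∀ v ∈ V, v ∘ₗ P ∈ V) (t : ℝ) {v : Module.Dual ℝ J}
    (hv : v ∈ V) : v ∘ₗ interpolate P t ∈ V := by
  rw [comp_interpolate]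
  exact add_mem (hP v hv) (V.smul_mem t (sub_mem hv (hP v hv)))

/-- The change of variables by the interpolations at all times. -/
def interpolatePullback (P₀ : J₀ →ₗ[ℝ] J₀) (P₁ : J₁ →ₗ[ℝ] J₁) :
    Superfunction J₀ J₁ →ₐ[ℝ] Superfunction (ℝ × J₀) J₁ :=
  pullback (fun z : ℝ × J₀ => interpolate P₀ z.1 z.2) (fun z : ℝ × J₀ => interpolate P₁ z.1)

/-- The interpolation is affine in time: a variable pulls back to `v ∘ P` plus time times `v - v ∘
P`. No inverse power of time arises, so smoothness persists at time zero. -/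
theorem comp_interpolate_mem_cylinder (hP : ∀ v ∈ V₀, v ∘ₗ P₀ ∈ V₀) {G : J₀ → ℝ}
    (hG : G ∈ cylinder (V₀ : Set (Module.Dual ℝ J₀))) :
    G ∘ (fun z : ℝ × J₀ => interpolate P₀ z.1 z.2) ∈ cylinder (timeVars V₀) := by
  obtain ⟨m, g, t, hg, ht, rfl⟩ := hG
  refine comp_mem_cylinder hg (H := fun k (z : ℝ × J₀) => t k (interpolate P₀ z.1 z.2)) fun k => ?_
  have e : (fun z : ℝ × J₀ => t k (interpolate P₀ z.1 z.2)) =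
      (((t k ∘ₗ P₀) ∘ₗ LinearMap.snd ℝ ℝ J₀ : _ →ₗ[ℝ] ℝ) : ℝ × J₀ → ℝ) +
        (LinearMap.fst ℝ ℝ J₀ : ℝ × J₀ → ℝ) *
          (((t k - t k ∘ₗ P₀) ∘ₗ LinearMap.snd ℝ ℝ J₀ : _ →ₗ[ℝ] ℝ) : ℝ × J₀ → ℝ) :=
    funext fun z => LinearMap.congr_fun (comp_interpolate P₀ z.1 (t k)) z.2
  rw [e]
  exact add_mem (S := Subalgebra ℝ (ℝ × J₀ → ℝ)) (s := cylinderAlgebra (timeVars V₀))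
    (coe_mem_cylinder (comp_snd_mem_timeVars (hP _ (ht k))))
    (mul_mem (S := Subalgebra ℝ (ℝ × J₀ → ℝ)) (s := cylinderAlgebra (timeVars V₀))
      (coe_mem_cylinder fst_mem_timeVars)
      (coe_mem_cylinder (comp_snd_mem_timeVars (sub_mem (ht k) (hP _ (ht k))))))

theorem interpolatePullback_oddFn (v : Module.Dual ℝ J₁) :
    interpolatePullback P₀ P₁ (oddFn J₀ v) =
      pureFn (fun _ => 1) (ExteriorAlgebra.ι ℝ (v ∘ₗ P₁)) +
        pureFn (LinearMap.fst ℝ ℝ J₀) (ExteriorAlgebra.ι ℝ (v - v ∘ₗ P₁)) := by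
  rw [interpolatePullback, pullback_oddFn]
  funext z
  rw [comp_interpolate, map_add, map_smul, Pi.add_apply, pureFn, one_smul]
  rfl

theorem interpolatePullback_mem (hP₀ : ∀ v ∈ V₀, v ∘ₗ P₀ ∈ V₀) (hP₁ : ∀ v ∈ V₁, v ∘ₗ P₁ ∈ V₁)
    {f : Superfunction J₀ J₁} (hf : f ∈ fnAlgebra (V₀ : Set _) (V₁ : Set _)) :
    interpolatePullback P₀ P₁ f ∈ fnAlgebra (timeVars V₀) (V₁ : Set _) := by
  have h₁ : ∀ v ∈ V₁, interpolatePullback P₀ P₁ (oddFn J₀ v) ∈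
      fnAlgebra (timeVars V₀) (V₁ : Set (Module.Dual ℝ J₁)) := by
    intro v hv
    rw [interpolatePullback_oddFn v]
    refine add_mem (pureFn_mem (const_mem_cylinder (timeVars V₀) 1)
      (Submonoid.subset_closure (Set.mem_image_of_mem _ (hP₁ v hv)))) (pureFn_mem ?_
      (Submonoid.subset_closure (Set.mem_image_of_mem _ (sub_mem hv (hP₁ v hv)))))
    exact coe_mem_cylinder (S := timeVars V₀) (v := LinearMap.fst ℝ ℝ J₀) fst_mem_timeVars
  have h₀ : ∀ G ∈ cylinder (V₀ : Set (Module.Dual ℝ J₀)), interpolatePullback P₀ P₁ (scalFn J₁ G) ∈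
      fnAlgebra (timeVars V₀) (V₁ : Set (Module.Dual ℝ J₁)) := by
    intro G hG
    rw [interpolatePullback, pullback_scalFn]
    exact scalFn_mem (comp_interpolate_mem_cylinder hP₀ hG)
  have h := fnAlgebra_le_of (B := (fnAlgebra (timeVars V₀) (V₁ : Set (Module.Dual ℝ J₁))).comap
    (interpolatePullback P₀ P₁)) (fun G hG => (Subalgebra.mem_comap _ _ _).2 (h₀ G hG))
    (fun v hv => (Subalgebra.mem_comap _ _ _).2 (h₁ v hv))
  exact (Subalgebra.mem_comap _ _ _).1 (h hf)

namespace IsContraction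

/-- The homotopy formula, at each time. -/
theorem exists_timeDerivative (h : IsContraction V₀ H₀ V₁ H₁ δ₁ ρ₁ δ₀ ρ₀ P₀ P₁)
    (hD : IsInducedDerivation (V₀ : Set _) id (fun _ => LinearMap.id) δ₁ δ₀ D) :
    ∃ B : Superfunction J₀ J₁ →ₗ[ℝ] Superfunction (ℝ × J₀) J₁,
      (∀ f ∈ fnAlgebra (V₀ : Set _) (V₁ : Set _), B f ∈ fnAlgebra (timeVars V₀) (V₁ : Set _)) ∧
      ∀ f ∈ fnAlgebra (V₀ : Set _) (V₁ : Set _), ∀ t φ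
        (l : Module.Dual ℝ (ExteriorAlgebra ℝ (Module.Dual ℝ J₁))),
        HasDerivAt (fun s : ℝ => l (interpolatePullback P₀ P₁ f (s, φ)))
          (l ((D (timeSlice t (B f)) + timeSlice t (B (D f))) φ)) t := by
  have hP₀ : ∀ v ∈ V₀, v ∘ₗ P₀ ∈ V₀ := fun v hv => h.le₀ (h.P₀_mem v hv)
  have hP₁ : ∀ v ∈ V₁, v ∘ₗ P₁ ∈ V₁ := fun v hv => h.le₁ (h.P₁_mem v hv)
  let T := interpolatePullback P₀ P₁
  -- `B` is the derivation along the interpolation induced by the homotopy; its values are functions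
  -- of time.
  obtain ⟨B, hB⟩ := exists_isInducedDerivation (V₀ : Set (Module.Dual ℝ J₀))
    (fun z : ℝ × J₀ => interpolate P₀ z.1 z.2) (fun z => interpolate P₁ z.1) ρ₁
    (fun z => ρ₀ z.2)
  have hTmem : ∀ f ∈ fnAlgebra (V₀ : Set _) (V₁ : Set _), T f ∈ fnAlgebra (timeVars V₀) (V₁ : Set _) :=
    fun f hf => interpolatePullback_mem hP₀ hP₁ hf
  have hBmem : ∀ f ∈ fnAlgebra (V₀ : Set _) (V₁ : Set _),
      B f ∈ fnAlgebra (timeVars V₀) (V₁ : Set _) := fun f hf =>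
    hB.apply_mem (S₁ := (V₁ : Set (Module.Dual ℝ J₁))) hTmem
      (fun G hG => comp_interpolate_mem_cylinder hP₀ hG) h.ρ₁_mem
      (fun v hv => coe_mem_cylinder (S := timeVars V₀)
        (v := (v ∘ₗ ρ₀) ∘ₗ LinearMap.snd ℝ ℝ J₀) (comp_snd_mem_timeVars (h.ρ₀_mem v hv))) hf
  have hDmem : ∀ f ∈ fnAlgebra (V₀ : Set _) (V₁ : Set _), D f ∈ fnAlgebra (V₀ : Set _) (V₁ : Set _) :=
    fun f hf => hD.apply_mem_id h.δ₁_mem h.δ₀_mem hf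
  refine ⟨B, hBmem, fun f hf t φ l => ?_⟩
  choose E hE1 hE2 hE3 using fun z : ℝ × J₀ =>
    exists_dirDeriv (timeVars V₀) (V₁ : Set (Module.Dual ℝ J₁)) z (1, 0)
  let Et : Superfunction J₀ J₁ →ₗ[ℝ] Superfunction J₀ J₁ :=
    LinearMap.pi fun φ => E (t, φ) ∘ₗ T.toLinearMap
  let Bt : Superfunction J₀ J₁ →ₗ[ℝ] Superfunction J₀ J₁ := timeSlice t ∘ₗ B
  let Tt : Superfunction J₀ J₁ →ₐ[ℝ] Superfunction J₀ J₁ :=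
    pullback (interpolate P₀ t) (fun _ => interpolate P₁ t)
  have hTt : ∀ f ∈ fnAlgebra (V₀ : Set _) (V₁ : Set _), Tt f ∈ fnAlgebra (V₀ : Set _) (V₁ : Set _) :=
    fun f hf => timeSlice_mem t (hTmem f hf)
  have hBt : ∀ f ∈ fnAlgebra (V₀ : Set _) (V₁ : Set _), Bt f ∈ fnAlgebra (V₀ : Set _) (V₁ : Set _) :=
    fun f hf => timeSlice_mem t (hBmem f hf)
  have hBleib : ∀ f ∈ fnAlgebra (V₀ : Set _) (V₁ : Set _), ∀ f' ∈ fnAlgebra (V₀ : Set _) (V₁ : Set _),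
      Bt (f * f') = Bt f * Tt f' + Tt (parityMap J₀ J₁ f) * Bt f' := fun f hf f' hf' =>
    funext fun φ => congrFun (hB.leibniz hf hf') (t, φ)
  have hBodd : ∀ f ∈ fnAlgebra (V₀ : Set _) (V₁ : Set _),
      Bt (parityMap J₀ J₁ f) = - parityMap J₀ J₁ (Bt f) := fun f hf =>
    funext fun φ => congrFun (hB.odd hf) (t, φ)
  -- At a fixed time the substitution commutes with `D`, because the projections compose to zero
  -- with `δ` on either side.
  have hcomm : ∀ f ∈ fnAlgebra (V₀ : Set _) (V₁ : Set _), D (Tt f) = Tt (D f) := fun f hf =>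
    hD.pullback_comm (fun v hv => comp_interpolate_mem hP₀ t hv)
      (fun v hv => comp_interpolate_mem hP₁ t hv)
      (by simp only [interpolate, LinearMap.add_comp, LinearMap.smul_comp, LinearMap.sub_comp,
            h.P₀_comp, LinearMap.comp_add, LinearMap.comp_smul, LinearMap.comp_sub, h.comp_P₁,
            LinearMap.id_comp, LinearMap.comp_id])
      (by simp only [interpolate, LinearMap.add_comp, LinearMap.smul_comp, LinearMap.sub_comp,
            h.P₁_comp, LinearMap.comp_add, LinearMap.comp_smul, LinearMap.comp_sub, h.comp_P₀,
            LinearMap.id_comp, LinearMap.comp_id]) hf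
  -- The time derivative and the anticommutator of `D` with `Bt` are both even derivations along
  -- `Tt`; in the anticommutator the signs of the two odd maps cancel. On the variables their
  -- equality is the homotopy identity.
  have key : Et f - (D (Bt f) + Bt (D f)) = 0 := by
    refine twistedDerivation_eq_zero (D := Et - (D ∘ₗ Bt + Bt ∘ₗ D)) (χ := Tt) (ψ := Tt)
      (interpolate P₀ t) (fun G hG => pullback_scalFn _ _ _) (map_one _) (fun f hf f' hf' => ?_)
      (fun v hv => ?_) (fun v hv => ?_) hf
    · have e1 : Et (f * f') = Et f * Tt f' + Tt f * Et f' := funext fun φ => by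
        have := hE2 (t, φ) (T f) (hTmem f hf) (T f') (hTmem f' hf')
        rw [← map_mul] at this
        exact this
      simp only [LinearMap.sub_apply, LinearMap.add_apply, LinearMap.comp_apply]
      have hπ := parityMap_mem hf
      rw [e1, hBleib f hf f' hf', hD.leibniz_id hf hf', map_add, map_add,
        hD.leibniz_id (hBt f hf) (hTt f' hf'), hD.leibniz_id (hTt _ hπ) (hBt f' hf'),
        hBleib _ (hDmem f hf) f' hf', hBleib _ hπ _ (hDmem f' hf'), hcomm f' hf', hcomm _ hπ,
        hD.odd hf, hBodd f hf, parityMap_parityMap]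
      have e2 : parityMap J₀ J₁ (Tt (parityMap J₀ J₁ f)) = Tt f := by
        rw [parityMap_pullback, parityMap_parityMap]
      rw [e2, map_neg]
      noncomm_ring
    · simp only [LinearMap.sub_apply, LinearMap.add_apply, LinearMap.comp_apply]
      have e1 : Et (scalFn J₁ v) = scalFn J₁ (v - v ∘ₗ P₀) := funext fun φ => by
        change E (t, φ) (interpolatePullback P₀ P₁ (scalFn J₁ v)) = _
        rw [interpolatePullback, pullback_scalFn, scalFn_eq_pureFn,
          hE1 _ _ (comp_interpolate_mem_cylinder hP₀ (coe_mem_cylinder hv))]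
        have e : v ∘ (fun z : ℝ × J₀ => interpolate P₀ z.1 z.2) =
            (((v ∘ₗ P₀) ∘ₗ LinearMap.snd ℝ ℝ J₀ : _ →ₗ[ℝ] ℝ) : ℝ × J₀ → ℝ) +
            (LinearMap.fst ℝ ℝ J₀ : ℝ × J₀ → ℝ) *
              (((v - v ∘ₗ P₀) ∘ₗ LinearMap.snd ℝ ℝ J₀ : _ →ₗ[ℝ] ℝ) : ℝ × J₀ → ℝ) :=
          funext fun z => LinearMap.congr_fun (comp_interpolate P₀ z.1 v) z.2
        rw [e, ((hasGrad_coe _ _).add ((hasGrad_coe _ _).mul (hasGrad_coe _ _))).grad_eq]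
        simp [scalFn, Algebra.algebraMap_eq_smul_one]
      have e2 : Bt (scalFn J₁ v) = oddFn J₀ (v ∘ₗ ρ₁) :=
        funext fun φ => congrFun (hB.apply_coe hv) (t, φ)
      have e3 : Bt (oddFn J₀ (v ∘ₗ δ₁)) = scalFn J₁ fun φ => v (δ₁ (ρ₀ φ)) :=
        funext fun φ => congrFun (hB.apply_oddFn _) (t, φ)
      rw [e1, e2, hD.apply_oddFn, hD.apply_coe hv, e3, sub_eq_zero]
      funext φ
      have h1 := LinearMap.congr_fun h.homotopy₀ φ
      simp only [LinearMap.add_apply, LinearMap.comp_apply, LinearMap.sub_apply,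
        LinearMap.id_apply] at h1
      simp only [scalFn, Pi.add_apply, LinearMap.comp_apply, LinearMap.sub_apply]
      rw [← map_add, ← map_add, add_comm, h1, map_sub v, map_sub]
    · simp only [LinearMap.sub_apply, LinearMap.add_apply, LinearMap.comp_apply]
      have e1 : Et (oddFn J₀ v) = oddFn J₀ (v - v ∘ₗ P₁) := funext fun φ => by
        change E (t, φ) (interpolatePullback P₀ P₁ (oddFn J₀ v)) = _
        rw [interpolatePullback_oddFn, map_add, hE1 _ _ (const_mem_cylinder _ 1),
          hE1 _ _ (coe_mem_cylinder fst_mem_timeVars), (hasGrad_const _ _).grad_eq,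
          (hasGrad_coe _ _).grad_eq]
        simp [oddFn]
      have e2 : Bt (oddFn J₀ v) = scalFn J₁ fun φ => v (ρ₀ φ) :=
        funext fun φ => congrFun (hB.apply_oddFn _) (t, φ)
      have e3 : Bt (scalFn J₁ fun φ => v (δ₀ φ)) = oddFn J₀ ((v ∘ₗ δ₀) ∘ₗ ρ₁) :=
        funext fun φ => congrFun (hB.apply_coe (h.δ₀_mem v hv)) (t, φ)
      have e4 : D (scalFn J₁ fun φ => v (ρ₀ φ)) = oddFn J₀ ((v ∘ₗ ρ₀) ∘ₗ δ₁) :=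
        hD.apply_coe (h.ρ₀_mem v hv)
      rw [e1, e2, hD.apply_oddFn, e3, e4, sub_eq_zero]
      funext φ
      simp only [oddFn, Pi.add_apply]
      rw [← map_add, LinearMap.comp_assoc, LinearMap.comp_assoc, ← LinearMap.comp_add, add_comm,
        h.homotopy₁, LinearMap.comp_sub, LinearMap.comp_id]
  have h3 := hE3 (t, φ) (T f) (hTmem f hf) l
  have h4 : Et f φ = (D (Bt f) + Bt (D f)) φ := congrFun (sub_eq_zero.1 key) φ
  -- `E` differentiates at increment zero; a shift of the parameter by `t` gives the derivative at
  -- time `t`.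
  have h5 : HasDerivAt (fun s : ℝ => l (T f ((t, φ) + s • (1, 0)))) (l (Et f φ)) (t - t) := by
    rw [sub_self]; exact h3
  rw [h4] at h5
  have h6 := h5.comp_sub_const t t
  refine h6.congr_of_eventuallyEq (Filter.Eventually.of_forall fun s => ?_)
  simp [T]

/-- Functions of the variables in `H` are closed. -/
theorem apply_eq_zero (h : IsContraction V₀ H₀ V₁ H₁ δ₁ ρ₁ δ₀ ρ₀ P₀ P₁)
    (hD : IsInducedDerivation (V₀ : Set _) id (fun _ => LinearMap.id) δ₁ δ₀ D)
    {f : Superfunction J₀ J₁} (hf : f ∈ fnAlgebra (H₀ : Set _) (H₁ : Set _)) :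
    pullback P₀ (fun _ => P₁) f = f ∧ D f = 0 := by
  have h1 : pullback P₀ (fun _ => P₁) f = f := by
    refine fnAlgebra_prod_induction (p := fun f => pullback P₀ (fun _ => P₁) f = f)
      (fun G hG => ?_) (fun v hv => ?_) (fun f _ f' _ h h' => ?_) (fun f _ f' _ h h' => ?_) hf
    · obtain ⟨m, g, t, -, ht, rfl⟩ := hG
      rw [pullback_scalFn]
      refine congrArg (scalFn J₁) (funext fun φ => congrArg g (funext fun k => ?_))
      exact LinearMap.congr_fun (h.P₀_id _ (ht k)) φ
    · rw [pullback_oddFn, h.P₁_id v hv]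
      rfl
    · rw [map_add, h, h']
    · rw [map_mul, h, h']
  have hf' : f ∈ fnAlgebra (V₀ : Set (Module.Dual ℝ J₀)) (V₁ : Set (Module.Dual ℝ J₁)) :=
    fnAlgebra_le_of (fun G hG => scalFn_mem (by
      obtain ⟨m, g, t, hg, ht, rfl⟩ := hG
      exact ⟨m, g, t, hg, fun k => h.le₀ (ht k), rfl⟩)) (fun v hv => oddFn_mem (h.le₁ hv)) hf
  refine ⟨h1, ?_⟩
  -- `f` equals its own projection, and commuting `D` past the projection leaves the projection of a
  -- coboundary, which is zero.
  rw [← h1, hD.pullback_comm (fun v hv => h.le₀ (h.P₀_mem v hv))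
    (fun v hv => h.le₁ (h.P₁_mem v hv)) (by rw [h.P₀_comp, h.comp_P₁])
    (by rw [h.P₁_comp, h.comp_P₀]) hf', hD.pullback_apply_eq_zero h.comp_P₁ h.comp_P₀ hf']

/-- Coboundaries that depend only on the variables in `H` vanish. -/
theorem eq_zero_of_apply_mem (h : IsContraction V₀ H₀ V₁ H₁ δ₁ ρ₁ δ₀ ρ₀ P₀ P₁)
    (hD : IsInducedDerivation (V₀ : Set _) id (fun _ => LinearMap.id) δ₁ δ₀ D)
    {f : Superfunction J₀ J₁} (hf : f ∈ fnAlgebra (V₀ : Set _) (V₁ : Set _))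
    (hDf : D f ∈ fnAlgebra (H₀ : Set _) (H₁ : Set _)) : D f = 0 := by
  rw [← (h.apply_eq_zero hD hDf).1, hD.pullback_apply_eq_zero h.comp_P₁ h.comp_P₀ hf]

/-- Every closed function is cohomologous to a function of the variables in `H`. -/
theorem exists_of_apply_eq_zero (h : IsContraction V₀ H₀ V₁ H₁ δ₁ ρ₁ δ₀ ρ₀ P₀ P₁)
    (hD : IsInducedDerivation (V₀ : Set _) id (fun _ => LinearMap.id) δ₁ δ₀ D)
    {f : Superfunction J₀ J₁} (hf : f ∈ fnAlgebra (V₀ : Set _) (V₁ : Set _)) (hDf : D f = 0) :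
    ∃ f₀ ∈ fnAlgebra (H₀ : Set _) (H₁ : Set _),
      ∃ b ∈ fnAlgebra (V₀ : Set _) (V₁ : Set _), D b = f - f₀ := by
  obtain ⟨B, hBmem, hB⟩ := h.exists_timeDerivative hD
  obtain ⟨b, hb, hb'⟩ := exists_timeIntegral hD (hBmem f hf)
  refine ⟨pullback P₀ (fun _ => P₁) f,
    IsInducedDerivation.pullback_linear_mem h.P₀_mem h.P₁_mem hf, b, hb, funext fun φ => ?_⟩
  rw [← sub_eq_zero, ← Module.forall_dual_apply_eq_zero_iff ℝ]
  intro l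
  obtain ⟨hc, hi⟩ := hb' φ l
  -- For a cocycle the term `B (D f)` drops out, so the time derivative is a coboundary; its
  -- integral is the difference between the identity at time 1 and the projection at time 0.
  have hd : ∀ t, HasDerivAt (fun s : ℝ => l (interpolatePullback P₀ P₁ f (s, φ)))
      (l (D (timeSlice t (B f)) φ)) t := fun t => by
    have := hB f hf t φ l
    rwa [hDf, map_zero, map_zero, add_zero] at this
  have hftc := intervalIntegral.integral_eq_sub_of_hasDerivAt (a := 0) (b := 1)
    (fun t _ => hd t) (hc.intervalIntegrable _ _)
  have e1 : interpolatePullback P₀ P₁ f (1, φ) = f φ := by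
    change pullback (interpolate P₀ 1) (fun _ => interpolate P₁ 1) f φ = _
    rw [interpolate_one, interpolate_one]
    exact congrFun (pullback_id_apply f) φ
  have e0 : interpolatePullback P₀ P₁ f (0, φ) = pullback P₀ (fun _ => P₁) f φ := by
    change pullback (interpolate P₀ 0) (fun _ => interpolate P₁ 0) f φ = _
    rw [interpolate_zero, interpolate_zero]
  rw [map_sub, hi, hftc, e1, e0, Pi.sub_apply, map_sub, sub_self]

end IsContraction

end Contraction

/-! ### Splitting a linear complex of period two, and transposition to the jets -/

section LinearContraction

variable {W₀ W₁ : Type*} [AddCommGroup W₀] [Module ℝ W₀] [AddCommGroup W₁] [Module ℝ W₁]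

/-- Over a field a right inverse exists on the range and extends from there to `W₁`, in infinite
dimension too. -/
theorem exists_generalizedInverse (g : W₀ →ₗ[ℝ] W₁) : ∃ s : W₁ →ₗ[ℝ] W₀, ∀ w, g (s (g w)) = g w := by
  obtain ⟨t, ht⟩ := g.rangeRestrict.exists_rightInverse_of_surjective g.range_rangeRestrict
  obtain ⟨s, hs⟩ := t.exists_extend
  refine ⟨s, fun w => ?_⟩
  have h1 : s (g w) = t (g.rangeRestrict w) := LinearMap.congr_fun hs (g.rangeRestrict w)
  rw [h1]
  exact congrArg Subtype.val (LinearMap.congr_fun ht (g.rangeRestrict w))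

theorem exists_projection {K C : Submodule ℝ W₀} (h : Disjoint K C) :
    ∃ P : W₀ →ₗ[ℝ] W₀, (∀ w, P w ∈ K) ∧ (∀ w ∈ K, P w = w) ∧ ∀ w ∈ C, P w = 0 := by
  obtain ⟨C', hC, hK'⟩ := h.symm.exists_isCompl
  have hK := hK'.symm
  refine ⟨K.subtype ∘ₗ K.projectionOnto C' hK, fun w => Subtype.mem _, fun w hw => ?_, fun w hw => ?_⟩
  · exact congrArg Subtype.val (Submodule.projectionOnto_apply_left hK ⟨w, hw⟩)
  · simpa using hC hw

/-- A complement of the coboundaries in the cocycles determines a special contraction. -/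
theorem exists_homotopies {g₀ : W₀ →ₗ[ℝ] W₁} {g₁ : W₁ →ₗ[ℝ] W₀} (h₀₁ : ∀ w, g₁ (g₀ w) = 0)
    (h₁₀ : ∀ w, g₀ (g₁ w) = 0) {K₀ : Submodule ℝ W₀} {K₁ : Submodule ℝ W₁}
    (hK₀ : ∀ w ∈ K₀, g₀ w = 0) (hK₁ : ∀ w ∈ K₁, g₁ w = 0)
    (hd₀ : ∀ w, g₁ w ∈ K₀ → g₁ w = 0) (hd₁ : ∀ w, g₀ w ∈ K₁ → g₀ w = 0)
    (he₀ : ∀ w, g₀ w = 0 → ∃ k ∈ K₀, ∃ y, w = k + g₁ y)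
    (he₁ : ∀ w, g₁ w = 0 → ∃ k ∈ K₁, ∃ y, w = k + g₀ y) :
    ∃ (P₀ : W₀ →ₗ[ℝ] W₀) (P₁ : W₁ →ₗ[ℝ] W₁) (r₀ : W₀ →ₗ[ℝ] W₁) (r₁ : W₁ →ₗ[ℝ] W₀),
      ((∀ w, P₀ w ∈ K₀) ∧ (∀ w ∈ K₀, P₀ w = w) ∧ ∀ w, P₀ (g₁ w) = 0) ∧
      ((∀ w, P₁ w ∈ K₁) ∧ (∀ w ∈ K₁, P₁ w = w) ∧ ∀ w, P₁ (g₀ w) = 0) ∧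
      (∀ w, r₁ (g₀ w) + g₁ (r₀ w) = w - P₀ w) ∧ ∀ w, r₀ (g₁ w) + g₀ (r₁ w) = w - P₁ w := by
  obtain ⟨P₀, a₀, b₀, c₀⟩ := exists_projection (K := K₀) (C := LinearMap.range g₁) (by
    rw [Submodule.disjoint_def]; rintro _ h ⟨y, rfl⟩; exact hd₀ y h)
  obtain ⟨P₁, a₁, b₁, c₁⟩ := exists_projection (K := K₁) (C := LinearMap.range g₀) (by
    rw [Submodule.disjoint_def]; rintro _ h ⟨y, rfl⟩; exact hd₁ y h)
  obtain ⟨s₀, hs₀⟩ := exists_generalizedInverse g₀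
  obtain ⟨s₁, hs₁⟩ := exists_generalizedInverse g₁
  have c₀' : ∀ y, P₀ (g₁ y) = 0 := fun y => c₀ _ ⟨y, rfl⟩
  have c₁' : ∀ y, P₁ (g₀ y) = 0 := fun y => c₁ _ ⟨y, rfl⟩
  -- Removing the component in `K₀` keeps the inverse property, as `g₀` vanishes on `K₀`, and makes
  -- `P₀` annihilate the values of `t₀`.
  let t₀ := s₀ - P₀ ∘ₗ s₀
  let t₁ := s₁ - P₁ ∘ₗ s₁
  have ht₀ : ∀ w, t₀ w = s₀ w - P₀ (s₀ w) := fun _ => rfl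
  have ht₁ : ∀ w, t₁ w = s₁ w - P₁ (s₁ w) := fun _ => rfl
  refine ⟨P₀, P₁, t₁ ∘ₗ (LinearMap.id - t₀ ∘ₗ g₀ - P₀), t₀ ∘ₗ (LinearMap.id - t₁ ∘ₗ g₁ - P₁),
    ⟨a₀, b₀, c₀'⟩, ⟨a₁, b₁, c₁'⟩, fun w => ?_, fun w => ?_⟩
  -- `w - t₀ (g₀ w) - P₀ w` is a cocycle without component in `K₀`, hence a coboundary `g₁ y`, and
  -- `g₁ ∘ t₁` fixes coboundaries.
  · obtain ⟨k, hk, y, hy⟩ := he₀ (w - t₀ (g₀ w) - P₀ w) (by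
      rw [map_sub, map_sub, ht₀, map_sub, hs₀, hK₀ _ (a₀ _), hK₀ _ (a₀ _)]; simp)
    have hk0 : k = 0 := by
      have := congrArg P₀ hy
      rw [map_add, b₀ k hk, c₀', map_sub, map_sub, ht₀, map_sub, b₀ _ (a₀ _), b₀ _ (a₀ _)] at this
      simpa using this.symm
    rw [hk0, zero_add] at hy
    simp only [LinearMap.comp_apply, LinearMap.sub_apply, LinearMap.id_apply]
    rw [h₀₁, map_zero, c₁', sub_zero, sub_zero, hy, ht₁, map_sub, hs₁, hK₁ _ (a₁ _), sub_zero, ← hy]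
    abel
  · obtain ⟨k, hk, y, hy⟩ := he₁ (w - t₁ (g₁ w) - P₁ w) (by
      rw [map_sub, map_sub, ht₁, map_sub, hs₁, hK₁ _ (a₁ _), hK₁ _ (a₁ _)]; simp)
    have hk0 : k = 0 := by
      have := congrArg P₁ hy
      rw [map_add, b₁ k hk, c₁', map_sub, map_sub, ht₁, map_sub, b₁ _ (a₁ _), b₁ _ (a₁ _)] at this
      simpa using this.symm
    rw [hk0, zero_add] at hy
    simp only [LinearMap.comp_apply, LinearMap.sub_apply, LinearMap.id_apply]
    rw [h₁₀, map_zero, c₀', sub_zero, sub_zero, hy, ht₀, map_sub, hs₀, hK₀ _ (a₀ _), sub_zero, ← hy]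
    abel

variable {J₀ J₁ : Type*} [AddCommGroup J₀] [Module ℝ J₀] [AddCommGroup J₁] [Module ℝ J₁]

/-- The space `V` of linear functions on `J` is in perfect duality with `J = V*`. -/
structure IsPredual {J : Type*} [AddCommGroup J] [Module ℝ J] (V : Submodule ℝ (Module.Dual ℝ J)) :
    Prop where
  ext : ∀ φ : J, (∀ v ∈ V, v φ = 0) → φ = 0
  exists_eval : ∀ ψ : Module.Dual ℝ V, ∃ φ : J, ∀ v : V, v.1 φ = ψ v

/-- Perfect duality identifies `J₀` with the full dual of `V₀`, so every linear map of function
spaces is the transpose of a map of jets. In this way homotopies found on functions act on the jets.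
-/
theorem IsPredual.exists_transpose {V₀ : Submodule ℝ (Module.Dual ℝ J₀)}
    {V₁ : Submodule ℝ (Module.Dual ℝ J₁)} (h : IsPredual V₀) (g : V₀ →ₗ[ℝ] V₁) :
    ∃ T : J₁ →ₗ[ℝ] J₀, ∀ v : V₀, v.1 ∘ₗ T = (g v).1 := by
  let e := LinearEquiv.ofBijective (V₀.subtype.flip) ⟨by
    rw [injective_iff_map_eq_zero]
    exact fun φ hφ => h.ext φ fun v hv => LinearMap.congr_fun hφ ⟨v, hv⟩, fun ψ => by
    obtain ⟨φ, hφ⟩ := h.exists_eval ψ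
    exact ⟨φ, LinearMap.ext hφ⟩⟩
  refine ⟨e.symm.toLinearMap ∘ₗ (V₁.subtype ∘ₗ g).flip, fun v => LinearMap.ext fun φ => ?_⟩
  exact LinearMap.congr_fun (e.apply_symm_apply ((V₁.subtype ∘ₗ g).flip φ)) v

theorem IsPredual.linearMap_ext {V : Submodule ℝ (Module.Dual ℝ J₀)} (h : IsPredual V)
    {A B : J₁ →ₗ[ℝ] J₀} (hAB : ∀ v ∈ V, v ∘ₗ A = v ∘ₗ B) : A = B :=
  LinearMap.ext fun φ => sub_eq_zero.1 <| h.ext _ fun v hv => by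
    rw [map_sub, sub_eq_zero]; exact LinearMap.congr_fun (hAB v hv) φ

/-- The splitting is done on spaces of linear functions, and the projections and homotopies are then
transposed. Arrows reverse: the homotopy from `V₀` to `V₁` becomes `ρ₁ : J₁ → J₀`. -/
theorem exists_isContraction {V₀ H₀ : Submodule ℝ (Module.Dual ℝ J₀)}
    {V₁ H₁ : Submodule ℝ (Module.Dual ℝ J₁)} (hV₀ : IsPredual V₀) (hV₁ : IsPredual V₁)
    (hH₀ : H₀ ≤ V₀) (hH₁ : H₁ ≤ V₁) {δ₁ : J₁ →ₗ[ℝ] J₀} {δ₀ : J₀ →ₗ[ℝ] J₁}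
    (hδ₁ : ∀ v ∈ V₀, v ∘ₗ δ₁ ∈ V₁) (hδ₀ : ∀ v ∈ V₁, v ∘ₗ δ₀ ∈ V₀)
    (h₀₁ : ∀ v ∈ V₀, (v ∘ₗ δ₁) ∘ₗ δ₀ = 0) (h₁₀ : ∀ v ∈ V₁, (v ∘ₗ δ₀) ∘ₗ δ₁ = 0)
    (hc₀ : ∀ v ∈ H₀, v ∘ₗ δ₁ = 0) (hc₁ : ∀ v ∈ H₁, v ∘ₗ δ₀ = 0)
    (hd₀ : ∀ v ∈ V₁, v ∘ₗ δ₀ ∈ H₀ → v ∘ₗ δ₀ = 0) (hd₁ : ∀ v ∈ V₀, v ∘ₗ δ₁ ∈ H₁ → v ∘ₗ δ₁ = 0)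
    (he₀ : ∀ v ∈ V₀, v ∘ₗ δ₁ = 0 → ∃ k ∈ H₀, ∃ y ∈ V₁, v = k + y ∘ₗ δ₀)
    (he₁ : ∀ v ∈ V₁, v ∘ₗ δ₀ = 0 → ∃ k ∈ H₁, ∃ y ∈ V₀, v = k + y ∘ₗ δ₁) :
    ∃ (ρ₁ : J₁ →ₗ[ℝ] J₀) (ρ₀ : J₀ →ₗ[ℝ] J₁) (P₀ : J₀ →ₗ[ℝ] J₀) (P₁ : J₁ →ₗ[ℝ] J₁),
      IsContraction V₀ H₀ V₁ H₁ δ₁ ρ₁ δ₀ ρ₀ P₀ P₁ := by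
  let g₀ : V₀ →ₗ[ℝ] V₁ := LinearMap.restrict (LinearMap.lcomp ℝ ℝ δ₁) hδ₁
  let g₁ : V₁ →ₗ[ℝ] V₀ := LinearMap.restrict (LinearMap.lcomp ℝ ℝ δ₀) hδ₀
  obtain ⟨P₀, P₁, r₀, r₁, ⟨a₀, b₀, c₀⟩, ⟨a₁, b₁, c₁⟩, k₀, k₁⟩ := exists_homotopies (g₀ := g₀) (g₁ := g₁)
    (K₀ := H₀.comap V₀.subtype) (K₁ := H₁.comap V₁.subtype)
    (fun w => Subtype.ext (h₀₁ w.1 w.2)) (fun w => Subtype.ext (h₁₀ w.1 w.2))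
    (fun w hw => Subtype.ext (hc₀ w.1 (Submodule.mem_comap.1 hw))) (fun w hw => Subtype.ext (hc₁ w.1 (Submodule.mem_comap.1 hw)))
    (fun w hw => Subtype.ext (hd₀ w.1 w.2 hw)) (fun w hw => Subtype.ext (hd₁ w.1 w.2 hw))
    (fun w hw => by
      obtain ⟨k, hk, y, hy, e⟩ := he₀ w.1 w.2 (congrArg Subtype.val hw)
      exact ⟨⟨k, hH₀ hk⟩, hk, ⟨y, hy⟩, Subtype.ext e⟩)
    (fun w hw => by
      obtain ⟨k, hk, y, hy, e⟩ := he₁ w.1 w.2 (congrArg Subtype.val hw)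
      exact ⟨⟨k, hH₁ hk⟩, hk, ⟨y, hy⟩, Subtype.ext e⟩)
  obtain ⟨Q₀, hQ₀⟩ := hV₀.exists_transpose P₀
  obtain ⟨Q₁, hQ₁⟩ := hV₁.exists_transpose P₁
  obtain ⟨ρ₁, hρ₁⟩ := hV₀.exists_transpose r₀
  obtain ⟨ρ₀, hρ₀⟩ := hV₁.exists_transpose r₁
  have q₀ : ∀ v (hv : v ∈ V₀), v ∘ₗ Q₀ = (P₀ ⟨v, hv⟩).1 := fun v hv => hQ₀ ⟨v, hv⟩
  have q₁ : ∀ v (hv : v ∈ V₁), v ∘ₗ Q₁ = (P₁ ⟨v, hv⟩).1 := fun v hv => hQ₁ ⟨v, hv⟩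
  have s₁ : ∀ v (hv : v ∈ V₀), v ∘ₗ ρ₁ = (r₀ ⟨v, hv⟩).1 := fun v hv => hρ₁ ⟨v, hv⟩
  have s₀ : ∀ v (hv : v ∈ V₁), v ∘ₗ ρ₀ = (r₁ ⟨v, hv⟩).1 := fun v hv => hρ₀ ⟨v, hv⟩
  refine ⟨ρ₁, ρ₀, Q₀, Q₁, hH₀, hH₁, hδ₁, hδ₀, fun v hv => s₁ v hv ▸ (r₀ _).2,
    fun v hv => s₀ v hv ▸ (r₁ _).2, fun v hv => q₀ v hv ▸ a₀ _, fun v hv => q₁ v hv ▸ a₁ _,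
    fun v hv => ?_, fun v hv => ?_, ?_, ?_, ?_, ?_, ?_, ?_⟩
  · rw [q₀ v (hH₀ hv), b₀ ⟨v, hH₀ hv⟩ hv]
  · rw [q₁ v (hH₁ hv), b₁ ⟨v, hH₁ hv⟩ hv]
  · refine hV₀.linearMap_ext fun v hv => ?_
    rw [← LinearMap.comp_assoc, q₀ v hv, LinearMap.comp_zero]
    exact hc₀ _ (a₀ _)
  · refine hV₁.linearMap_ext fun v hv => ?_
    rw [← LinearMap.comp_assoc, q₁ v hv, LinearMap.comp_zero]
    exact hc₁ _ (a₁ _)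
  · refine hV₀.linearMap_ext fun v hv => ?_
    rw [← LinearMap.comp_assoc, q₁ _ (hδ₁ v hv), LinearMap.comp_zero]
    exact congrArg Subtype.val (c₁ ⟨v, hv⟩)
  · refine hV₁.linearMap_ext fun v hv => ?_
    rw [← LinearMap.comp_assoc, q₀ _ (hδ₀ v hv), LinearMap.comp_zero]
    exact congrArg Subtype.val (c₀ ⟨v, hv⟩)
  · refine hV₀.linearMap_ext fun v hv => ?_
    rw [LinearMap.comp_add, LinearMap.comp_sub, ← LinearMap.comp_assoc, ← LinearMap.comp_assoc,
      s₀ _ (hδ₁ v hv), s₁ v hv, q₀ v hv, LinearMap.comp_id]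
    exact congrArg Subtype.val (k₀ ⟨v, hv⟩)
  · refine hV₁.linearMap_ext fun v hv => ?_
    rw [LinearMap.comp_add, LinearMap.comp_sub, ← LinearMap.comp_assoc, ← LinearMap.comp_assoc,
      s₁ _ (hδ₀ v hv), s₀ v hv, q₁ v hv, LinearMap.comp_id]
    exact congrArg Subtype.val (k₁ ⟨v, hv⟩)

end LinearContraction

section Fock

open scoped TensorProduct

variable {n : ℕ}

/-! ### Creation and annihilation operators -/

/-- The exterior algebra on one generator for each index. -/
def Ext (n : ℕ) : Type := ExteriorAlgebra ℝ (Fin n → ℝ)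

instance : Ring (Ext n) := inferInstanceAs (Ring (ExteriorAlgebra ℝ (Fin n → ℝ)))

instance : Algebra ℝ (Ext n) := inferInstanceAs (Algebra ℝ (ExteriorAlgebra ℝ (Fin n → ℝ)))

/-- The polynomials, with the monomials as a basis. -/
abbrev Poly (n : ℕ) := Multiset (Fin n) →₀ ℝ

def gen (m : Fin n) : Ext n := ExteriorAlgebra.ι ℝ (Pi.single m 1 : Fin n → ℝ)

/-- The creation operators. -/
def cr (m : Fin n) : Module.End ℝ (Ext n) := LinearMap.mulLeft ℝ (gen m)

/-- The annihilation operators. -/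
def an (m : Fin n) : Module.End ℝ (Ext n) :=
  CliffordAlgebra.contractLeft (LinearMap.proj m : Module.Dual ℝ (Fin n → ℝ))

/-- Multiplication by a coordinate. -/
def mx (m : Fin n) : Module.End ℝ (Poly n) := Finsupp.lmapDomain ℝ ℝ fun ρ => m ::ₘ ρ

/-- Differentiation with respect to a coordinate. -/
def pd (m : Fin n) : Module.End ℝ (Poly n) :=
  Finsupp.lsum ℝ fun ρ => (ρ.count m : ℝ) • Finsupp.lsingle (ρ.erase m)

/-- Multiplication of each monomial by a number that depends on its degree. -/
def sc (f : ℕ → ℝ) : Module.End ℝ (Poly n) :=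
  Finsupp.lsum ℝ fun ρ => f ρ.card • Finsupp.lsingle ρ

theorem mx_single (m : Fin n) (ρ : Multiset (Fin n)) (c : ℝ) :
    mx m (Finsupp.single ρ c) = Finsupp.single (m ::ₘ ρ) c := Finsupp.mapDomain_single

theorem pd_single (m : Fin n) (ρ : Multiset (Fin n)) (c : ℝ) :
    pd m (Finsupp.single ρ c) = Finsupp.single (ρ.erase m) (ρ.count m * c) := by
  simp [pd]

theorem sc_single (f : ℕ → ℝ) (ρ : Multiset (Fin n)) (c : ℝ) :
    sc f (Finsupp.single ρ c) = Finsupp.single ρ (f ρ.card * c) := by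
  simp [sc]

theorem cr_mul_cr (m k : Fin n) : cr m * cr k = -(cr k * cr m) := by
  refine LinearMap.ext fun x => ?_
  have h : gen m * gen k = -(gen k * gen m) :=
    eq_neg_of_add_eq_zero_left (ExteriorAlgebra.ι_add_mul_swap _ _)
  simp only [cr, Module.End.mul_apply, LinearMap.mulLeft_apply, LinearMap.neg_apply, ← mul_assoc, h,
    neg_mul]

theorem an_mul_an (m k : Fin n) : an m * an k = -(an k * an m) :=
  LinearMap.ext fun x => CliffordAlgebra.contractLeft_comm _ _ x

theorem an_mul_cr (m k : Fin n) :
    an m * cr k = (if m = k then 1 else 0) - cr k * an m := by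
  refine LinearMap.ext fun x => ?_
  have h : an m (gen k * x) = (Pi.single k 1 : Fin n → ℝ) m • x - gen k * an m x :=
    CliffordAlgebra.contractLeft_ι_mul _ _ _
  refine h.trans ?_
  rw [Pi.single_apply]
  by_cases hmk : m = k
  · rw [if_pos hmk, if_pos hmk, one_smul]; rfl
  · rw [if_neg hmk, if_neg hmk, zero_smul]; rfl

theorem mx_mul_mx (m k : Fin n) : (mx m * mx k : Module.End ℝ (Poly n)) = mx k * mx m :=
  Finsupp.lhom_ext fun ρ c => by
    simp only [Module.End.mul_apply, mx_single, Multiset.cons_swap]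

theorem pd_mul_mx (m k : Fin n) :
    (pd m * mx k : Module.End ℝ (Poly n)) = (if m = k then 1 else 0) + mx k * pd m :=
  Finsupp.lhom_ext fun ρ c => by
    simp only [Module.End.mul_apply, mx_single, pd_single, LinearMap.add_apply]
    split_ifs with h
    · subst h
      rw [Multiset.erase_cons_head, Multiset.count_cons_self, Module.End.one_apply]
      by_cases hm : m ∈ ρ
      · rw [Multiset.cons_erase hm, ← Finsupp.single_add]
        push_cast
        ring_nf
      · rw [Multiset.count_eq_zero_of_notMem hm]
        simp
    · rw [Multiset.erase_cons_tail _ (Ne.symm h), Multiset.count_cons_of_ne h, LinearMap.zero_apply,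
        zero_add]

theorem sc_mul_mx (f : ℕ → ℝ) (m : Fin n) : sc f * mx m = mx m * sc fun k => f (k + 1) :=
  Finsupp.lhom_ext fun ρ c => by
    simp only [Module.End.mul_apply, mx_single, sc_single, Multiset.card_cons]

theorem sc_mul_sc (f g : ℕ → ℝ) : (sc f * sc g : Module.End ℝ (Poly n)) = sc (f * g) :=
  Finsupp.lhom_ext fun ρ c => by
    simp only [Module.End.mul_apply, sc_single, Pi.mul_apply, mul_assoc]

theorem sc_one : (sc 1 : Module.End ℝ (Poly n)) = 1 :=
  Finsupp.lhom_ext fun ρ c => by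
    simp only [sc_single, Pi.one_apply, one_mul, Module.End.one_apply]

theorem sum_mx_mul_pd : ∑ m, (mx m * pd m : Module.End ℝ (Poly n)) = sc fun k => k :=
  Finsupp.lhom_ext fun ρ c => by
    simp only [LinearMap.sum_apply, Module.End.mul_apply, mx_single, pd_single, sc_single]
    have h : ∀ m, Finsupp.single (m ::ₘ ρ.erase m) ((ρ.count m : ℝ) * c) =
        Finsupp.single ρ ((ρ.count m : ℝ) * c) := fun m => by
      by_cases hm : m ∈ ρ
      · rw [Multiset.cons_erase hm]
      · rw [Multiset.count_eq_zero_of_notMem hm]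
        simp
    simp only [h]
    rw [← Finsupp.single_finsetSum, ← Finset.sum_mul, ← Nat.cast_sum,
      Multiset.sum_count_eq_card fun a _ => Finset.mem_univ a]

theorem sc_mul_pd (m : Fin n) : (pd m * sc fun k => if k = 0 then 1 else 0) = 0 :=
  Finsupp.lhom_ext fun ρ c => by
    simp only [Module.End.mul_apply, pd_single, sc_single]
    split_ifs with h
    · rw [Multiset.card_eq_zero.1 h]; simp
    · simp

/-! ### Operators on the Fock space -/

/-- The Fock space of two kinds of fermions and one kind of bosons. -/
def Fock (n : ℕ) : Type := Ext n ⊗[ℝ] (Ext n ⊗[ℝ] Poly n)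

instance : AddCommGroup (Fock n) := inferInstanceAs (AddCommGroup (Ext n ⊗[ℝ] (Ext n ⊗[ℝ] Poly n)))

instance : Module ℝ (Fock n) := inferInstanceAs (Module ℝ (Ext n ⊗[ℝ] (Ext n ⊗[ℝ] Poly n)))

/-- A pure tensor. -/
def pure (x y : Ext n) (z : Poly n) : Fock n := (x ⊗ₜ[ℝ] (y ⊗ₜ[ℝ] z) : Ext n ⊗[ℝ] (Ext n ⊗[ℝ] Poly n))

/-- The tensor product of three operators. -/
def op (f g : Module.End ℝ (Ext n)) (h : Module.End ℝ (Poly n)) : Module.End ℝ (Fock n) :=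
  (TensorProduct.map f (TensorProduct.map g h) :
    Module.End ℝ (Ext n ⊗[ℝ] (Ext n ⊗[ℝ] Poly n)))

section Op

variable (f f' g g' : Module.End ℝ (Ext n)) (h h' : Module.End ℝ (Poly n))

theorem op_mul : op f g h * op f' g' h' = op (f * f') (g * g') (h * h') := by
  have e := TensorProduct.map_mul f f' (TensorProduct.map g h) (TensorProduct.map g' h')
  rw [← TensorProduct.map_mul g g' h h'] at e
  exact e.symm

theorem op_one : op (1 : Module.End ℝ (Ext n)) 1 1 = 1 := by
  rw [op, TensorProduct.map_one, TensorProduct.map_one]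
  rfl

theorem op_add_left : op (f + f') g h = op f g h + op f' g h := TensorProduct.map_add_left _ _ _

theorem op_add_mid : op f (g + g') h = op f g h + op f g' h := by
  rw [op, TensorProduct.map_add_left, TensorProduct.map_add_right]; rfl

theorem op_add_right : op f g (h + h') = op f g h + op f g h' := by
  rw [op, TensorProduct.map_add_right, TensorProduct.map_add_right]; rfl

theorem op_smul_left (c : ℝ) : op (c • f) g h = c • op f g h := TensorProduct.map_smul_left _ _ _

theorem op_smul_mid (c : ℝ) : op f (c • g) h = c • op f g h := by
  rw [op, TensorProduct.map_smul_left, TensorProduct.map_smul_right]; rfl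

theorem op_smul_right (c : ℝ) : op f g (c • h) = c • op f g h := by
  rw [op, TensorProduct.map_smul_right, TensorProduct.map_smul_right]; rfl

theorem op_neg_left : op (-f) g h = -op f g h := by
  rw [← neg_one_smul ℝ, op_smul_left, neg_one_smul]

theorem op_neg_mid : op f (-g) h = -op f g h := by
  rw [← neg_one_smul ℝ, op_smul_mid, neg_one_smul]

theorem op_sub_left : op (f - f') g h = op f g h - op f' g h := by
  rw [sub_eq_add_neg, op_add_left, op_neg_left, sub_eq_add_neg]

theorem op_sub_mid : op f (g - g') h = op f g h - op f g' h := by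
  rw [sub_eq_add_neg, op_add_mid, op_neg_mid, sub_eq_add_neg]

theorem op_zero_left : op 0 g h = 0 := by
  have e := op_smul_left 0 g h 0
  rwa [zero_smul, zero_smul] at e

theorem op_zero_mid : op f 0 h = 0 := by
  have e := op_smul_mid f 0 h 0
  rwa [zero_smul, zero_smul] at e

theorem op_zero_right : op f g 0 = 0 := by
  have e := op_smul_right f g 0 0
  rwa [zero_smul, zero_smul] at e

theorem op_sum_left {ι : Type*} (s : Finset ι) (F : ι → Module.End ℝ (Ext n)) :
    op (∑ i ∈ s, F i) g h = ∑ i ∈ s, op (F i) g h :=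
  map_sum (AddMonoidHom.mk' (fun F => op F g h) fun _ _ => op_add_left _ _ _ _) _ _

theorem op_sum_mid {ι : Type*} (s : Finset ι) (F : ι → Module.End ℝ (Ext n)) :
    op f (∑ i ∈ s, F i) h = ∑ i ∈ s, op f (F i) h :=
  map_sum (AddMonoidHom.mk' (fun F => op f F h) fun _ _ => op_add_mid _ _ _ _) _ _

theorem op_sum_right {ι : Type*} (s : Finset ι) (F : ι → Module.End ℝ (Poly n)) :
    op f g (∑ i ∈ s, F i) = ∑ i ∈ s, op f g (F i) :=
  map_sum (AddMonoidHom.mk' (fun F => op f g F) fun _ _ => op_add_right _ _ _ _) _ _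

end Op

/-- The exterior derivative on the first column, transposed. -/
def kL : Module.End ℝ (Fock n) := ∑ m, op (an m) 1 (mx m)

/-- The exterior derivative on the second column, transposed. -/
def kR : Module.End ℝ (Fock n) := ∑ m, op 1 (an m) (mx m)

/-- The counterpart of `kL` with creation and annihilation exchanged. Their anticommutator counts
bosons and first-column indices, so `dL` serves as a contracting homotopy; `dR` does the same for
`kR`. -/
def dL : Module.End ℝ (Fock n) := ∑ m, op (cr m) 1 (pd m)

def dR : Module.End ℝ (Fock n) := ∑ m, op 1 (cr m) (pd m)

/-- The raising operator of `sl₂`, which moves an index from the second to the first column. -/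
def raise : Module.End ℝ (Fock n) := ∑ m, op (cr m) (an m) 1

/-- The lowering operator of `sl₂`, which moves an index from the first to the second column. -/
def lower : Module.End ℝ (Fock n) := ∑ m, op (an m) (cr m) 1

/-- The number operator. -/
def num : Module.End ℝ (Ext n) := ∑ m, cr m * an m

def numL : Module.End ℝ (Fock n) := op num 1 1

def numR : Module.End ℝ (Fock n) := op 1 num 1

/-- Scaling by a function of the number of bosons. -/
def scale (f : ℕ → ℝ) : Module.End ℝ (Fock n) := op 1 1 (sc f)

theorem sum_sum_op_ite_left (g : Fin n → Fin n → Module.End ℝ (Ext n))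
    (h : Fin n → Fin n → Module.End ℝ (Poly n)) :
    ∑ m, ∑ k, op (if m = k then 1 else 0) (g m k) (h m k) = ∑ m, op 1 (g m m) (h m m) := by
  refine Finset.sum_congr rfl fun m _ => ?_
  rw [Finset.sum_eq_single m (fun k _ hk => by rw [if_neg hk.symm, op_zero_left])
    (fun h => absurd (Finset.mem_univ m) h), if_pos rfl]

theorem sum_sum_op_ite_mid (f : Fin n → Fin n → Module.End ℝ (Ext n))
    (h : Fin n → Fin n → Module.End ℝ (Poly n)) :
    ∑ m, ∑ k, op (f m k) (if m = k then 1 else 0) (h m k) = ∑ m, op (f m m) 1 (h m m) := by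
  refine Finset.sum_congr rfl fun m _ => ?_
  rw [Finset.sum_eq_single m (fun k _ hk => by rw [if_neg hk.symm, op_zero_mid])
    (fun h => absurd (Finset.mem_univ m) h), if_pos rfl]

theorem sum_sum_op_ite_right (f g : Fin n → Fin n → Module.End ℝ (Ext n)) :
    ∑ m, ∑ k, op (f m k) (g m k) (if m = k then 1 else 0) = ∑ m, op (f m m) (g m m) 1 := by
  refine Finset.sum_congr rfl fun m _ => ?_
  rw [Finset.sum_eq_single m (fun k _ hk => by rw [if_neg hk.symm, op_zero_right])
    (fun h => absurd (Finset.mem_univ m) h), if_pos rfl]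

theorem sum_sum_eq_zero {F : Fin n → Fin n → Module.End ℝ (Fock n)} (hF : ∀ m k, F m k = -F k m) :
    ∑ m, ∑ k, F m k = 0 := by
  have h : ∑ m, ∑ k, F m k = -∑ m, ∑ k, F m k := by
    conv_rhs => rw [Finset.sum_comm]
    simp only [← Finset.sum_neg_distrib]
    exact Finset.sum_congr rfl fun m _ => Finset.sum_congr rfl fun k _ => hF m k
  have h2 : (2 : ℝ) • ∑ m, ∑ k, F m k = 0 := by
    rw [two_smul]
    nth_rewrite 1 [h]
    exact neg_add_cancel _
  have h3 := congrArg ((2 : ℝ)⁻¹ • ·) h2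
  simpa only [smul_smul, inv_mul_cancel₀ (two_ne_zero' ℝ), one_smul, smul_zero] using h3

theorem kL_mul_kL : (kL * kL : Module.End ℝ (Fock n)) = 0 := by
  simp only [kL, Finset.sum_mul_sum, op_mul]
  exact sum_sum_eq_zero fun m k => by rw [an_mul_an, op_neg_left, mx_mul_mx]

theorem kR_mul_kR : (kR * kR : Module.End ℝ (Fock n)) = 0 := by
  simp only [kR, Finset.sum_mul_sum, op_mul]
  exact sum_sum_eq_zero fun m k => by rw [an_mul_an, op_neg_mid, mx_mul_mx]

theorem kL_mul_kR : (kL * kR : Module.End ℝ (Fock n)) = kR * kL := by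
  simp only [kL, kR, Finset.sum_mul_sum, op_mul, one_mul, mul_one]
  rw [Finset.sum_comm]
  simp only [mx_mul_mx]

theorem kL_mul_lower : (kL * lower : Module.End ℝ (Fock n)) = -(lower * kL) := by
  simp only [kL, lower, Finset.sum_mul_sum, op_mul, one_mul, mul_one]
  rw [Finset.sum_comm]
  simp only [← Finset.sum_neg_distrib, ← op_neg_left, ← an_mul_an]

theorem raise_mul_kR : (raise * kR : Module.End ℝ (Fock n)) = -(kR * raise) := by
  simp only [kR, raise, Finset.sum_mul_sum, op_mul, one_mul, mul_one]
  rw [Finset.sum_comm]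
  simp only [← Finset.sum_neg_distrib, ← op_neg_mid, ← an_mul_an]

/-- The only contraction pairs the creation operator of `raise` with the annihilation operator of
`kL`, and leaves one of the second column: anticommuting with `raise` turns `kL` into `kR`. -/
theorem raise_mul_kL : (raise * kL : Module.End ℝ (Fock n)) = kR - kL * raise := by
  simp only [kL, kR, raise, Finset.sum_mul_sum, op_mul, one_mul, mul_one, an_mul_cr, op_sub_left,
    Finset.sum_sub_distrib, sum_sum_op_ite_left]
  rw [sub_sub_cancel, Finset.sum_comm]

theorem kR_mul_lower : (kR * lower : Module.End ℝ (Fock n)) = kL - lower * kR := by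
  simp only [kL, kR, lower, Finset.sum_mul_sum, op_mul, one_mul, mul_one, an_mul_cr, op_sub_mid,
    Finset.sum_sub_distrib, sum_sum_op_ite_mid]
  rw [Finset.sum_comm (f := fun m k => op (an k) (cr k * an m) (mx m))]

/-- Normal ordering both products leaves the same quartic term, and the single contractions are the
two number operators. The weight for this `sl₂` is the difference of the column lengths. -/
theorem raise_mul_lower : (raise * lower : Module.End ℝ (Fock n)) = lower * raise + numL - numR := by
  have e₁ : (lower * raise : Module.End ℝ (Fock n)) =
      numR - ∑ m, ∑ k, op (cr k * an m) (cr m * an k) 1 := by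
    simp only [raise, lower, numR, num, Finset.sum_mul_sum, op_mul, one_mul, an_mul_cr, op_sub_left,
      Finset.sum_sub_distrib, sum_sum_op_ite_left, op_sum_mid]
  have e₂ : (raise * lower : Module.End ℝ (Fock n)) =
      numL - ∑ m, ∑ k, op (cr k * an m) (cr m * an k) 1 := by
    simp only [raise, lower, numL, num, Finset.sum_mul_sum, op_mul, one_mul, an_mul_cr, op_sub_mid,
      Finset.sum_sub_distrib, sum_sum_op_ite_mid, op_sum_left]
    rw [Finset.sum_comm (f := fun m k => op (cr m * an k) (cr k * an m) 1)]
  rw [e₁, e₂, add_sub_assoc, sub_add_sub_cancel']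

/-- The quartic terms cancel after normal ordering, and the contractions count bosons and
first-column fermions. This is the homotopy formula for `kL`. -/
theorem kL_mul_dL : (kL * dL : Module.End ℝ (Fock n)) = scale (fun k => k) + numL - dL * kL := by
  have e : (dL * kL : Module.End ℝ (Fock n)) =
      ∑ m, ∑ k, op (cr m * an k) 1 (mx k * pd m) + numL := by
    simp only [dL, kL, numL, num, Finset.sum_mul_sum, op_mul, one_mul, pd_mul_mx, op_add_right,
      Finset.sum_add_distrib, sum_sum_op_ite_right, op_sum_left]
    rw [add_comm]
  rw [e, add_sub_add_right_eq_sub]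
  simp only [dL, kL, scale, ← sum_mx_mul_pd, op_sum_right, Finset.sum_mul_sum, op_mul, one_mul,
    an_mul_cr, op_sub_left, Finset.sum_sub_distrib, sum_sum_op_ite_left]
  rw [Finset.sum_comm (f := fun m k => op (cr k * an m) 1 (mx m * pd k))]

theorem kR_mul_dR : (kR * dR : Module.End ℝ (Fock n)) = scale (fun k => k) + numR - dR * kR := by
  have e : (dR * kR : Module.End ℝ (Fock n)) =
      ∑ m, ∑ k, op 1 (cr m * an k) (mx k * pd m) + numR := by
    simp only [dR, kR, numR, num, Finset.sum_mul_sum, op_mul, one_mul, pd_mul_mx, op_add_right,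
      Finset.sum_add_distrib, sum_sum_op_ite_right, op_sum_mid]
    rw [add_comm]
  rw [e, add_sub_add_right_eq_sub]
  simp only [dR, kR, scale, ← sum_mx_mul_pd, op_sum_right, Finset.sum_mul_sum, op_mul, one_mul,
    an_mul_cr, op_sub_mid, Finset.sum_sub_distrib, sum_sum_op_ite_mid]
  rw [Finset.sum_comm (f := fun m k => op 1 (cr k * an m) (mx m * pd k))]

theorem dR_mul_lower : (dR * lower : Module.End ℝ (Fock n)) = -(lower * dR) := by
  simp only [dR, lower, Finset.sum_mul_sum, op_mul, one_mul, mul_one]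
  rw [Finset.sum_comm]
  simp only [← Finset.sum_neg_distrib, ← op_neg_mid, ← cr_mul_cr]

theorem dL_mul_raise : (dL * raise : Module.End ℝ (Fock n)) = -(raise * dL) := by
  simp only [dL, raise, Finset.sum_mul_sum, op_mul, one_mul, mul_one]
  rw [Finset.sum_comm]
  simp only [← Finset.sum_neg_distrib, ← op_neg_left, ← cr_mul_cr]

theorem dR_mul_kL : (dR * kL : Module.End ℝ (Fock n)) = kL * dR + lower := by
  simp only [dR, kL, lower, Finset.sum_mul_sum, op_mul, one_mul, mul_one, pd_mul_mx, op_add_right,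
    Finset.sum_add_distrib, sum_sum_op_ite_right]
  rw [Finset.sum_comm (f := fun m k => op (an k) (cr m) (mx k * pd m)), add_comm]

theorem dL_mul_kR : (dL * kR : Module.End ℝ (Fock n)) = kR * dL + raise := by
  simp only [dL, kR, raise, Finset.sum_mul_sum, op_mul, one_mul, mul_one, pd_mul_mx, op_add_right,
    Finset.sum_add_distrib, sum_sum_op_ite_right]
  rw [Finset.sum_comm (f := fun m k => op (cr m) (an k) (mx k * pd m)), add_comm]

theorem scale_mul_kL (f : ℕ → ℝ) : (scale f * kL : Module.End ℝ (Fock n)) = kL * scale fun k => f (k + 1) := by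
  simp only [scale, kL, Finset.mul_sum, Finset.sum_mul, op_mul, one_mul, mul_one, sc_mul_mx]

theorem scale_mul_kR (f : ℕ → ℝ) : (scale f * kR : Module.End ℝ (Fock n)) = kR * scale fun k => f (k + 1) := by
  simp only [scale, kR, Finset.mul_sum, Finset.sum_mul, op_mul, one_mul, mul_one, sc_mul_mx]

theorem scale_mul_lower (f : ℕ → ℝ) : (scale f * lower : Module.End ℝ (Fock n)) = lower * scale f := by
  simp only [scale, lower, Finset.mul_sum, Finset.sum_mul, op_mul, one_mul, mul_one]

theorem scale_mul_raise (f : ℕ → ℝ) : (scale f * raise : Module.End ℝ (Fock n)) = raise * scale f := by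
  simp only [scale, raise, Finset.mul_sum, Finset.sum_mul, op_mul, one_mul, mul_one]

theorem scale_mul_scale (f g : ℕ → ℝ) :
    (scale f * scale g : Module.End ℝ (Fock n)) = scale (f * g) := by
  simp only [scale, op_mul, one_mul, sc_mul_sc]

theorem scale_one : (scale 1 : Module.End ℝ (Fock n)) = 1 := by
  rw [scale, sc_one, op_one]

theorem dL_mul_scale : (dL * scale fun k => if k = 0 then 1 else 0 : Module.End ℝ (Fock n)) = 0 := by
  simp only [scale, dL, Finset.sum_mul, op_mul, mul_one, sc_mul_pd, op_zero_right,
    Finset.sum_const_zero]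

end Fock

section Grading

variable {n : ℕ}

/-! ### Words and the bigrading -/

/-- The exterior product of a list of generators. -/
def wedge (μ : List (Fin n)) : Ext n := (μ.map gen).prod

theorem wedge_nil : wedge ([] : List (Fin n)) = 1 := rfl

theorem wedge_cons (m : Fin n) (μ : List (Fin n)) : wedge (m :: μ) = cr m (wedge μ) :=
  List.prod_cons

/-- A basis word of the Fock space. -/
def word (ρ : Multiset (Fin n)) (μ ν : List (Fin n)) : Fock n :=
  pure (wedge μ) (wedge ν) (Finsupp.single ρ 1)

/-- The exterior forms of degree `a`. -/
def formsOfDegree (n : ℕ) (a : ℤ) : Submodule ℝ (Ext n) :=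
  Submodule.span ℝ {x | ∃ μ : List (Fin n), (μ.length : ℤ) = a ∧ wedge μ = x}

/-- The span of the words with columns of lengths `a` and `b`. -/
def bidegree (n : ℕ) (a b : ℤ) : Submodule ℝ (Fock n) :=
  Submodule.span ℝ {x | ∃ ρ μ ν, (μ.length : ℤ) = a ∧ (ν.length : ℤ) = b ∧ word ρ μ ν = x}

theorem wedge_mem {a : ℤ} {μ : List (Fin n)} (h : (μ.length : ℤ) = a) :
    wedge μ ∈ formsOfDegree n a := Submodule.subset_span ⟨μ, h, rfl⟩

theorem word_mem {a b : ℤ} {ρ : Multiset (Fin n)} {μ ν : List (Fin n)} (hμ : (μ.length : ℤ) = a)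
    (hν : (ν.length : ℤ) = b) : word ρ μ ν ∈ bidegree n a b :=
  Submodule.subset_span ⟨ρ, μ, ν, hμ, hν, rfl⟩

/-- The trilinear map `pure`. -/
def pureHom : Ext n →ₗ[ℝ] Ext n →ₗ[ℝ] Poly n →ₗ[ℝ] Fock n :=
  (LinearMap.mk₂ ℝ (fun x y => (TensorProduct.mk ℝ (Ext n) (TensorProduct ℝ (Ext n) (Poly n)) x) ∘ₗ
      TensorProduct.mk ℝ (Ext n) (Poly n) y)
    (fun x x' y => by rw [map_add, LinearMap.add_comp]) (fun c x y => by rw [map_smul]; rfl)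
    (fun x y y' => by rw [map_add, LinearMap.comp_add])
    (fun c x y => by rw [map_smul, LinearMap.comp_smul]) :
    Ext n →ₗ[ℝ] Ext n →ₗ[ℝ] Poly n →ₗ[ℝ] TensorProduct ℝ (Ext n) (TensorProduct ℝ (Ext n) (Poly n)))

theorem pure_mem {a b : ℤ} {x y : Ext n} (hx : x ∈ formsOfDegree n a) (hy : y ∈ formsOfDegree n b)
    (z : Poly n) : pure x y z ∈ bidegree n a b := by
  change pureHom x y z ∈ bidegree n a b
  induction hx using Submodule.span_induction with
  | zero => rw [map_zero]; exact zero_mem _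
  | add x x' _ _ h h' => rw [map_add]; exact add_mem h h'
  | smul c x _ h => rw [map_smul]; exact Submodule.smul_mem _ _ h
  | mem x hx =>
    obtain ⟨μ, hμ, rfl⟩ := hx
    induction hy using Submodule.span_induction with
    | zero => rw [map_zero]; exact zero_mem _
    | add x x' _ _ h h' => rw [map_add]; exact add_mem h h'
    | smul c x _ h => rw [map_smul]; exact Submodule.smul_mem _ _ h
    | mem y hy =>
      obtain ⟨ν, hν, rfl⟩ := hy
      induction z using Finsupp.induction_linear with
      | zero => rw [map_zero]; exact zero_mem _
      | add z z' h h' => rw [map_add]; exact add_mem h h'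
      | single ρ c =>
        rw [← mul_one c, ← smul_eq_mul, ← Finsupp.smul_single, map_smul]
        exact Submodule.smul_mem _ _ (word_mem hμ hν)

theorem op_mem {a b a' b' : ℤ} {f g : Module.End ℝ (Ext n)}
    (hf : ∀ x ∈ formsOfDegree n a, f x ∈ formsOfDegree n a')
    (hg : ∀ y ∈ formsOfDegree n b, g y ∈ formsOfDegree n b') (h : Module.End ℝ (Poly n)) {v : Fock n}
    (hv : v ∈ bidegree n a b) : op f g h v ∈ bidegree n a' b' := by
  induction hv using Submodule.span_induction with
  | zero => rw [map_zero]; exact zero_mem _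
  | add x x' _ _ h h' => rw [map_add]; exact add_mem h h'
  | smul c x _ h => rw [map_smul]; exact Submodule.smul_mem _ _ h
  | mem x hx =>
    obtain ⟨ρ, μ, ν, hμ, hν, rfl⟩ := hx
    exact pure_mem (hf _ (wedge_mem hμ)) (hg _ (wedge_mem hν)) _

theorem cr_mem {a : ℤ} (m : Fin n) {x : Ext n} (hx : x ∈ formsOfDegree n a) :
    cr m x ∈ formsOfDegree n (a + 1) := by
  induction hx using Submodule.span_induction with
  | zero => rw [map_zero]; exact zero_mem _
  | add x x' _ _ h h' => rw [map_add]; exact add_mem h h'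
  | smul c x _ h => rw [map_smul]; exact Submodule.smul_mem _ _ h
  | mem x hx =>
    obtain ⟨μ, hμ, rfl⟩ := hx
    rw [← wedge_cons]
    exact wedge_mem (by rw [List.length_cons, ← hμ]; push_cast; rfl)

theorem an_one (m : Fin n) : an m (1 : Ext n) = 0 := CliffordAlgebra.contractLeft_one _ _

theorem cr_cr (m k : Fin n) (x : Ext n) : cr m (cr k x) = -cr k (cr m x) :=
  LinearMap.congr_fun (cr_mul_cr m k) x

theorem an_cr (m k : Fin n) (x : Ext n) :
    an m (cr k x) = (if m = k then x else 0) - cr k (an m x) := by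
  refine (LinearMap.congr_fun (an_mul_cr m k) x).trans ?_
  rw [LinearMap.sub_apply]
  split_ifs <;> rfl

theorem an_wedge_mem (m : Fin n) (μ : List (Fin n)) :
    an m (wedge μ) ∈ formsOfDegree n (μ.length - 1) := by
  induction μ with
  | nil => rw [wedge_nil, an_one]; exact zero_mem _
  | cons k μ ih =>
    rw [wedge_cons, an_cr]
    have e : (((k :: μ).length : ℤ) - 1) = μ.length := by rw [List.length_cons]; push_cast; ring
    rw [e]
    refine sub_mem ?_ ?_
    · split_ifs
      · exact wedge_mem rfl
      · exact zero_mem _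
    · have := cr_mem k ih
      rwa [sub_add_cancel] at this

theorem an_mem {a : ℤ} (m : Fin n) {x : Ext n} (hx : x ∈ formsOfDegree n a) :
    an m x ∈ formsOfDegree n (a - 1) := by
  induction hx using Submodule.span_induction with
  | zero => rw [map_zero]; exact zero_mem _
  | add x x' _ _ h h' => rw [map_add]; exact add_mem h h'
  | smul c x _ h => rw [map_smul]; exact Submodule.smul_mem _ _ h
  | mem x hx =>
    obtain ⟨μ, rfl, rfl⟩ := hx
    exact an_wedge_mem m μ

theorem num_cr (k : Fin n) (x : Ext n) : num (cr k x) = cr k (num x) + cr k x := by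
  simp only [num, LinearMap.sum_apply, Module.End.mul_apply, an_cr, map_sub, cr_cr _ k, map_sum,
    sub_neg_eq_add, Finset.sum_add_distrib, apply_ite, map_zero]
  rw [add_comm, Finset.sum_ite_eq' Finset.univ k, if_pos (Finset.mem_univ k)]

theorem num_wedge (μ : List (Fin n)) : num (wedge μ) = (μ.length : ℝ) • wedge μ := by
  induction μ with
  | nil =>
    rw [wedge_nil, num, LinearMap.sum_apply, List.length_nil, Nat.cast_zero, zero_smul]
    exact Finset.sum_eq_zero fun m _ => by rw [Module.End.mul_apply, an_one, map_zero]
  | cons k μ ih =>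
    rw [wedge_cons, num_cr, ih, map_smul, List.length_cons, Nat.cast_add, Nat.cast_one, add_smul,
      one_smul]

variable {a b : ℤ} {v : Fock n}

theorem id_mem {x : Ext n} (hx : x ∈ formsOfDegree n a) :
    (1 : Module.End ℝ (Ext n)) x ∈ formsOfDegree n a := hx

theorem kL_mem (hv : v ∈ bidegree n a b) : kL v ∈ bidegree n (a - 1) b := by
  rw [kL, LinearMap.sum_apply]
  exact sum_mem fun m _ => op_mem (fun x => an_mem m) (fun x => id_mem) _ hv

theorem kR_mem (hv : v ∈ bidegree n a b) : kR v ∈ bidegree n a (b - 1) := by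
  rw [kR, LinearMap.sum_apply]
  exact sum_mem fun m _ => op_mem (fun x => id_mem) (fun x => an_mem m) _ hv

theorem dL_mem (hv : v ∈ bidegree n a b) : dL v ∈ bidegree n (a + 1) b := by
  rw [dL, LinearMap.sum_apply]
  exact sum_mem fun m _ => op_mem (fun x => cr_mem m) (fun x => id_mem) _ hv

theorem dR_mem (hv : v ∈ bidegree n a b) : dR v ∈ bidegree n a (b + 1) := by
  rw [dR, LinearMap.sum_apply]
  exact sum_mem fun m _ => op_mem (fun x => id_mem) (fun x => cr_mem m) _ hv

theorem raise_mem (hv : v ∈ bidegree n a b) : raise v ∈ bidegree n (a + 1) (b - 1) := by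
  rw [raise, LinearMap.sum_apply]
  exact sum_mem fun m _ => op_mem (fun x => cr_mem m) (fun x => an_mem m) _ hv

theorem lower_mem (hv : v ∈ bidegree n a b) : lower v ∈ bidegree n (a - 1) (b + 1) := by
  rw [lower, LinearMap.sum_apply]
  exact sum_mem fun m _ => op_mem (fun x => an_mem m) (fun x => cr_mem m) _ hv

theorem scale_mem (f : ℕ → ℝ) (hv : v ∈ bidegree n a b) : scale f v ∈ bidegree n a b :=
  op_mem (fun _ => id_mem) (fun _ => id_mem) _ hv

theorem numL_word (ρ : Multiset (Fin n)) (μ ν : List (Fin n)) :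
    numL (word ρ μ ν) = (μ.length : ℝ) • word ρ μ ν := by
  change pureHom (num (wedge μ)) (wedge ν) _ = _ • pureHom (wedge μ) (wedge ν) _
  rw [num_wedge, map_smul]
  rfl

theorem numR_word (ρ : Multiset (Fin n)) (μ ν : List (Fin n)) :
    numR (word ρ μ ν) = (ν.length : ℝ) • word ρ μ ν := by
  change pureHom (wedge μ) (num (wedge ν)) _ = _ • pureHom (wedge μ) (wedge ν) _
  rw [num_wedge, map_smul]
  rfl

theorem scale_word (f : ℕ → ℝ) (ρ : Multiset (Fin n)) (μ ν : List (Fin n)) :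
    scale f (word ρ μ ν) = f ρ.card • word ρ μ ν := by
  change pureHom (wedge μ) (wedge ν) (sc f _) = _ • pureHom (wedge μ) (wedge ν) _
  rw [sc_single, ← map_smul, Finsupp.smul_single, smul_eq_mul]

theorem numL_apply (hv : v ∈ bidegree n a b) : numL v = (a : ℝ) • v := by
  induction hv using Submodule.span_induction with
  | zero => rw [map_zero, smul_zero]
  | add x x' _ _ h h' => rw [map_add, h, h', smul_add]
  | smul c x _ h => rw [map_smul, h, smul_comm]
  | mem x hx =>
    obtain ⟨ρ, μ, ν, rfl, -, rfl⟩ := hx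
    exact_mod_cast numL_word ρ μ ν

theorem numR_apply (hv : v ∈ bidegree n a b) : numR v = (b : ℝ) • v := by
  induction hv using Submodule.span_induction with
  | zero => rw [map_zero, smul_zero]
  | add x x' _ _ h h' => rw [map_add, h, h', smul_add]
  | smul c x _ h => rw [map_smul, h, smul_comm]
  | mem x hx =>
    obtain ⟨ρ, μ, ν, -, rfl, rfl⟩ := hx
    exact_mod_cast numR_word ρ μ ν

/-- Degrees are integers so that lengths can be lowered without truncation; negative degrees contain
no words. -/
theorem eq_zero_of_left_neg (ha : a < 0) (hv : v ∈ bidegree n a b) : v = 0 := by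
  have h : bidegree n a b = ⊥ := by
    rw [bidegree, Submodule.span_eq_bot]
    rintro x ⟨ρ, μ, ν, h, -, -⟩
    omega
  rwa [h, Submodule.mem_bot] at hv

theorem eq_zero_of_right_neg (hb : b < 0) (hv : v ∈ bidegree n a b) : v = 0 := by
  have h : bidegree n a b = ⊥ := by
    rw [bidegree, Submodule.span_eq_bot]
    rintro x ⟨ρ, μ, ν, -, h, -⟩
    omega
  rwa [h, Submodule.mem_bot] at hv

/-! ### The relations, applied to a vector -/

theorem kL_kL (v : Fock n) : kL (kL v) = 0 := LinearMap.congr_fun kL_mul_kL v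

theorem kR_kR (v : Fock n) : kR (kR v) = 0 := LinearMap.congr_fun kR_mul_kR v

theorem kL_kR (v : Fock n) : kL (kR v) = kR (kL v) := LinearMap.congr_fun kL_mul_kR v

theorem kL_lower (v : Fock n) : kL (lower v) = -lower (kL v) := LinearMap.congr_fun kL_mul_lower v

theorem raise_kR (v : Fock n) : raise (kR v) = -kR (raise v) := LinearMap.congr_fun raise_mul_kR v

theorem raise_kL (v : Fock n) : raise (kL v) = kR v - kL (raise v) :=
  LinearMap.congr_fun raise_mul_kL v

theorem kR_lower (v : Fock n) : kR (lower v) = kL v - lower (kR v) :=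
  LinearMap.congr_fun kR_mul_lower v

theorem raise_lower (hv : v ∈ bidegree n a b) :
    raise (lower v) = lower (raise v) + ((a : ℝ) - b) • v := by
  have h := LinearMap.congr_fun (raise_mul_lower (n := n)) v
  rw [LinearMap.sub_apply, LinearMap.add_apply, numL_apply hv, numR_apply hv] at h
  rw [sub_smul, ← add_sub_assoc]
  exact h

theorem kL_dL (hv : v ∈ bidegree n a b) : kL (dL v) = scale (fun k => k + a) v - dL (kL v) := by
  have h := LinearMap.congr_fun (kL_mul_dL (n := n)) v
  rw [LinearMap.sub_apply, LinearMap.add_apply, numL_apply hv] at h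
  have e : scale (fun k => (k : ℝ) + a) v = scale (fun k => (k : ℝ)) v + (a : ℝ) • v := by
    have e1 : (sc fun k => (k : ℝ) + a : Module.End ℝ (Poly n)) =
        (sc fun k => (k : ℝ)) + (a : ℝ) • 1 := Finsupp.lhom_ext fun ρ c => by
      rw [LinearMap.add_apply, LinearMap.smul_apply, Module.End.one_apply, sc_single, sc_single,
        Finsupp.smul_single, ← Finsupp.single_add, add_mul, smul_eq_mul]
    rw [scale, e1, op_add_right, op_smul_right, op_one]
    rfl
  rw [e]
  exact h

theorem kR_dR (hv : v ∈ bidegree n a b) : kR (dR v) = scale (fun k => k + b) v - dR (kR v) := by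
  have h := LinearMap.congr_fun (kR_mul_dR (n := n)) v
  rw [LinearMap.sub_apply, LinearMap.add_apply, numR_apply hv] at h
  have e : scale (fun k => (k : ℝ) + b) v = scale (fun k => (k : ℝ)) v + (b : ℝ) • v := by
    have e1 : (sc fun k => (k : ℝ) + b : Module.End ℝ (Poly n)) =
        (sc fun k => (k : ℝ)) + (b : ℝ) • 1 := Finsupp.lhom_ext fun ρ c => by
      rw [LinearMap.add_apply, LinearMap.smul_apply, Module.End.one_apply, sc_single, sc_single,
        Finsupp.smul_single, ← Finsupp.single_add, add_mul, smul_eq_mul]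
    rw [scale, e1, op_add_right, op_smul_right, op_one]
    rfl
  rw [e]
  exact h

theorem dR_lower (v : Fock n) : dR (lower v) = -lower (dR v) := LinearMap.congr_fun dR_mul_lower v

theorem dL_raise (v : Fock n) : dL (raise v) = -raise (dL v) := LinearMap.congr_fun dL_mul_raise v

theorem dR_kL (v : Fock n) : dR (kL v) = kL (dR v) + lower v := LinearMap.congr_fun dR_mul_kL v

theorem dL_kR (v : Fock n) : dL (kR v) = kR (dL v) + raise v := LinearMap.congr_fun dL_mul_kR v

theorem scale_kL (f : ℕ → ℝ) (v : Fock n) : scale f (kL v) = kL (scale (fun k => f (k + 1)) v) :=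
  LinearMap.congr_fun (scale_mul_kL f) v

theorem scale_kR (f : ℕ → ℝ) (v : Fock n) : scale f (kR v) = kR (scale (fun k => f (k + 1)) v) :=
  LinearMap.congr_fun (scale_mul_kR f) v

theorem scale_lower (f : ℕ → ℝ) (v : Fock n) : scale f (lower v) = lower (scale f v) :=
  LinearMap.congr_fun (scale_mul_lower f) v

theorem scale_raise (f : ℕ → ℝ) (v : Fock n) : scale f (raise v) = raise (scale f v) :=
  LinearMap.congr_fun (scale_mul_raise f) v

theorem scale_scale (f g : ℕ → ℝ) (v : Fock n) : scale f (scale g v) = scale (f * g) v :=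
  LinearMap.congr_fun (scale_mul_scale f g) v

theorem scale_id (v : Fock n) : scale (fun _ => 1) v = v := LinearMap.congr_fun scale_one v

theorem scale_zero (v : Fock n) : scale (fun _ => 0) v = 0 := by
  have e : (sc fun _ => (0 : ℝ) : Module.End ℝ (Poly n)) = 0 := Finsupp.lhom_ext fun ρ c => by
    rw [sc_single, zero_mul, Finsupp.single_zero, LinearMap.zero_apply]
  rw [scale, e, op_zero_right, LinearMap.zero_apply]

theorem dL_scale (v : Fock n) : dL (scale (fun k => if k = 0 then 1 else 0) v) = 0 :=
  LinearMap.congr_fun dL_mul_scale v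

/-! ### Representation theory of `sl₂` -/

theorem raise_pow_mem (hv : v ∈ bidegree n a b) (j : ℕ) :
    (raise ^ j) v ∈ bidegree n (a + j) (b - j) := by
  induction j with
  | zero => simpa using hv
  | succ j ih =>
    rw [pow_succ', Module.End.mul_apply]
    have := raise_mem ih
    push_cast
    rwa [← add_assoc, ← sub_sub]

theorem raise_pow_eq_zero (hv : v ∈ bidegree n a b) {j : ℕ} (hj : b < j) : (raise ^ j) v = 0 :=
  eq_zero_of_right_neg (by omega) (raise_pow_mem hv j)

/-- `τ σ^{j+1} v` is a negative multiple of `σ^j v` if `τ v = 0` and `v` has positive weight. -/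
theorem lower_raise_pow (hv : v ∈ bidegree n a b) (hab : b < a) (h : lower v = 0) (j : ℕ) :
    ∃ c : ℝ, 0 < c ∧ lower ((raise ^ (j + 1)) v) = -c • (raise ^ j) v := by
  have key : ∀ j : ℕ, ∀ c : ℝ, lower (raise ((raise ^ j) v)) = raise (lower ((raise ^ j) v)) -
      ((a : ℝ) - b + 2 * j) • (raise ^ j) v := fun j c => by
    rw [raise_lower (raise_pow_mem hv j), eq_sub_iff_add_eq]
    congr 2
    push_cast
    ring
  have hpos : ∀ j : ℕ, 0 < (a : ℝ) - b + 2 * j := fun j => by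
    have : (b : ℝ) < a := by exact_mod_cast hab
    have : (0 : ℝ) ≤ j := by positivity
    linarith
  induction j with
  | zero =>
    refine ⟨_, hpos 0, ?_⟩
    have := key 0 0
    rw [pow_zero, Module.End.one_apply, h, map_zero, zero_sub] at this
    rw [zero_add, pow_one, pow_zero, Module.End.one_apply, this, neg_smul]
  | succ j ih =>
    obtain ⟨c, hc, e⟩ := ih
    refine ⟨_, add_pos hc (hpos (j + 1)), ?_⟩
    rw [pow_succ', Module.End.mul_apply, key (j + 1) 0, e, map_smul, ← Module.End.mul_apply,
      ← pow_succ', neg_smul, neg_smul, add_smul c, neg_add']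

/-- The lowering operator is injective on vectors of positive weight. -/
theorem eq_zero_of_lower_eq_zero (hab : b < a) (hv : v ∈ bidegree n a b) (h : lower v = 0) :
    v = 0 := by
  -- Applying `lower` to `(raise ^ (j + 1)) v` returns a nonzero multiple of `(raise ^ j) v`, so
  -- vanishing descends to `v`. A high power of `raise` vanishes for lack of second-column indices.
  have key : ∀ j : ℕ, (raise ^ j) v = 0 → v = 0 := by
    intro j
    induction j with
    | zero => exact fun h => h
    | succ j ih =>
      intro hj
      obtain ⟨c, hc, e⟩ := lower_raise_pow hv hab h j
      rw [hj, map_zero, eq_comm] at e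
      refine ih ?_
      have e2 := congrArg ((-c)⁻¹ • ·) e
      simpa only [smul_smul, inv_mul_cancel₀ (neg_ne_zero.2 hc.ne'), one_smul, smul_zero] using e2
  exact key (b.toNat + 1) (raise_pow_eq_zero hv (by omega))

theorem lower_pow_mem (hv : v ∈ bidegree n a b) (j : ℕ) :
    (lower ^ j) v ∈ bidegree n (a - j) (b + j) := by
  induction j with
  | zero => simpa using hv
  | succ j ih =>
    rw [pow_succ', Module.End.mul_apply]
    have := lower_mem ih
    push_cast
    rwa [← add_assoc, ← sub_sub]

/-- The raising operator is injective on vectors of weight `-1`. -/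
theorem eq_zero_of_raise_eq_zero (hv : v ∈ bidegree n a (a + 1)) (h : raise v = 0) : v = 0 := by
  -- The mirror image of the argument for `lower`: here the weight is -1 and `raise` kills `v`, so
  -- each step again adds a positive constant.
  have h1 : ∀ j : ℕ, ∃ c : ℝ, 0 < c ∧ raise ((lower ^ (j + 1)) v) = -c • (lower ^ j) v := by
    have key : ∀ j : ℕ, raise (lower ((lower ^ j) v)) = lower (raise ((lower ^ j) v)) -
        (1 + 2 * (j : ℝ)) • (lower ^ j) v := fun j => by
      have e : (((a - j : ℤ) : ℝ) - ((a + 1 + j : ℤ) : ℝ)) = -(1 + 2 * (j : ℝ)) := by push_cast; ring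
      rw [raise_lower (lower_pow_mem hv j), e, neg_smul, sub_eq_add_neg]
    intro j
    induction j with
    | zero =>
      refine ⟨1 + 2 * ((0 : ℕ) : ℝ), by positivity, ?_⟩
      have := key 0
      rw [pow_zero, Module.End.one_apply, h, map_zero, zero_sub] at this
      rw [zero_add, pow_one, pow_zero, Module.End.one_apply, this, neg_smul]
    | succ j ih =>
      obtain ⟨c, hc, e⟩ := ih
      refine ⟨_, add_pos hc (by positivity : (0 : ℝ) < 1 + 2 * ((j + 1 : ℕ) : ℝ)), ?_⟩
      rw [pow_succ', Module.End.mul_apply, key (j + 1), e, map_smul, ← Module.End.mul_apply,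
        ← pow_succ', neg_smul, neg_smul, add_smul c, neg_add']
  have key : ∀ j : ℕ, (lower ^ j) v = 0 → v = 0 := by
    intro j
    induction j with
    | zero => exact fun h => h
    | succ j ih =>
      intro hj
      obtain ⟨c, hc, e⟩ := h1 j
      rw [hj, map_zero, eq_comm] at e
      refine ih ?_
      have e2 := congrArg ((-c)⁻¹ • ·) e
      simpa only [smul_smul, inv_mul_cancel₀ (neg_ne_zero.2 hc.ne'), one_smul, smul_zero] using e2
  exact key (a.toNat + 1) (eq_zero_of_left_neg (by omega) (lower_pow_mem hv _))

/-- Each `raise` that passes `lower` contributes the current weight, which grows by two per step;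
the sum of `a - b + 2 * i` over `i ≤ j` is `(j + 1) * (a - b + j)`. -/
theorem raise_pow_lower (hv : v ∈ bidegree n a b) (j : ℕ) :
    (raise ^ (j + 1)) (lower v) =
      lower ((raise ^ (j + 1)) v) + ((j + 1) * ((a : ℝ) - b + j)) • (raise ^ j) v := by
  induction j with
  | zero =>
    rw [zero_add, pow_one, raise_lower hv, pow_zero, Module.End.one_apply]
    congr 2
    push_cast
    ring
  | succ j ih =>
    have e : ((a + (j + 1 : ℕ) : ℤ) : ℝ) - ((b - (j + 1 : ℕ) : ℤ) : ℝ) +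
        (j + 1) * ((a : ℝ) - b + j) = ((j + 1 : ℕ) + 1) * ((a : ℝ) - b + (j + 1 : ℕ)) := by
      push_cast; ring
    rw [pow_succ', Module.End.mul_apply, ih, map_add, raise_lower (raise_pow_mem hv (j + 1)), map_smul,
      ← Module.End.mul_apply, ← pow_succ', ← Module.End.mul_apply raise (raise ^ j), ← pow_succ',
      add_assoc, ← add_smul, e, pow_succ' raise (j + 1)]
    rfl

/-- The lowering operator is onto in weight `-1`. -/
theorem exists_lower_eq (hv : v ∈ bidegree n a (a + 1)) :
    ∃ u ∈ bidegree n (a + 1) a, lower u = v := by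
  have key : ∀ j : ℕ, ∀ v ∈ bidegree n a (a + 1), (raise ^ (j + 1)) v = 0 →
      ∃ u ∈ bidegree n (a + 1) a, lower u = v := by
    intro j
    induction j with
    | zero =>
      intro v hv h
      exact ⟨0, zero_mem _, by rw [map_zero, eq_zero_of_raise_eq_zero hv h]⟩
    | succ j ih =>
      intro v hv h
      have hr : raise v ∈ bidegree n (a + 1) a := by
        have := raise_mem hv
        rwa [add_sub_cancel_right] at this
      have e := raise_pow_lower hr j
      rw [← Module.End.mul_apply (raise ^ (j + 1)) raise, ← pow_succ, h, map_zero, zero_add,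
        ← Module.End.mul_apply (raise ^ j) raise, ← pow_succ] at e
      have hc : ((j + 1) * (((a + 1 : ℤ) : ℝ) - a + j) : ℝ) ≠ 0 := by
        push_cast
        have : (0 : ℝ) < (j + 1) * (a + 1 - a + j) := by
          have : (a + 1 - a + j : ℝ) = j + 1 := by ring
          rw [this]
          positivity
        exact this.ne'
      -- As `raise v` has weight 1, `c` equals `(j + 1) ^ 2`. Subtracting `c⁻¹ • lower (raise v)`,
      -- which lies in the image, lowers by one the power of `raise` that annihilates the vector.
      set c := ((j + 1) * (((a + 1 : ℤ) : ℝ) - a + j) : ℝ)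
      have hl : lower (raise v) ∈ bidegree n a (a + 1) := by
        have := lower_mem hr
        rwa [add_sub_cancel_right] at this
      obtain ⟨u, hu, hu'⟩ := ih (v - c⁻¹ • lower (raise v))
        (sub_mem hv (Submodule.smul_mem _ _ hl))
        (by rw [map_sub, map_smul, e, smul_smul, inv_mul_cancel₀ hc, one_smul, sub_self])
      refine ⟨u + c⁻¹ • raise v, add_mem hu (Submodule.smul_mem _ _ hr), ?_⟩
      rw [map_add, hu', map_smul, sub_add_cancel]
  exact key (a.toNat + 1) v hv (raise_pow_eq_zero hv (by omega))

end Grading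

section Tableaux

variable {n : ℕ} {a b : ℤ} {v w : Fock n}

/-! ### Tensors of mixed symmetry as a quotient of the Fock space -/

/-- The relations between the components of a tensor with two columns of lengths `a` and `b`. -/
def rel (n : ℕ) (a b : ℤ) : Submodule ℝ (Fock n) := (bidegree n (a + 1) (b - 1)).map lower

theorem lower_mem_rel (hv : v ∈ bidegree n (a + 1) (b - 1)) : lower v ∈ rel n a b :=
  Submodule.mem_map_of_mem hv

theorem eq_zero_of_mem_rel_zero (hv : v ∈ rel n a 0) : v = 0 := by
  obtain ⟨u, hu, rfl⟩ := hv
  rw [eq_zero_of_right_neg (by omega) hu, map_zero]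

/-- The exterior derivative on the second column, corrected by a multiple `c` of the one on the
first column. -/
def kT (c : ℝ) : Module.End ℝ (Fock n) := kR + c • (raise * kL)

theorem kT_apply (c : ℝ) (v : Fock n) : kT c v = kR v + c • raise (kL v) := rfl

/-- The coefficient with which `kT` preserves the relations. -/
def ktCoeff (a b : ℤ) : ℝ := ((a : ℝ) - b + 1)⁻¹

theorem kT_mem (c : ℝ) (hv : v ∈ bidegree n a b) : kT c v ∈ bidegree n a (b - 1) := by
  refine add_mem (kR_mem hv) (Submodule.smul_mem _ _ ?_)
  have := raise_mem (kL_mem hv)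
  rwa [sub_add_cancel] at this

theorem kL_mem_rel (hv : v ∈ rel n a b) : kL v ∈ rel n (a - 1) b := by
  obtain ⟨u, hu, rfl⟩ := hv
  rw [kL_lower, ← map_neg]
  refine lower_mem_rel (neg_mem ?_)
  have := kL_mem hu
  rwa [add_sub_cancel_right, ← sub_add_cancel a 1] at this

/-- On `lower u` the operator `kR` leaves a stray `kL u`, and `raise * kL` leaves minus the weight
of `kL u` times the same vector. The coefficient is the inverse of that weight, so the stray terms
cancel. -/
theorem kT_mem_rel (hab : b ≤ a) (hv : v ∈ rel n a b) : kT (ktCoeff a b) v ∈ rel n a (b - 1) := by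
  obtain ⟨u, hu, rfl⟩ := hv
  have h1 : kL u ∈ bidegree n a (b - 1) := by
    have := kL_mem hu
    rwa [add_sub_cancel_right] at this
  have hc : ktCoeff a b * ((a : ℝ) - (b - 1 : ℤ)) = 1 := by
    have : (b : ℝ) ≤ a := by exact_mod_cast hab
    rw [ktCoeff]
    push_cast
    rw [← sub_add]
    exact inv_mul_cancel₀ (by linarith)
  have e : kT (ktCoeff a b) (lower u) = lower (-(kR u + ktCoeff a b • raise (kL u))) := by
    rw [kT_apply, kR_lower, kL_lower, map_neg, raise_lower h1, smul_neg, smul_add, smul_smul, hc,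
      one_smul, map_neg, map_add, map_smul]
    abel
  rw [e]
  refine lower_mem_rel (neg_mem (kT_mem (ktCoeff a b) hu))

/-- Since `kL` squares to zero, the relation between `raise` and `kL` gives `kL (raise (kL v)) = kR
(kL v)`; so the mixed composition is a multiple of `kR * kL`. -/
theorem kL_kT (c : ℝ) (v : Fock n) : kL (kT c v) = (1 + c) • kR (kL v) := by
  have h : kL (raise (kL v)) = kR (kL v) := by
    rw [eq_comm, ← sub_eq_zero, ← raise_kL, kL_kL, map_zero]
  rw [kT_apply, map_add, map_smul, kL_kR, h, add_smul, one_smul]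

theorem kT_kL (c : ℝ) (v : Fock n) : kT c (kL v) = kR (kL v) := by
  rw [kT_apply, kL_kL, map_zero, smul_zero, add_zero]

theorem kT_eq (c : ℝ) (v : Fock n) : kT c v = (1 + c) • kR v - c • kL (raise v) := by
  rw [kT_apply, raise_kL, smul_sub, add_smul, one_smul, add_sub_assoc]

/-- All terms are multiples of `kR (raise (kL v))`, with total coefficient `c - c' * (1 + c)`. With
`w = a - b` one has `c = 1 / (w + 1)` and `c' = 1 / (w + 2)`, which makes it zero. -/
theorem kT_kT (hab : b ≤ a) (v : Fock n) :
    kT (ktCoeff a (b - 1)) (kT (ktCoeff a b) v) = 0 := by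
  have h1 : (0 : ℝ) < (a : ℝ) - b + 1 := by
    have : (b : ℝ) ≤ a := by exact_mod_cast hab
    linarith
  have hc : ktCoeff a (b - 1) * (1 + ktCoeff a b) = ktCoeff a b := by
    rw [ktCoeff, ktCoeff]
    push_cast
    have : (a : ℝ) - (b - 1) + 1 ≠ 0 := by linarith
    field_simp
    ring
  rw [kT_apply, kL_kT, map_smul, raise_kR, smul_neg, smul_neg, smul_smul, hc, kT_apply, map_add, kR_kR,
    zero_add, map_smul, add_neg_cancel]

theorem scale_kT (f : ℕ → ℝ) (c : ℝ) (v : Fock n) :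
    scale f (kT c v) = kT c (scale (fun k => f (k + 1)) v) := by
  rw [kT_apply, map_add, map_smul, scale_kR, scale_raise, scale_kL, kT_apply]

/-! ### Two Poincaré lemmas -/

/-- The anticommutator of `kL` and `dL` is the number of bosons plus `a`; this is positive, so it
can be inverted before `dL` is applied. -/
theorem exists_kL_eq (ha : 1 ≤ a) (hv : v ∈ bidegree n a b) (h : kL v = 0) :
    ∃ y ∈ bidegree n (a + 1) b, v = kL y := by
  refine ⟨dL (scale (fun k => ((k : ℝ) + a)⁻¹) v), dL_mem (scale_mem _ hv), ?_⟩
  have hk : ∀ f : ℕ → ℝ, kL (scale (fun k => f (k + 1)) v) = 0 := fun f => by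
    rw [← scale_kL, h, map_zero]
  have h0 : kL (scale (fun k => ((k : ℝ) + a)⁻¹) v) = 0 := by
    have := hk fun k => ((k : ℝ) - 1 + a)⁻¹
    push_cast at this
    simpa only [add_sub_cancel_right] using this
  rw [kL_dL (scale_mem _ hv), h0, map_zero, sub_zero, scale_scale]
  refine (scale_id v).symm.trans ?_
  congr 1
  refine congrArg _ (funext fun k => ?_)
  have : (1 : ℝ) ≤ a := by exact_mod_cast ha
  have hk : (0 : ℝ) ≤ k := by positivity
  exact (mul_inv_cancel₀ (by linarith)).symm

/-- If `kL v = lower u`, then `lower (kL u) = 0`; since `b < a` the weight of `kL u` is positive, so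
`u` is closed and `u = kL u'`. Then `v + lower u'` is closed on the nose, and the exact Poincaré
lemma applies. -/
theorem exists_sub_kL_mem_rel (hab : b < a) (ha : 1 ≤ a) (hv : v ∈ bidegree n a b)
    (h : kL v ∈ rel n (a - 1) b) : ∃ y ∈ bidegree n (a + 1) b, v - kL y ∈ rel n a b := by
  obtain ⟨u, hu, hv'⟩ := h
  rw [sub_add_cancel] at hu
  have hu0 : kL u = 0 := by
    refine eq_zero_of_lower_eq_zero (by omega) (kL_mem hu) ?_
    rw [← neg_eq_zero, ← kL_lower, hv', kL_kL]
  obtain ⟨u', hu', rfl⟩ := exists_kL_eq ha hu hu0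
  have hl : lower u' ∈ bidegree n a b := by
    have := lower_mem hu'
    rwa [add_sub_cancel_right, sub_add_cancel] at this
  obtain ⟨y, hy, e⟩ := exists_kL_eq ha (add_mem hv hl) (by rw [map_add, kL_lower, hv', add_neg_cancel])
  refine ⟨y, hy, ?_⟩
  rw [← e, sub_add_cancel_left, ← map_neg]
  exact lower_mem_rel (neg_mem hu')

/-- The projection on the part without bosons. -/
def vac : Module.End ℝ (Fock n) := scale fun k => if k = 0 then 1 else 0

theorem vac_kL (v : Fock n) : vac (kL v) = 0 := by
  rw [vac, scale_kL]
  simp only [Nat.add_eq_zero_iff, one_ne_zero, and_false, if_false]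
  rw [scale_zero, map_zero]

theorem vac_kT (c : ℝ) (v : Fock n) : vac (kT c v) = 0 := by
  rw [vac, scale_kT]
  simp only [Nat.add_eq_zero_iff, one_ne_zero, and_false, if_false]
  rw [scale_zero, map_zero]

theorem vac_mem (hv : v ∈ bidegree n a b) : vac v ∈ bidegree n a b := scale_mem _ hv

theorem vac_vac (v : Fock n) : vac (vac v) = vac v := by
  rw [vac, scale_scale]
  congr 1
  refine congrArg _ (funext fun k => ?_)
  rw [Pi.mul_apply]
  split_ifs <;> simp

/-- The number of bosons plus `b` fails to be invertible only on the part without bosons for `b =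
0`, whence the vacuum term. Applied to `u + kL y` the homotopy stays within the allowed terms: `dR`
anticommutes with `lower`, and its commutator with `kL` is `lower`. -/
theorem exists_sub_kR_mem_rel (hb : 0 ≤ b) (hv : v ∈ bidegree n a b) {u y : Fock n}
    (hu : u ∈ rel n a (b - 1)) (hy : y ∈ bidegree n (a + 1) (b - 1)) (h : kR v = u + kL y) :
    ∃ z ∈ bidegree n a (b + 1), ∃ y ∈ bidegree n (a + 1) b,
      v - (if b = 0 then vac v else 0) - kR z - kL y ∈ rel n a b := by
  -- For `k = b = 0` the inverse takes the default value 0, which is what projecting off the vacuum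
  -- requires. `g` is shifted by one because `kR` adds a boson.
  let f : ℕ → ℝ := fun k => ((k : ℝ) + b)⁻¹
  let g : ℕ → ℝ := fun k => ((k : ℝ) - 1 + b)⁻¹
  have hgf : (fun k => g (k + 1)) = f := funext fun k => by
    simp only [g, f]
    push_cast
    rw [add_sub_cancel_right]
  have e1 : kR (dR (scale f v)) = v - (if b = 0 then vac v else 0) - dR (kR (scale f v)) := by
    rw [kR_dR (scale_mem f hv), scale_scale]
    congr 1
    rw [eq_sub_iff_add_eq]
    have e2 : (if b = 0 then vac v else 0) = scale (fun k => if (k : ℝ) + b = 0 then 1 else 0) v := by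
      split_ifs with h0
      · rw [vac, h0]; simp
      · have : ∀ k : ℕ, ¬ ((k : ℝ) + b = 0) := fun k hk => by
          have : (0 : ℝ) < b := by exact_mod_cast lt_of_le_of_ne hb (Ne.symm h0)
          have : (0 : ℝ) ≤ k := by positivity
          linarith
        simp only [this, if_false, scale_zero]
    have e3 : ∀ f g : ℕ → ℝ, scale f v + scale g v = scale (f + g) v := fun f g => by
      have : (sc (f + g) : Module.End ℝ (Poly n)) = sc f + sc g := Finsupp.lhom_ext fun ρ c => by
        rw [LinearMap.add_apply, sc_single, sc_single, sc_single, ← Finsupp.single_add, ← add_mul]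
        rfl
      rw [scale, scale, scale, this, op_add_right, LinearMap.add_apply]
    rw [e2, e3]
    refine Eq.trans ?_ (scale_id v)
    congr 1
    refine congrArg _ (funext fun k => ?_)
    simp only [Pi.add_apply, Pi.mul_apply, f]
    split_ifs with h0
    · rw [h0]; simp
    · rw [mul_inv_cancel₀ h0, add_zero]
  obtain ⟨u', hu', rfl⟩ := hu
  have e4 : kR (scale f v) = lower (scale g u') + kL (scale (fun k => g (k + 1)) y) := by
    rw [← hgf, ← scale_kR, h, map_add, scale_lower, scale_kL, hgf]
  have hy' : scale (fun k => g (k + 1)) y ∈ bidegree n (a + 1) (b - 1) := scale_mem _ hy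
  set y' := scale (fun k => g (k + 1)) y
  have hu'' : scale g u' ∈ bidegree n (a + 1) (b - 1 - 1) := scale_mem _ hu'
  set u'' := scale g u'
  refine ⟨dR (scale f v), dR_mem (scale_mem f hv), dR y', ?_, ?_⟩
  · have := dR_mem hy'
    rwa [sub_add_cancel] at this
  · rw [e1, e4, map_add, dR_lower, dR_kL]
    have e5 : ∀ x p q r : Fock n, x - (x - (-p + (q + r))) - q = r - p := fun x p q r => by abel
    rw [e5, ← map_sub]
    refine lower_mem_rel (sub_mem hy' ?_)
    have := dR_mem hu''
    rwa [sub_add_cancel] at this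

end Tableaux

section Families

variable {n : ℕ} {p q : ℤ} {α : ℤ → ℝ} {β : ℤ → ℤ → ℝ}

/-! ### The complex of families of tensors -/

/-- The pairs of column lengths that occur. -/
def InBox (p q a b : ℤ) : Prop := (q ≤ a ∧ a ≤ p) ∧ 0 ≤ b ∧ b ≤ q

instance (p q a b : ℤ) : Decidable (InBox p q a b) :=
  inferInstanceAs (Decidable ((q ≤ a ∧ a ≤ p) ∧ 0 ≤ b ∧ b ≤ q))

/-- Families of vectors, one of each bidegree that occurs. -/
def families (n : ℕ) (p q : ℤ) : Submodule ℝ (ℤ → ℤ → Fock n) where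
  carrier := {F | ∀ a b, F a b ∈ bidegree n a b ∧ (¬ InBox p q a b → F a b = 0)}
  add_mem' hF hG a b := ⟨add_mem (hF a b).1 (hG a b).1, fun h => by
    rw [Pi.add_apply, Pi.add_apply, (hF a b).2 h, (hG a b).2 h, add_zero]⟩
  zero_mem' a b := ⟨zero_mem _, fun _ => rfl⟩
  smul_mem' c F hF a b := ⟨Submodule.smul_mem _ _ (hF a b).1, fun h => by
    rw [Pi.smul_apply, Pi.smul_apply, (hF a b).2 h, smul_zero]⟩

/-- The families that represent zero tensors. -/
def relFamilies (n : ℕ) : Submodule ℝ (ℤ → ℤ → Fock n) where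
  carrier := {F | ∀ a b, F a b ∈ rel n a b}
  add_mem' hF hG a b := add_mem (hF a b) (hG a b)
  zero_mem' _ _ := zero_mem _
  smul_mem' _ _ hF a b := Submodule.smul_mem _ _ (hF a b)

/-- The differential on families. -/
def delta (n : ℕ) (p q : ℤ) (α : ℤ → ℝ) (β : ℤ → ℤ → ℝ) :
    (ℤ → ℤ → Fock n) →ₗ[ℝ] (ℤ → ℤ → Fock n) :=
  LinearMap.pi fun a => LinearMap.pi fun b => if InBox p q a b then
    α (a + 1) • kL ∘ₗ LinearMap.proj b ∘ₗ LinearMap.proj (a + 1) +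
      β a (b + 1) • kT (ktCoeff a (b + 1)) ∘ₗ LinearMap.proj (b + 1) ∘ₗ LinearMap.proj a
  else 0

theorem delta_of_inBox {a b : ℤ} (h : InBox p q a b) (F : ℤ → ℤ → Fock n) :
    delta n p q α β F a b =
      α (a + 1) • kL (F (a + 1) b) + β a (b + 1) • kT (ktCoeff a (b + 1)) (F a (b + 1)) := by
  simp only [delta, LinearMap.pi_apply, if_pos h]
  rfl

theorem delta_of_not_inBox {a b : ℤ} (h : ¬ InBox p q a b) (F : ℤ → ℤ → Fock n) :
    delta n p q α β F a b = 0 := by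
  simp only [delta, LinearMap.pi_apply, if_neg h]
  rfl

theorem delta_apply {F : ℤ → ℤ → Fock n} (hF : F ∈ families n p q) {a b : ℤ} (ha : q ≤ a)
    (hb : 0 ≤ b) : delta n p q α β F a b =
      α (a + 1) • kL (F (a + 1) b) + β a (b + 1) • kT (ktCoeff a (b + 1)) (F a (b + 1)) := by
  by_cases h : InBox p q a b
  · exact delta_of_inBox h F
  · have h1 : ¬ InBox p q (a + 1) b := by unfold InBox at h ⊢; omega
    have h2 : ¬ InBox p q a (b + 1) := by unfold InBox at h ⊢; omega
    rw [delta_of_not_inBox h, (hF _ _).2 h1, (hF _ _).2 h2, map_zero, map_zero, smul_zero, smul_zero,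
      add_zero]

theorem delta_mem {F : ℤ → ℤ → Fock n} (hF : F ∈ families n p q) :
    delta n p q α β F ∈ families n p q := fun a b => by
  refine ⟨?_, fun h => delta_of_not_inBox h F⟩
  by_cases h : InBox p q a b
  · rw [delta_of_inBox h]
    have h1 := kL_mem (hF (a + 1) b).1
    have h2 := kT_mem (ktCoeff a (b + 1)) (hF a (b + 1)).1
    rw [add_sub_cancel_right] at h1 h2
    exact add_mem (Submodule.smul_mem _ _ h1) (Submodule.smul_mem _ _ h2)
  · rw [delta_of_not_inBox h]
    exact zero_mem _

theorem delta_mem_relFamilies {F : ℤ → ℤ → Fock n} (hF : F ∈ families n p q)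
    (h : F ∈ relFamilies n) : delta n p q α β F ∈ relFamilies n := fun a b => by
  by_cases hab : InBox p q a b
  · rw [delta_of_inBox hab]
    refine add_mem (Submodule.smul_mem _ _ ?_) (Submodule.smul_mem _ _ ?_)
    · have := kL_mem_rel (h (a + 1) b)
      rwa [add_sub_cancel_right] at this
    · by_cases hb : InBox p q a (b + 1)
      · have := kT_mem_rel (by unfold InBox at hb; omega) (h a (b + 1))
        rwa [add_sub_cancel_right] at this
      · rw [(hF _ _).2 hb, map_zero]
        exact zero_mem _
  · rw [delta_of_not_inBox hab]
    exact zero_mem _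

/-- The coefficients are nonzero, and such that the differential squares to zero. -/
structure IsAdmissible (p q : ℤ) (α : ℤ → ℝ) (β : ℤ → ℤ → ℝ) : Prop where
  one_le : 1 ≤ q
  le : q ≤ p
  left_ne_zero : ∀ a, q < a → a ≤ p → α a ≠ 0
  right_ne_zero : ∀ a b, q ≤ a → a ≤ p → 1 ≤ b → b ≤ q → β a b ≠ 0
  compatible : ∀ a b, q ≤ a → a + 1 ≤ p → 1 ≤ b → b ≤ q →
    β (a + 1) b * (1 + ktCoeff (a + 1) b) + β a b = 0

/-- The unmixed terms vanish by `kL_kL` and `kT_kT`. Both mixed terms are multiples of `kR (kL (F (a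
+ 1) (b + 1)))`, and compatibility of the coefficients says that they add up to zero. -/
theorem IsAdmissible.delta_delta (h : IsAdmissible p q α β) {F : ℤ → ℤ → Fock n}
    (hF : F ∈ families n p q) : delta n p q α β (delta n p q α β F) = 0 := by
  funext a b
  by_cases hab : InBox p q a b
  · have hab' := hab
    unfold InBox at hab'
    rw [delta_of_inBox hab, delta_apply hF (by omega) (by omega), delta_apply hF (by omega) (by omega)]
    simp only [map_add, map_smul, kL_kL, smul_zero, zero_add, kL_kT, kT_kL]
    have h1 : kT (ktCoeff a (b + 1)) (kT (ktCoeff a (b + 1 + 1)) (F a (b + 1 + 1))) = 0 := by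
      by_cases hb : InBox p q a (b + 1 + 1)
      · have := kT_kT (a := a) (b := b + 1 + 1) (by unfold InBox at hb; omega) (F a (b + 1 + 1))
        rwa [add_sub_cancel_right] at this
      · rw [(hF _ _).2 hb, map_zero, map_zero]
    rw [h1, smul_zero, add_zero]
    by_cases hb : InBox p q (a + 1) (b + 1)
    · unfold InBox at hb
      have e := h.compatible a (b + 1) (by omega) (by omega) (by omega) (by omega)
      simp only [smul_smul, ← add_smul]
      have e2 : α (a + 1) * (β (a + 1) (b + 1) * (1 + ktCoeff (a + 1) (b + 1))) +
          β a (b + 1) * α (a + 1) = 0 := by rw [mul_comm (β a _), ← mul_add, e, mul_zero]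
      rw [e2, zero_smul]
      rfl
    · rw [(hF _ _).2 hb, map_zero, map_zero]
      simp
  · rw [delta_of_not_inBox hab]
    rfl

/-- The families of invariants: a last ghost, a curl and a curvature. -/
def invariantFamily (n : ℕ) (p q : ℤ) : Fock n × Fock n × Fock n →ₗ[ℝ] (ℤ → ℤ → Fock n) :=
  LinearMap.pi fun a => LinearMap.pi fun b =>
    (if a = q ∧ b = 0 then vac ∘ₗ LinearMap.fst ℝ _ _ else 0) +
      (if a = p ∧ b = 0 then kL ∘ₗ vac ∘ₗ LinearMap.fst ℝ _ _ ∘ₗ LinearMap.snd ℝ _ _ else 0) +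
      if a = p ∧ b = q then kR ∘ₗ kL ∘ₗ LinearMap.snd ℝ _ _ ∘ₗ LinearMap.snd ℝ _ _ else 0

theorem invariantFamily_apply (h d z : Fock n) (a b : ℤ) :
    invariantFamily n p q (h, d, z) a b = (if a = q ∧ b = 0 then vac h else 0) +
      (if a = p ∧ b = 0 then kL (vac d) else 0) + if a = p ∧ b = q then kR (kL z) else 0 := by
  simp only [invariantFamily, LinearMap.pi_apply, LinearMap.add_apply]
  split_ifs <;> rfl

def invariantDomain (n : ℕ) (p q : ℤ) : Submodule ℝ (Fock n × Fock n × Fock n) :=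
  (bidegree n q 0).prod ((bidegree n (p + 1) 0).prod (bidegree n (p + 1) (q + 1)))

theorem invariantFamily_mem (hq : 1 ≤ q) (hqp : q ≤ p) {x : Fock n × Fock n × Fock n}
    (hx : x ∈ invariantDomain n p q) : invariantFamily n p q x ∈ families n p q := by
  obtain ⟨h, d, z⟩ := x
  obtain ⟨hh, hd, hz⟩ := hx
  intro a b
  rw [invariantFamily_apply]
  have h2 := kL_mem (vac_mem hd)
  have h3 := kR_mem (kL_mem hz)
  simp only [add_sub_cancel_right] at h2 h3
  refine ⟨add_mem (add_mem ?_ ?_) ?_, fun hab => ?_⟩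
  · split_ifs with h
    · obtain ⟨rfl, rfl⟩ := h; exact vac_mem hh
    · exact zero_mem _
  · split_ifs with h
    · obtain ⟨rfl, rfl⟩ := h; exact h2
    · exact zero_mem _
  · split_ifs with h
    · obtain ⟨rfl, rfl⟩ := h; exact h3
    · exact zero_mem _
  · unfold InBox at hab
    rw [if_neg (by omega), if_neg (by omega), if_neg (by omega), add_zero, add_zero]

theorem delta_invariantFamily (hq : 1 ≤ q) (x : Fock n × Fock n × Fock n) :
    delta n p q α β (invariantFamily n p q x) = 0 := by
  obtain ⟨h, d, z⟩ := x
  funext a b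
  by_cases hab : InBox p q a b
  · rw [delta_of_inBox hab, invariantFamily_apply, invariantFamily_apply]
    unfold InBox at hab
    rw [if_neg (by omega), if_neg (c := a = q ∧ b + 1 = 0) (by omega),
      if_neg (c := a = p ∧ b + 1 = 0) (by omega)]
    have h1 : kL (if a + 1 = p ∧ b = 0 then kL (vac d) else 0) = 0 := by
      split_ifs
      · exact kL_kL _
      · exact map_zero _
    have h2 : kL (if a + 1 = p ∧ b = q then kR (kL z) else 0) = 0 := by
      split_ifs
      · rw [kL_kR, kL_kL, map_zero]
      · exact map_zero _
    have h3 : kT (ktCoeff a (b + 1)) (if a = p ∧ b + 1 = q then kR (kL z) else 0) = 0 := by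
      split_ifs
      · rw [kT_apply, kR_kR, kL_kR, kL_kL, map_zero, map_zero, smul_zero, add_zero]
      · exact map_zero _
    simp only [zero_add, map_add, h1, h2, h3, smul_zero, Pi.zero_apply]
  · rw [delta_of_not_inBox hab]
    rfl

/-! ### Cohomology of the complex of families -/

/-- The families that are cohomologous to a family of invariants. -/
def invariantModExact (n : ℕ) (p q : ℤ) (α : ℤ → ℝ) (β : ℤ → ℤ → ℝ) :
    Submodule ℝ (ℤ → ℤ → Fock n) :=
  relFamilies n ⊔ (families n p q).map (delta n p q α β) ⊔
    (invariantDomain n p q).map (invariantFamily n p q)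

theorem delta_mem_invariantModExact {Y : ℤ → ℤ → Fock n} (hY : Y ∈ families n p q) :
    delta n p q α β Y ∈ invariantModExact n p q α β :=
  Submodule.mem_sup_left (Submodule.mem_sup_right (Submodule.mem_map_of_mem hY))

theorem invariantFamily_mem_invariantModExact {x : Fock n × Fock n × Fock n}
    (hx : x ∈ invariantDomain n p q) :
    invariantFamily n p q x ∈ invariantModExact n p q α β :=
  Submodule.mem_sup_right (Submodule.mem_map_of_mem hx)

namespace IsAdmissible

/-- In the longest column the potentials `y` cannot be cancelled, as column `p + 1` lies outside the
box. Closedness in the other direction makes `kR y` a relation plus a `kL`-image, so the second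
Poincaré lemma turns `kL y` into `kR (kL z)`, plus `kL (vac y)` at `b = 0`. For `b < q` the term `kR
(kL z) = kT (kL z)` is exact; the curl at `b = 0` and the curvature at `b = q` remain. -/
theorem mem_of_last_column (h : IsAdmissible p q α β) {F : ℤ → ℤ → Fock n}
    (hF : F ∈ families n p q) (hδ : delta n p q α β F ∈ relFamilies n)
    (hlt : ∀ a b, a < p → F a b ∈ rel n a b)
    (hy : ∀ b, 0 ≤ b → b ≤ q → ∃ y ∈ bidegree n (p + 1) b, F p b - kL y ∈ rel n p b) :
    F ∈ invariantModExact n p q α β := by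
  have hq := h.one_le
  have hqp := h.le
  have key : ∀ b, 0 ≤ b → b ≤ q → ∃ y ∈ bidegree n (p + 1) b, ∃ z ∈ bidegree n (p + 1) (b + 1),
      F p b - (if b = 0 then kL (vac y) else 0) - kR (kL z) ∈ rel n p b := by
    intro b hb hbq
    obtain ⟨y, hy, hFy⟩ := hy b hb hbq
    have h1 : ∃ u ∈ rel n (p + 1) (b - 1), ∃ y' ∈ bidegree n (p + 1 + 1) (b - 1), kR y = u + kL y' := by
      rcases eq_or_lt_of_le hb with rfl | hb0
      · refine ⟨0, zero_mem _, 0, zero_mem _, ?_⟩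
        rw [map_zero, add_zero]
        exact eq_zero_of_right_neg (by omega) (kR_mem hy)
      · have h2 := hδ p (b - 1)
        rw [delta_apply hF hqp (by omega), (hF (p + 1) (b - 1)).2 (by unfold InBox; omega), map_zero,
          smul_zero, zero_add, sub_add_cancel,
          Submodule.smul_mem_iff _ (h.right_ne_zero p b hqp le_rfl (by omega) hbq)] at h2
        have h3 := sub_mem h2 (kT_mem_rel (by omega) hFy)
        rw [map_sub, sub_sub_cancel, kT_kL, ← kL_kR, ← add_sub_cancel_right p 1] at h3
        obtain ⟨y', hy', h4⟩ := exists_sub_kL_mem_rel (by omega) (by omega) (kR_mem hy) h3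
        exact ⟨_, h4, y', hy', (sub_add_cancel _ _).symm⟩
    obtain ⟨u, hu, y', hy', e⟩ := h1
    obtain ⟨z, hz, y'', hy'', h5⟩ := exists_sub_kR_mem_rel hb hy hu hy' e
    refine ⟨y, hy, z, hz, ?_⟩
    have h6 := kL_mem_rel h5
    rw [add_sub_cancel_right, map_sub, map_sub, map_sub, kL_kL, sub_zero, kL_kR] at h6
    have h7 := add_mem hFy h6
    have e2 : kL (if b = 0 then vac y else 0) = if b = 0 then kL (vac y) else 0 := by
      split_ifs
      · rfl
      · exact map_zero _
    rw [e2] at h7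
    have e3 : ∀ f k i w : Fock n, f - k + (k - i - w) = f - i - w := fun f k i w => by abel
    rwa [e3] at h7
  choose! y hy z hz hF' using key
  -- Primitives in column `p`: since the differential lowers `b`, the entry at `b` is built from the
  -- vector found at `b - 1`.
  let Y : ℤ → ℤ → Fock n := fun a b => if a = p ∧ 1 ≤ b ∧ b ≤ q then
    (β p b)⁻¹ • kL (z (b - 1)) else 0
  have hY : Y ∈ families n p q := fun a b => by
    by_cases hab : a = p ∧ 1 ≤ b ∧ b ≤ q
    · simp only [Y, if_pos hab]
      obtain ⟨rfl, hb, hbq⟩ := hab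
      refine ⟨Submodule.smul_mem _ _ ?_, fun h => absurd ?_ h⟩
      · have := kL_mem (hz (b - 1) (by omega) (by omega))
        rwa [add_sub_cancel_right, sub_add_cancel] at this
      · unfold InBox; omega
    · simp only [Y, if_neg hab]
      exact ⟨zero_mem _, fun _ => trivial⟩
  have hx : ((0, y 0, z q) : Fock n × Fock n × Fock n) ∈ invariantDomain n p q :=
    ⟨zero_mem _, hy 0 le_rfl (by omega), hz q (by omega) le_rfl⟩
  have hR : F - delta n p q α β Y - invariantFamily n p q (0, y 0, z q) ∈ relFamilies n := by
    intro a b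
    rw [Pi.sub_apply, Pi.sub_apply, Pi.sub_apply, Pi.sub_apply]
    by_cases hab : InBox p q a b
    · rw [delta_of_inBox hab, invariantFamily_apply, map_zero, ite_self, zero_add]
      unfold InBox at hab
      have e1 : kL (Y (a + 1) b) = 0 := by
        simp only [Y]
        split_ifs
        · rw [map_smul, kL_kL, smul_zero]
        · exact map_zero _
      rw [e1, smul_zero, zero_add]
      by_cases hap : a = p
      · subst hap
        have h1 := hF' b (by omega) (by omega)
        by_cases hbq : b = q
        · subst hbq
          have e2 : Y a (b + 1) = 0 := if_neg (by omega)
          rw [e2, map_zero, smul_zero, sub_zero, if_neg (by omega), if_pos ⟨rfl, rfl⟩, zero_add]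
          rwa [if_neg (by omega), sub_zero] at h1
        · have e2 : Y a (b + 1) = (β a (b + 1))⁻¹ • kL (z b) :=
            (if_pos ⟨rfl, by omega, by omega⟩).trans (by rw [add_sub_cancel_right])
          rw [e2, map_smul, smul_smul, mul_inv_cancel₀
            (h.right_ne_zero a (b + 1) (by omega) le_rfl (by omega) (by omega)), one_smul, kT_kL,
            if_neg (c := a = a ∧ b = q) (by omega), add_zero]
          have e3 : (if a = a ∧ b = 0 then kL (vac (y 0)) else 0) =
              if b = 0 then kL (vac (y b)) else 0 := by
            by_cases hb0 : b = 0
            · subst hb0; simp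
            · rw [if_neg (by omega), if_neg hb0]
          rwa [e3, sub_right_comm]
      · have e2 : Y a (b + 1) = 0 := if_neg (by omega)
        rw [e2, map_zero, smul_zero, sub_zero, if_neg (by omega), if_neg (by omega), add_zero, sub_zero]
        exact hlt a b (by omega)
    · rw [delta_of_not_inBox hab, (hF a b).2 hab,
        (invariantFamily_mem hq hqp hx a b).2 hab, sub_zero, sub_zero]
      exact zero_mem _
  have e : F = F - delta n p q α β Y - invariantFamily n p q (0, y 0, z q) + delta n p q α β Y +
      invariantFamily n p q (0, y 0, z q) := by abel
  rw [e]
  exact add_mem (add_mem (Submodule.mem_sup_left (Submodule.mem_sup_left hR))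
    (delta_mem_invariantModExact hY)) (invariantFamily_mem_invariantModExact hx)

/-- Induction on the number of columns to the right of `m`. A column `kL y` modulo relations is
cancelled by the differential of `y` placed in the next column. Closedness then makes that next
column `kL`-closed modulo relations, hence again of this form, because its length exceeds `q`. -/
theorem mem_of_columns (h : IsAdmissible p q α β) (k : ℕ) : ∀ m, m + k = p → q ≤ m →
    ∀ F ∈ families n p q, delta n p q α β F ∈ relFamilies n → (∀ a b, a < m → F a b ∈ rel n a b) →
    (∀ b, 0 ≤ b → b ≤ q → ∃ y ∈ bidegree n (m + 1) b, F m b - kL y ∈ rel n m b) →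
    F ∈ invariantModExact n p q α β := by
  have hq := h.one_le
  induction k with
  | zero =>
    intro m hm _ F hF hδ hlt hy
    obtain rfl : m = p := by omega
    exact h.mem_of_last_column hF hδ hlt hy
  | succ k ih =>
    intro m hm hqm F hF hδ hlt hy
    choose! y hy hFy using hy
    let Y : ℤ → ℤ → Fock n := fun a b => if a = m + 1 ∧ 0 ≤ b ∧ b ≤ q then
      (α (m + 1))⁻¹ • y b else 0
    have hY : Y ∈ families n p q := fun a b => by
      by_cases hab : a = m + 1 ∧ 0 ≤ b ∧ b ≤ q
      · simp only [Y, if_pos hab]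
        obtain ⟨rfl, hb, hbq⟩ := hab
        refine ⟨Submodule.smul_mem _ _ (hy b hb hbq), fun h => absurd ?_ h⟩
        unfold InBox; omega
      · simp only [Y, if_neg hab]
        exact ⟨zero_mem _, fun _ => trivial⟩
    have hF' : F - delta n p q α β Y ∈ families n p q := sub_mem hF (delta_mem hY)
    have hδ' : delta n p q α β (F - delta n p q α β Y) ∈ relFamilies n := by
      rw [map_sub, h.delta_delta hY, sub_zero]
      exact hδ
    have hlt' : ∀ a b, a < m + 1 → (F - delta n p q α β Y) a b ∈ rel n a b := by
      intro a b ham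
      rw [Pi.sub_apply, Pi.sub_apply]
      by_cases hab : InBox p q a b
      · rw [delta_of_inBox hab]
        have e2 : Y a (b + 1) = 0 := if_neg (by omega)
        rw [e2, map_zero, smul_zero, add_zero]
        unfold InBox at hab
        by_cases hm' : a = m
        · subst hm'
          have e1 : Y (a + 1) b = (α (a + 1))⁻¹ • y b := if_pos (by omega)
          rw [e1, map_smul, smul_smul, mul_inv_cancel₀ (h.left_ne_zero (a + 1) (by omega) (by omega)),
            one_smul]
          exact hFy b (by omega) (by omega)
        · have e1 : Y (a + 1) b = 0 := if_neg (by omega)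
          rw [e1, map_zero, smul_zero, sub_zero]
          exact hlt a b (by omega)
      · rw [delta_of_not_inBox hab, (hF a b).2 hab, sub_zero]
        exact zero_mem _
    have := ih (m + 1) (by push_cast at hm; omega) (by omega) _ hF' hδ' hlt' fun b hb hbq => by
      have h1 := hδ' m b
      rw [delta_apply hF' hqm hb] at h1
      have h2 : kT (ktCoeff m (b + 1)) ((F - delta n p q α β Y) m (b + 1)) ∈ rel n m b := by
        by_cases hb' : InBox p q m (b + 1)
        · have := kT_mem_rel (by unfold InBox at hb'; omega) (hlt' m (b + 1) (by omega))
          rwa [add_sub_cancel_right] at this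
        · rw [(hF' _ _).2 hb', map_zero]
          exact zero_mem _
      rw [Submodule.add_mem_iff_left _ (Submodule.smul_mem _ _ h2),
        Submodule.smul_mem_iff _ (h.left_ne_zero (m + 1) (by omega) (by omega)),
        ← add_sub_cancel_right m 1] at h1
      rw [add_sub_cancel_right m 1] at h1
      exact exists_sub_kL_mem_rel (by omega) (by omega) (hF' _ _).1
        (by rwa [add_sub_cancel_right])
    have e : F = F - delta n p q α β Y + delta n p q α β Y := by abel
    rw [e]
    exact add_mem this (delta_mem_invariantModExact hY)

/-- Every closed family is cohomologous to a family of invariants. -/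
theorem mem_of_delta_mem (h : IsAdmissible p q α β) {F : ℤ → ℤ → Fock n}
    (hF : F ∈ families n p q) (hδ : delta n p q α β F ∈ relFamilies n) :
    F ∈ invariantModExact n p q α β := by
  have hq := h.one_le
  have hqp := h.le
  -- In the shortest column closedness makes `kR (F q b)` a relation plus a `kL`-image, so the
  -- second Poincaré lemma applies; its vacuum term at `b = 0` is the undifferentiated last ghost.
  have key : ∀ b, 0 ≤ b → b ≤ q → ∃ z ∈ bidegree n q (b + 1), ∃ y ∈ bidegree n (q + 1) b,
      F q b - (if b = 0 then vac (F q b) else 0) -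
        (if b < q then kT (ktCoeff q (b + 1)) z else 0) - kL y ∈ rel n q b := by
    intro b hb hbq
    have h1 : ∃ u ∈ rel n q (b - 1), ∃ y' ∈ bidegree n (q + 1) (b - 1), kR (F q b) = u + kL y' := by
      rcases eq_or_lt_of_le hb with rfl | hb0
      · refine ⟨0, zero_mem _, 0, zero_mem _, ?_⟩
        rw [map_zero, add_zero]
        exact eq_zero_of_right_neg (by omega) (kR_mem (hF q 0).1)
      · have h2 := hδ q (b - 1)
        rw [delta_apply hF le_rfl (by omega), sub_add_cancel, kT_eq] at h2
        -- `kT` equals `(1 + c) • kR` up to a `kL`-image, so dividing by this coefficient isolates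
        -- `kR`.
        have hc : β q b * (1 + ktCoeff q b) ≠ 0 := by
          refine mul_ne_zero (h.right_ne_zero q b le_rfl hqp (by omega) hbq) ?_
          have : (b : ℝ) ≤ q := by exact_mod_cast hbq
          have : 0 < ktCoeff q b := inv_pos.2 (by linarith)
          linarith
        set c := β q b * (1 + ktCoeff q b)
        have hr : raise (F q b) ∈ bidegree n (q + 1) (b - 1) := raise_mem (hF q b).1
        refine ⟨_, Submodule.smul_mem _ c⁻¹ h2, -(c⁻¹ • (α (q + 1) • F (q + 1) (b - 1) -
          (β q b * ktCoeff q b) • raise (F q b))), neg_mem (Submodule.smul_mem _ _ (sub_mem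
            (Submodule.smul_mem _ _ (hF _ _).1) (Submodule.smul_mem _ _ hr))), ?_⟩
        have e : ∀ x y w : Fock n, c⁻¹ • (α (q + 1) • x + β q b • ((1 + ktCoeff q b) • y -
            ktCoeff q b • w)) + -(c⁻¹ • (α (q + 1) • x - (β q b * ktCoeff q b) • w)) = y := by
          intro x y w
          rw [← smul_neg, ← smul_add, smul_sub, smul_smul, smul_smul]
          have : ∀ s t r : Fock n, s + (t - r) + -(s - r) = t := fun s t r => by abel
          rw [this, smul_smul, inv_mul_cancel₀ hc, one_smul]
        rw [map_neg, map_smul, map_sub, map_smul, map_smul, e]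
    obtain ⟨u, hu, y', hy', e⟩ := h1
    obtain ⟨z, hz, y, hy, h5⟩ := exists_sub_kR_mem_rel hb (hF q b).1 hu hy' e
    by_cases hbq' : b < q
    · have hc : 1 + ktCoeff q (b + 1) ≠ 0 := by
        have : ((b + 1 : ℤ) : ℝ) ≤ q := by exact_mod_cast hbq'
        have : 0 < ktCoeff q (b + 1) := inv_pos.2 (by linarith)
        linarith
      set c := ktCoeff q (b + 1)
      have hr : raise z ∈ bidegree n (q + 1) b := by
        have := raise_mem hz
        rwa [add_sub_cancel_right] at this
      refine ⟨(1 + c)⁻¹ • z, Submodule.smul_mem _ _ hz, y + ((1 + c)⁻¹ * c) • raise z,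
        add_mem hy (Submodule.smul_mem _ _ hr), ?_⟩
      rw [if_pos hbq', kT_eq, map_add, map_smul, map_smul, map_smul, map_smul, smul_smul, smul_smul,
        mul_inv_cancel₀ hc, one_smul, mul_comm c]
      have e3 : ∀ f i s t r : Fock n, f - i - (s - t) - (r + t) = f - i - s - r := by
        intro f i s t r; abel
      rwa [e3]
    -- No tensor with columns of lengths `q` and `q + 1` is available as a primitive. But `z` has
    -- weight -1, so `z = lower u`, and `kR (lower u)` is `kL u` up to relations.
    · obtain rfl : b = q := by omega
      obtain ⟨u, hu, rfl⟩ := exists_lower_eq hz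
      refine ⟨0, zero_mem _, y + u, add_mem hy hu, ?_⟩
      rw [if_neg hbq', sub_zero, map_add]
      rw [kR_lower] at h5
      have h6 := sub_mem h5 (lower_mem_rel (kR_mem hu))
      have e3 : ∀ f i s t r : Fock n, f - i - (s - t) - r - t = f - i - (r + s) := by
        intro f i s t r; abel
      rwa [e3] at h6
  choose! z hz y hy hFy using key
  let Y : ℤ → ℤ → Fock n := fun a b => if a = q ∧ 1 ≤ b ∧ b ≤ q then
    (β q b)⁻¹ • z (b - 1) else 0
  have hY : Y ∈ families n p q := fun a b => by
    by_cases hab : a = q ∧ 1 ≤ b ∧ b ≤ q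
    · simp only [Y, if_pos hab]
      obtain ⟨rfl, hb, hbq⟩ := hab
      refine ⟨Submodule.smul_mem _ _ ?_, fun h => absurd ?_ h⟩
      · have := hz (b - 1) (by omega) (by omega)
        rwa [sub_add_cancel] at this
      · unfold InBox; omega
    · simp only [Y, if_neg hab]
      exact ⟨zero_mem _, fun _ => trivial⟩
  have hx : ((F q 0, 0, 0) : Fock n × Fock n × Fock n) ∈ invariantDomain n p q :=
    ⟨(hF q 0).1, zero_mem _, zero_mem _⟩
  have hI := invariantFamily_mem hq hqp hx
  have hF' : F - delta n p q α β Y - invariantFamily n p q (F q 0, 0, 0) ∈ families n p q :=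
    sub_mem (sub_mem hF (delta_mem hY)) hI
  have := h.mem_of_columns (p - q).toNat q (by omega) le_rfl _ hF' (by
    rw [map_sub, map_sub, h.delta_delta hY, delta_invariantFamily hq, sub_zero, sub_zero]
    exact hδ) (fun a b ha => by
      rw [(hF' a b).2 (by unfold InBox; omega)]
      exact zero_mem _) fun b hb hbq => ⟨y b, hy b hb hbq, by
    rw [Pi.sub_apply, Pi.sub_apply, Pi.sub_apply, Pi.sub_apply, delta_apply hY le_rfl hb,
      invariantFamily_apply]
    have e1 : Y (q + 1) b = 0 := if_neg (by omega)
    have e2 : β q (b + 1) • kT (ktCoeff q (b + 1)) (Y q (b + 1)) =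
        if b < q then kT (ktCoeff q (b + 1)) (z b) else 0 := by
      by_cases hbq' : b < q
      · have e3 : Y q (b + 1) = (β q (b + 1))⁻¹ • z b :=
          (if_pos ⟨rfl, by omega, by omega⟩).trans (by rw [add_sub_cancel_right])
        rw [if_pos hbq', e3, map_smul, smul_smul, mul_inv_cancel₀
          (h.right_ne_zero q (b + 1) le_rfl hqp (by omega) (by omega)), one_smul]
      · have e3 : Y q (b + 1) = 0 := if_neg (by omega)
        rw [if_neg hbq', e3, map_zero, smul_zero]
    have e4 : (if q = q ∧ b = 0 then vac (F q 0) else 0) = if b = 0 then vac (F q b) else 0 := by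
      by_cases hb0 : b = 0
      · subst hb0; simp
      · rw [if_neg (by omega), if_neg hb0]
    rw [e1, e2, e4]
    simp only [map_zero, smul_zero, ite_self, zero_add, add_zero]
    rw [sub_right_comm (F q b)]
    exact hFy b hb hbq⟩
  have e : F = F - delta n p q α β Y - invariantFamily n p q (F q 0, 0, 0) + delta n p q α β Y +
      invariantFamily n p q (F q 0, 0, 0) := by abel
  rw [e]
  exact add_mem (add_mem this (delta_mem_invariantModExact hY))
    (invariantFamily_mem_invariantModExact hx)

end IsAdmissible

theorem scale_vac (f : ℕ → ℝ) (v : Fock n) : scale f (vac v) = f 0 • vac v := by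
  have h : (sc f * sc fun k => if k = 0 then 1 else 0 : Module.End ℝ (Poly n)) =
      f 0 • sc fun k => if k = 0 then 1 else 0 := Finsupp.lhom_ext fun ρ c => by
    rw [Module.End.mul_apply, sc_single, LinearMap.smul_apply, sc_single, sc_single,
      Finsupp.smul_single, smul_eq_mul]
    split_ifs with h
    · rw [h]
    · simp
  have h2 : (scale f * vac : Module.End ℝ (Fock n)) = f 0 • vac := by
    rw [vac, scale, scale, op_mul, h, op_smul_right, mul_one]
  exact LinearMap.congr_fun h2 v

/-- A family of invariants is exact only if it is trivial. -/
theorem invariantFamily_mem_relFamilies (hq : 1 ≤ q) (hqp : q ≤ p) {x : Fock n × Fock n × Fock n}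
    (hx : x ∈ invariantDomain n p q) {Y : ℤ → ℤ → Fock n} (hY : Y ∈ families n p q)
    (h : invariantFamily n p q x - delta n p q α β Y ∈ relFamilies n) :
    invariantFamily n p q x ∈ relFamilies n := by
  obtain ⟨g, d, z⟩ := x
  obtain ⟨hg, hd, hz⟩ := hx
  -- Both parts of the differential create a boson, and so does the curl; the part without bosons
  -- sees only the ghost.
  have hg0 : vac g = 0 := by
    have h1 := eq_zero_of_mem_rel_zero (h q 0)
    rw [Pi.sub_apply, Pi.sub_apply, delta_apply hY le_rfl le_rfl, invariantFamily_apply,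
      if_pos ⟨rfl, rfl⟩, if_neg (c := q = p ∧ 0 = q) (by omega), add_zero] at h1
    have h2 := congrArg vac h1
    have e : vac (if q = p ∧ (0 : ℤ) = 0 then kL (vac d) else 0) = 0 := by
      split_ifs
      · exact vac_kL _
      · exact map_zero _
    rwa [map_sub, map_add, map_add, map_smul, map_smul, vac_kL, vac_kT, e, vac_vac, smul_zero, smul_zero,
      add_zero, add_zero, sub_zero, map_zero] at h2
  -- At `(p, 0)` the only incoming term is `kT (Y p 1)`. After projection onto one boson, `dL` sends
  -- the curl of `d` to `(p + 1) • vac d` and annihilates `kT` of a vector without bosons.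
  have hd0 : vac d = 0 := by
    have h1 := eq_zero_of_mem_rel_zero (h p 0)
    rw [Pi.sub_apply, Pi.sub_apply, delta_apply hY hqp le_rfl, invariantFamily_apply, hg0, ite_self,
      zero_add, if_pos ⟨rfl, rfl⟩, if_neg (by omega), add_zero,
      (hY (p + 1) 0).2 (by unfold InBox; omega), map_zero, smul_zero, zero_add, zero_add] at h1
    have hone : (fun k : ℕ => if k + 1 = 1 then (1 : ℝ) else 0) = fun k => if k = 0 then 1 else 0 :=
      funext fun k => by simp
    have h2 := congrArg (scale fun k => if k = 1 then 1 else 0) h1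
    rw [map_sub, map_smul, scale_kL, scale_kT, hone, map_zero, scale_vac, if_pos rfl, one_smul] at h2
    have hW : vac (Y p 1) ∈ bidegree n p 1 := vac_mem (hY p 1).1
    have hD : vac d ∈ bidegree n (p + 1) 0 := vac_mem hd
    have dLkL : ∀ {a b : ℤ} {v : Fock n}, v ∈ bidegree n a b → dL (kL (vac v)) = (a : ℝ) • vac v := by
      intro a b v hv
      have := kL_dL (vac_mem hv)
      rw [show dL (vac v) = 0 from dL_scale v, map_zero, scale_vac, Nat.cast_zero, zero_add] at this
      exact (sub_eq_zero.1 this.symm).symm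
    have h3 := congrArg dL h2
    rw [map_sub, map_smul, dLkL hd, map_zero] at h3
    have h4 : dL (kT (ktCoeff p 1) (vac (Y p 1))) = 0 := by
      rw [kT_apply, map_add, map_smul, dL_kR, dL_raise, dLkL (hY p 1).1,
        show dL (vac (Y p 1)) = 0 from dL_scale _, map_zero, zero_add, map_smul, smul_neg, smul_smul]
      -- `dL` turns `kR` into `raise` and `raise * kL` into `-p • raise` on such a vector; the
      -- coefficient `1 / p` makes them cancel.
      have : ktCoeff p 1 * (p : ℝ) = 1 := by
        have : (1 : ℝ) ≤ p := by exact_mod_cast hq.trans hqp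
        rw [ktCoeff, Int.cast_one, sub_add_cancel]
        exact inv_mul_cancel₀ (by linarith)
      rw [this, one_smul, add_neg_cancel]
    change ((p + 1 : ℤ) : ℝ) • vac d - β p 1 • dL (kT (ktCoeff p 1) (vac (Y p 1))) = 0 at h3
    rw [h4, smul_zero, sub_zero] at h3
    have hp : ((p + 1 : ℤ) : ℝ) ≠ 0 := by exact_mod_cast (by omega : p + 1 ≠ 0)
    have h5 := congrArg ((((p + 1 : ℤ) : ℝ)⁻¹) • ·) h3
    simpa only [smul_smul, inv_mul_cancel₀ hp, one_smul, smul_zero] using h5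
  intro a b
  rw [invariantFamily_apply, hg0, hd0, map_zero, ite_self, ite_self, zero_add, zero_add]
  -- At the corner `(p, q)` nothing comes in, so the difference is the curvature term itself.
  split_ifs with hab
  · obtain ⟨rfl, rfl⟩ := hab
    have h1 := h a b
    rw [Pi.sub_apply, Pi.sub_apply, delta_apply hY hqp (by omega), invariantFamily_apply, hg0, hd0,
      map_zero, ite_self, ite_self, zero_add, zero_add, if_pos ⟨rfl, rfl⟩,
      (hY (a + 1) b).2 (by unfold InBox; omega), (hY a (b + 1)).2 (by unfold InBox; omega), map_zero,
      map_zero, smul_zero, smul_zero, add_zero, sub_zero] at h1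
    exact h1
  · exact zero_mem _

end Families

section Antisymmetrization

variable {n : ℕ} {V V' : Type*} [AddCommGroup V] [Module ℝ V] [AddCommGroup V'] [Module ℝ V']

/-! ### Antisymmetrization and the exterior algebra -/

theorem alt_ofFn (T : List (Fin n) → V) {a : ℕ} (f : Fin a → Fin n) :
    alt T (List.ofFn f) = (a.factorial : ℝ)⁻¹ • ∑ σ : Equiv.Perm (Fin a),
      ((Equiv.Perm.sign σ : ℤ) : ℝ) • T (List.ofFn (f ∘ σ)) := by
  have key : ∀ (l : List (Fin n)) (b : ℕ) (h : l.length = b), alt T l =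
      (b.factorial : ℝ)⁻¹ • ∑ σ : Equiv.Perm (Fin b),
        ((Equiv.Perm.sign σ : ℤ) : ℝ) • T (List.ofFn fun k => l.get (Fin.cast h.symm (σ k))) := by
    rintro l b rfl
    rfl
  rw [key _ a (List.length_ofFn)]
  congr 1
  refine Finset.sum_congr rfl fun σ _ => ?_
  congr 3
  funext k
  simp

theorem exists_eq_ofFn {l : List (Fin n)} {a : ℕ} (h : l.length = a) :
    ∃ f : Fin a → Fin n, l = List.ofFn f := by
  subst h
  exact ⟨l.get, (List.ofFn_get l).symm⟩

theorem map_alt (L : V →ₗ[ℝ] V') (T : List (Fin n) → V) (l : List (Fin n)) :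
    L (alt T l) = alt (fun m => L (T m)) l := by
  simp only [alt, map_smul, map_sum]

theorem alt_congr {T U : List (Fin n) → V} {l : List (Fin n)}
    (h : ∀ m, m.length = l.length → T m = U m) : alt T l = alt U l := by
  rw [alt, alt]
  congr 1
  exact Finset.sum_congr rfl fun σ _ => by rw [h _ List.length_ofFn]

theorem alt_eq_zero (l : List (Fin n)) : alt (fun _ : List (Fin n) => (0 : V)) l = 0 := by
  have h : (0 : V →ₗ[ℝ] V) (alt (fun _ => (0 : V)) l) = _ := map_alt _ _ l
  exact h.symm

/-- Antisymmetrization after a permutation of the indices. -/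
theorem alt_eq_sign_smul_alt {T U : List (Fin n) → V} {a : ℕ} (π : Equiv.Perm (Fin a))
    (h : ∀ g : Fin a → Fin n, T (List.ofFn g) = U (List.ofFn (g ∘ π))) {l : List (Fin n)}
    (hl : l.length = a) : alt T l = ((Equiv.Perm.sign π : ℤ) : ℝ) • alt U l := by
  obtain ⟨f, rfl⟩ := exists_eq_ofFn hl
  rw [alt_ofFn, alt_ofFn, smul_comm]
  congr 1
  rw [Finset.smul_sum]
  refine Fintype.sum_equiv (Equiv.mulRight π) _ _ fun σ => ?_
  rw [h, Equiv.coe_mulRight, Equiv.Perm.sign_mul, smul_smul]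
  congr 1
  have : ((Equiv.Perm.sign π : ℤ) : ℝ) * ((Equiv.Perm.sign π : ℤ) : ℝ) = 1 := by
    rw [← Int.cast_mul, Int.units_coe_mul_self, Int.cast_one]
  push_cast
  rw [mul_comm, mul_assoc, this, mul_one]

theorem wedge_ofFn {a : ℕ} (f : Fin a → Fin n) :
    wedge (List.ofFn f) = ExteriorAlgebra.ιMulti ℝ a fun k => (Pi.single (f k) 1 : Fin n → ℝ) := by
  rw [ExteriorAlgebra.ιMulti_apply, wedge, List.map_ofFn]
  rfl

theorem wedge_ofFn_comp {a : ℕ} (f : Fin a → Fin n) (σ : Equiv.Perm (Fin a)) :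
    wedge (List.ofFn (f ∘ σ)) = ((Equiv.Perm.sign σ : ℤ) : ℝ) • wedge (List.ofFn f) := by
  have h : wedge (List.ofFn (f ∘ σ)) = Equiv.Perm.sign σ • wedge (List.ofFn f) := by
    rw [wedge_ofFn, wedge_ofFn]
    exact AlternatingMap.map_perm (ExteriorAlgebra.ιMulti ℝ a)
      (fun k => (Pi.single (f k) 1 : Fin n → ℝ)) σ
  rw [h]
  rcases Int.units_eq_one_or (Equiv.Perm.sign σ) with e | e <;> simp [e]

/-- An alternating expression is its own antisymmetrization. -/
theorem alt_wedge (L : Ext n →ₗ[ℝ] V) (l : List (Fin n)) :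
    alt (fun m => L (wedge m)) l = L (wedge l) := by
  obtain ⟨f, hf⟩ := exists_eq_ofFn (l := l) rfl
  rw [hf, alt_ofFn]
  generalize l.length = a at f
  have h : ∀ σ : Equiv.Perm (Fin a), ((Equiv.Perm.sign σ : ℤ) : ℝ) • L (wedge (List.ofFn (f ∘ σ))) =
      L (wedge (List.ofFn f)) := fun σ => by
    rw [wedge_ofFn_comp, map_smul, smul_smul, ← Int.cast_mul, Int.units_coe_mul_self, Int.cast_one,
      one_smul]
  rw [Finset.sum_congr rfl fun σ _ => h σ, Finset.sum_const, Finset.card_univ, Fintype.card_perm,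
    Fintype.card_fin, ← Nat.cast_smul_eq_nsmul ℝ, smul_smul, inv_mul_cancel₀, one_smul]
  exact_mod_cast Nat.factorial_ne_zero a

/-- Contraction of an exterior product. -/
theorem an_wedge_ofFn (m : Fin n) {a : ℕ} (f : Fin (a + 1) → Fin n) :
    an m (wedge (List.ofFn f)) = ∑ k : Fin (a + 1), (-1 : ℝ) ^ (k : ℕ) •
      if m = f k then wedge (List.ofFn (f ∘ k.succAbove)) else 0 := by
  induction a with
  | zero =>
    rw [Fin.sum_univ_one, List.ofFn_succ, wedge_cons, an_cr, List.ofFn_zero, wedge_nil, an_one, map_zero,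
      sub_zero, List.ofFn_zero, wedge_nil]
    simp
  | succ a ih =>
    rw [List.ofFn_succ, wedge_cons, an_cr, ih, Fin.sum_univ_succ (n := a + 1), map_sum, sub_eq_add_neg,
      ← Finset.sum_neg_distrib]
    congr 1
    · rw [Fin.val_zero, pow_zero, one_smul]
      rfl
    · refine Finset.sum_congr rfl fun k _ => ?_
      rw [map_smul, apply_ite (cr (f 0)), map_zero, ← wedge_cons, Fin.val_succ, pow_succ, mul_neg_one,
        neg_smul, List.ofFn_succ (f := f ∘ k.succ.succAbove)]
      simp [Function.comp_def]

theorem sum_an_wedge_ofFn (Z : Fin n → Ext n →ₗ[ℝ] V) {a : ℕ} (f : Fin (a + 1) → Fin n) :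
    ∑ m, Z m (an m (wedge (List.ofFn f))) =
      ∑ k : Fin (a + 1), (-1 : ℝ) ^ (k : ℕ) • Z (f k) (wedge (List.ofFn (f ∘ k.succAbove))) := by
  simp only [an_wedge_ofFn, map_sum, map_smul]
  rw [Finset.sum_comm]
  refine Finset.sum_congr rfl fun k _ => ?_
  rw [Finset.sum_eq_single (f k) (fun m _ hm => by rw [if_neg hm, map_zero, smul_zero])
    (fun h => absurd (Finset.mem_univ _) h), if_pos rfl]

/-- A contraction expands over the position `k` of the removed factor. Under the antisymmetrization
the cycle that brings position `k` to the front shows that all positions contribute equally, whence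
the factor `a + 1`. -/
theorem alt_cons_wedge (Z : Fin n → Ext n →ₗ[ℝ] V) {T : List (Fin n) → V} {a : ℕ}
    (hT : ∀ k m, m.length = a → T (k :: m) = Z k (wedge m)) {μ : List (Fin n)}
    (hμ : μ.length = a + 1) :
    ((a + 1 : ℕ) : ℝ) • alt T μ = ∑ m, Z m (an m (wedge μ)) := by
  have h1 : ∑ m, Z m (an m (wedge μ)) = alt (fun l => ∑ m, Z m (an m (wedge l))) μ := by
    have := alt_wedge (∑ m, Z m ∘ₗ an m) μ
    simp only [LinearMap.sum_apply, LinearMap.comp_apply] at this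
    exact this.symm
  rw [h1]
  obtain ⟨f, rfl⟩ := exists_eq_ofFn hμ
  have hT' : ∀ g : Fin (a + 1) → Fin n, T (List.ofFn g) = Z (g 0) (wedge (List.ofFn (g ∘ Fin.succ))) :=
    fun g => by rw [List.ofFn_succ, hT _ _ List.length_ofFn]; rfl
  rw [alt_ofFn, alt_ofFn, smul_comm]
  congr 1
  simp only [sum_an_wedge_ofFn, hT', Finset.smul_sum]
  rw [Finset.sum_comm (s := (Finset.univ : Finset (Equiv.Perm (Fin (a + 1)))))]
  have h2 : ∀ k : Fin (a + 1), ∑ σ : Equiv.Perm (Fin (a + 1)), ((Equiv.Perm.sign σ : ℤ) : ℝ) •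
      (-1 : ℝ) ^ (k : ℕ) • Z ((f ∘ σ) k) (wedge (List.ofFn ((f ∘ σ) ∘ k.succAbove))) =
      ∑ σ : Equiv.Perm (Fin (a + 1)), ((Equiv.Perm.sign σ : ℤ) : ℝ) •
        Z ((f ∘ σ) 0) (wedge (List.ofFn ((f ∘ σ) ∘ Fin.succ))) := fun k => by
    symm
    refine Fintype.sum_equiv (Equiv.mulRight k.cycleRange) _ _ fun σ => ?_
    rw [Equiv.coe_mulRight, Equiv.Perm.sign_mul, Fin.sign_cycleRange, smul_smul]
    have e1 : (f ∘ ⇑(σ * k.cycleRange)) k = (f ∘ σ) 0 := by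
      simp
    have e2 : (f ∘ ⇑(σ * k.cycleRange)) ∘ k.succAbove = (f ∘ σ) ∘ Fin.succ := by
      funext j
      simp [Fin.cycleRange_succAbove]
    rw [e1, e2]
    congr 1
    push_cast
    rw [mul_assoc, ← mul_pow, neg_one_mul, neg_neg, one_pow, mul_one]
  rw [Finset.sum_congr rfl fun k _ => h2 k, Finset.sum_const, Finset.card_univ, Fintype.card_fin,
    ← Nat.cast_smul_eq_nsmul ℝ, Finset.smul_sum]

/-- The antisymmetrization depends only on the antisymmetrization in all but the first index. -/
theorem alt_cons_congr {T U : List (Fin n) → V} {a : ℕ}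
    (h : ∀ k m, m.length = a → alt (fun l => T (k :: l)) m = alt (fun l => U (k :: l)) m)
    {μ : List (Fin n)} (hμ : μ.length = a + 1) : alt T μ = alt U μ := by
  obtain ⟨f, rfl⟩ := exists_eq_ofFn hμ
  -- A permutation of `a + 1` indices is given by the image `k` of the first one and a permutation
  -- of the rest, up to the transposition of `0` and `k`. The inner sum antisymmetrizes all but the
  -- first index.
  have key : ∀ W : List (Fin n) → V, ∑ σ : Equiv.Perm (Fin (a + 1)),
      ((Equiv.Perm.sign σ : ℤ) : ℝ) • W (List.ofFn (f ∘ σ)) =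
      ∑ k : Fin (a + 1), (if k = 0 then (1 : ℝ) else -1) • (a.factorial : ℝ) •
        alt (fun l => W (f k :: l)) (List.ofFn fun j : Fin a => f (Equiv.swap 0 k j.succ)) := by
    intro W
    rw [← Equiv.Perm.decomposeFin.symm.sum_comp, Fintype.sum_prod_type]
    refine Finset.sum_congr rfl fun k _ => ?_
    rw [alt_ofFn, smul_smul (a.factorial : ℝ), mul_inv_cancel₀
      (by exact_mod_cast Nat.factorial_ne_zero a), one_smul, Finset.smul_sum]
    refine Finset.sum_congr rfl fun σ _ => ?_
    have e : f ∘ ⇑(Equiv.Perm.decomposeFin.symm (k, σ)) =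
        Fin.cons (f k) ((fun j : Fin a => f (Equiv.swap 0 k j.succ)) ∘ σ) := by
      funext j
      refine Fin.cases ?_ (fun j => ?_) j
      · simp
      · simp
    rw [e, List.ofFn_cons, Equiv.Perm.decomposeFin.symm_sign, smul_smul]
    congr 1
    split_ifs <;> simp
  rw [alt_ofFn, alt_ofFn, key, key]
  congr 1
  refine Finset.sum_congr rfl fun k _ => ?_
  rw [h _ _ List.length_ofFn]

/-- Laplace expansion along the first index. -/
theorem alt_eq_sum_an (Z : Fin n → Ext n →ₗ[ℝ] V) {T : List (Fin n) → V} {a : ℕ}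
    (hT : ∀ k m, m.length = a → alt (fun l => T (k :: l)) m = Z k (wedge m)) {μ : List (Fin n)}
    (hμ : μ.length = a + 1) :
    ((a + 1 : ℕ) : ℝ) • alt T μ = ∑ m, Z m (an m (wedge μ)) := by
  let U : List (Fin n) → V := fun l => match l with
    | [] => 0
    | k :: m => Z k (wedge m)
  rw [alt_cons_congr (U := U) (fun k m hm => by rw [hT k m hm]; exact (alt_wedge (Z k) m).symm) hμ]
  exact alt_cons_wedge Z (fun _ _ _ => rfl) hμ

/-- Laplace expansion along the last index. -/
theorem alt_concat_eq_sum_an (Z : Fin n → Ext n →ₗ[ℝ] V) {T : List (Fin n) → V} {a : ℕ}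
    (hT : ∀ k m, m.length = a → T (m ++ [k]) = Z k (wedge m)) {μ : List (Fin n)}
    (hμ : μ.length = a + 1) :
    ((a + 1 : ℕ) : ℝ) • alt T μ = (-1 : ℝ) ^ a • ∑ m, Z m (an m (wedge μ)) := by
  let U : List (Fin n) → V := fun l => match l with
    | [] => 0
    | k :: m => Z k (wedge m)
  -- Rotating the last index to the front has sign `(-1) ^ a` and reduces to expansion along the
  -- first index.
  have h := alt_eq_sign_smul_alt (T := T) (U := U) (finRotate (a + 1))⁻¹ (fun g => by
    have e1 : g ∘ ⇑(finRotate (a + 1))⁻¹ = Fin.cons (g (Fin.last a)) (g ∘ Fin.castSucc) := by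
      funext j
      refine Fin.cases ?_ (fun j => ?_) j
      · have : (finRotate (a + 1))⁻¹ 0 = Fin.last a := by
          rw [Equiv.Perm.inv_eq_iff_eq, finRotate_last]
        rw [Function.comp_apply, this, Fin.cons_zero]
      · have : (finRotate (a + 1))⁻¹ j.succ = j.castSucc := by
          rw [Equiv.Perm.inv_eq_iff_eq, finRotate_apply, Fin.coeSucc_eq_succ]
        rw [Function.comp_apply, this, Fin.cons_succ, Function.comp_apply]
    rw [e1, List.ofFn_cons, List.ofFn_succ', List.concat_eq_append, hT _ _ List.length_ofFn]
    rfl) hμ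
  rw [h, smul_comm, alt_cons_wedge Z (T := U) (fun _ _ _ => rfl) hμ, Equiv.Perm.sign_inv,
    sign_finRotate]
  push_cast
  rfl

/-- The extension of an alternating expression in `a` indices to the exterior algebra. -/
theorem exists_extension (T : List (Fin n) → V) (a : ℕ) :
    ∃ L : Ext n →ₗ[ℝ] V, ∀ μ, μ.length = a → L (wedge μ) = alt T μ := by
  -- The multilinear map with the values of `T` on basis vectors; its alternatization divided by
  -- `a!` descends to the exterior algebra.
  let B : MultilinearMap ℝ (fun _ : Fin a => Fin n → ℝ) V := ∑ f : Fin a → Fin n,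
    ((MultilinearMap.mkPiAlgebra ℝ (Fin a) ℝ).compLinearMap fun i =>
      LinearMap.proj (f i)).smulRight (T (List.ofFn f))
  have hB : ∀ g : Fin a → Fin n, B (fun k => Pi.single (g k) 1) = T (List.ofFn g) := fun g => by
    simp only [B, sum_apply, MultilinearMap.smulRight_apply,
      MultilinearMap.compLinearMap_apply, MultilinearMap.mkPiAlgebra_apply, LinearMap.proj_apply]
    rw [Finset.sum_eq_single g]
    · simp
    · intro f _ hf
      obtain ⟨k, hk⟩ := Function.ne_iff.1 hf
      rw [Finset.prod_eq_zero (Finset.mem_univ k), zero_smul]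
      rw [Pi.single_apply, if_neg hk]
    · exact fun h => absurd (Finset.mem_univ _) h
  refine ⟨(ExteriorAlgebra.liftAlternating (R := ℝ) (M := Fin n → ℝ)
    (Pi.single a ((a.factorial : ℝ)⁻¹ • MultilinearMap.alternatization B)) :
      ExteriorAlgebra ℝ (Fin n → ℝ) →ₗ[ℝ] V), fun μ hμ => ?_⟩
  obtain ⟨f, rfl⟩ := exists_eq_ofFn hμ
  rw [wedge_ofFn, alt_ofFn]
  refine (ExteriorAlgebra.liftAlternating_apply_ιMulti _ _).trans ?_
  rw [Pi.single_eq_same, AlternatingMap.smul_apply, MultilinearMap.alternatization_apply]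
  congr 1
  refine Finset.sum_congr rfl fun σ _ => ?_
  have h : (B.domDomCongr σ) (fun k => (Pi.single (f k) 1 : Fin n → ℝ)) = T (List.ofFn (f ∘ σ)) :=
    hB (f ∘ σ)
  change Equiv.Perm.sign σ • (B.domDomCongr σ) (fun k => (Pi.single (f k) 1 : Fin n → ℝ)) = _
  rw [h]
  rcases Int.units_eq_one_or (Equiv.Perm.sign σ) with e | e <;> simp [e]

end Antisymmetrization

section GaugeTransformation

variable {n : ℕ}

/-! ### The gauge transformations as operators on the Fock space -/

theorem wedge_append (μ ν : List (Fin n)) : wedge (μ ++ ν) = wedge μ * wedge ν := by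
  rw [wedge, List.map_append, List.prod_append]
  rfl

theorem wedge_concat (μ : List (Fin n)) (k : Fin n) :
    wedge (μ ++ [k]) = (-1 : ℝ) ^ μ.length • cr k (wedge μ) := by
  induction μ with
  | nil => rw [List.nil_append, wedge_cons, List.length_nil, pow_zero, one_smul]
  | cons m μ ih =>
    rw [List.cons_append, wedge_cons, ih, map_smul, cr_cr, wedge_cons, List.length_cons, pow_succ,
      mul_neg_one, neg_smul, smul_neg]

theorem num_apply {b : ℤ} {y : Ext n} (hy : y ∈ formsOfDegree n b) : num y = (b : ℝ) • y := by
  induction hy using Submodule.span_induction with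
  | zero => rw [map_zero, smul_zero]
  | add x x' _ _ h h' => rw [map_add, h, h', smul_add]
  | smul c x _ h => rw [map_smul, h, smul_comm]
  | mem x hx =>
    obtain ⟨ν, rfl, rfl⟩ := hx
    exact_mod_cast num_wedge ν

/-- Multiplication by a form in the first column. -/
def leftMul (y : Ext n) : Module.End ℝ (Fock n) := op (LinearMap.mulLeft ℝ y) 1 1

theorem leftMul_add (x y : Ext n) : leftMul (x + y) = leftMul x + leftMul y := by
  rw [leftMul, leftMul, leftMul, ← op_add_left]
  congr 1
  exact LinearMap.ext fun z => add_mul x y z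

theorem leftMul_smul (c : ℝ) (y : Ext n) : leftMul (c • y) = c • leftMul y := by
  rw [leftMul, leftMul, ← op_smul_left]
  congr 1
  exact LinearMap.ext fun z => smul_mul_assoc c y z

theorem leftMul_one : leftMul (1 : Ext n) = 1 := by
  rw [← op_one, leftMul]
  congr 1
  exact LinearMap.ext fun z => one_mul z

theorem leftMul_sum {ι : Type*} (s : Finset ι) (y : ι → Ext n) :
    leftMul (∑ k ∈ s, y k) = ∑ k ∈ s, leftMul (y k) :=
  map_sum (AddMonoidHom.mk' leftMul leftMul_add) _ _

theorem op_cr_mul_leftMul (m : Fin n) (y : Ext n) : op (cr m) 1 1 * leftMul y = leftMul (cr m y) := by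
  rw [leftMul, op_mul, leftMul, mul_one, mul_one]
  congr 1
  exact LinearMap.ext fun z => (mul_assoc (gen m) y z).symm

/-- The operation `O ↦ ∑ cL O aR`, which inserts a normal-ordered raising operator. -/
def insertRaise (O : Module.End ℝ (Fock n)) : Module.End ℝ (Fock n) :=
  ∑ m, op (cr m) 1 1 * O * op 1 (an m) 1

theorem insertRaise_smul (c : ℝ) (O : Module.End ℝ (Fock n)) :
    insertRaise (c • O) = c • insertRaise O := by
  simp only [insertRaise, mul_smul_comm, smul_mul_assoc, Finset.smul_sum]

theorem iterate_insertRaise_smul (c : ℝ) (O : Module.End ℝ (Fock n)) (k : ℕ) :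
    insertRaise^[k] (c • O) = c • insertRaise^[k] O := by
  induction k with
  | zero => rfl
  | succ k ih => rw [Function.iterate_succ_apply', ih, insertRaise_smul, Function.iterate_succ_apply']

/-- Each insertion contracts an index of `y` and multiplies it back into the first column from the
left; `b` insertions move all of `y`, in every order, whence the factorial. So the indices `ν` get
in front of the first column in the exchange term. -/
theorem iterate_insertRaise_pure (O : Module.End ℝ (Fock n)) (x : Ext n) (z : Poly n) (b : ℕ)
    {y : Ext n} (hy : y ∈ formsOfDegree n b) :
    (insertRaise^[b] O) (pure x y z) = (b.factorial : ℝ) • leftMul y (O (pure x 1 z)) := by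
  induction b generalizing y with
  | zero =>
    rw [Function.iterate_zero, id, Nat.factorial_zero, Nat.cast_one, one_smul]
    change O (pureHom x y z) = leftMul y (O (pureHom x 1 z))
    induction hy using Submodule.span_induction with
    | zero =>
      have h : leftMul (0 : Ext n) = 0 := by rw [← zero_smul ℝ (0 : Ext n), leftMul_smul, zero_smul]
      rw [map_zero, LinearMap.zero_apply, map_zero, h, LinearMap.zero_apply]
    | add y y' _ _ h h' =>
      rw [map_add, LinearMap.add_apply, map_add, h, h', leftMul_add, LinearMap.add_apply]
    | smul c y _ h =>
      rw [map_smul, LinearMap.smul_apply, map_smul, h, leftMul_smul, LinearMap.smul_apply]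
    | mem y hy =>
      obtain ⟨ν, hν, rfl⟩ := hy
      rw [show ν = [] from List.eq_nil_of_length_eq_zero (by exact_mod_cast hν), wedge_nil, leftMul_one,
        Module.End.one_apply]
  | succ b ih =>
    rw [Function.iterate_succ_apply', insertRaise, LinearMap.sum_apply]
    have h : ∀ m, (op (cr m) 1 1 * insertRaise^[b] O * op 1 (an m) 1) (pure x y z) =
        (b.factorial : ℝ) • leftMul (cr m (an m y)) (O (pure x 1 z)) := fun m => by
      have hm : an m y ∈ formsOfDegree n (b : ℤ) := by
        have := an_mem m hy
        rwa [Nat.cast_add, Nat.cast_one, add_sub_cancel_right] at this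
      rw [← op_cr_mul_leftMul, Module.End.mul_apply, Module.End.mul_apply, Module.End.mul_apply,
        ← map_smul, ← ih hm]
      rfl
    rw [Finset.sum_congr rfl fun m _ => h m, ← Finset.smul_sum, ← LinearMap.sum_apply, ← leftMul_sum]
    have hn : ∑ m, cr m (an m y) = ((b + 1 : ℕ) : ℝ) • y := by
      have := num_apply hy
      rw [num, LinearMap.sum_apply] at this
      exact_mod_cast this
    rw [hn, leftMul_smul, LinearMap.smul_apply, smul_smul, Nat.factorial_succ, mul_comm, Nat.cast_mul]

theorem lower_mul_op_cr (m : Fin n) : lower * op (cr m) 1 1 = op 1 (cr m) 1 - op (cr m) 1 1 * lower := by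
  simp only [lower, Finset.sum_mul, Finset.mul_sum, op_mul, one_mul, mul_one, an_mul_cr, op_sub_left,
    Finset.sum_sub_distrib]
  congr 1
  rw [Finset.sum_eq_single m (fun k _ hk => by rw [if_neg hk, op_zero_left])
    (fun h => absurd (Finset.mem_univ m) h), if_pos rfl]

/-- The operation `O ↦ ∑ cR O aR`. -/
def insertNum (O : Module.End ℝ (Fock n)) : Module.End ℝ (Fock n) :=
  ∑ m, op 1 (cr m) 1 * O * op 1 (an m) 1

theorem lower_mul_insertRaise (O : Module.End ℝ (Fock n)) :
    lower * insertRaise O = insertNum O - insertRaise (lower * O) := by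
  simp only [insertRaise, insertNum, Finset.mul_sum, ← mul_assoc, lower_mul_op_cr, sub_mul,
    Finset.sum_sub_distrib]

theorem insertNum_insertRaise (O : Module.End ℝ (Fock n)) :
    insertNum (insertRaise O) = -insertRaise (insertNum O) := by
  simp only [insertRaise, insertNum, Finset.mul_sum, Finset.sum_mul, ← Finset.sum_neg_distrib]
  rw [Finset.sum_comm]
  refine Finset.sum_congr rfl fun m _ => Finset.sum_congr rfl fun k _ => ?_
  have e1 : op 1 (cr k) 1 * op (cr m) 1 1 = op (cr m) 1 1 * op 1 (cr k) (1 : Module.End ℝ (Poly n)) := by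
    simp only [op_mul, one_mul, mul_one]
  have e2 : op 1 (an m) 1 * op 1 (an k) (1 : Module.End ℝ (Poly n)) =
      -(op 1 (an k) 1 * op 1 (an m) 1) := by
    rw [op_mul, op_mul, an_mul_an, op_neg_mid]
  calc op 1 (cr k) 1 * (op (cr m) 1 1 * O * op 1 (an m) 1) * op 1 (an k) 1
      = (op 1 (cr k) 1 * op (cr m) 1 1) * O * (op 1 (an m) 1 * op 1 (an k) 1) := by
        simp only [mul_assoc]
    _ = -(op (cr m) 1 1 * (op 1 (cr k) 1 * O * op 1 (an k) 1) * op 1 (an m) 1) := by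
        rw [e1, e2, mul_neg]
        simp only [mul_assoc]

/-- When `lower` passes an insertion it leaves an `insertNum`, which anticommutes through the other
insertions; the `k` places where this happens contribute equally. -/
theorem lower_mul_iterate_insertRaise (O : Module.End ℝ (Fock n)) (k : ℕ) :
    lower * insertRaise^[k] O = (-1 : ℝ) ^ k • insertRaise^[k] (lower * O) -
      ((-1 : ℝ) ^ k * k) • insertRaise^[k - 1] (insertNum O) := by
  have hN : ∀ k : ℕ, insertNum (insertRaise^[k] O) = (-1 : ℝ) ^ k • insertRaise^[k] (insertNum O) := by
    intro k
    induction k with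
    | zero => rw [pow_zero, one_smul]; rfl
    | succ k ih =>
      rw [Function.iterate_succ_apply', insertNum_insertRaise, ih, insertRaise_smul,
        Function.iterate_succ_apply', pow_succ, mul_neg_one, neg_smul]
  have hsub : ∀ A B : Module.End ℝ (Fock n), insertRaise (A - B) = insertRaise A - insertRaise B :=
    fun A B => by simp only [insertRaise, mul_sub, sub_mul, Finset.sum_sub_distrib]
  induction k with
  | zero => rw [pow_zero, one_smul, Nat.cast_zero, mul_zero, zero_smul, sub_zero]; rfl
  | succ k ih =>
    rw [Function.iterate_succ_apply', lower_mul_insertRaise, ih, hN, hsub, insertRaise_smul,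
      insertRaise_smul, ← Function.iterate_succ_apply' insertRaise k, Nat.add_sub_cancel]
    rcases k with _ | k
    · simp only [pow_zero, Nat.cast_zero, mul_zero, zero_smul, sub_zero, zero_add, pow_one,
        Nat.cast_one, mul_one, one_smul, neg_smul, sub_neg_eq_add]
      rw [add_comm, sub_eq_neg_add, add_comm]
    · rw [Nat.add_sub_cancel, ← Function.iterate_succ_apply' insertRaise k]
      push_cast
      module

theorem op_an_mul_numR (m : Fin n) (c : ℝ) :
    (numR - c • 1) * op 1 (an m) 1 = op 1 (an m) 1 * (numR - (c + 1) • 1 : Module.End ℝ (Fock n)) := by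
  have h : num * an m = an m * num - an m := by
    have e : ∀ k, an m * (cr k * an k) = (if m = k then an k else 0) + cr k * an k * an m := fun k => LinearMap.ext fun x => by
      have h : an m (an k x) = -an k (an m x) := LinearMap.congr_fun (an_mul_an m k) x
      simp only [Module.End.mul_apply, LinearMap.add_apply, an_cr, h, map_neg, sub_neg_eq_add]
      split_ifs <;> rfl
    simp only [num, Finset.sum_mul, Finset.mul_sum, e, Finset.sum_add_distrib]
    rw [Finset.sum_ite_eq Finset.univ m, if_pos (Finset.mem_univ m), add_sub_cancel_left]
  rw [sub_mul, numR, op_mul, h, op_sub_mid, mul_sub, op_mul, smul_mul_assoc, one_mul, mul_smul_comm,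
    mul_one, one_mul, mul_one, add_smul, one_smul]
  abel

theorem iterate_insertRaise_mul_numR (O : Module.End ℝ (Fock n)) (k : ℕ) :
    insertRaise^[k] (O * numR) = insertRaise^[k] O * (numR - (k : ℝ) • 1) := by
  induction k with
  | zero => rw [Nat.cast_zero, zero_smul, sub_zero]; rfl
  | succ k ih =>
    rw [Function.iterate_succ_apply', ih, Function.iterate_succ_apply', insertRaise, insertRaise,
      Finset.sum_mul]
    refine Finset.sum_congr rfl fun m _ => ?_
    rw [mul_assoc, mul_assoc, op_an_mul_numR, mul_assoc, mul_assoc, Nat.cast_add, Nat.cast_one]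

/-- A creation operator of the second column commutes with `kL` and anticommutes with each `lower`;
carried to the right, it forms `numR` with its annihilation operator. -/
theorem insertNum_kL_mul_lower_pow (s : ℕ) :
    insertNum (kL * lower ^ s : Module.End ℝ (Fock n)) = (-1 : ℝ) ^ s • (kL * lower ^ s * numR) := by
  have h1 : ∀ m, op 1 (cr m) 1 * kL = (kL * op 1 (cr m) 1 : Module.End ℝ (Fock n)) := fun m => by
    simp only [kL, Finset.mul_sum, Finset.sum_mul, op_mul, one_mul, mul_one]
  have h2 : ∀ m, op 1 (cr m) 1 * lower ^ s =
      (-1 : ℝ) ^ s • (lower ^ s * op 1 (cr m) 1 : Module.End ℝ (Fock n)) := fun m => by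
    have h : op 1 (cr m) 1 * lower = -(lower * op 1 (cr m) 1 : Module.End ℝ (Fock n)) := by
      simp only [lower, Finset.mul_sum, Finset.sum_mul, op_mul, one_mul, mul_one,
        ← Finset.sum_neg_distrib, ← op_neg_mid, ← cr_mul_cr]
    induction s with
    | zero => rw [pow_zero, pow_zero, one_smul, one_mul, mul_one]
    | succ s ih =>
      rw [pow_succ lower, ← mul_assoc, ih, smul_mul_assoc, mul_assoc, h, mul_neg, smul_neg, pow_succ,
        mul_neg_one, neg_smul, mul_assoc]
  rw [insertNum, numR, num, op_sum_mid, Finset.mul_sum, Finset.smul_sum]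
  refine Finset.sum_congr rfl fun m _ => ?_
  rw [← mul_assoc, h1, mul_assoc kL, h2, mul_smul_comm, smul_mul_assoc]
  simp only [mul_assoc, op_mul, one_mul]

theorem insertRaise_kL : insertRaise kL = (raise * kL : Module.End ℝ (Fock n)) := by
  rw [insertRaise, raise, Finset.sum_mul]
  refine Finset.sum_congr rfl fun m _ => ?_
  simp only [kL, Finset.mul_sum, Finset.sum_mul, op_mul, one_mul, mul_one]

theorem iterate_insertRaise_mem {a b : ℤ} {d e : ℤ} {O : Module.End ℝ (Fock n)}
    (hO : ∀ {a b : ℤ} {v : Fock n}, v ∈ bidegree n a b → O v ∈ bidegree n (a + d) (b + e)) (k : ℕ)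
    {v : Fock n} (hv : v ∈ bidegree n a b) :
    (insertRaise^[k] O) v ∈ bidegree n (a + d + k) (b + e - k) := by
  induction k generalizing a b v with
  | zero => simpa using hO hv
  | succ k ih =>
    rw [Function.iterate_succ_apply', insertRaise, LinearMap.sum_apply]
    refine sum_mem fun m _ => ?_
    have h1 : op 1 (an m) 1 v ∈ bidegree n a (b - 1) := op_mem (fun _ => id_mem) (fun _ => an_mem m) _ hv
    have h2 := op_mem (fun _ => cr_mem m) (fun _ => id_mem) (1 : Module.End ℝ (Poly n)) (ih h1)
    have e1 : a + d + (k : ℤ) + 1 = a + d + ((k + 1 : ℕ) : ℤ) := by push_cast; ring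
    have e2 : b - 1 + e - (k : ℤ) = b + e - ((k + 1 : ℕ) : ℤ) := by push_cast; ring
    rwa [e1, e2] at h2

theorem kL_mul_lower_pow_mem (s : ℕ) {a b : ℤ} {v : Fock n} (hv : v ∈ bidegree n a b) :
    (kL * lower ^ s : Module.End ℝ (Fock n)) v ∈ bidegree n (a + (-s - 1)) (b + s) := by
  have := kL_mem (lower_pow_mem hv s)
  rw [Module.End.mul_apply]
  convert this using 2
  ring

/-- Modulo the image of `lower`, all the operators obtained by inserting raising operators are
multiples of `raise * kL`. -/
theorem iterate_insertRaise_sub_mem_rel {a : ℤ} {b : ℕ} {v : Fock n} (hv : v ∈ bidegree n a b) (s : ℕ)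
    (hs : s + 1 ≤ b) :
    ((b - 1 - s).factorial : ℝ) • (insertRaise^[s + 1] (kL * lower ^ s)) v -
      ((-1 : ℝ) ^ (∑ i ∈ Finset.range (s + 1), i) * (s + 1).factorial * (b - 1).factorial) •
        raise (kL v) ∈ rel n a (b - 1) := by
  induction s with
  | zero =>
    have : (insertRaise^[0 + 1] (kL * lower ^ 0)) v = raise (kL v) := by
      rw [pow_zero, mul_one]
      exact LinearMap.congr_fun insertRaise_kL v
    rw [this]
    simp
  | succ s ih =>
    have ih := ih (by omega)
    obtain ⟨d, hd⟩ : ∃ d, b = s + 2 + d := ⟨b - (s + 2), by omega⟩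
    have e1 : b - 1 - s = d + 1 := by omega
    have e2 : b - 1 - (s + 1) = d := by omega
    rw [e1] at ih
    rw [e2]
    -- The image under `lower` of `s + 2` insertions into `kL * lower ^ s` is a relation. Expanding
    -- it links the operators for `s + 1` and `s`.
    have h := LinearMap.congr_fun (lower_mul_iterate_insertRaise (n := n) (kL * lower ^ s) (s + 2)) v
    have hl : (lower * (kL * lower ^ s) : Module.End ℝ (Fock n)) = (-1 : ℝ) • (kL * lower ^ (s + 1)) := by
      rw [← mul_assoc, pow_succ', ← mul_assoc, kL_mul_lower, neg_mul, neg_one_smul, neg_neg]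
    have hmem : lower ((insertRaise^[s + 2] (kL * lower ^ s)) v) ∈ rel n a (b - 1) := by
      refine lower_mem_rel ?_
      have := iterate_insertRaise_mem (n := n) (fun hv => kL_mul_lower_pow_mem s hv) (s + 2) hv
      convert this using 2 <;> push_cast <;> ring
    rw [Module.End.mul_apply] at h
    rw [h, hl, iterate_insertRaise_smul, insertNum_kL_mul_lower_pow, iterate_insertRaise_smul,
      iterate_insertRaise_mul_numR] at hmem
    simp only [LinearMap.sub_apply, LinearMap.smul_apply, Module.End.mul_apply, Module.End.one_apply,
      numR_apply hv, map_sub, map_smul, show s + 2 - 1 = s + 1 from rfl] at hmem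
    set X := (insertRaise^[s + 1] (kL * lower ^ s)) v
    set Y := (insertRaise^[s + 2] (kL * lower ^ (s + 1))) v
    change (d.factorial : ℝ) • Y - _ ∈ _
    have hp : ((-1 : ℝ) ^ s) * (-1) ^ s = 1 := by rw [← mul_pow, neg_one_mul, neg_neg, one_pow]
    -- The multipliers are chosen so that the operator for `s` cancels between the expanded relation
    -- and the induction hypothesis.
    have key := add_mem (Submodule.smul_mem _ ((-1 : ℝ) ^ (s + 1) * d.factorial) hmem)
      (Submodule.smul_mem _ ((-1 : ℝ) ^ (s + 1) * (s + 2)) ih)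
    convert key using 1
    have hb : (((b : ℕ) : ℤ) : ℝ) = s + 2 + d := by rw [hd]; push_cast; ring
    rw [hb, Finset.sum_range_succ _ (s + 1), Nat.factorial_succ (s + 1), Nat.factorial_succ d, pow_add]
    push_cast
    match_scalars
    · linear_combination (-(d.factorial : ℝ)) * hp
    · ring
    · linear_combination (-(d.factorial : ℝ) * (s + 2) * (d + 1) * (-1) ^ s) * hp

end GaugeTransformation

/-! ### The antisymmetrizations of the gauge transformation, evaluated on words -/

section Words

variable {n : ℕ}

theorem mx_single_one (k : Fin n) (ρ : Multiset (Fin n)) :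
    mx k (Finsupp.single ρ (1 : ℝ)) = Finsupp.single (ρ + Multiset.ofList [k]) 1 := by
  rw [mx_single, Multiset.coe_singleton, add_comm, Multiset.singleton_add]

/-- The curl on the first column. -/
theorem alt_word_cons (ρ : Multiset (Fin n)) {μ : List (Fin n)} (ν : List (Fin n)) {a : ℕ}
    (hμ : μ.length = a + 1) :
    ((a + 1 : ℕ) : ℝ) • alt (fun m => word (ρ + Multiset.ofList (m.take 1)) (m.drop 1) ν) μ =
      kL (word ρ μ ν) := by
  rw [alt_cons_wedge (a := a)
    (fun k => (pureHom.flip (wedge ν)).flip (mx k (Finsupp.single ρ (1 : ℝ)))) (fun k m _ => ?_) hμ, kL,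
    LinearMap.sum_apply]
  · rfl
  · rw [mx_single_one]
    rfl

/-- The curl on the second column. -/
theorem alt_word_concat (ρ : Multiset (Fin n)) (μ : List (Fin n)) {ν : List (Fin n)} {b : ℕ}
    (hν : ν.length = b + 1) :
    ((b + 1 : ℕ) : ℝ) • alt (fun l => word (ρ + Multiset.ofList (l.drop b)) μ (l.take b)) ν =
      (-1 : ℝ) ^ b • kR (word ρ μ ν) := by
  rw [alt_concat_eq_sum_an (a := b)
    (fun k => (pureHom (wedge μ)).flip (mx k (Finsupp.single ρ (1 : ℝ)))) (fun k m hm => ?_) hν, kR,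
    LinearMap.sum_apply]
  · rfl
  · rw [mx_single_one, List.drop_left' hm, List.take_left' hm]
    rfl

/-- The exchange of columns in the gauge transformation, before normalization. -/
theorem alt_word_exchange (ρ : Multiset (Fin n)) (ν : List (Fin n)) (c s : ℕ) (pre : List (Fin n))
    {μ : List (Fin n)} (hμ : μ.length = c + s + 1) :
    ((c + s + 1).factorial : ℝ) • alt (fun m => word (ρ + Multiset.ofList ((m.drop s).take 1))
      (ν ++ m.drop (s + 1)) (pre ++ m.take s)) μ =
    (c.factorial * (-1 : ℝ) ^ (∑ i ∈ Finset.range s, (pre.length + i))) •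
      leftMul (wedge ν) ((kL * lower ^ s : Module.End ℝ (Fock n)) (pure (wedge μ) (wedge pre) (Finsupp.single ρ 1))) := by
  -- Indices leave the front of `μ` one at a time and join the second column behind `pre`; each move
  -- is a `lower`, up to the sign of passing `pre`. When none is left to move, `kL` splits off the
  -- derivative index.
  induction s generalizing pre μ with
  | zero =>
    have hf : ((c + 0 + 1).factorial : ℝ) = c.factorial * ((c + 1 : ℕ) : ℝ) := by
      rw [add_zero, Nat.factorial_succ, Nat.cast_mul, mul_comm]
    rw [hf, mul_smul, Finset.sum_range_zero, pow_zero, mul_one, pow_zero, mul_one]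
    congr 1
    rw [alt_cons_wedge (a := c) (fun k => leftMul (wedge ν) ∘ₗ
      (pureHom.flip (wedge pre)).flip (mx k (Finsupp.single ρ (1 : ℝ)))) (fun k m _ => ?_) hμ, kL,
      LinearMap.sum_apply, map_sum]
    · rfl
    · rw [mx_single_one, List.take_zero, List.append_nil]
      change pure (wedge (ν ++ m)) _ _ = _
      rw [wedge_append]
      rfl
  | succ s ih =>
    have hf : ((c + (s + 1) + 1).factorial : ℝ) =
        (c + s + 1).factorial * ((c + s + 1 + 1 : ℕ) : ℝ) := by
      rw [show c + (s + 1) + 1 = c + s + 1 + 1 by ring, Nat.factorial_succ (c + s + 1), Nat.cast_mul,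
        mul_comm]
    have hne : ((c + s + 1).factorial : ℝ) ≠ 0 := by exact_mod_cast Nat.factorial_ne_zero _
    rw [hf, mul_smul, alt_eq_sum_an (a := c + s + 1) (fun k => ((c + s + 1).factorial : ℝ)⁻¹ •
      (c.factorial * (-1 : ℝ) ^ (∑ i ∈ Finset.range s, ((pre ++ [k]).length + i))) •
      leftMul (wedge ν) ∘ₗ (kL * lower ^ s) ∘ₗ
        (pureHom.flip (wedge (pre ++ [k]))).flip (Finsupp.single ρ (1 : ℝ))) (fun k m hm => ?_) (by omega)]
    · have e : ∑ i ∈ Finset.range (s + 1), (pre.length + i) =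
          ∑ i ∈ Finset.range s, (pre.length + 1 + i) + pre.length := by
        rw [Finset.sum_range_succ', add_zero]
        congr 1
        exact Finset.sum_congr rfl fun i _ => by ring
      have h : ∀ m : Fin n, pureHom (an m (wedge μ)) (wedge (pre ++ [m])) (Finsupp.single ρ (1 : ℝ)) =
          (-1 : ℝ) ^ pre.length • op (an m) (cr m) 1 (pure (wedge μ) (wedge pre) (Finsupp.single ρ 1)) :=
        fun m => by
          rw [wedge_concat, map_smul]
          rfl
      rw [e, pow_add, ← mul_assoc, mul_smul _ ((-1 : ℝ) ^ pre.length), pow_succ,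
        ← mul_assoc kL, Module.End.mul_apply (kL * lower ^ s), lower, LinearMap.sum_apply]
      simp only [List.length_append, List.length_singleton, LinearMap.smul_apply, LinearMap.comp_apply,
        LinearMap.flip_apply, h, map_smul, map_sum, ← Finset.smul_sum, smul_smul]
      rw [mul_assoc _ _ ((-1 : ℝ) ^ pre.length), mul_inv_cancel_left₀ hne]
    · rw [LinearMap.smul_apply, eq_inv_smul_iff₀ hne]
      have := ih (pre ++ [k]) hm
      simp only [List.append_assoc, List.singleton_append] at this
      exact this

/-- The exchange of columns in the gauge transformation. -/
theorem alt_word_exchange_sub_mem_rel (ρ : Multiset (Fin n)) {μ ν : List (Fin n)} {b c : ℕ}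
    (hμ : μ.length = c + (b + 1)) (hν : ν.length = b + 1) :
    ((c + (b + 1)).factorial / ((c + 1).factorial * (b + 1).factorial) : ℝ) •
      alt (fun m => word (ρ + Multiset.ofList ((m.drop b).take 1)) (ν ++ m.drop (b + 1)) (m.take b)) μ -
    ((-1 : ℝ) ^ b * ((c + 1) * (b + 1) : ℝ)⁻¹) • raise (kL (word ρ μ ν)) ∈
      rel n (c + (b + 1)) b := by
  -- The exchange term is `kL * lower ^ b` followed by multiplication by `ν`; this multiplication
  -- amounts to `b + 1` insertions; and these reduce to `raise * kL` modulo relations.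
  have h1 := alt_word_exchange ρ ν c b [] (by omega : μ.length = c + b + 1)
  have h2 := iterate_insertRaise_pure (kL * lower ^ b) (wedge μ) (Finsupp.single ρ (1 : ℝ)) (b + 1)
    (wedge_mem (by rw [hν]) : wedge ν ∈ formsOfDegree n ((b + 1 : ℕ) : ℤ))
  have h3 := iterate_insertRaise_sub_mem_rel
    (word_mem (a := ((c + (b + 1) : ℕ) : ℤ)) (b := ((b + 1 : ℕ) : ℤ)) (ρ := ρ) (by rw [hμ]) (by rw [hν]))
    b le_rfl
  change (insertRaise^[b + 1] (kL * lower ^ b)) (word ρ μ ν) = _ at h2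
  simp only [List.nil_append, List.length_nil, zero_add, wedge_nil] at h1
  rw [h2] at h3
  simp only [Nat.add_sub_cancel, Nat.sub_self, Nat.factorial_zero, Nat.cast_one, one_smul] at h3
  set X := leftMul (wedge ν) ((kL * lower ^ b : Module.End ℝ (Fock n)) (pure (wedge μ) 1 (Finsupp.single ρ 1)))
  set A := alt (fun m => word (ρ + Multiset.ofList ((m.drop b).take 1)) (ν ++ m.drop (b + 1)) (m.take b)) μ
  set R := raise (kL (word ρ μ ν))
  have hA : A = ((c.factorial * (-1 : ℝ) ^ (∑ i ∈ Finset.range b, i)) / (c + b + 1).factorial) • X := by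
    have hne : ((c + b + 1).factorial : ℝ) ≠ 0 := by exact_mod_cast Nat.factorial_ne_zero _
    rw [div_eq_inv_mul, mul_smul, ← h1, smul_smul, inv_mul_cancel₀ hne, one_smul]
  have e : ((c + (b + 1) : ℕ) : ℤ) = c + (b + 1) := by push_cast; ring
  have e' : (((b + 1 : ℕ) : ℤ) - 1) = b := by push_cast; ring
  rw [e, e'] at h3
  have key := Submodule.smul_mem _ ((-1 : ℝ) ^ (∑ i ∈ Finset.range b, i) *
    ((c + 1) * (b + 1).factorial * (b + 1).factorial : ℝ)⁻¹) h3
  convert key using 1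
  rw [hA, smul_sub, smul_smul, smul_smul, smul_smul, show c + (b + 1) = c + b + 1 by ring]
  have hc : ((c + 1).factorial : ℝ) = (c + 1) * c.factorial := by
    rw [Nat.factorial_succ]; push_cast; ring
  have hb : ((b + 1).factorial : ℝ) = (b + 1) * b.factorial := by
    rw [Nat.factorial_succ]; push_cast; ring
  have f1 : ((c + b + 1).factorial : ℝ) ≠ 0 := by exact_mod_cast Nat.factorial_ne_zero _
  have f2 : (c.factorial : ℝ) ≠ 0 := by exact_mod_cast Nat.factorial_ne_zero _
  have f3 : (b.factorial : ℝ) ≠ 0 := by exact_mod_cast Nat.factorial_ne_zero _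
  have f4 : (b + 1 : ℝ) ≠ 0 := by positivity
  have f5 : (c + 1 : ℝ) ≠ 0 := by positivity
  have hs : (-1 : ℝ) ^ (∑ i ∈ Finset.range b, i) * (-1 : ℝ) ^ (∑ i ∈ Finset.range b, i) = 1 := by
    rw [← mul_pow, neg_one_mul, neg_neg, one_pow]
  rw [hc, hb, Finset.sum_range_succ, pow_add]
  congr 2
  · field_simp
  · field_simp
    linear_combination -hs

/-- The gauge transformation in words. -/
theorem alt_word_add_alt_word_sub_mem_rel (ρ : Multiset (Fin n)) {μ ν : List (Fin n)} {b c : ℕ}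
    (hμ : μ.length = c + (b + 1)) (hν : ν.length = b + 1) :
    alt (fun l => word (ρ + Multiset.ofList (l.drop b)) μ (l.take b)) ν +
      ((c + (b + 1)).factorial / ((c + 1).factorial * (b + 1).factorial) : ℝ) •
        alt (fun m => word (ρ + Multiset.ofList ((m.drop b).take 1)) (ν ++ m.drop (b + 1)) (m.take b)) μ -
    ((-1 : ℝ) ^ b * (b + 1 : ℝ)⁻¹) • kT ((c + 1 : ℝ)⁻¹) (word ρ μ ν) ∈ rel n (c + (b + 1)) b := by
  have h := alt_word_exchange_sub_mem_rel ρ hμ hν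
  have hne : ((b + 1 : ℕ) : ℝ) ≠ 0 := by exact_mod_cast Nat.succ_ne_zero b
  have h1 : alt (fun l => word (ρ + Multiset.ofList (l.drop b)) μ (l.take b)) ν =
      ((-1 : ℝ) ^ b * (b + 1 : ℝ)⁻¹) • kR (word ρ μ ν) := by
    rw [mul_comm, mul_smul, ← alt_word_concat ρ μ hν, smul_smul, ← Nat.cast_succ, inv_mul_cancel₀ hne,
      one_smul]
  convert h using 1
  rw [h1, kT_apply, smul_add, add_sub_add_left_eq_sub, smul_smul, mul_assoc, mul_inv_rev]

end Words

section Jets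

variable {n : ℕ}

/-! ### Jets as linear functionals on the Fock space -/

/-- Moving an index of the first column to the front of the second is a term of `lower`. Thus the
Young condition on jets becomes vanishing on the image of `lower`. -/
theorem alt_word_young (ρ : Multiset (Fin n)) {μ : List (Fin n)} (ν : List (Fin n)) {a : ℕ}
    (hμ : μ.length = a + 1) :
    ((a + 1 : ℕ) : ℝ) • alt (fun m => word ρ (m.take a) (m.drop a ++ ν)) μ =
      (-1 : ℝ) ^ a • lower (word ρ μ ν) := by
  rw [alt_concat_eq_sum_an (a := a)
    (fun k => (pureHom.flip (cr k (wedge ν))).flip (Finsupp.single ρ (1 : ℝ))) (fun k m hm => ?_) hμ,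
    lower, LinearMap.sum_apply]
  · rfl
  · rw [List.drop_left' hm, List.take_left' hm, List.singleton_append]
    change pure _ (wedge (k :: ν)) _ = _
    rw [wedge_cons]
    rfl

theorem exists_functional (M : Ext n →ₗ[ℝ] Ext n →ₗ[ℝ] Poly n →ₗ[ℝ] ℝ) :
    ∃ Φ : Fock n →ₗ[ℝ] ℝ, ∀ x y z, Φ (pure x y z) = M x y z :=
  ⟨(TensorProduct.lift ((TensorProduct.uncurry (RingHom.id ℝ) (Ext n) (Poly n) ℝ) ∘ₗ M) :
    TensorProduct ℝ (Ext n) (TensorProduct ℝ (Ext n) (Poly n)) →ₗ[ℝ] ℝ), fun _ _ _ => rfl⟩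

variable {p q : ℕ}

/-- Antisymmetry in each column extends the jet to both exterior factors, linearity extends it to
the polynomials, and the Young condition makes the extension vanish on relations. -/
theorem exists_functional_of_mem_jets {ε : ZMod 2} {φ : Comp n → ℝ} (hφ : φ ∈ jets n p q ε) (A : Bool)
    {i j : ℕ} (hi : i ≤ p) :
    ∃ Φ : Fock n →ₗ[ℝ] ℝ, (∀ ρ μ ν, μ.length = p - i → ν.length = q - j →
      Φ (word ρ μ ν) = φ ⟨A, i, j, ρ, μ, ν⟩) ∧ ∀ v ∈ rel n ((p : ℤ) - i) ((q : ℤ) - j), Φ v = 0 := by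
  obtain ⟨-, h2, h3, h4⟩ := hφ
  let T : List (Fin n) → List (Fin n) → Poly n →ₗ[ℝ] ℝ := fun μ ν =>
    Finsupp.linearCombination ℝ fun ρ => φ ⟨A, i, j, ρ, μ, ν⟩
  choose L hL using fun μ => exists_extension (T μ) (q - j)
  obtain ⟨M, hM⟩ := exists_extension L (p - i)
  obtain ⟨Φ, hΦ⟩ := exists_functional M
  have hw : ∀ ρ μ ν, μ.length = p - i → ν.length = q - j →
      Φ (word ρ μ ν) = φ ⟨A, i, j, ρ, μ, ν⟩ := by
    intro ρ μ ν hμ hν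
    have e1 : ∀ m, L m (wedge ν) (Finsupp.single ρ 1) = φ ⟨A, i, j, ρ, m, ν⟩ := fun m => by
      rw [hL m ν hν]
      have := map_alt (LinearMap.applyₗ (Finsupp.single ρ (1 : ℝ))) (T m) ν
      refine this.trans ?_
      rw [h3 A i j ρ m ν]
      refine alt_congr fun l _ => ?_
      change Finsupp.linearCombination ℝ _ (Finsupp.single ρ 1) = _
      rw [Finsupp.linearCombination_single, one_smul]
    rw [word, hΦ, hM μ hμ, h2 A i j ρ μ ν]
    have := map_alt (LinearMap.applyₗ (Finsupp.single ρ (1 : ℝ)) ∘ₗ LinearMap.applyₗ (wedge ν)) L μ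
    exact this.trans (alt_congr fun m _ => e1 m)
  refine ⟨Φ, hw, ?_⟩
  rintro _ ⟨v, hv, rfl⟩
  rw [SetLike.mem_coe] at hv
  induction hv using Submodule.span_induction with
  | zero => rw [map_zero, map_zero]
  | add x y _ _ hx hy => rw [map_add, map_add, hx, hy, add_zero]
  | smul c x _ hx => rw [map_smul, map_smul, hx, smul_zero]
  | mem x hx =>
    obtain ⟨ρ, μ, ν, hμ, hν, rfl⟩ := hx
    have hμ' : μ.length = p - i + 1 := by omega
    have h := congrArg Φ (alt_word_young ρ ν hμ')
    rw [map_smul, map_smul, map_alt] at h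
    have e : alt (fun m => Φ (word ρ (m.take (p - i)) (m.drop (p - i) ++ ν))) μ = 0 := by
      rw [← h4 A i j ρ μ ν hμ']
      refine alt_congr fun m hm => hw _ _ _ ?_ ?_
      · rw [List.length_take]; omega
      · rw [List.length_append, List.length_drop]; omega
    rw [e, smul_zero] at h
    exact (smul_eq_zero.1 h.symm).resolve_left (pow_ne_zero _ (by norm_num))

open Classical in
/-- The jet determined by a functional on the Fock space. -/
def jetOf (p q : ℕ) (A : Bool) (i j : ℕ) (Φ : Fock n →ₗ[ℝ] ℝ) : Comp n → ℝ := fun s =>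
  if s.Occurs p q ∧ s.anti = A ∧ s.i = i ∧ s.j = j then Φ (word s.der s.mu s.nu) else 0

/-- The converse: exterior products supply the antisymmetries, and vanishing on relations supplies
the Young condition. In each sector jets are thus dual to the Fock space modulo relations. -/
theorem jetOf_mem {A : Bool} {i j : ℕ} (hi : i ≤ p) {Φ : Fock n →ₗ[ℝ] ℝ}
    (hΦ : ∀ v ∈ rel n ((p : ℤ) - i) ((q : ℤ) - j), Φ v = 0) {ε : ZMod 2}
    (hε : ∀ ρ μ ν, (⟨A, i, j, ρ, μ, ν⟩ : Comp n).parity = ε) :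
    jetOf p q A i j Φ ∈ jets n p q ε := by
  refine ⟨fun s hs => if_neg ?_, fun a i' j' ρ μ ν => ?_, fun a i' j' ρ μ ν => ?_,
    fun a i' j' ρ μ ν hμ => ?_⟩
  · rintro ⟨h, rfl, rfl, rfl⟩
    exact hs ⟨h, hε s.der s.mu s.nu⟩
  · by_cases h : (⟨a, i', j', ρ, μ, ν⟩ : Comp n).Occurs p q ∧ a = A ∧ i' = i ∧ j' = j
    · refine (if_pos h).trans ?_
      have := alt_wedge (Φ ∘ₗ (pureHom.flip (wedge ν)).flip (Finsupp.single ρ (1 : ℝ))) μ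
      refine this.symm.trans (alt_congr fun m hm => ?_)
      exact (if_pos ⟨⟨h.1.1, h.1.2.1, hm.trans h.1.2.2.1, h.1.2.2.2⟩, h.2⟩).symm
    · refine (if_neg h).trans ?_
      rw [← alt_eq_zero μ]
      refine alt_congr fun m hm => ?_
      exact (if_neg fun h' => h ⟨⟨h'.1.1, h'.1.2.1, hm.symm.trans h'.1.2.2.1, h'.1.2.2.2⟩, h'.2⟩).symm
  · by_cases h : (⟨a, i', j', ρ, μ, ν⟩ : Comp n).Occurs p q ∧ a = A ∧ i' = i ∧ j' = j
    · refine (if_pos h).trans ?_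
      have := alt_wedge (Φ ∘ₗ (pureHom (wedge μ)).flip (Finsupp.single ρ (1 : ℝ))) ν
      refine this.symm.trans (alt_congr fun m hm => ?_)
      exact (if_pos ⟨⟨h.1.1, h.1.2.1, h.1.2.2.1, hm.trans h.1.2.2.2⟩, h.2⟩).symm
    · refine (if_neg h).trans ?_
      rw [← alt_eq_zero ν]
      refine alt_congr fun m hm => ?_
      exact (if_neg fun h' => h ⟨⟨h'.1.1, h'.1.2.1, h'.1.2.2.1, hm.symm.trans h'.1.2.2.2⟩, h'.2⟩).symm
  · by_cases h : (i' ≤ p - q ∧ j' ≤ q ∧ 1 + ν.length = q - j') ∧ a = A ∧ i' = i ∧ j' = j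
    · obtain ⟨⟨h1, h2, h3⟩, rfl, rfl, rfl⟩ := h
      have e : Φ (alt (fun m => word ρ (m.take (p - i')) (m.drop (p - i') ++ ν)) μ) = 0 := by
        have h := congrArg Φ (alt_word_young ρ ν hμ)
        rw [map_smul, map_smul, hΦ _ (lower_mem_rel (word_mem (by omega) (by omega))), smul_zero] at h
        exact (smul_eq_zero.1 h).resolve_left (Nat.cast_ne_zero.2 (Nat.succ_ne_zero _))
      rw [map_alt] at e
      rw [← e]
      refine alt_congr fun m hm => ?_
      refine if_pos ⟨⟨h1, h2, ?_, ?_⟩, rfl, rfl, rfl⟩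
      · change (m.take _).length = p - i'
        rw [List.length_take]; omega
      · change (m.drop _ ++ ν).length = q - j'
        rw [List.length_append, List.length_drop]; omega
    · rw [← alt_eq_zero μ]
      refine alt_congr fun m hm => if_neg fun h' => h ⟨⟨h'.1.1, h'.1.2.1, ?_⟩, h'.2⟩
      have : (m.drop (p - i') ++ ν).length = q - j' := h'.1.2.2.2
      have h2 : j' ≤ q := h'.1.2.1
      rw [List.length_append, List.length_drop] at this
      omega

/-! ### The family of tensors of a linear combination of symbols -/

/-- A family with one nonzero member. -/
def place (a b : ℤ) : Fock n →ₗ[ℝ] (ℤ → ℤ → Fock n) :=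
  LinearMap.single ℝ _ a ∘ₗ LinearMap.single ℝ (fun _ => Fock n) b

theorem place_apply (a b : ℤ) (v : Fock n) (a' b' : ℤ) :
    place a b v a' b' = if a' = a ∧ b' = b then v else 0 := by
  change (Pi.single a (Pi.single b v : ℤ → Fock n) : ℤ → ℤ → Fock n) a' b' = _
  by_cases h : a' = a
  · subst h
    rw [Pi.single_eq_same, Pi.single_apply]
    simp
  · rw [Pi.single_eq_of_ne h, if_neg fun h' => h h'.1]
    rfl

theorem place_mem_families {a b : ℤ} (h : InBox p q a b) {v : Fock n} (hv : v ∈ bidegree n a b) :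
    place a b v ∈ families n p q := fun a' b' => by
  rw [place_apply]
  split_ifs with h'
  · obtain ⟨rfl, rfl⟩ := h'
    exact ⟨hv, fun h' => absurd h h'⟩
  · exact ⟨zero_mem _, fun _ => rfl⟩

theorem place_mem_relFamilies {a b : ℤ} {v : Fock n} (hv : v ∈ rel n a b) :
    place a b v ∈ relFamilies n := fun a' b' => by
  rw [place_apply]
  split_ifs with h'
  · obtain ⟨rfl, rfl⟩ := h'
    exact hv
  · exact zero_mem _

open Classical in
/-- The family of tensors that represents the fields (or the antifields) in a linear combination. -/
def fam (p q : ℕ) (A : Bool) : Lin n →ₗ[ℝ] (ℤ → ℤ → Fock n) :=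
  Finsupp.linearCombination ℝ fun s => if s.anti = A ∧ s.Occurs p q then
    place ((p : ℤ) - s.i) ((q : ℤ) - s.j) (word s.der s.mu s.nu) else 0

open Classical in
theorem fam_sym (A : Bool) (s : Comp n) : fam p q A (sym s) = if s.anti = A ∧ s.Occurs p q then
    place ((p : ℤ) - s.i) ((q : ℤ) - s.j) (word s.der s.mu s.nu) else 0 := by
  rw [fam, sym, Finsupp.linearCombination_single, one_smul]

theorem Comp.Occurs.inBox (hqp : q ≤ p) {s : Comp n} (h : s.Occurs p q) :
    InBox p q ((p : ℤ) - s.i) ((q : ℤ) - s.j) := by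
  obtain ⟨h1, h2, -, -⟩ := h
  unfold InBox
  omega

theorem Comp.Occurs.word_mem (hqp : q ≤ p) {s : Comp n} (h : s.Occurs p q) :
    word s.der s.mu s.nu ∈ bidegree n ((p : ℤ) - s.i) ((q : ℤ) - s.j) := by
  obtain ⟨h1, h2, h3, h4⟩ := h
  exact MixedGauge.word_mem (by omega) (by omega)

theorem lin_induction {P : Lin n → Prop} (hzero : P 0) (hadd : ∀ t u, P t → P u → P (t + u))
    (hsmul : ∀ (c : ℝ) t, P t → P (c • t)) (hsym : ∀ s, P (sym s)) (t : Lin n) : P t := by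
  induction t using Finsupp.induction_linear with
  | zero => exact hzero
  | add t u ht hu => exact hadd t u ht hu
  | single s c =>
    have := hsmul c _ (hsym s)
    rwa [sym, Finsupp.smul_single, smul_eq_mul, mul_one] at this

theorem fam_mem_families (hqp : q ≤ p) (A : Bool) (t : Lin n) : fam p q A t ∈ families n p q := by
  induction t using lin_induction with
  | hzero => rw [map_zero]; exact zero_mem _
  | hadd t u ht hu => rw [map_add]; exact add_mem ht hu
  | hsmul c t ht => rw [map_smul]; exact Submodule.smul_mem _ _ ht
  | hsym s =>
    rw [fam_sym]
    split_ifs with h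
    · exact place_mem_families (h.2.inBox hqp) (h.2.word_mem hqp)
    · exact zero_mem _

theorem coord_apply (t : Lin n) (φ : Comp n → ℝ) : coord t φ = Finsupp.linearCombination ℝ φ t := by
  rw [coord, Finsupp.linearCombination_apply, Finsupp.sum, Finsupp.sum, LinearMap.sum_apply]
  rfl

theorem coord_sym (s : Comp n) (φ : Comp n → ℝ) : coord (sym s) φ = φ s := by
  rw [coord_apply, sym, Finsupp.linearCombination_single, one_smul]

/-- The evaluation of linear combinations of symbols on jets. -/
def coordHom (n : ℕ) : Lin n →ₗ[ℝ] Module.Dual ℝ (Comp n → ℝ) where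
  toFun := coord
  map_add' t u := LinearMap.ext fun φ => by
    rw [LinearMap.add_apply, coord_apply, coord_apply, coord_apply, map_add]
  map_smul' c t := LinearMap.ext fun φ => by
    rw [LinearMap.smul_apply, coord_apply, coord_apply, map_smul]; rfl

theorem coord_add (t u : Lin n) : coord (t + u) = coord t + coord u := map_add (coordHom n) t u

theorem coord_smul (c : ℝ) (t : Lin n) : coord (c • t) = c • coord t := map_smul (coordHom n) c t

/-- Evaluation on a jet is a sum over the finitely many sectors `(A, i, j)` of functionals of the
family, and each of these functionals vanishes on relations. -/
theorem coord_eq_zero_of_fam_mem {t : Lin n}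
    (ht : ∀ A, fam p q A t ∈ relFamilies n) {ε : ZMod 2} {φ : Comp n → ℝ} (hφ : φ ∈ jets n p q ε) :
    coord t φ = 0 := by
  have hex : ∀ (A : Bool) (i j : ℕ), ∃ Φ : Fock n →ₗ[ℝ] ℝ, i ≤ p - q → j ≤ q →
      (∀ ρ μ ν, μ.length = p - i → ν.length = q - j → Φ (word ρ μ ν) = φ ⟨A, i, j, ρ, μ, ν⟩) ∧
      ∀ v ∈ rel n ((p : ℤ) - i) ((q : ℤ) - j), Φ v = 0 := fun A i j => by
    by_cases h : i ≤ p - q ∧ j ≤ q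
    · obtain ⟨Φ, hΦ⟩ := exists_functional_of_mem_jets hφ A (h.1.trans (Nat.sub_le _ _))
      exact ⟨Φ, fun _ _ => hΦ⟩
    · exact ⟨0, fun h1 h2 => absurd ⟨h1, h2⟩ h⟩
  choose Φ hΦ using hex
  have key : ∀ t : Lin n, coord t φ = ∑ A : Bool, ∑ i ∈ Finset.range (p - q + 1),
      ∑ j ∈ Finset.range (q + 1), Φ A i j (fam p q A t ((p : ℤ) - i) ((q : ℤ) - j)) := by
    intro t
    induction t using lin_induction with
    | hzero =>
      rw [coord_apply, map_zero]
      simp only [map_zero, Pi.zero_apply, Finset.sum_const_zero]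
    | hadd t u ht hu =>
      rw [coord_add, LinearMap.add_apply, ht, hu]
      simp only [map_add, Pi.add_apply, Finset.sum_add_distrib]
    | hsmul c t ht =>
      rw [coord_smul, LinearMap.smul_apply, ht]
      simp only [map_smul, Pi.smul_apply, Finset.smul_sum]
    | hsym s =>
      rw [coord_sym]
      by_cases hs : s.Occurs p q
      · obtain ⟨h1, h2, h3, h4⟩ := hs
        rw [Finset.sum_eq_single s.anti, Finset.sum_eq_single s.i, Finset.sum_eq_single s.j, fam_sym,
          if_pos ⟨rfl, h1, h2, h3, h4⟩, place_apply, if_pos ⟨rfl, rfl⟩,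
          (hΦ s.anti s.i s.j h1 h2).1 _ _ _ h3 h4]
        · intro j _ hj
          rw [fam_sym, if_pos ⟨rfl, h1, h2, h3, h4⟩, place_apply, if_neg (by omega), map_zero]
        · exact fun h => absurd (Finset.mem_range.2 (by omega)) h
        · intro i _ hi
          refine Finset.sum_eq_zero fun j _ => ?_
          rw [fam_sym, if_pos ⟨rfl, h1, h2, h3, h4⟩, place_apply, if_neg (by omega), map_zero]
        · exact fun h => absurd (Finset.mem_range.2 (by omega)) h
        · intro A _ hA
          refine Finset.sum_eq_zero fun i _ => Finset.sum_eq_zero fun j _ => ?_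
          rw [fam_sym, if_neg fun h => hA h.1.symm]
          exact map_zero _
        · exact fun h => absurd (Finset.mem_univ _) h
      · rw [hφ.1 s fun h => hs h.1, eq_comm]
        refine Finset.sum_eq_zero fun A _ => Finset.sum_eq_zero fun i _ =>
          Finset.sum_eq_zero fun j _ => ?_
        rw [fam_sym, if_neg fun h => hs h.2]
        exact map_zero _
  rw [key]
  refine Finset.sum_eq_zero fun A _ => Finset.sum_eq_zero fun i hi => Finset.sum_eq_zero fun j hj => ?_
  rw [Finset.mem_range] at hi hj
  exact (hΦ A i j (by omega) (by omega)).2 _ (ht A _ _)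

theorem coord_jetOf (A : Bool) (i j : ℕ) (Φ : Fock n →ₗ[ℝ] ℝ) (t : Lin n) :
    coord t (jetOf p q A i j Φ) = Φ (fam p q A t ((p : ℤ) - i) ((q : ℤ) - j)) := by
  induction t using lin_induction with
  | hzero => rw [coord_apply, map_zero, map_zero]; exact (map_zero Φ).symm
  | hadd t u ht hu =>
    rw [coord_add, LinearMap.add_apply, ht, hu, map_add, Pi.add_apply, Pi.add_apply, map_add]
  | hsmul c t ht =>
    rw [coord_smul, LinearMap.smul_apply, ht, map_smul, Pi.smul_apply, Pi.smul_apply, map_smul]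
  | hsym s =>
    rw [coord_sym, fam_sym, jetOf]
    by_cases h : s.anti = A ∧ s.Occurs p q
    · rw [if_pos h, place_apply]
      by_cases h' : s.i = i ∧ s.j = j
      · rw [if_pos ⟨h.2, h.1, h'⟩, if_pos (by omega)]
      · rw [if_neg fun e => h' e.2.2, if_neg (by omega), map_zero]
    · rw [if_neg h, if_neg fun e => h ⟨e.2.1, e.1⟩]
      exact (map_zero Φ).symm

theorem exists_coord_ne_zero {t : Lin n} {A : Bool} {i j : ℕ} (hi : i ≤ p)
    (ht : fam p q A t ((p : ℤ) - i) ((q : ℤ) - j) ∉ rel n ((p : ℤ) - i) ((q : ℤ) - j)) :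
    ∃ ε, ∃ φ ∈ jets n p q ε, coord t φ ≠ 0 := by
  obtain ⟨Φ, hne, hle⟩ := Submodule.exists_le_ker_of_notMem ht
  exact ⟨(⟨A, i, j, 0, [], []⟩ : Comp n).parity, jetOf p q A i j Φ, jetOf_mem hi (fun v hv => hle hv) fun _ _ _ => rfl, by rwa [coord_jetOf]⟩

/-- A linear combination of symbols vanishes on jets if and only if the tensors that represent it are
multiples of the Young relations. -/
theorem fam_mem_relFamilies_iff (hqp : q ≤ p) {t : Lin n} :
    (∀ A, fam p q A t ∈ relFamilies n) ↔ ∀ ε, ∀ φ ∈ jets n p q ε, coord t φ = 0 := by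
  refine ⟨fun h ε φ hφ => coord_eq_zero_of_fam_mem h hφ, fun h A a b => ?_⟩
  by_cases hab : InBox p q a b
  · by_contra hne
    unfold InBox at hab
    obtain ⟨i, rfl⟩ : ∃ i : ℕ, a = (p : ℤ) - i := ⟨(p - a).toNat, by omega⟩
    obtain ⟨j, rfl⟩ : ∃ j : ℕ, b = (q : ℤ) - j := ⟨(q - b).toNat, by omega⟩
    obtain ⟨ε, φ, hφ, hne⟩ := exists_coord_ne_zero (by omega) hne
    exact hne (h ε φ hφ)
  · rw [(fam_mem_families hqp A t a b).2 hab]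
    exact zero_mem _

end Jets

section GaugeDifferential

variable {n p q : ℕ}

/-! ### The gauge differential on linear combinations of symbols -/

open Classical in
/-- The gauge differential on linear combinations of symbols. -/
def gammaLin (p q : ℕ) : Lin n →ₗ[ℝ] Lin n :=
  Finsupp.linearCombination ℝ fun s => if s.anti = false ∧ s.Occurs p q then
    gammaField p q s.i s.j s.der s.mu s.nu else 0

open Classical in
theorem gammaLin_sym (s : Comp n) : gammaLin p q (sym s) = if s.anti = false ∧ s.Occurs p q then
    gammaField p q s.i s.j s.der s.mu s.nu else 0 := by
  rw [gammaLin, sym, Finsupp.linearCombination_single, one_smul]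

/-- Strength-one antisymmetrization over `a` indices gives the curl this factor. -/
def leftCoeff (a : ℤ) : ℝ := (a : ℝ)⁻¹

/-- The indices of the ghost are `i = p - a` and `j = q - b`. The second factor normalizes the
antisymmetrization over `b` indices with the derivative index in the last place. -/
def rightCoeff (p q : ℕ) (a b : ℤ) : ℝ :=
  coeffB p q (p - a).toNat (q - b).toNat * ((-1) ^ (b - 1).toNat * (b : ℝ)⁻¹)

theorem coeffB_ne_zero {i j : ℕ} (hi : i ≤ p - q) (hqp : q ≤ p) : coeffB p q i j ≠ 0 := by
  have h1 : (i : ℝ) + q ≤ p := by exact_mod_cast (by omega : i + q ≤ p)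
  have hi0 : (0 : ℝ) ≤ i := i.cast_nonneg
  have hj0 : (0 : ℝ) ≤ j := j.cast_nonneg
  exact mul_ne_zero (pow_ne_zero _ (by norm_num)) (div_ne_zero (by linarith) (by linarith))

/-- With `x = p - i - q + j + 1`, passing from `i` to `i + 1` multiplies `coeffB` by `-(1 + 1 / x)`,
and `1 / x` is the `ktCoeff` that enters. The coefficients `b_{i,j}` are thus such that the mixed
terms cancel. -/
theorem isAdmissible (hq : 1 ≤ q) (hqp : q ≤ p) : IsAdmissible p q leftCoeff (rightCoeff p q) where
  one_le := by exact_mod_cast hq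
  le := by exact_mod_cast hqp
  left_ne_zero a h1 _ := inv_ne_zero (by exact_mod_cast (by omega : a ≠ 0))
  right_ne_zero a b h1 h2 h3 h4 := mul_ne_zero (coeffB_ne_zero (by omega) hqp)
    (mul_ne_zero (pow_ne_zero _ (by norm_num)) (inv_ne_zero (by exact_mod_cast (by omega : b ≠ 0))))
  compatible a b h1 h2 h3 h4 := by
    obtain ⟨i, rfl⟩ : ∃ i : ℕ, a = (p : ℤ) - (i + 1) := ⟨(p - a - 1).toNat, by omega⟩
    obtain ⟨j, rfl⟩ : ∃ j : ℕ, b = (q : ℤ) - j := ⟨(q - b).toNat, by omega⟩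
    have e1 : ((p : ℤ) - (p - (i + 1) + 1)).toNat = i := by omega
    have e2 : ((p : ℤ) - (p - (i + 1))).toNat = i + 1 := by omega
    have e3 : ((q : ℤ) - (q - j)).toNat = j := by omega
    rw [rightCoeff, rightCoeff, e1, e2, e3, ktCoeff, coeffB, coeffB]
    have hd : (0 : ℝ) < p - (i + 1) - q + j + 2 := by
      have : (q : ℝ) ≤ p - (i + 1) := by exact_mod_cast h1
      have : (0 : ℝ) ≤ j := j.cast_nonneg
      linarith
    have hd' : (0 : ℝ) < p - i - q + j + 2 := by linarith
    have e4 : (((p : ℤ) - (i + 1) + 1 : ℤ) : ℝ) - ((q - j : ℤ) : ℝ) + 1 = p - (i + 1) - q + j + 2 := by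
      push_cast; ring
    rw [e4, Nat.cast_succ, pow_succ]
    generalize (-1 : ℝ) ^ ((q : ℤ) - j - 1).toNat * (((q - j : ℤ) : ℝ))⁻¹ = c
    field_simp
    ring

theorem map_alt_of {V W : Type*} [AddCommGroup V] [Module ℝ V] [AddCommGroup W] [Module ℝ W]
    {U : Type*} [AddCommGroup U] [Module ℝ U] (f : V →ₗ[ℝ] W) (g : U →ₗ[ℝ] W) {T : List (Fin n) → V}
    {S : List (Fin n) → U} {l : List (Fin n)} (h : ∀ m, m.length = l.length → f (T m) = g (S m)) :
    f (alt T l) = g (alt S l) := by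
  rw [map_alt, map_alt]
  exact alt_congr h

theorem map_alt_eq_zero {V W : Type*} [AddCommGroup V] [Module ℝ V] [AddCommGroup W] [Module ℝ W]
    (f : V →ₗ[ℝ] W) {T : List (Fin n) → V} {l : List (Fin n)}
    (h : ∀ m, m.length = l.length → f (T m) = 0) : f (alt T l) = 0 := by
  rw [map_alt, ← alt_eq_zero l]
  exact alt_congr h

theorem delta_place {α : ℤ → ℝ} {β : ℤ → ℤ → ℝ} {p q a b : ℤ} (v : Fock n) :
    delta n p q α β (place a b v) =
      (if InBox p q (a - 1) b then place (a - 1) b (α a • kL v) else 0) +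
      if InBox p q a (b - 1) then place a (b - 1) (β a b • kT (ktCoeff a b) v) else 0 := by
  funext a' b'
  by_cases hab : InBox p q a' b'
  · rw [delta_of_inBox hab, place_apply, place_apply, Pi.add_apply, Pi.add_apply]
    congr 1
    · by_cases h : a' + 1 = a ∧ b' = b
      · obtain ⟨rfl, rfl⟩ := h
        rw [add_sub_cancel_right, if_pos hab, if_pos ⟨rfl, rfl⟩, place_apply, if_pos ⟨rfl, rfl⟩]
      · rw [if_neg h, map_zero, smul_zero]
        split_ifs
        · rw [place_apply, if_neg (by omega)]
        · rfl
    · by_cases h : a' = a ∧ b' + 1 = b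
      · obtain ⟨rfl, rfl⟩ := h
        rw [add_sub_cancel_right, if_pos hab, if_pos ⟨rfl, rfl⟩, place_apply, if_pos ⟨rfl, rfl⟩]
      · rw [if_neg h, map_zero, smul_zero]
        split_ifs
        · rw [place_apply, if_neg (by omega)]
        · rfl
  · rw [delta_of_not_inBox hab, Pi.add_apply, Pi.add_apply, eq_comm]
    have h1 : (if InBox p q (a - 1) b then place (a - 1) b (α a • kL v) else 0) a' b' = 0 := by
      split_ifs with h
      · rw [place_apply, if_neg]
        rintro ⟨rfl, rfl⟩
        exact hab h
      · rfl
    have h2 : (if InBox p q a (b - 1) then place a (b - 1) (β a b • kT (ktCoeff a b) v) else 0) a' b' =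
        0 := by
      split_ifs with h
      · rw [place_apply, if_neg]
        rintro ⟨rfl, rfl⟩
        exact hab h
      · rfl
    rw [h1, h2, add_zero]

/-- The gauge transformation of a field, as a family of tensors. -/
theorem fam_gammaField (hqp : q ≤ p) {i j : ℕ} (ρ : Multiset (Fin n)) {μ ν : List (Fin n)}
    (hi : i ≤ p - q) (hj : j ≤ q) (hμ : μ.length = p - i) (hν : ν.length = q - j) :
    fam p q false (gammaField p q i j ρ μ ν) =
      (if i + 1 ≤ p - q then place ((p : ℤ) - (i + 1 : ℕ)) ((q : ℤ) - j)
        (alt (fun m => word (ρ + Multiset.ofList (m.take 1)) (m.drop 1) ν) μ) else 0) +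
      if j + 1 ≤ q then place ((p : ℤ) - i) ((q : ℤ) - (j + 1 : ℕ)) (coeffB p q i j •
        (alt (fun l => word (ρ + Multiset.ofList (l.drop (q - j - 1))) μ (l.take (q - j - 1))) ν +
          coeffA p q i j • alt (fun m => word (ρ + Multiset.ofList ((m.drop (q - j - 1)).take 1))
            (ν ++ m.drop (q - j)) (m.take (q - j - 1))) μ)) else 0 := by
  rw [gammaField, map_add, map_smul, map_add, map_smul]
  congr 1
  · split_ifs with h
    · refine map_alt_of _ _ fun m hm => ?_
      have h1 : (m.drop 1).length = p - (i + 1) := by rw [List.length_drop]; omega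
      rw [fam_sym, if_pos ⟨rfl, h, hj, h1, hν⟩]
    · refine map_alt_eq_zero _ fun m hm => ?_
      rw [fam_sym, if_neg fun h' => h h'.2.1]
  · split_ifs with h
    · rw [map_smul, map_add, map_smul]
      congr 2
      · refine map_alt_of _ _ fun m hm => ?_
        have h1 : (m.take (q - j - 1)).length = q - (j + 1) := by rw [List.length_take]; omega
        rw [fam_sym, if_pos ⟨rfl, hi, h, hμ, h1⟩]
      · congr 1
        refine map_alt_of _ _ fun m hm => ?_
        have h1 : (ν ++ m.drop (q - j)).length = p - i := by
          rw [List.length_append, List.length_drop]; omega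
        have h2 : (m.take (q - j - 1)).length = q - (j + 1) := by rw [List.length_take]; omega
        rw [fam_sym, if_pos ⟨rfl, hi, h, h1, h2⟩]
    · rw [map_alt_eq_zero _ fun m hm => ?_,
        map_alt_eq_zero _ fun m hm => ?_, smul_zero,
        add_zero, smul_zero]
      · rw [fam_sym, if_neg fun h' => h h'.2.2.1]
      · rw [fam_sym, if_neg fun h' => h h'.2.2.1]

/-- The first term is the normalized curl exactly. The other two combine to `kT` only modulo Young
relations: `a_{i,j}` gives the exchange term the weight of `ktCoeff` times `raise * kL`, up to the
common normalization. -/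
theorem fam_gammaField_sub_mem (hq : 1 ≤ q) (hqp : q ≤ p) {i j : ℕ} (ρ : Multiset (Fin n))
    {μ ν : List (Fin n)} (hi : i ≤ p - q) (hj : j ≤ q) (hμ : μ.length = p - i) (hν : ν.length = q - j) :
    fam p q false (gammaField p q i j ρ μ ν) - delta n p q leftCoeff (rightCoeff p q)
      (place ((p : ℤ) - i) ((q : ℤ) - j) (word ρ μ ν)) ∈ relFamilies n := by
  rw [fam_gammaField hqp ρ hi hj hμ hν, delta_place, add_sub_add_comm]
  refine add_mem ?_ ?_
  · have e : (p : ℤ) - (i + 1 : ℕ) = p - i - 1 := by push_cast; ring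
    by_cases h : i + 1 ≤ p - q
    · rw [if_pos h, if_pos (by unfold InBox; omega), e, ← map_sub]
      have h1 := alt_word_cons ρ ν (by omega : μ.length = p - i - 1 + 1)
      have h2 : ((p - i - 1 + 1 : ℕ) : ℝ) = ((p - i : ℤ) : ℝ) := by
        rw [← Int.cast_natCast]; congr 1; omega
      have h3 : ((p - i : ℤ) : ℝ) ≠ 0 := by exact_mod_cast (by omega : (p : ℤ) - i ≠ 0)
      rw [← h1, h2, leftCoeff, smul_smul, inv_mul_cancel₀ h3, one_smul, sub_self, map_zero]
      exact zero_mem _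
    · rw [if_neg h, if_neg (by unfold InBox; omega), sub_zero]
      exact zero_mem _
  · have e : (q : ℤ) - (j + 1 : ℕ) = q - j - 1 := by push_cast; ring
    by_cases h : j + 1 ≤ q
    · rw [if_pos h, if_pos (by unfold InBox; omega), e, ← map_sub]
      refine place_mem_relFamilies ?_
      obtain ⟨b, hb⟩ : ∃ b, q - j = b + 1 := ⟨q - j - 1, by omega⟩
      obtain ⟨c, hc⟩ : ∃ c, p - i = c + (b + 1) := ⟨p - i - (b + 1), by omega⟩
      have h1 := Submodule.smul_mem _ (coeffB p q i j)
        (alt_word_add_alt_word_sub_mem_rel ρ (hμ.trans hc) (hν.trans hb))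
      have e1 : (q : ℤ) - j = b + 1 := by omega
      have e2 : (p : ℤ) - i = c + (b + 1) := by omega
      have e3 : coeffA p q i j = (c + (b + 1)).factorial / ((c + 1).factorial * (b + 1).factorial) := by
        rw [coeffA, show p - i + j + 1 - q = c + 1 by omega, hb, hc]
      have e4 : ktCoeff (c + (b + 1)) (b + 1) = ((c : ℝ) + 1)⁻¹ := by
        rw [ktCoeff]; push_cast; congr 1; ring
      have e5 : rightCoeff p q ((p : ℤ) - i) ((q : ℤ) - j) = coeffB p q i j *
          ((-1) ^ b * ((b : ℝ) + 1)⁻¹) := by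
        rw [rightCoeff, sub_sub_cancel, sub_sub_cancel, Int.toNat_natCast, Int.toNat_natCast, e1,
          add_sub_cancel_right, Int.toNat_natCast]
        push_cast
        rfl
      rw [e5, e1, e2, hb, e3, e4, Nat.add_sub_cancel, add_sub_cancel_right]
      rwa [smul_sub, smul_smul] at h1
    · rw [if_neg h, if_neg (by unfold InBox; omega), sub_zero]
      exact zero_mem _

theorem fam_gammaLin_sub_mem (hq : 1 ≤ q) (hqp : q ≤ p) (t : Lin n) :
    fam p q false (gammaLin p q t) - delta n p q leftCoeff (rightCoeff p q) (fam p q false t) ∈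
      relFamilies n := by
  induction t using lin_induction with
  | hzero => rw [map_zero, map_zero, map_zero, sub_zero]; exact zero_mem _
  | hadd t u ht hu =>
    rw [map_add, map_add, map_add, map_add, add_sub_add_comm]
    exact add_mem ht hu
  | hsmul c t ht =>
    rw [map_smul, map_smul, map_smul, map_smul, ← smul_sub]
    exact Submodule.smul_mem _ _ ht
  | hsym s =>
    rw [gammaLin_sym, fam_sym]
    split_ifs with h
    · obtain ⟨-, h1, h2, h3, h4⟩ := h
      exact fam_gammaField_sub_mem hq hqp s.der h1 h2 h3 h4
    · rw [map_zero, map_zero, sub_zero]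
      exact zero_mem _

theorem fam_true_gammaLin (t : Lin n) : fam p q true (gammaLin p q t) = 0 := by
  have hz : ∀ (T : List (Fin n) → Lin n) (l : List (Fin n)), (∀ m, fam p q true (T m) = 0) →
      fam p q true (alt T l) = 0 := fun T l h => by
    rw [map_alt]
    exact (alt_congr fun m _ => h m).trans (alt_eq_zero l)
  induction t using lin_induction with
  | hzero => rw [map_zero, map_zero]
  | hadd t u ht hu => rw [map_add, map_add, ht, hu, add_zero]
  | hsmul c t ht => rw [map_smul, map_smul, ht, smul_zero]
  | hsym s =>
    rw [gammaLin_sym]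
    split_ifs with h
    · have hs : ∀ (i j : ℕ) (ρ : Multiset (Fin n)) (μ ν : List (Fin n)),
          fam p q true (sym ⟨false, i, j, ρ, μ, ν⟩) = 0 := fun i j ρ μ ν => by
        rw [fam_sym, if_neg fun h => Bool.false_ne_true h.1]
      rw [gammaField, map_add, map_smul, map_add, map_smul, hz _ _ fun m => hs _ _ _ _ _,
        hz _ _ fun m => hs _ _ _ _ _, hz _ _ fun m => hs _ _ _ _ _, smul_zero, add_zero, smul_zero, add_zero]
    · exact map_zero _

end GaugeDifferential

section LinearCohomology

variable {n p q : ℕ}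

/-! ### The cohomology of the gauge differential on linear combinations of symbols -/

/-- The linear combinations of symbols that vanish on jets. -/
def nullLin (n p q : ℕ) : Submodule ℝ (Lin n) := ⨅ A, (relFamilies n).comap (fam p q A)

theorem mem_nullLin {t : Lin n} : t ∈ nullLin n p q ↔ ∀ A, fam p q A t ∈ relFamilies n := by
  simp only [nullLin, Submodule.mem_iInf, Submodule.mem_comap]

theorem gammaLin_mem_nullLin (hq : 1 ≤ q) (hqp : q ≤ p) {t : Lin n} (ht : t ∈ nullLin n p q) :
    gammaLin p q t ∈ nullLin n p q := by
  rw [mem_nullLin] at ht ⊢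
  rintro (_ | _)
  · have h := add_mem (fam_gammaLin_sub_mem hq hqp t)
      (delta_mem_relFamilies (α := leftCoeff) (β := rightCoeff p q) (fam_mem_families hqp false t) (ht false))
    rwa [sub_add_cancel] at h
  · rw [fam_true_gammaLin]
    exact zero_mem _

/-- On symbols the square vanishes only up to Young relations: `gammaLin` agrees with `delta` modulo
these, and `delta` preserves them and squares to zero. -/
theorem gammaLin_gammaLin_mem_nullLin (hq : 1 ≤ q) (hqp : q ≤ p) (t : Lin n) :
    gammaLin p q (gammaLin p q t) ∈ nullLin n p q := by
  rw [mem_nullLin]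
  rintro (_ | _)
  · have hF := fam_mem_families hqp false t
    have h1 := delta_mem_relFamilies (α := leftCoeff) (β := rightCoeff p q)
      (sub_mem (fam_mem_families hqp false (gammaLin p q t)) (delta_mem hF)) (fam_gammaLin_sub_mem hq hqp t)
    rw [map_sub, (isAdmissible hq hqp).delta_delta hF, sub_zero] at h1
    have h := add_mem (fam_gammaLin_sub_mem hq hqp (gammaLin p q t)) h1
    rwa [sub_add_cancel] at h
  · rw [fam_true_gammaLin]
    exact zero_mem _

theorem invariantFamily_eq_place (h d z : Fock n) : invariantFamily n p q (h, d, z) =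
    place q 0 (vac h) + place p 0 (kL (vac d)) + place p q (kR (kL z)) := by
  funext a b
  rw [invariantFamily_apply, Pi.add_apply, Pi.add_apply, Pi.add_apply, Pi.add_apply, place_apply,
    place_apply, place_apply]

theorem vac_word (ρ : Multiset (Fin n)) (μ ν : List (Fin n)) :
    vac (word ρ μ ν) = if ρ = 0 then word 0 μ ν else 0 := by
  rw [vac, scale_word]
  by_cases h : ρ = 0
  · subst h
    rw [if_pos rfl, if_pos Multiset.card_zero, one_smul]
  · rw [if_neg h, if_neg (by rwa [Multiset.card_eq_zero]), zero_smul]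

theorem fam_true_sym_false (i j : ℕ) (ρ : Multiset (Fin n)) (μ ν : List (Fin n)) :
    fam p q true (sym ⟨false, i, j, ρ, μ, ν⟩) = 0 := by
  rw [fam_sym, if_neg fun h => Bool.false_ne_true h.1]

theorem fam_curvature (ρ : Multiset (Fin n)) {μ ν : List (Fin n)} (hμ : μ.length = p + 1)
    (hν : ν.length = q + 1) : fam p q false (curvature q ρ μ ν) =
      ((-1 : ℝ) ^ q * ((p + 1) * (q + 1) : ℝ)⁻¹) • place p q (kR (kL (word ρ μ ν))) := by
  have hp : ((p + 1 : ℕ) : ℝ) ≠ 0 := Nat.cast_ne_zero.2 (Nat.succ_ne_zero p)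
  have hq : ((q + 1 : ℕ) : ℝ) ≠ 0 := Nat.cast_ne_zero.2 (Nat.succ_ne_zero q)
  have h1 : ∀ m : List (Fin n), m.length = μ.length → fam p q false (alt (fun l =>
      sym ⟨false, 0, 0, ρ + Multiset.ofList (m.take 1) + Multiset.ofList (l.drop q), m.drop 1, l.take q⟩) ν) =
      (place p q ∘ₗ ((((q + 1 : ℕ) : ℝ)⁻¹ * (-1 : ℝ) ^ q) • kR : Module.End ℝ (Fock n)))
        (word (ρ + Multiset.ofList (m.take 1)) (m.drop 1) ν) := by
    intro m hm
    have h2 : fam p q false (alt (fun l =>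
        sym ⟨false, 0, 0, ρ + Multiset.ofList (m.take 1) + Multiset.ofList (l.drop q), m.drop 1, l.take q⟩) ν) =
        place p q (alt (fun l => word (ρ + Multiset.ofList (m.take 1) + Multiset.ofList (l.drop q))
          (m.drop 1) (l.take q)) ν) := by
      refine map_alt_of _ _ fun l hl => ?_
      have e1 : (m.drop 1).length = p - 0 := by rw [List.length_drop]; omega
      have e2 : (l.take q).length = q - 0 := by rw [List.length_take]; omega
      rw [fam_sym, if_pos ⟨rfl, Nat.zero_le _, Nat.zero_le _, e1, e2⟩, Nat.cast_zero, sub_zero, sub_zero]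
    rw [h2, LinearMap.comp_apply, LinearMap.smul_apply, mul_smul,
      ← alt_word_concat (ρ + Multiset.ofList (m.take 1)) (m.drop 1) hν, smul_smul, inv_mul_cancel₀ hq, one_smul]
  rw [curvature, map_alt_of _ _ h1, ← alt_word_cons ρ ν hμ, LinearMap.comp_apply, LinearMap.smul_apply]
  simp only [map_smul, smul_smul]
  congr 1
  rw [mul_inv, mul_assoc, mul_assoc, ← Nat.cast_succ p, mul_comm _ ((p + 1 : ℕ) : ℝ), inv_mul_cancel_left₀ hp]
  push_cast
  ring

theorem fam_curl {μ : List (Fin n)} (hμ : μ.length = p + 1) : fam p q false (curl q μ) =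
    ((-1 : ℝ) ^ q * (p + 1 : ℝ)⁻¹) • place p 0 (kL (word 0 μ [])) := by
  have hp : ((p + 1 : ℕ) : ℝ) ≠ 0 := Nat.cast_ne_zero.2 (Nat.succ_ne_zero p)
  have h1 : fam p q false (alt (fun m => sym ⟨false, 0, q, Multiset.ofList (m.take 1), m.drop 1, []⟩) μ) =
      place p 0 (alt (fun m => word (0 + Multiset.ofList (m.take 1)) (m.drop 1) []) μ) := by
    refine map_alt_of _ _ fun m hm => ?_
    have e1 : (m.drop 1).length = p - 0 := by rw [List.length_drop]; omega
    rw [fam_sym, if_pos ⟨rfl, Nat.zero_le _, le_rfl, e1, (Nat.sub_self q).symm⟩, Nat.cast_zero, sub_zero,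
      sub_self, zero_add]
  rw [curl, map_smul, h1, ← alt_word_cons 0 [] hμ, map_smul, smul_smul, mul_assoc, Nat.cast_succ,
    inv_mul_cancel₀ (by exact_mod_cast hp), mul_one]

theorem fam_lastGhost (hqp : q ≤ p) {μ : List (Fin n)} (hμ : μ.length = q) :
    fam p q false (sym ⟨false, p - q, q, 0, μ, []⟩) = place q 0 (word 0 μ []) := by
  have e1 : μ.length = p - (p - q) := by omega
  rw [fam_sym, if_pos ⟨rfl, le_rfl, le_rfl, e1, (Nat.sub_self q).symm⟩]
  change place ((p : ℤ) - (p - q : ℕ)) ((q : ℤ) - q) _ = _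
  rw [sub_self, Nat.cast_sub hqp, sub_sub_cancel]

theorem span_invariantVars_le (hqp : q ≤ p) : Submodule.span ℝ (invariantVars n p q) ≤
    ((invariantDomain n p q).map (invariantFamily n p q)).comap (fam p q false) := by
  rw [Submodule.span_le]
  rintro t (((⟨i, j, ρ, μ, ν, hs, rfl⟩ | ⟨ρ, μ, ν, hμ, hν, rfl⟩) | ⟨μ, hμ, rfl⟩) | ⟨μ, hμ, rfl⟩)
  · refine ⟨0, zero_mem _, ?_⟩
    rw [map_zero, fam_sym, if_neg fun h => Bool.false_ne_true h.1.symm]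
  · have hw : word ρ μ ν ∈ bidegree n ((p : ℤ) + 1) ((q : ℤ) + 1) := word_mem (by omega) (by omega)
    refine ⟨(0, 0, ((-1 : ℝ) ^ q * ((p + 1) * (q + 1) : ℝ)⁻¹) • word ρ μ ν),
      ⟨zero_mem _, zero_mem _, Submodule.smul_mem _ _ hw⟩, ?_⟩
    rw [invariantFamily_eq_place, fam_curvature ρ hμ hν]
    simp only [map_zero, zero_add, map_smul]
  · have hw : word 0 μ [] ∈ bidegree n (q : ℤ) 0 := word_mem (by omega) rfl
    refine ⟨(word 0 μ [], 0, 0), ⟨hw, zero_mem _, zero_mem _⟩, ?_⟩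
    rw [invariantFamily_eq_place, fam_lastGhost hqp hμ, vac_word, if_pos rfl]
    simp only [map_zero, add_zero]
  · have hw : word 0 μ [] ∈ bidegree n ((p : ℤ) + 1) 0 := word_mem (by omega) rfl
    refine ⟨(0, ((-1 : ℝ) ^ q * (p + 1 : ℝ)⁻¹) • word 0 μ [], 0),
      ⟨zero_mem _, Submodule.smul_mem _ _ hw, zero_mem _⟩, ?_⟩
    rw [invariantFamily_eq_place, fam_curl hμ]
    simp only [map_zero, zero_add, add_zero, map_smul, vac_word, if_pos]

/-- Up to nonzero normalizations the last ghosts, curls and curvatures come from all words of the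
domain, so their span fills the image of `invariantFamily` without any antifield. -/
theorem exists_mem_span_fam_eq (hqp : q ≤ p) {x : Fock n × Fock n × Fock n}
    (hx : x ∈ invariantDomain n p q) : ∃ k ∈ Submodule.span ℝ (invariantVars n p q),
      fam p q false k = invariantFamily n p q x ∧ fam p q true k = 0 := by
  let S : Submodule ℝ (ℤ → ℤ → Fock n) :=
    (Submodule.span ℝ (invariantVars n p q) ⊓ LinearMap.ker (fam p q true)).map (fam p q false)
  suffices h : invariantFamily n p q x ∈ S by
    obtain ⟨k, ⟨h1, h2⟩, h3⟩ := h
    exact ⟨k, h1, h3, h2⟩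
  have hS : ∀ t ∈ invariantVars n p q, fam p q true t = 0 → fam p q false t ∈ S := fun t h h' =>
    Submodule.mem_map_of_mem ⟨Submodule.subset_span h, h'⟩
  have hc1 : ((-1 : ℝ) ^ q * (p + 1 : ℝ)⁻¹) ≠ 0 :=
    mul_ne_zero (pow_ne_zero _ (by norm_num)) (by positivity)
  have hc2 : ((-1 : ℝ) ^ q * ((p + 1) * (q + 1) : ℝ)⁻¹) ≠ 0 :=
    mul_ne_zero (pow_ne_zero _ (by norm_num)) (by positivity)
  obtain ⟨h, d, z⟩ := x
  obtain ⟨hh, hd, hz⟩ := hx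
  rw [invariantFamily_eq_place]
  refine add_mem (add_mem ?_ ?_) ?_
  · change h ∈ S.comap (place q 0 ∘ₗ vac)
    refine (Submodule.span_le.2 ?_ : bidegree n q 0 ≤ _) hh
    rintro _ ⟨ρ, μ, ν, hμ, hν, rfl⟩
    obtain rfl : ν = [] := List.eq_nil_of_length_eq_zero (by exact_mod_cast hν)
    change place q 0 (vac (word ρ μ [])) ∈ S
    rw [vac_word]
    split_ifs
    · have hμ' : μ.length = q := by omega
      rw [← fam_lastGhost hqp hμ']
      exact hS _ (Or.inl (Or.inr ⟨μ, hμ', rfl⟩)) (fam_true_sym_false _ _ _ _ _)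
    · rw [map_zero]; exact zero_mem _
  · change d ∈ S.comap (place p 0 ∘ₗ kL ∘ₗ vac)
    refine (Submodule.span_le.2 ?_ : bidegree n (p + 1) 0 ≤ _) hd
    rintro _ ⟨ρ, μ, ν, hμ, hν, rfl⟩
    obtain rfl : ν = [] := List.eq_nil_of_length_eq_zero (by exact_mod_cast hν)
    change place p 0 (kL (vac (word ρ μ []))) ∈ S
    rw [vac_word]
    split_ifs
    · have hμ' : μ.length = p + 1 := by omega
      rw [← Submodule.smul_mem_iff S hc1, ← fam_curl hμ']
      refine hS _ (Or.inr ⟨μ, hμ', rfl⟩) ?_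
      rw [curl, map_smul, map_alt_eq_zero _ fun m _ => fam_true_sym_false _ _ _ _ _, smul_zero]
    · rw [map_zero, map_zero]; exact zero_mem _
  · change z ∈ S.comap (place p q ∘ₗ kR ∘ₗ kL)
    refine (Submodule.span_le.2 ?_ : bidegree n (p + 1) (q + 1) ≤ _) hz
    rintro _ ⟨ρ, μ, ν, hμ, hν, rfl⟩
    change place p q (kR (kL (word ρ μ ν))) ∈ S
    have hμ' : μ.length = p + 1 := by omega
    have hν' : ν.length = q + 1 := by omega
    rw [← Submodule.smul_mem_iff S hc2, ← fam_curvature ρ hμ' hν']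
    refine hS _ (Or.inl (Or.inl (Or.inr ⟨ρ, μ, ν, hμ', hν', rfl⟩))) ?_
    exact map_alt_eq_zero _ fun m _ => map_alt_eq_zero _ fun l _ => fam_true_sym_false _ _ _ _ _

theorem exists_mem_span_fam_true_eq (t : Lin n) : ∃ k ∈ Submodule.span ℝ (invariantVars n p q),
    fam p q true k = fam p q true t ∧ fam p q false k = 0 := by
  induction t using lin_induction with
  | hzero => exact ⟨0, zero_mem _, rfl, map_zero _⟩
  | hadd t u ht hu =>
    obtain ⟨k, hk, h1, h2⟩ := ht
    obtain ⟨l, hl, h3, h4⟩ := hu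
    exact ⟨k + l, add_mem hk hl, by rw [map_add, map_add, h1, h3], by rw [map_add, h2, h4, add_zero]⟩
  | hsmul c t ht =>
    obtain ⟨k, hk, h1, h2⟩ := ht
    exact ⟨c • k, Submodule.smul_mem _ _ hk, by rw [map_smul, map_smul, h1],
      by rw [map_smul, h2, smul_zero]⟩
  | hsym s =>
    by_cases h : s.anti = true ∧ s.Occurs p q
    · refine ⟨sym s, Submodule.subset_span (Or.inl (Or.inl (Or.inl ?_))), rfl, ?_⟩
      · obtain ⟨A, i, j, ρ, μ, ν⟩ := s
        obtain ⟨rfl, h⟩ := h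
        exact ⟨i, j, ρ, μ, ν, h, rfl⟩
      · rw [fam_sym, if_neg fun h' => Bool.false_ne_true (h'.1.symm.trans h.1)]
    · refine ⟨0, zero_mem _, ?_, map_zero _⟩
      rw [fam_sym, if_neg h, map_zero]

/-- A family is a finite sum of words over the box, and each word represents one symbol; so
primitives found among families come from symbols. -/
theorem families_le_range_fam (hqp : q ≤ p) : families n p q ≤ LinearMap.range (fam p q false) := by
  intro Y hY
  have e : Y = ∑ a ∈ Finset.Icc (q : ℤ) p, ∑ b ∈ Finset.Icc (0 : ℤ) q, place a b (Y a b) := by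
    funext a b
    simp only [Finset.sum_apply, place_apply]
    by_cases hab : InBox p q a b
    · rw [Finset.sum_eq_single a, Finset.sum_eq_single b, if_pos ⟨rfl, rfl⟩]
      · exact fun b' _ h => if_neg fun h' => h h'.2.symm
      · exact fun h => absurd (Finset.mem_Icc.2 hab.2) h
      · exact fun a' _ h => Finset.sum_eq_zero fun b' _ => if_neg fun h' => h h'.1.symm
      · exact fun h => absurd (Finset.mem_Icc.2 hab.1) h
    · rw [(hY a b).2 hab, Finset.sum_eq_zero]
      refine fun a' ha' => Finset.sum_eq_zero fun b' hb' => if_neg ?_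
      rintro ⟨rfl, rfl⟩
      exact hab ⟨Finset.mem_Icc.1 ha', Finset.mem_Icc.1 hb'⟩
  rw [e]
  refine sum_mem fun a ha => sum_mem fun b hb => ?_
  rw [Finset.mem_Icc] at ha hb
  change Y a b ∈ (LinearMap.range (fam p q false)).comap (place a b)
  refine (Submodule.span_le.2 ?_ : bidegree n a b ≤ _) (hY a b).1
  rintro _ ⟨ρ, μ, ν, hμ, hν, rfl⟩
  refine ⟨sym ⟨false, (p - a).toNat, (q - b).toNat, ρ, μ, ν⟩, ?_⟩
  have h1 : (p - a).toNat ≤ p - q := by omega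
  have h2 : (q - b).toNat ≤ q := by omega
  have h3 : μ.length = p - (p - a).toNat := by omega
  have h4 : ν.length = q - (q - b).toNat := by omega
  rw [fam_sym, if_pos ⟨rfl, h1, h2, h3, h4⟩]
  have e1 : (p : ℤ) - ((p - a).toNat : ℕ) = a := by omega
  have e2 : (q : ℤ) - ((q - b).toNat : ℕ) = b := by omega
  change place ((p : ℤ) - ((p - a).toNat : ℕ)) ((q : ℤ) - ((q - b).toNat : ℕ)) _ = _
  rw [e1, e2]

theorem gammaLin_mem_nullLin_of_mem_span (hq : 1 ≤ q) (hqp : q ≤ p) {k : Lin n}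
    (hk : k ∈ Submodule.span ℝ (invariantVars n p q)) : gammaLin p q k ∈ nullLin n p q := by
  rw [mem_nullLin]
  rintro (_ | _)
  · obtain ⟨x, -, hx⟩ := span_invariantVars_le hqp hk
    have h := fam_gammaLin_sub_mem hq hqp k
    rwa [← hx, delta_invariantFamily (by exact_mod_cast hq), sub_zero] at h
  · rw [fam_true_gammaLin]
    exact zero_mem _

/-- An exact linear combination of invariants vanishes on jets. -/
theorem mem_nullLin_of_sub_gammaLin_mem (hq : 1 ≤ q) (hqp : q ≤ p) {k y : Lin n}
    (hk : k ∈ Submodule.span ℝ (invariantVars n p q)) (h : k - gammaLin p q y ∈ nullLin n p q) :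
    k ∈ nullLin n p q := by
  rw [mem_nullLin] at h ⊢
  rintro (_ | _)
  · obtain ⟨x, hx, e⟩ := span_invariantVars_le hqp hk
    have h1 := add_mem (h false) (fam_gammaLin_sub_mem hq hqp y)
    rw [map_sub, sub_add_sub_cancel, ← e] at h1
    rw [← e]
    exact invariantFamily_mem_relFamilies (by exact_mod_cast hq) (by exact_mod_cast hqp) hx
      (fam_mem_families hqp false y) h1
  · have h1 := h true
    rwa [map_sub, fam_true_gammaLin, sub_zero] at h1

/-- A closed linear combination of symbols is cohomologous to a linear combination of invariants. -/
theorem exists_sub_sub_gammaLin_mem_nullLin (hq : 1 ≤ q) (hqp : q ≤ p) {t : Lin n}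
    (ht : gammaLin p q t ∈ nullLin n p q) : ∃ k ∈ Submodule.span ℝ (invariantVars n p q), ∃ y,
      t - k - gammaLin p q y ∈ nullLin n p q := by
  rw [mem_nullLin] at ht
  have hδ := sub_mem (ht false) (fam_gammaLin_sub_mem hq hqp t)
  rw [sub_sub_cancel] at hδ
  have hF := (isAdmissible hq hqp).mem_of_delta_mem (fam_mem_families hqp false t) hδ
  obtain ⟨v, hv, w, hw, e⟩ := Submodule.mem_sup.1 hF
  obtain ⟨u, hu, _, ⟨Y, hY, rfl⟩, rfl⟩ := Submodule.mem_sup.1 hv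
  obtain ⟨x, hx, rfl⟩ := hw
  obtain ⟨y, rfl⟩ := families_le_range_fam hqp hY
  obtain ⟨k, hk, h1, h2⟩ := exists_mem_span_fam_eq hqp hx
  -- The antifields are themselves invariants, so the antifield part of `t` goes unchanged into the
  -- representative.
  obtain ⟨l, hl, h3, h4⟩ := exists_mem_span_fam_true_eq (p := p) (q := q) t
  refine ⟨k + l, add_mem hk hl, y, mem_nullLin.2 ?_⟩
  rintro (_ | _)
  · have h5 := sub_mem hu (fam_gammaLin_sub_mem hq hqp y)
    rw [map_sub, map_sub, map_add, h1, h4, ← e]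
    convert h5 using 1
    abel
  · rw [map_sub, map_sub, map_add, h2, h3, fam_true_gammaLin, zero_add, sub_self, sub_zero]
    exact zero_mem _

end LinearCohomology

section Parity

variable {n p q : ℕ}

/-! ### Grassmann parity -/

/-- The linear combinations of symbols of parity `ε`. -/
def parityLin (n : ℕ) (ε : ZMod 2) : Submodule ℝ (Lin n) := Submodule.span ℝ {t | ∃ s, s.parity = ε ∧ t = sym s}

theorem sym_mem_parityLin (s : Comp n) : sym s ∈ parityLin n s.parity :=
  Submodule.subset_span ⟨s, rfl, rfl⟩

theorem sym_false_mem_parityLin (i j : ℕ) (ρ : Multiset (Fin n)) (μ ν : List (Fin n)) :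
    sym ⟨false, i, j, ρ, μ, ν⟩ ∈ parityLin n (i + j : ℕ) :=
  Submodule.subset_span ⟨⟨false, i, j, ρ, μ, ν⟩, if_neg Bool.false_ne_true, rfl⟩

theorem alt_mem {V : Type*} [AddCommGroup V] [Module ℝ V] {W : Submodule ℝ V} {T : List (Fin n) → V}
    (h : ∀ m, T m ∈ W) (l : List (Fin n)) : alt T l ∈ W :=
  Submodule.smul_mem _ _ (sum_mem fun _ _ => Submodule.smul_mem _ _ (h _))

/-- The part of parity `ε` of a linear combination of symbols. -/
def parityProj (ε : ZMod 2) : Lin n →ₗ[ℝ] Lin n :=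
  Finsupp.linearCombination ℝ fun s => if s.parity = ε then sym s else 0

theorem parityProj_sym (ε : ZMod 2) (s : Comp n) :
    parityProj ε (sym s) = if s.parity = ε then sym s else 0 := by
  rw [parityProj, sym, Finsupp.linearCombination_single, one_smul]
  rfl

theorem parityProj_of_mem {e : ZMod 2} (ε : ZMod 2) {t : Lin n} (ht : t ∈ parityLin n e) :
    parityProj ε t = if e = ε then t else 0 := by
  induction ht using Submodule.span_induction with
  | zero => rw [map_zero, ite_self]
  | add x y _ _ hx hy => rw [map_add, hx, hy]; split_ifs <;> simp
  | smul c x _ hx => rw [map_smul, hx]; split_ifs <;> simp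
  | mem x hx =>
    obtain ⟨s, rfl, rfl⟩ := hx
    exact parityProj_sym ε s

theorem gammaField_mem_parityLin (i j : ℕ) (ρ : Multiset (Fin n)) (μ ν : List (Fin n)) :
    gammaField p q i j ρ μ ν ∈ parityLin n ((i + j : ℕ) + 1) := by
  have h1 : ∀ ρ μ ν, sym ⟨false, i + 1, j, ρ, μ, ν⟩ ∈ parityLin n ((i + j : ℕ) + 1) := fun ρ μ ν => by
    convert sym_false_mem_parityLin (i + 1) j ρ μ ν using 2
    push_cast; ring
  have h2 : ∀ ρ μ ν, sym ⟨false, i, j + 1, ρ, μ, ν⟩ ∈ parityLin n ((i + j : ℕ) + 1) := fun ρ μ ν => by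
    convert sym_false_mem_parityLin i (j + 1) ρ μ ν using 2
    push_cast; ring
  exact add_mem (alt_mem (fun _ => h1 _ _ _) _) (Submodule.smul_mem _ _ (add_mem (alt_mem (fun _ => h2 _ _ _) _)
    (Submodule.smul_mem _ _ (alt_mem (fun _ => h2 _ _ _) _))))

theorem gammaLin_parityProj (ε : ZMod 2) (t : Lin n) :
    gammaLin p q (parityProj ε t) = parityProj (ε + 1) (gammaLin p q t) := by
  induction t using lin_induction with
  | hzero => simp only [map_zero]
  | hadd t u ht hu => simp only [map_add, ht, hu]
  | hsmul c t ht => simp only [map_smul, ht]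
  | hsym s =>
    rw [parityProj_sym, gammaLin_sym]
    by_cases h : s.anti = false ∧ s.Occurs p q
    · have e : s.parity = (s.i + s.j : ℕ) := if_neg (by rw [h.1]; exact Bool.false_ne_true)
      rw [if_pos h, parityProj_of_mem _ (gammaField_mem_parityLin _ _ _ _ _), e]
      by_cases h' : ((s.i + s.j : ℕ) : ZMod 2) = ε
      · rw [if_pos h', if_pos (by rw [h']), gammaLin_sym, if_pos h]
      · rw [if_neg h', if_neg fun e => h' (add_right_cancel e), map_zero]
    · rw [if_neg h, map_zero]
      split_ifs
      · rw [gammaLin_sym, if_neg h]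
      · exact map_zero _

theorem exists_invariantVars_mem_parityLin {t : Lin n} (ht : t ∈ invariantVars n p q) :
    ∃ e, t ∈ parityLin n e := by
  rcases ht with ((⟨i, j, ρ, μ, ν, hs, rfl⟩ | ⟨ρ, μ, ν, hμ, hν, rfl⟩) | ⟨μ, hμ, rfl⟩) | ⟨μ, hμ, rfl⟩
  · exact ⟨_, sym_mem_parityLin _⟩
  · exact ⟨_, alt_mem (fun _ => alt_mem (fun _ => sym_false_mem_parityLin 0 0 _ _ _) _) _⟩
  · exact ⟨_, sym_mem_parityLin _⟩
  · exact ⟨_, Submodule.smul_mem _ _ (alt_mem (fun _ => sym_false_mem_parityLin 0 q _ _ _) _)⟩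

theorem parityProj_mem_span {k : Lin n} (hk : k ∈ Submodule.span ℝ (invariantVars n p q)) (ε : ZMod 2) :
    parityProj ε k ∈ Submodule.span ℝ (invariantVars n p q) := by
  have h : Submodule.span ℝ (invariantVars n p q) ≤
      (Submodule.span ℝ (invariantVars n p q)).comap (parityProj ε) := by
    refine Submodule.span_le.2 fun t ht => ?_
    obtain ⟨e, he⟩ := exists_invariantVars_mem_parityLin ht
    change parityProj ε t ∈ Submodule.span ℝ (invariantVars n p q)
    rw [parityProj_of_mem ε he]
    split_ifs
    · exact Submodule.subset_span ht
    · exact zero_mem _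
  exact h hk

/-! ### Linear functions on jets of given parity -/

/-- The linear function on the jets of parity `ε` given by a linear combination of symbols. -/
def res (n p q : ℕ) (ε : ZMod 2) : Lin n →ₗ[ℝ] Module.Dual ℝ (jets n p q ε) :=
  (jets n p q ε).subtype.dualMap ∘ₗ coordHom n

theorem res_apply (ε : ZMod 2) (t : Lin n) (φ : jets n p q ε) : res n p q ε t φ = coord t φ := rfl

theorem mem_nullLin_iff_res (hqp : q ≤ p) {t : Lin n} : t ∈ nullLin n p q ↔ ∀ ε, res n p q ε t = 0 := by
  rw [mem_nullLin, fam_mem_relFamilies_iff hqp]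
  exact forall_congr' fun ε => ⟨fun h => LinearMap.ext fun φ => h φ φ.2,
    fun h φ hφ => LinearMap.congr_fun h (⟨φ, hφ⟩ : jets n p q ε)⟩

theorem res_parityProj (ε ε' : ZMod 2) (t : Lin n) :
    res n p q ε' (parityProj ε t) = if ε' = ε then res n p q ε' t else 0 := by
  induction t using lin_induction with
  | hzero => simp only [map_zero, ite_self]
  | hadd t u ht hu => simp only [map_add, ht, hu]; split_ifs <;> simp
  | hsmul c t ht => simp only [map_smul, ht]; split_ifs <;> simp
  | hsym s =>
    rw [parityProj_sym]
    have h0 : s.parity ≠ ε' → res n p q ε' (sym s) = 0 := fun h => LinearMap.ext fun φ => by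
      rw [res_apply, coord_sym]
      exact φ.2.1 s fun h' => h h'.2
    by_cases h : s.parity = ε
    · rw [if_pos h]
      split_ifs with h'
      · rfl
      · exact h0 fun e => h' (e.symm.trans h)
    · rw [if_neg h, map_zero]
      split_ifs with h'
      · exact (h0 fun e => h (e.trans h')).symm
      · rfl

theorem parityProj_mem_nullLin (hqp : q ≤ p) {ε : ZMod 2} {t : Lin n} (h : res n p q ε t = 0) :
    parityProj ε t ∈ nullLin n p q := by
  rw [mem_nullLin_iff_res hqp]
  intro ε'
  rw [res_parityProj]
  split_ifs with h'
  · rw [h', h]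
  · rfl

/-- A functional on the linear functions assigns a number to each symbol. Every symmetry required of
a jet is a linear relation that holds on all jets, hence among these linear functions, so the
numbers form a jet. -/
theorem isPredual_range_res (ε : ZMod 2) : IsPredual (LinearMap.range (res n p q ε)) where
  ext φ h := Subtype.ext (funext fun s => by
    have := h _ ⟨sym s, rfl⟩
    rwa [res_apply, coord_sym] at this)
  exists_eval ψ := by
    let L := ψ ∘ₗ (res n p q ε).rangeRestrict
    have hL : ∀ t, (∀ φ ∈ jets n p q ε, coord t φ = 0) → L t = 0 := fun t h => by
      have e : (res n p q ε).rangeRestrict t = 0 :=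
        Subtype.ext (LinearMap.ext fun φ : jets n p q ε => h φ φ.2)
      change ψ _ = 0
      rw [e, map_zero]
    have hsub : ∀ t u : Lin n, (∀ φ ∈ jets n p q ε, coord t φ = coord u φ) → L t = L u := fun t u h => by
      rw [← sub_eq_zero, ← map_sub]
      refine hL _ fun φ hφ => ?_
      have e : coord (t - u) = coord t - coord u := map_sub (coordHom n) t u
      rw [e, LinearMap.sub_apply, h φ hφ, sub_self]
    have halt : ∀ (φ : Comp n → ℝ) (T : List (Fin n) → Comp n) l,
        coord (alt (fun m => sym (T m)) l) φ = alt (fun m => φ (T m)) l := fun φ T l => by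
      have h := map_alt (LinearMap.applyₗ φ ∘ₗ coordHom n) (fun m => sym (T m)) l
      exact h.trans (alt_congr fun m _ => coord_sym _ _)
    refine ⟨⟨fun s => L (sym s), fun s hs => hL _ fun φ hφ => ?_, fun a i j ρ μ ν => ?_,
      fun a i j ρ μ ν => ?_, fun a i j ρ μ ν hμ => ?_⟩, ?_⟩
    · rw [coord_sym]
      exact hφ.1 s hs
    · rw [← map_alt]
      refine hsub _ _ fun φ hφ => ?_
      rw [halt, coord_sym]
      exact hφ.2.1 _ _ _ _ _ _
    · rw [← map_alt]
      refine hsub _ _ fun φ hφ => ?_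
      rw [halt, coord_sym]
      exact hφ.2.2.1 _ _ _ _ _ _
    · rw [← map_alt]
      refine hL _ fun φ hφ => ?_
      rw [halt]
      exact hφ.2.2.2 _ _ _ _ _ _ hμ
    · rintro ⟨_, t, rfl⟩
      change coord t (fun s => L (sym s)) = L t
      rw [coord_apply]
      have e : (Finsupp.linearCombination ℝ fun s => L (sym s)) = L :=
        Finsupp.lhom_ext' fun s => LinearMap.ext_ring (by
          change Finsupp.linearCombination ℝ _ (Finsupp.single s 1) = L (sym s)
          rw [Finsupp.linearCombination_single, one_smul])
      rw [e]

/-- The gauge differential of linear functions is dual to a linear map of jets. -/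
theorem exists_dual_gammaLin (hq : 1 ≤ q) (hqp : q ≤ p) {ε ε' : ZMod 2} (h : ε + 1 = ε') :
    ∃ δ : jets n p q ε' →ₗ[ℝ] jets n p q ε, ∀ t, res n p q ε t ∘ₗ δ = res n p q ε' (gammaLin p q t) := by
  -- A combination that vanishes on jets of parity `ε` may survive on the other parity, but its
  -- `ε`-part vanishes on all jets; `gammaLin` carries that part to parity `ε'`.
  have hker : ∀ t, res n p q ε t = 0 → res n p q ε' (gammaLin p q t) = 0 := fun t ht => by
    have h1 := gammaLin_mem_nullLin hq hqp (parityProj_mem_nullLin hqp ht)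
    rw [gammaLin_parityProj, h] at h1
    have h2 := (mem_nullLin_iff_res hqp).1 h1 ε'
    rwa [res_parityProj, if_pos rfl] at h2
  obtain ⟨g, hg⟩ : ∃ g : LinearMap.range (res n p q ε) →ₗ[ℝ] LinearMap.range (res n p q ε'),
      ∀ t, g ((res n p q ε).rangeRestrict t) = (res n p q ε').rangeRestrict (gammaLin p q t) := by
    obtain ⟨r, hr⟩ := exists_generalizedInverse (res n p q ε)
    refine ⟨(res n p q ε').rangeRestrict ∘ₗ gammaLin p q ∘ₗ r ∘ₗ Submodule.subtype _, fun t => Subtype.ext ?_⟩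
    change res n p q ε' (gammaLin p q (r (res n p q ε t))) = res n p q ε' (gammaLin p q t)
    rw [← sub_eq_zero, ← map_sub, ← map_sub]
    exact hker _ (by rw [map_sub, hr, sub_self])
  obtain ⟨δ, hδ⟩ := (isPredual_range_res ε).exists_transpose g
  refine ⟨δ, fun t => ?_⟩
  have h1 := hδ ((res n p q ε).rangeRestrict t)
  rwa [hg] at h1

theorem res_eq_zero_of_eq_res_gammaLin (hq : 1 ≤ q) (hqp : q ≤ p) {ε ε' : ZMod 2} (h : ε' + 1 = ε)
    {k y : Lin n} (hk : k ∈ Submodule.span ℝ (invariantVars n p q))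
    (e : res n p q ε k = res n p q ε (gammaLin p q y)) : res n p q ε k = 0 := by
  have h1 : parityProj ε (k - gammaLin p q y) ∈ nullLin n p q :=
    parityProj_mem_nullLin hqp (by rw [map_sub, e, sub_self])
  rw [map_sub, ← h, ← gammaLin_parityProj, h] at h1
  have h2 := (mem_nullLin_iff_res hqp).1
    (mem_nullLin_of_sub_gammaLin_mem hq hqp (parityProj_mem_span hk ε) h1) ε
  rwa [res_parityProj, if_pos rfl] at h2

theorem exists_res_eq_add (hq : 1 ≤ q) (hqp : q ≤ p) {ε ε' : ZMod 2} (h : ε + 1 = ε') {t : Lin n}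
    (ht : res n p q ε' (gammaLin p q t) = 0) : ∃ k ∈ Submodule.span ℝ (invariantVars n p q), ∃ y,
      res n p q ε t = res n p q ε k + res n p q ε (gammaLin p q y) := by
  have h1 := parityProj_mem_nullLin hqp ht
  rw [← h, ← gammaLin_parityProj] at h1
  obtain ⟨k, hk, y, h2⟩ := exists_sub_sub_gammaLin_mem_nullLin hq hqp h1
  have h3 := (mem_nullLin_iff_res hqp).1 h2 ε
  rw [map_sub, map_sub, res_parityProj, if_pos rfl, sub_sub, sub_eq_zero] at h3
  exact ⟨k, hk, y, h3⟩

/-- The contraction of the linear functions on jets onto the invariants. -/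
theorem exists_isContraction_res (hq : 1 ≤ q) (hqp : q ≤ p) :
    ∃ (δ₁ : jets n p q 1 →ₗ[ℝ] jets n p q 0) (δ₀ : jets n p q 0 →ₗ[ℝ] jets n p q 1),
      (∀ t, res n p q 0 t ∘ₗ δ₁ = res n p q 1 (gammaLin p q t)) ∧
      (∀ t, res n p q 1 t ∘ₗ δ₀ = res n p q 0 (gammaLin p q t)) ∧ ∃ ρ₁ ρ₀ P₀ P₁,
        IsContraction (LinearMap.range (res n p q 0))
          ((Submodule.span ℝ (invariantVars n p q)).map (res n p q 0)) (LinearMap.range (res n p q 1))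
          ((Submodule.span ℝ (invariantVars n p q)).map (res n p q 1)) δ₁ ρ₁ δ₀ ρ₀ P₀ P₁ := by
  obtain ⟨δ₁, h₁⟩ := exists_dual_gammaLin (n := n) hq hqp (zero_add (1 : ZMod 2))
  obtain ⟨δ₀, h₀⟩ := exists_dual_gammaLin (n := n) hq hqp (by decide : (1 : ZMod 2) + 1 = 0)
  have hnull : ∀ {t : Lin n}, t ∈ nullLin n p q → ∀ ε, res n p q ε t = 0 := fun h =>
    (mem_nullLin_iff_res hqp).1 h
  refine ⟨δ₁, δ₀, h₁, h₀, exists_isContraction (isPredual_range_res 0) (isPredual_range_res 1)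
    LinearMap.map_le_range LinearMap.map_le_range ?_ ?_ ?_ ?_ ?_ ?_ ?_ ?_ ?_ ?_⟩
  · rintro _ ⟨t, rfl⟩
    exact ⟨_, (h₁ t).symm⟩
  · rintro _ ⟨t, rfl⟩
    exact ⟨_, (h₀ t).symm⟩
  · rintro _ ⟨t, rfl⟩
    rw [h₁, h₀]
    exact hnull (gammaLin_gammaLin_mem_nullLin hq hqp t) 0
  · rintro _ ⟨t, rfl⟩
    rw [h₀, h₁]
    exact hnull (gammaLin_gammaLin_mem_nullLin hq hqp t) 1
  · rintro _ ⟨k, hk, rfl⟩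
    rw [h₁]
    exact hnull (gammaLin_mem_nullLin_of_mem_span hq hqp hk) 1
  · rintro _ ⟨k, hk, rfl⟩
    rw [h₀]
    exact hnull (gammaLin_mem_nullLin_of_mem_span hq hqp hk) 0
  · rintro _ ⟨y, rfl⟩ ⟨k, hk, e⟩
    rw [h₀] at e ⊢
    rw [← e]
    exact res_eq_zero_of_eq_res_gammaLin hq hqp (by decide : (1 : ZMod 2) + 1 = 0) hk e
  · rintro _ ⟨y, rfl⟩ ⟨k, hk, e⟩
    rw [h₁] at e ⊢
    rw [← e]
    exact res_eq_zero_of_eq_res_gammaLin hq hqp (zero_add (1 : ZMod 2)) hk e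
  · rintro _ ⟨t, rfl⟩ ht
    rw [h₁] at ht
    obtain ⟨k, hk, y, e⟩ := exists_res_eq_add hq hqp (zero_add (1 : ZMod 2)) ht
    exact ⟨_, ⟨k, hk, rfl⟩, _, ⟨y, rfl⟩, by rw [h₀, e]⟩
  · rintro _ ⟨t, rfl⟩ ht
    rw [h₀] at ht
    obtain ⟨k, hk, y, e⟩ := exists_res_eq_add hq hqp (by decide : (1 : ZMod 2) + 1 = 0) ht
    exact ⟨_, ⟨k, hk, rfl⟩, _, ⟨y, rfl⟩, by rw [h₁, e]⟩

end Parity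

section Span

variable {J₀ J₁ : Type*} [AddCommGroup J₀] [Module ℝ J₀] [AddCommGroup J₁] [Module ℝ J₁]

/-! ### The algebra of local functions and the gauge differential -/

theorem cylinder_mono {S T : Set (Module.Dual ℝ J₀)} (h : S ⊆ T) : cylinder S ⊆ cylinder T := by
  rintro _ ⟨m, g, t, hg, ht, rfl⟩
  exact ⟨m, g, t, hg, fun k => h (ht k), rfl⟩

theorem cylinder_span (S : Set (Module.Dual ℝ J₀)) :
    cylinder (Submodule.span ℝ S : Set (Module.Dual ℝ J₀)) = cylinder S := by
  refine Set.Subset.antisymm ?_ (cylinder_mono Submodule.subset_span)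
  rintro _ ⟨m, g, t, hg, ht, rfl⟩
  refine comp_mem_cylinder hg (H := fun k => t k) fun k => ?_
  have h := ht k
  generalize t k = v at h
  rw [SetLike.mem_coe] at h
  induction h using Submodule.span_induction with
  | mem v hv => exact coe_mem_cylinder hv
  | zero => exact const_mem_cylinder S 0
  | add v v' _ _ h h' => exact add_mem (S := Subalgebra ℝ (J₀ → ℝ)) (s := cylinderAlgebra S) h h'
  | smul c v _ h => exact Subalgebra.smul_mem (cylinderAlgebra S) h c

theorem fnAlgebra_span (S₀ : Set (Module.Dual ℝ J₀)) (S₁ : Set (Module.Dual ℝ J₁)) :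
    fnAlgebra (Submodule.span ℝ S₀ : Set (Module.Dual ℝ J₀)) (Submodule.span ℝ S₁ : Set (Module.Dual ℝ J₁)) =
      fnAlgebra S₀ S₁ := by
  refine le_antisymm (fnAlgebra_le_of (fun G hG => ?_) fun v hv => ?_)
    (fnAlgebra_le_of (fun G hG => scalFn_mem (cylinder_mono Submodule.subset_span hG))
      fun v hv => oddFn_mem (Submodule.subset_span hv))
  · rw [cylinder_span] at hG
    exact scalFn_mem hG
  · rw [SetLike.mem_coe] at hv
    have hv' : v ∈ (Subalgebra.toSubmodule (fnAlgebra S₀ S₁)).comap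
        ((LinearMap.pi fun _ => ExteriorAlgebra.ι ℝ) : Module.Dual ℝ J₁ →ₗ[ℝ] Superfunction J₀ J₁) :=
      Submodule.span_le.2 (fun v hv => oddFn_mem hv) hv
    exact hv'

end Span

/-! ### Formal properties of odd derivations -/

section OddDerivation

variable {A : Type*} [Ring A] [Algebra ℝ A] {π : A ≃ₐ[ℝ] A} {γ γ' : A →ₗ[ℝ] A}

theorem IsOddDerivation.sub_apply_mul (h : IsOddDerivation π γ) (h' : IsOddDerivation π γ') (f g : A) :
    (γ - γ') (f * g) = (γ - γ') f * g + π f * (γ - γ') g := by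
  rw [LinearMap.sub_apply, LinearMap.sub_apply, LinearMap.sub_apply, h.leibniz, h'.leibniz]
  noncomm_ring

theorem IsOddDerivation.comp_apply_mul (h : IsOddDerivation π γ) (hπ : ∀ f, π (π f) = f) (f g : A) :
    (γ ∘ₗ γ) (f * g) = (γ ∘ₗ γ) f * g + f * (γ ∘ₗ γ) g := by
  simp only [LinearMap.comp_apply]
  rw [h.leibniz, map_add, h.leibniz, h.leibniz, h.odd, hπ]
  noncomm_ring

/-- A map onto representatives of the cohomology classes is an isomorphism. -/
theorem exists_algEquiv_cohomology {B : Type*} [Ring B] [Algebra ℝ B] (hγ : IsOddDerivation π γ)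
    (F : B →ₐ[ℝ] A) (hF : Function.Injective F) (h₀ : ∀ f, γ (F f) = 0)
    (h₁ : ∀ f b, γ b = F f → F f = 0) (h₂ : ∀ a, γ a = 0 → ∃ f b, γ b = a - F f) :
    ∃ e : B ≃ₐ[ℝ] Cohomology hγ, ∀ f, ∃ hf : F f ∈ cocycles hγ, e f = cohomologyClass hγ ⟨F f, hf⟩ := by
  let F' : B →ₐ[ℝ] cocycles hγ := F.codRestrict _ h₀
  refine ⟨AlgEquiv.ofBijective ((cohomologyClass hγ).comp F') ⟨?_, ?_⟩, fun f => ⟨h₀ f, rfl⟩⟩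
  · rw [injective_iff_map_eq_zero]
    intro f hf
    have hf' : cohomologyClass hγ (F' f) = cohomologyClass hγ (F' 0) := by
      rw [map_zero, map_zero]; exact hf
    obtain ⟨b, hb⟩ : cohomologous hγ (F' f) (F' 0) := (RingCon.eq _).1 hf'
    have h0 : ((F' 0 : cocycles hγ) : A) = 0 := map_zero F
    rw [h0, sub_zero] at hb
    exact (injective_iff_map_eq_zero F).1 hF f (h₁ f b hb)
  · intro x
    obtain ⟨a, rfl⟩ := RingCon.mk'_surjective _ x
    obtain ⟨f, b, hb⟩ := h₂ a a.2
    refine ⟨f, (RingCon.eq _).2 ⟨-b, ?_⟩⟩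
    rw [map_neg, hb, neg_sub]
    rfl

end OddDerivation

/-! ### The gauge differential on local functions -/

section LocalFunctions

variable {n p q : ℕ}

theorem functionsOf_eq (S : Set (Lin n)) :
    functionsOf n p q S = fnAlgebra (res n p q 0 '' S) (res n p q 1 '' S) := by
  refine le_antisymm (Algebra.adjoin_le ?_) (fnAlgebra_le_of ?_ ?_)
  · rintro f (⟨m, g, t, hg, ht, rfl⟩ | ⟨t, ht, rfl⟩)
    · exact scalFn_mem ⟨m, g, fun k => res n p q 0 (t k), hg, fun k => ⟨_, ht k, rfl⟩, rfl⟩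
    · exact oddFn_mem (v := res n p q 1 t) ⟨t, ht, rfl⟩
  · rintro _ ⟨m, g, t, hg, ht, rfl⟩
    choose u hu e using ht
    obtain rfl : (fun k => res n p q 0 (u k)) = t := funext e
    exact Algebra.subset_adjoin (Or.inl ⟨m, g, u, hg, hu, rfl⟩)
  · rintro _ ⟨t, ht, rfl⟩
    exact Algebra.subset_adjoin (Or.inr ⟨t, ht, rfl⟩)

theorem localFunctions_eq : localFunctions n p q =
    fnAlgebra (LinearMap.range (res n p q 0) : Set _) (LinearMap.range (res n p q 1) : Set _) := by
  rw [localFunctions, functionsOf_eq, Set.image_univ, Set.image_univ]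
  rfl

theorem invariantFunctions_eq : invariantFunctions n p q =
    fnAlgebra ((Submodule.span ℝ (invariantVars n p q)).map (res n p q 0) : Set _)
      ((Submodule.span ℝ (invariantVars n p q)).map (res n p q 1) : Set _) := by
  rw [Submodule.map_span, Submodule.map_span, fnAlgebra_span, invariantFunctions, functionsOf_eq]

theorem mem_localFunctions_iff {f : SuperFun n p q} : f ∈ localFunctions n p q ↔
    f ∈ fnAlgebra (LinearMap.range (res n p q 0) : Set _) (LinearMap.range (res n p q 1) : Set _) := by
  rw [localFunctions_eq]

theorem mem_invariantFunctions_iff {f : SuperFun n p q} : f ∈ invariantFunctions n p q ↔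
    f ∈ fnAlgebra ((Submodule.span ℝ (invariantVars n p q)).map (res n p q 0) : Set _)
      ((Submodule.span ℝ (invariantVars n p q)).map (res n p q 1) : Set _) := by
  rw [invariantFunctions_eq]

theorem coe_var (t : Lin n) : (var n p q t : SuperFun n p q) =
    scalFn (jets n p q 1) (res n p q 0 t) + oddFn (jets n p q 0) (res n p q 1 t) := rfl

/-- A linear combination of variables, as a linear function of its coefficients. -/
def varHom (n p q : ℕ) : Lin n →ₗ[ℝ] localFunctions n p q where
  toFun := var n p q
  map_add' t u := Subtype.ext <| by
    change linVar n p q (t + u) = linVar n p q t + linVar n p q u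
    funext φ
    change algebraMap ℝ _ (res n p q 0 (t + u) φ) + ExteriorAlgebra.ι ℝ (res n p q 1 (t + u)) =
      (algebraMap ℝ _ (res n p q 0 t φ) + ExteriorAlgebra.ι ℝ (res n p q 1 t)) +
      (algebraMap ℝ _ (res n p q 0 u φ) + ExteriorAlgebra.ι ℝ (res n p q 1 u))
    rw [map_add, map_add, LinearMap.add_apply, map_add, map_add]
    abel
  map_smul' c t := Subtype.ext <| by
    change linVar n p q (c • t) = c • linVar n p q t
    funext φ
    change algebraMap ℝ _ (res n p q 0 (c • t) φ) + ExteriorAlgebra.ι ℝ (res n p q 1 (c • t)) =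
      c • (algebraMap ℝ _ (res n p q 0 t φ) + ExteriorAlgebra.ι ℝ (res n p q 1 t))
    rw [map_smul, map_smul, LinearMap.smul_apply, smul_eq_mul, map_mul, smul_add,
      ← Algebra.smul_def, LinearMap.map_smul (ExteriorAlgebra.ι ℝ)]

theorem var_parityProj_zero (t : Lin n) :
    (var n p q (parityProj 0 t) : SuperFun n p q) = scalFn (jets n p q 1) (res n p q 0 t) := by
  rw [coe_var, res_parityProj, res_parityProj, if_pos rfl, if_neg (by decide)]
  funext φ
  exact (congrArg _ (map_zero (ExteriorAlgebra.ι ℝ))).trans (add_zero _)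

theorem var_parityProj_one (t : Lin n) :
    (var n p q (parityProj 1 t) : SuperFun n p q) = oddFn (jets n p q 0) (res n p q 1 t) := by
  rw [coe_var, res_parityProj, res_parityProj, if_pos rfl, if_neg (by decide)]
  funext φ
  change algebraMap ℝ _ 0 + ExteriorAlgebra.ι ℝ (res n p q 1 t) = ExteriorAlgebra.ι ℝ (res n p q 1 t)
  rw [map_zero, zero_add]

theorem var_sym_eq_zero {s : Comp n} (hs : ¬ s.Occurs p q) : var n p q (sym s) = 0 := by
  have h : ∀ ε, res n p q ε (sym s) = 0 := fun ε => LinearMap.ext fun φ => by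
    rw [res_apply, coord_sym]
    exact φ.2.1 s fun h' => hs h'.1
  refine Subtype.ext ?_
  rw [coe_var, h, h]
  funext φ
  exact (congrArg₂ _ (map_zero (algebraMap ℝ _)) (map_zero (ExteriorAlgebra.ι ℝ))).trans (add_zero _)

theorem IsGaugeDifferential.apply_var {γ : localFunctions n p q →ₗ[ℝ] localFunctions n p q}
    (hγ : IsGaugeDifferential n p q γ) (t : Lin n) :
    γ (var n p q t) = var n p q (gammaLin p q t) := by
  change (γ ∘ₗ varHom n p q) t = (varHom n p q ∘ₗ gammaLin p q) t
  induction t using lin_induction with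
  | hzero => rw [map_zero, map_zero]
  | hadd t u ht hu => rw [map_add, map_add, ht, hu]
  | hsmul c t ht => rw [map_smul, map_smul, ht]
  | hsym s =>
    change γ (var n p q (sym s)) = varHom n p q (gammaLin p q (sym s))
    rw [gammaLin_sym]
    by_cases h : s.Occurs p q
    · obtain ⟨_ | _, i, j, ρ, μ, ν⟩ := s
      · rw [if_pos ⟨rfl, h⟩]
        exact hγ.field i j ρ μ ν h
      · rw [if_neg fun h' => Bool.false_ne_true h'.1.symm, map_zero]
        exact hγ.antifield i j ρ μ ν h
    · rw [if_neg fun h' => h h'.2, map_zero, var_sym_eq_zero h, map_zero]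

/-- A linear map on local functions that is a derivation up to the parity involution and vanishes on
the variables is zero. -/
theorem eq_zero_of_var_eq_zero {D : localFunctions n p q →ₗ[ℝ] localFunctions n p q}
    {ψ : localFunctions n p q → localFunctions n p q}
    (hψ : ∀ f : localFunctions n p q, parityInv n p q f = f → ψ f = f)
    (leibniz : ∀ f f', D (f * f') = D f * f' + ψ f * D f') (hD : ∀ t, D (var n p q t) = 0)
    (f : localFunctions n p q) : D f = 0 := by
  classical
  -- `twistedDerivation_eq_zero` concerns maps on all superfunctions, so `D` is extended linearly
  -- and `ψ` by the identity. Keeping `ψ` general covers both odd derivations and their squares.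
  obtain ⟨E, hE⟩ := LinearMap.exists_extend (p := Subalgebra.toSubmodule (localFunctions n p q))
    ((localFunctions n p q).val.toLinearMap ∘ₗ D)
  have hE' : ∀ f : localFunctions n p q, E f = D f := fun f => LinearMap.congr_fun hE f
  let Ψ : SuperFun n p q → SuperFun n p q := fun f =>
    if h : f ∈ localFunctions n p q then (ψ ⟨f, h⟩ : SuperFun n p q) else f
  have key := twistedDerivation_eq_zero (S₀ := LinearMap.range (res n p q 0))
    (S₁ := LinearMap.range (res n p q 1)) (D := E) (χ := id) (ψ := Ψ) id (fun G hG => ?_) rfl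
    (fun f hf f' hf' => ?_) ?_ ?_ (f := f) (by rw [← localFunctions_eq]; exact f.2)
  · rw [hE'] at key
    exact Subtype.ext key
  · have h : scalFn (jets n p q 1) G ∈ localFunctions n p q := by
      rw [localFunctions_eq]; exact scalFn_mem hG
    change (if h : _ then _ else _) = _
    rw [dif_pos h, hψ]
    · rfl
    · exact Subtype.ext (parityMap_scalFn G)
  · rw [← localFunctions_eq] at hf hf'
    have h := congrArg Subtype.val (leibniz ⟨f, hf⟩ ⟨f', hf'⟩)
    have e : Ψ f = ψ ⟨f, hf⟩ := dif_pos hf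
    rw [e]
    exact (hE' (⟨f, hf⟩ * ⟨f', hf'⟩)).trans (h.trans
      (congrArg₂ (fun x y => x * f' + (ψ ⟨f, hf⟩ : SuperFun n p q) * y) (hE' ⟨f, hf⟩).symm (hE' ⟨f', hf'⟩).symm))
  · rintro _ ⟨t, rfl⟩
    rw [← var_parityProj_zero, hE', hD]
    rfl
  · rintro _ ⟨t, rfl⟩
    rw [← var_parityProj_one, hE', hD]
    rfl

theorem IsGaugeDifferential.unique {γ γ' : localFunctions n p q →ₗ[ℝ] localFunctions n p q}
    (hγ : IsGaugeDifferential n p q γ) (hγ' : IsGaugeDifferential n p q γ') : γ = γ' := by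
  refine LinearMap.ext fun f => sub_eq_zero.1 ?_
  refine eq_zero_of_var_eq_zero (D := γ - γ') (ψ := parityInv n p q) (fun f hf => hf) (fun f f' => ?_)
    (fun t => ?_) f
  · exact hγ.toIsOddDerivation.sub_apply_mul hγ'.toIsOddDerivation f f'
  · rw [LinearMap.sub_apply, hγ.apply_var, hγ'.apply_var, sub_self]

theorem parityInv_parityInv (f : localFunctions n p q) : parityInv n p q (parityInv n p q f) = f :=
  (parityInv n p q).apply_symm_apply f

/-- The square of an odd derivation is an even derivation, so it need only vanish on the variables,
where it is the square of `gammaLin`. -/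
theorem IsGaugeDifferential.apply_apply (hq : 1 ≤ q) (hqp : q ≤ p)
    {γ : localFunctions n p q →ₗ[ℝ] localFunctions n p q} (hγ : IsGaugeDifferential n p q γ)
    (f : localFunctions n p q) : γ (γ f) = 0 := by
  refine eq_zero_of_var_eq_zero (D := γ ∘ₗ γ) (ψ := id) (fun f _ => rfl) (fun f f' => ?_)
    (fun t => ?_) f
  · exact hγ.toIsOddDerivation.comp_apply_mul parityInv_parityInv f f'
  · rw [LinearMap.comp_apply, hγ.apply_var, hγ.apply_var]
    have h := (mem_nullLin_iff_res hqp).1 (gammaLin_gammaLin_mem_nullLin hq hqp t)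
    refine Subtype.ext ?_
    rw [coe_var, h, h]
    funext φ
    exact (congrArg₂ _ (map_zero (algebraMap ℝ _)) (map_zero (ExteriorAlgebra.ι ℝ))).trans (add_zero _)

/-- The odd derivation induced by the dual maps restricts to local functions, because these maps
pull linear functions of symbols back to linear functions of symbols. -/
theorem exists_isGaugeDifferential {δ₁ : jets n p q 1 →ₗ[ℝ] jets n p q 0}
    {δ₀ : jets n p q 0 →ₗ[ℝ] jets n p q 1}
    (h₁ : ∀ t, res n p q 0 t ∘ₗ δ₁ = res n p q 1 (gammaLin p q t))
    (h₀ : ∀ t, res n p q 1 t ∘ₗ δ₀ = res n p q 0 (gammaLin p q t))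
    {D : SuperFun n p q →ₗ[ℝ] SuperFun n p q}
    (hD : IsInducedDerivation (LinearMap.range (res n p q 0) : Set _) id (fun _ => LinearMap.id) δ₁ δ₀ D) :
    ∃ γ : localFunctions n p q →ₗ[ℝ] localFunctions n p q,
      IsGaugeDifferential n p q γ ∧ ∀ f, (γ f : SuperFun n p q) = D f := by
  have hmem : ∀ f ∈ localFunctions n p q, D f ∈ localFunctions n p q := fun f hf => by
    rw [localFunctions_eq] at hf ⊢
    refine hD.apply_mem_id ?_ ?_ hf
    · rintro _ ⟨t, rfl⟩; exact ⟨_, (h₁ t).symm⟩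
    · rintro _ ⟨t, rfl⟩; exact ⟨_, (h₀ t).symm⟩
  let γ : localFunctions n p q →ₗ[ℝ] localFunctions n p q :=
    D.restrict (p := Subalgebra.toSubmodule (localFunctions n p q))
      (q := Subalgebra.toSubmodule (localFunctions n p q)) hmem
  have hγ : ∀ f, (γ f : SuperFun n p q) = D f := fun _ => rfl
  have hloc : ∀ f : localFunctions n p q, (f : SuperFun n p q) ∈
      fnAlgebra (LinearMap.range (res n p q 0) : Set _) (LinearMap.range (res n p q 1) : Set _) := fun f => by
    rw [← localFunctions_eq]; exact f.2
  have hvar : ∀ t, γ (var n p q t) = var n p q (gammaLin p q t) := fun t => Subtype.ext <| by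
    rw [hγ, coe_var, coe_var, map_add, hD.apply_coe ⟨t, rfl⟩, hD.apply_oddFn, h₁, ← h₀, add_comm]
    rfl
  refine ⟨γ, ⟨⟨fun f => Subtype.ext ?_, fun f f' => Subtype.ext ?_⟩, fun i j ρ μ ν hs => ?_,
    fun i j ρ μ ν hs => ?_⟩, hγ⟩
  · exact hD.odd (hloc f)
  · exact hD.leibniz_id (hloc f) (hloc f')
  · rw [hvar, gammaLin_sym, if_pos ⟨rfl, hs⟩]
  · rw [hvar, gammaLin_sym, if_neg fun h' => Bool.false_ne_true h'.1.symm]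
    exact map_zero (varHom n p q)

theorem coe_toLocal (f : invariantFunctions n p q) : (toLocal n p q f).1 = f.1 :=
  Subalgebra.coe_inclusion _ _

/-- The cohomology of the gauge differential is represented by the invariant functions. -/
theorem exists_isGaugeDifferential_representatives (hq : 1 ≤ q) (hqp : q ≤ p) :
    ∃ γ : localFunctions n p q →ₗ[ℝ] localFunctions n p q, IsGaugeDifferential n p q γ ∧
      (∀ f, γ (toLocal n p q f) = 0) ∧ (∀ f b, γ b = toLocal n p q f → toLocal n p q f = 0) ∧
      ∀ a, γ a = 0 → ∃ f b, γ b = a - toLocal n p q f := by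
  obtain ⟨δ₁, δ₀, h₁, h₀, ρ₁, ρ₀, P₀, P₁, hc⟩ := exists_isContraction_res (n := n) hq hqp
  refine (exists_isInducedDerivation (LinearMap.range (res n p q 0) : Set _) id
    (fun _ => LinearMap.id) δ₁ δ₀).elim fun D hD => ?_
  refine (exists_isGaugeDifferential h₁ h₀ hD).elim fun γ hγ => ?_
  refine ⟨γ, hγ.1, fun f => Subtype.ext ?_, fun f b hb => Subtype.ext ?_, fun a ha => ?_⟩
  · rw [hγ.2, coe_toLocal]
    exact (hc.apply_eq_zero hD (mem_invariantFunctions_iff.1 f.2)).2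
  · have e : D b.1 = f.1 := (hγ.2 b).symm.trans ((congrArg Subtype.val hb).trans (coe_toLocal f))
    have h := hc.eq_zero_of_apply_mem hD (mem_localFunctions_iff.1 b.2)
      (by rw [e]; exact mem_invariantFunctions_iff.1 f.2)
    rw [coe_toLocal, ← e, h]
    rfl
  · obtain ⟨f₀, hf₀, b, hb, e⟩ := hc.exists_of_apply_eq_zero hD (mem_localFunctions_iff.1 a.2)
      ((hγ.2 a).symm.trans (congrArg Subtype.val ha))
    exact ⟨⟨f₀, mem_invariantFunctions_iff.2 hf₀⟩, ⟨b, mem_localFunctions_iff.2 hb⟩,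
      Subtype.ext ((hγ.2 _).trans e)⟩

end LocalFunctions

end MixedGauge

end

theorem mainTheorem5 (n p q : ℕ) (hq : 1 ≤ q) (hqp : q ≤ p) (hp : 1 < p) (hn : p + q + 2 ≤ n) :
    (∃! γ : MixedGauge.localFunctions n p q →ₗ[ℝ] MixedGauge.localFunctions n p q,
        MixedGauge.IsGaugeDifferential n p q γ) ∧
      ∀ (γ : MixedGauge.localFunctions n p q →ₗ[ℝ] MixedGauge.localFunctions n p q)
        (hγ : MixedGauge.IsGaugeDifferential n p q γ),
        (∀ f, γ (γ f) = 0) ∧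
          ∃ e : MixedGauge.invariantFunctions n p q ≃ₐ[ℝ] MixedGauge.Cohomology hγ.toIsOddDerivation,
            ∀ f : MixedGauge.invariantFunctions n p q,
              ∃ hf : MixedGauge.toLocal n p q f ∈ MixedGauge.cocycles hγ.toIsOddDerivation,
                e f = MixedGauge.cohomologyClass hγ.toIsOddDerivation
                  ⟨MixedGauge.toLocal n p q f, hf⟩ := by
  obtain ⟨γ₀, hγ₀, h₀, h₁, h₂⟩ := MixedGauge.exists_isGaugeDifferential_representatives (n := n) hq hqp
  refine ⟨⟨γ₀, hγ₀, fun γ hγ => hγ.unique hγ₀⟩, ?_⟩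
  intro γ hγ
  refine ⟨hγ.apply_apply hq hqp, ?_⟩
  -- By uniqueness every gauge differential is the constructed one, whose representatives are known.
  have e := hγ.unique hγ₀
  subst e
  exact MixedGauge.exists_algEquiv_cohomology hγ.toIsOddDerivation (MixedGauge.toLocal n p q)
    (Subalgebra.inclusion_injective _) h₀ h₁ h₂
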